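/- Let $\mathfrak g$ be a real semisimple Lie algebra, realised as a real Lie subalgebra of $\mathfrak{gl}_n(\mathbb C)$ with $\mathfrak g\cap i\mathfrak g=0$, so that $\mathfrak g^{\mathbb C}=\mathfrak g\oplus i\mathfrak g\subset\mathfrak{gl}_n(\mathbb C)$. Let $\theta$ be a Cartan involution of $\mathfrak g$, $\mathfrak g=\mathfrak k\oplus\mathfrak p$ the corresponding Cartan decomposition, $\mathfrak k^{\mathbb C}=\mathfrak k\oplus i\mathfrak k$, and let $K\subset G\subset G^{\mathbb C}$ and $K^{\mathbb C}\subset G^{\mathbb C}$ be the connected Lie subgroups of $GL_n(\mathbb C)$ with Lie algebras $\mathfrak k,\mathfrak g,\mathfrak g^{\mathbb C},\mathfrak k^{\mathbb C}$. Let $\mathfrak a\subset\mathfrak p$ be maximal abelian, $\Sigma\subset\mathfrak a^*\setminus\{0\}$ the set of restricted roots of $\mathfrak g$ with respect to $\mathfrak a$, $W=N_K(\mathfrak a)/Z_K(\mathfrak a)$ the Weyl group, $$\omega=\{H\in\mathfrak a : |\alpha(H)|<\tfrac{\pi}{2}\ \text{ for all } \alpha\in\Sigma\},$$ and let $$\Omega_{\mathrm{AG}}=\{g\exp(iH)K^{\mathbb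 C} : g\in G,\ H\in\omega\}\subset G^{\mathbb C}/K^{\mathbb C}$$ be the Akhiezer–Gindikin domain. Theorem. Let $u$ be a smooth, $W$-invariant real function on $\omega$ that is strictly convex in the sense that its Hessian is positive definite at every point of $\omega$. Then there is a unique function $\tilde u$ on $\Omega_{\mathrm{AG}}$ (the $G$-invariant extension of $u$) with $\tilde u(g\exp(iH)K^{\mathbb C})=u(H)$ for all $g\in G$ and $H\in\omega$, and $\tilde u$ is strictly plurisubharmonic: it is of class $C^2$ and its Levi form $i\partial\bar\partial\tilde u$ is positive definite at every point of $\Omega_{\mathrm{AG}}$. -/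

import Mathlib

open scoped ContDiff

attribute [local instance] Matrix.linftyOpNormedRing Matrix.linftyOpNormedAlgebra

attribute [local instance 100] LieRing.ofAssociativeRing

noncomputable section

namespace AkhiezerGindikin

/-- Complex square matrices, the Lie algebra of `GL n ℂ`. -/
abbrev Mat (n : ℕ) : Type := Matrix (Fin n) (Fin n) ℂ

variable {n : ℕ}

/-- The exponential map of `GL n ℂ`. -/
def expGL (A : Mat n) : GL (Fin n) ℂ where
  val := NormedSpace.exp A
  inv := NormedSpace.exp (-A)
  val_inv := by
    rw [← Matrix.exp_add_of_commute _ _ (Commute.neg_right (Commute.refl A))]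
    simp
  inv_val := by
    rw [← Matrix.exp_add_of_commute _ _ (Commute.neg_left (Commute.refl A))]
    simp

/-- The subgroup of `GL n ℂ` generated by the exponentials of the elements of `s`. When `s` is a
Lie algebra of matrices, this is the connected Lie subgroup with Lie algebra `s`. -/
def analyticSubgroup (s : Set (Mat n)) : Subgroup (GL (Fin n) ℂ) :=
  Subgroup.closure (expGL '' s)

/-- A Cartan involution of a real Lie algebra: an involutive automorphism `θ` for which
`-B(X, θ Y)` is positive definite, where `B` is the Killing form. -/
structure IsCartanInvolution {L : Type*} [LieRing L] [LieAlgebra ℝ L] (θ : L →ₗ⁅ℝ⁆ L) :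
    Prop where
  involutive : ∀ X : L, θ (θ X) = X
  killing_neg : ∀ X : L, X ≠ 0 → killingForm ℝ L X (θ X) < 0

/-- `𝔤 ∩ i𝔤 = 0`: the complex span of `𝔤` is its complexification `𝔤 ⊗ ℂ = 𝔤 ⊕ i𝔤`. -/
def IsTotallyReal (𝔤 : LieSubalgebra ℝ (Mat n)) : Prop :=
  ∀ X : Mat n, X ∈ 𝔤 → Complex.I • X ∈ 𝔤 → X = 0

section Symmetric

variable (𝔤 : LieSubalgebra ℝ (Mat n)) (θ : 𝔤 →ₗ⁅ℝ⁆ 𝔤)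

/-- `𝔨`, the `+1` eigenspace of `θ`. -/
def kPart : Submodule ℝ (Mat n) :=
  (LinearMap.ker ((θ : 𝔤 →ₗ[ℝ] 𝔤) - LinearMap.id)).map 𝔤.toSubmodule.subtype

/-- `𝔭`, the `-1` eigenspace of `θ`. -/
def pPart : Submodule ℝ (Mat n) :=
  (LinearMap.ker ((θ : 𝔤 →ₗ[ℝ] 𝔤) + LinearMap.id)).map 𝔤.toSubmodule.subtype

theorem mem_kPart {X : Mat n} : X ∈ kPart 𝔤 θ ↔ ∃ Y : 𝔤, θ Y = Y ∧ (Y : Mat n) = X := by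
  simp only [kPart, Submodule.mem_map, LinearMap.mem_ker, LinearMap.sub_apply,
    LinearMap.id_apply, sub_eq_zero]
  rfl

theorem mem_pPart {X : Mat n} : X ∈ pPart 𝔤 θ ↔ ∃ Y : 𝔤, θ Y = -Y ∧ (Y : Mat n) = X := by
  simp only [pPart, Submodule.mem_map, LinearMap.mem_ker, LinearMap.add_apply,
    LinearMap.id_apply, add_eq_zero_iff_eq_neg]
  rfl

/-- `𝔞` is a maximal abelian subspace of `𝔭`. -/
def IsMaximalAbelian (𝔞 : Submodule ℝ (Mat n)) : Prop :=
  Maximal (fun 𝔟 : Submodule ℝ (Mat n) =>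
    𝔟 ≤ pPart 𝔤 θ ∧ ∀ X ∈ 𝔟, ∀ Y ∈ 𝔟, ⁅X, Y⁆ = 0) 𝔞

/-- `𝔤^ℂ`. -/
def gC : Submodule ℂ (Mat n) := Submodule.span ℂ (𝔤 : Set (Mat n))

/-- `𝔨^ℂ`. -/
def kC : Submodule ℂ (Mat n) := Submodule.span ℂ (kPart 𝔤 θ : Set (Mat n))

/-- The real group `G`. -/
def groupG : Subgroup (GL (Fin n) ℂ) := analyticSubgroup (𝔤 : Set (Mat n))

/-- The maximal compact subgroup `K` of `G`; it is connected because `G` is. -/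
def groupK : Subgroup (GL (Fin n) ℂ) := analyticSubgroup (kPart 𝔤 θ : Set (Mat n))

/-- The complexification `G^ℂ` of `G`. -/
def groupGC : Subgroup (GL (Fin n) ℂ) := analyticSubgroup (gC 𝔤 : Set (Mat n))

/-- The complexification `K^ℂ` of `K`. -/
def groupKC : Subgroup (GL (Fin n) ℂ) := analyticSubgroup (kC 𝔤 θ : Set (Mat n))

theorem groupG_le_groupGC : groupG 𝔤 ≤ groupGC 𝔤 :=
  Subgroup.closure_mono (Set.image_mono Submodule.subset_span)

/-- The complex homogeneous space `G^ℂ / K^ℂ`. -/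
abbrev Complexification : Type :=
  groupGC 𝔤 ⧸ (groupKC 𝔤 θ).subgroupOf (groupGC 𝔤)

/-- The exponential map `𝔤^ℂ → G^ℂ`. -/
def expGC (Z : gC 𝔤) : groupGC 𝔤 :=
  ⟨expGL (Z : Mat n), Subgroup.subset_closure ⟨_, Z.2, rfl⟩⟩

/-- The restricted roots of `𝔤` with respect to `𝔞`. -/
def restrictedRoots (𝔞 : Submodule ℝ (Mat n)) : Set (Module.Dual ℝ 𝔞) :=
  {α | α ≠ 0 ∧ ∃ X ∈ 𝔤, X ≠ 0 ∧ ∀ H : 𝔞, ⁅(H : Mat n), X⁆ = α H • X}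

/-- `ω = {H ∈ 𝔞 : |α(H)| < π/2 for all restricted roots α}`. -/
def omega (𝔞 : Submodule ℝ (Mat n)) : Set 𝔞 :=
  {H | ∀ α ∈ restrictedRoots 𝔤 𝔞, |α H| < Real.pi / 2}

/-- The Weyl group `N_K(𝔞) / Z_K(𝔞)`, as the group of automorphisms of `𝔞` that are induced by
`Ad(k)` for some `k ∈ K`. -/
def weylGroup (𝔞 : Submodule ℝ (Mat n)) : Subgroup (𝔞 ≃ₗ[ℝ] 𝔞) where
  carrier := {w | ∃ k ∈ groupK 𝔤 θ, ∀ H : 𝔞,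
    (w H : Mat n) = (k : Mat n) * (H : Mat n) * ((k⁻¹ : GL (Fin n) ℂ) : Mat n)}
  one_mem' := ⟨1, Subgroup.one_mem _, fun H => by simp⟩
  mul_mem' := by
    rintro w₁ w₂ ⟨k₁, h₁, e₁⟩ ⟨k₂, h₂, e₂⟩
    refine ⟨k₁ * k₂, Subgroup.mul_mem _ h₁ h₂, fun H => ?_⟩
    rw [LinearEquiv.mul_apply, e₁, e₂, mul_inv_rev, Units.val_mul, Units.val_mul]
    simp only [mul_assoc]
  inv_mem' := by
    rintro w ⟨k, hk, e⟩
    refine ⟨k⁻¹, Subgroup.inv_mem _ hk, fun H => ?_⟩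
    have h := e (w⁻¹ H)
    have hw : w (w⁻¹ H) = H := w.apply_symm_apply H
    rw [hw] at h
    rw [h, inv_inv]
    simp only [mul_assoc, Units.inv_mul, mul_one]
    rw [← mul_assoc, Units.inv_mul, one_mul]

/-- `iH`, as an element of `𝔤^ℂ`, for `H` in a subspace `𝔞` of `𝔤`. -/
def iMul {𝔞 : Submodule ℝ (Mat n)} (h𝔞 : ∀ H ∈ 𝔞, H ∈ 𝔤) (H : 𝔞) : gC 𝔤 :=
  ⟨Complex.I • (H : Mat n), Submodule.smul_mem _ _ (Submodule.subset_span (h𝔞 _ H.2))⟩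

theorem IsMaximalAbelian.mem_g {𝔤 : LieSubalgebra ℝ (Mat n)} {θ : 𝔤 →ₗ⁅ℝ⁆ 𝔤}
    {𝔞 : Submodule ℝ (Mat n)} (h : IsMaximalAbelian 𝔤 θ 𝔞) : ∀ H ∈ 𝔞, H ∈ 𝔤 := by
  intro H hH
  obtain ⟨Y, -, rfl⟩ := (mem_pPart 𝔤 θ).1 (h.prop.1 hH)
  exact Y.2

/-- The point `g exp(iH) K^ℂ` of `G^ℂ / K^ℂ`, for `g ∈ G` and `H ∈ 𝔞`. -/
def point {𝔞 : Submodule ℝ (Mat n)} (h𝔞 : ∀ H ∈ 𝔞, H ∈ 𝔤) (g : groupG 𝔤) (H : 𝔞) :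
    Complexification 𝔤 θ :=
  QuotientGroup.mk (Subgroup.inclusion (groupG_le_groupGC 𝔤) g * expGC 𝔤 (iMul 𝔤 h𝔞 H))

/-- The Akhiezer–Gindikin domain `{g exp(iH) K^ℂ : g ∈ G, H ∈ ω}`. -/
def domainAG {𝔞 : Submodule ℝ (Mat n)} (h𝔞 : ∀ H ∈ 𝔞, H ∈ 𝔤) :
    Set (Complexification 𝔤 θ) :=
  {x | ∃ g : groupG 𝔤, ∃ H ∈ omega 𝔤 𝔞, x = point 𝔤 θ h𝔞 g H}

/-- `f` is (on the Akhiezer–Gindikin domain) the `G`-invariant extension of `u`: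
`f (g exp(iH) K^ℂ) = u H` for all `g ∈ G` and `H ∈ ω`. -/
def IsInvariantExtension {𝔞 : Submodule ℝ (Mat n)} (h𝔞 : ∀ H ∈ 𝔞, H ∈ 𝔤) (u : 𝔞 → ℝ)
    (f : Complexification 𝔤 θ → ℝ) : Prop :=
  ∀ g : groupG 𝔤, ∀ H ∈ omega 𝔤 𝔞, f (point 𝔤 θ h𝔞 g H) = u H

end Symmetric

/-- The Levi form `∑ ∂²φ/∂z_j∂z̄_k v_j v̄_k` of a real function on a complex vector space, at the
point `p` and in the direction `v`. -/
def leviForm {V : Type*} [NormedAddCommGroup V] [NormedSpace ℂ V] (φ : V → ℝ) (p v : V) : ℝ :=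
  (1 / 4 : ℝ) * (fderiv ℝ (fderiv ℝ φ) p v v +
    fderiv ℝ (fderiv ℝ φ) p (Complex.I • v) (Complex.I • v))

section Psh

variable (𝔤 : LieSubalgebra ℝ (Mat n)) (θ : 𝔤 →ₗ⁅ℝ⁆ 𝔤)

/-- The pullback of a function `f` on `G^ℂ / K^ℂ` to `G^ℂ`, in the holomorphic coordinates
`Z ↦ g exp(Z)` of `G^ℂ` around `g`. -/
def pullback (f : Complexification 𝔤 θ → ℝ) (g : groupGC 𝔤) (Z : gC 𝔤) : ℝ :=
  f (QuotientGroup.mk (g * expGC 𝔤 Z))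

/-- `f` is of class `C²` with positive definite Levi form on a set `Ω` of points of `G^ℂ / K^ℂ`.

The complex structure of `G^ℂ / K^ℂ` is the one for which `π : G^ℂ → G^ℂ / K^ℂ` is a holomorphic
submersion. So `f` is `C²` near `gK^ℂ` if and only if `f ∘ π` is `C²` near `g`, and the Levi form of
`f` in the direction of the tangent vector `dπ(Z)` (with `Z ∈ 𝔤^ℂ = T_g G^ℂ`) is the Levi form of
`f ∘ π` in the direction of `Z`. As `ker dπ = 𝔨^ℂ`, the nonzero tangent vectors at `gK^ℂ` are those
given by the `Z ∈ 𝔤^ℂ` outside `𝔨^ℂ`. -/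
def StrictlyPlurisubharmonicOn (f : Complexification 𝔤 θ → ℝ)
    (Ω : Set (Complexification 𝔤 θ)) : Prop :=
  ∀ g : groupGC 𝔤, (QuotientGroup.mk g : Complexification 𝔤 θ) ∈ Ω →
    ContDiffAt ℝ 2 (pullback 𝔤 θ f g) 0 ∧
      ∀ Z : gC 𝔤, (Z : Mat n) ∉ kC 𝔤 θ → 0 < leviForm (pullback 𝔤 θ f g) 0 Z

end Psh

/-- Strict convexity of a `C²` function on an open set: the Hessian is positive definite. -/
def HasPosDefHessianOn {V : Type*} [NormedAddCommGroup V] [NormedSpace ℝ V] (u : V → ℝ)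
    (s : Set V) : Prop :=
  ∀ x ∈ s, ∀ v : V, v ≠ 0 → 0 < fderiv ℝ (fderiv ℝ u) x v v

end AkhiezerGindikin

end

/-! The extension is well defined because the decomposition G exp(iω) K^ℂ determines the ω-component
up to W (`CartanData.Realization.exists_normalizer`). Suppose g exp(iH₁) k = exp(iH₂), and write Ad
g = κ exp(ad P) by the Cartan decomposition of the adjoint group. Ad k commutes with the complex
linear extension of θ, which eliminates k, and complex conjugation supplies a second relation.
Together they force Ad(exp 2iH₁) P = -P. The eigenvalues of Ad(exp 2iH₁) are exp(2iα(H₁)), and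
|α(H₁)| < π/2 excludes -1, so P = 0. What remains is exp(2i ad H₁) = exp(2i ad κ⁻¹H₂). Both
exponents have spectrum in i(-π, π), so H₁ = κ⁻¹H₂, and elements of 𝔞 that are conjugate under K are
conjugate under W.

For regularity, 𝔤^ℂ = 𝔤 + i Z_𝔭(H) + Ad(exp iH) 𝔨^ℂ when H ∈ ω. In the corresponding coordinates of
the second kind near exp(iH), the extension becomes U(H + Y) with Y ∈ Z_𝔭(H), where U is the
K-invariant extension of u to 𝔭. So it suffices that U is C²
(`CartanData.IsInvariantExt.contDiffOn`), and the difficulty lies on the walls of the Weyl chambers.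
By equivariance the Hessian of U at H ∈ 𝔞 must be Hess u on 𝔞 and the scalar α(∇u)/α(H) on the
α-directions. Where α(H) = 0, invariance under the reflection in α replaces the quotient by its
limit, a second derivative of u. This candidate `hessExt` commutes with the centralizer of H in K
and is continuous along 𝔞. Both derivatives of U are then computed by writing points of 𝔭 near H as
exp(ad T) w (H + Y), with T ∈ 𝔨, w in the centralizer of H and Y ∈ 𝔞.

For positivity (`CartanData.levi_pos`), let Q(z, w) be the mixed second derivative of the function
at exp(sz) exp(tw) exp(iH), and L its first derivative. Q vanishes for z ∈ 𝔤 by left invariance and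
for w ∈ Ad(exp iH) 𝔨^ℂ by right invariance, and Q(z, w) - Q(w, z) = L([z, w]). These rules reduce
Q(z, z) + Q(iz, iz) to two terms Q(iP, iP) with P ∈ 𝔭, and yield Q(iP, iP) = Q(iP₀, iP₀) + ∑
cot(α(H)) α(∇u) q_α², where P₀ is the component of P that commutes with H and the sum runs over α(H)
≠ 0. The first term is a second derivative of u in a direction of 𝔞 conjugate to P₀. In the sum,
convexity and reflection invariance give α(∇u) the sign of α(H), and |α(H)| < π/2 gives the
cotangent the same sign. -/

noncomputable section

/-! ### Lie algebras with a Cartan involution and their restricted root decomposition -/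

namespace AkhiezerGindikin

open Module Filter Topology

local notation "⟪" x ", " y "⟫" => inner ℝ x y

/-- A finite-dimensional real Lie algebra with a Cartan involution `θ`, in terms of its bracket
`br` and of the inner product `-B(x, θ y)`. -/
structure CartanData (E : Type*) [NormedAddCommGroup E] [InnerProductSpace ℝ E] where
  br : E →L[ℝ] E →L[ℝ] E
  br_self : ∀ x, br x x = 0
  jacobi : ∀ x y z, br x (br y z) = br (br x y) z + br y (br x z)
  θ : E →L[ℝ] E
  θ_θ : ∀ x, θ (θ x) = x
  θ_br : ∀ x y, θ (br x y) = br (θ x) (θ y)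
  inner_θ : ∀ x y, ⟪θ x, θ y⟫ = ⟪x, y⟫
  inner_br : ∀ x y z, ⟪br x y, z⟫ = -⟪y, br (θ x) z⟫
  center : ∀ x, (∀ y, br x y = 0) → x = 0
  derivation : ∀ D : E →ₗ[ℝ] E, (∀ x y, D (br x y) = br (D x) y + br x (D y)) →
    ∃ x, ∀ y, D y = br x y

variable {E : Type*} [NormedAddCommGroup E] [InnerProductSpace ℝ E]

namespace CartanData

variable (S : CartanData E)

theorem br_swap (x y : E) : S.br x y = -S.br y x := by
  have h := S.br_self (x + y)
  simp only [map_add, add_apply, S.br_self, zero_add, add_zero] at h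
  exact eq_neg_of_add_eq_zero_left (by rw [add_comm]; exact h)

theorem inner_br_p {x : E} (hx : S.θ x = -x) (y z : E) : ⟪S.br x y, z⟫ = ⟪y, S.br x z⟫ := by
  rw [S.inner_br, hx]; simp

theorem inner_br_k {x : E} (hx : S.θ x = x) (y z : E) : ⟪S.br x y, z⟫ = -⟪y, S.br x z⟫ := by
  rw [S.inner_br, hx]

theorem inner_θ_left (x y : E) : ⟪S.θ x, y⟫ = ⟪x, S.θ y⟫ := by
  rw [← S.inner_θ, S.θ_θ]

theorem inner_k_p {x y : E} (hx : S.θ x = x) (hy : S.θ y = -y) : ⟪x, y⟫ = 0 := by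
  have h := S.inner_θ x y
  rw [hx, hy, inner_neg_right] at h
  linarith

theorem br_pp {x y : E} (hx : S.θ x = -x) (hy : S.θ y = -y) : S.θ (S.br x y) = S.br x y := by
  rw [S.θ_br, hx, hy]; simp

theorem br_kp {x y : E} (hx : S.θ x = x) (hy : S.θ y = -y) : S.θ (S.br x y) = -S.br x y := by
  rw [S.θ_br, hx, hy]; simp

theorem br_pk {x y : E} (hx : S.θ x = -x) (hy : S.θ y = y) : S.θ (S.br x y) = -S.br x y := by
  rw [S.θ_br, hx, hy]; simp

theorem br_kk {x y : E} (hx : S.θ x = x) (hy : S.θ y = y) : S.θ (S.br x y) = S.br x y := by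
  rw [S.θ_br, hx, hy]

theorem eq_of_br_eq {x y : E} (h : S.br x = S.br y) : x = y := by
  rw [← sub_eq_zero]
  refine S.center _ fun z => ?_
  rw [map_sub, h, sub_self, zero_apply]

/-- The projection to the `-1` eigenspace of `θ`. -/
def projP : E →L[ℝ] E := (2⁻¹ : ℝ) • (ContinuousLinearMap.id ℝ E - S.θ)

/-- The projection to the `+1` eigenspace of `θ`. -/
def projK : E →L[ℝ] E := (2⁻¹ : ℝ) • (ContinuousLinearMap.id ℝ E + S.θ)

theorem projP_apply (x : E) : S.projP x = (2⁻¹ : ℝ) • (x - S.θ x) := rfl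

theorem projK_apply (x : E) : S.projK x = (2⁻¹ : ℝ) • (x + S.θ x) := rfl

theorem θ_projP (x : E) : S.θ (S.projP x) = -S.projP x := by
  simp only [projP_apply, map_smul, map_sub, S.θ_θ, ← smul_neg, neg_sub]

theorem θ_projK (x : E) : S.θ (S.projK x) = S.projK x := by
  simp only [projK_apply, map_smul, map_add, S.θ_θ, add_comm]

theorem projK_add_projP (x : E) : S.projK x + S.projP x = x := by
  rw [projK_apply, projP_apply, ← smul_add]
  rw [show x + S.θ x + (x - S.θ x) = (2 : ℝ) • x by rw [two_smul]; abel, smul_smul]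
  norm_num

theorem projP_of_p {x : E} (hx : S.θ x = -x) : S.projP x = x := by
  rw [projP_apply, hx, sub_neg_eq_add, ← two_smul ℝ x, smul_smul]; norm_num

theorem projP_of_k {x : E} (hx : S.θ x = x) : S.projP x = 0 := by
  rw [projP_apply, hx, sub_self, smul_zero]

theorem projK_of_k {x : E} (hx : S.θ x = x) : S.projK x = x := by
  rw [projK_apply, hx, ← two_smul ℝ x, smul_smul]; norm_num

theorem inner_projP_of_p {y : E} (hy : S.θ y = -y) (x : E) : ⟪S.projP x, y⟫ = ⟪x, y⟫ := by
  conv_rhs => rw [← S.projK_add_projP x, inner_add_left, S.inner_k_p (S.θ_projK x) hy, zero_add]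

theorem inner_projK_of_k {y : E} (hy : S.θ y = y) (x : E) : ⟪S.projK x, y⟫ = ⟪x, y⟫ := by
  conv_rhs => rw [← S.projK_add_projP x, inner_add_left, real_inner_comm y (S.projP x),
    S.inner_k_p hy (S.θ_projP x), add_zero]

/-- `𝔞` is a maximal abelian subspace of the `-1` eigenspace of `θ`. -/
structure IsMaxAbelian (𝔞 : Submodule ℝ E) : Prop where
  θ_eq : ∀ x ∈ 𝔞, S.θ x = -x
  comm : ∀ x ∈ 𝔞, ∀ y ∈ 𝔞, S.br x y = 0
  max : ∀ x, S.θ x = -x → (∀ y ∈ 𝔞, S.br y x = 0) → x ∈ 𝔞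

/-- An orthonormal basis of joint eigenvectors of `𝔞`; the weight of `e i` is represented by the
vector `A i` of `𝔞`. -/
structure RootBasis (𝔞 : Submodule ℝ E) where
  ι : Type
  [fintype : Fintype ι]
  e : OrthonormalBasis ι ℝ E
  A : ι → E
  A_mem : ∀ i, A i ∈ 𝔞
  br_e : ∀ H ∈ 𝔞, ∀ i, S.br H (e i) = ⟪A i, H⟫ • e i

attribute [instance] RootBasis.fintype

/-- The operators ad H, H ∈ 𝔞, are symmetric because θH = -H, and they commute by the Jacobi
identity, so they are simultaneously diagonalisable. The eigenvalue on a joint eigenvector is linear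
in H, hence represented by a vector of 𝔞. -/
theorem nonempty_rootBasis [FiniteDimensional ℝ E] {𝔞 : Submodule ℝ E}
    (h𝔞 : S.IsMaxAbelian 𝔞) : Nonempty (S.RootBasis 𝔞) := by
  classical
  let T : 𝔞 → E →ₗ[ℝ] E := fun H => (S.br (H : E)).toLinearMap
  have hT : ∀ H, (T H).IsSymmetric := fun H x y => S.inner_br_p (h𝔞.θ_eq _ H.2) x y
  have hC : Pairwise (Function.onFun Commute T) := by
    intro H H' _
    refine LinearMap.ext fun x => ?_
    change S.br H (S.br H' x) = S.br H' (S.br H x)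
    rw [S.jacobi, h𝔞.comm _ H.2 _ H'.2]
    simp
  have hI := LinearMap.IsSymmetric.directSum_isInternal_of_pairwise_commute hT hC
  have hO := LinearMap.IsSymmetric.orthogonalFamily_iInf_eigenspaces hT
  set V : (𝔞 → ℝ) → Submodule ℝ E := fun γ => ⨅ j, End.eigenspace (T j) (γ j) with hV
  have hfin : {γ | V γ ≠ ⊥}.Finite :=
    WellFoundedGT.finite_ne_bot_of_iSupIndep hI.submodule_iSupIndep
  have : Fintype {γ // V γ ≠ ⊥} := hfin.fintype
  have hI' := (DirectSum.isInternal_ne_bot_iff).2 hI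
  have hO' : OrthogonalFamily ℝ (fun γ : {γ // V γ ≠ ⊥} => V γ) fun γ => (V γ).subtypeₗᵢ :=
    hO.comp Subtype.val_injective
  let e := hI'.subordinateOrthonormalBasis rfl hO'
  have he : ∀ i, ∃ γ : 𝔞 → ℝ, ∀ H : 𝔞, S.br H (e i) = γ H • e i := by
    intro i
    have := hI'.subordinateOrthonormalBasis_subordinate rfl i hO'
    generalize (hI'.subordinateOrthonormalBasisIndex rfl i hO' : {γ // V γ ≠ ⊥}) = γ at this
    exact ⟨γ, fun H => End.mem_eigenspace_iff.1 ((Submodule.mem_iInf _).1 this H)⟩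
  have hA : ∀ i, ∃ A ∈ 𝔞, ∀ H ∈ 𝔞, S.br H (e i) = ⟪A, H⟫ • e i := by
    intro i
    obtain ⟨γ, hγ⟩ := he i
    have hγ' : ∀ H : 𝔞, γ H = ⟪e i, S.br H (e i)⟫ := by
      intro H
      rw [hγ, inner_smul_right, real_inner_self_eq_norm_sq, e.orthonormal.1]; simp
    let φ : 𝔞 →L[ℝ] ℝ := LinearMap.toContinuousLinearMap
      { toFun := fun H => ⟪e i, S.br (H : E) (e i)⟫
        map_add' := fun x y => by simp [inner_add_right]
        map_smul' := fun c x => by simp [inner_smul_right] }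
    refine ⟨((InnerProductSpace.toDual ℝ 𝔞).symm φ : 𝔞), Subtype.mem _, fun H hH => ?_⟩
    have h1 : ⟪((InnerProductSpace.toDual ℝ 𝔞).symm φ : 𝔞), (⟨H, hH⟩ : 𝔞)⟫ = φ ⟨H, hH⟩ :=
      InnerProductSpace.toDual_symm_apply
    have h2 := hγ ⟨H, hH⟩
    rw [Submodule.coe_inner] at h1
    rw [h1, show φ ⟨H, hH⟩ = γ ⟨H, hH⟩ from (hγ' _).symm]
    exact h2
  choose A hA1 hA2 using hA
  exact ⟨⟨_, e, A, hA1, fun H hH i => hA2 i H hH⟩⟩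

namespace RootBasis

variable {S} {𝔞 : Submodule ℝ E} (b : S.RootBasis 𝔞)

/-- The component of a root vector in the `-1` eigenspace of `θ`. -/
def X (i : b.ι) : E := S.projP (b.e i)

/-- The component of a root vector in the `+1` eigenspace of `θ`. -/
def T (i : b.ι) : E := S.projK (b.e i)

theorem θ_X (i : b.ι) : S.θ (b.X i) = -b.X i := S.θ_projP _

theorem θ_T (i : b.ι) : S.θ (b.T i) = b.T i := S.θ_projK _

variable (h𝔞 : S.IsMaxAbelian 𝔞)

include h𝔞 in
theorem br_θe {H : E} (hH : H ∈ 𝔞) (i : b.ι) :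
    S.br H (S.θ (b.e i)) = -(⟪b.A i, H⟫ • S.θ (b.e i)) := by
  have h := congrArg S.θ (b.br_e H hH i)
  rw [S.θ_br, h𝔞.θ_eq H hH, map_smul, map_neg, neg_apply] at h
  rw [← h, neg_neg]

include h𝔞 in
theorem br_X {H : E} (hH : H ∈ 𝔞) (i : b.ι) : S.br H (b.X i) = ⟪b.A i, H⟫ • b.T i := by
  rw [X, T, projP_apply, projK_apply, map_smul, map_sub, b.br_e H hH, b.br_θe h𝔞 hH,
    sub_neg_eq_add, smul_add, smul_add, smul_add, smul_comm, smul_comm (2⁻¹ : ℝ)]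

include h𝔞 in
theorem br_T {H : E} (hH : H ∈ 𝔞) (i : b.ι) : S.br H (b.T i) = ⟪b.A i, H⟫ • b.X i := by
  rw [X, T, projP_apply, projK_apply, map_smul, map_add, b.br_e H hH, b.br_θe h𝔞 hH,
    ← sub_eq_add_neg, smul_sub, smul_sub, smul_sub, smul_comm, smul_comm (2⁻¹ : ℝ)]

theorem inner_X {V : E} (hV : S.θ V = -V) (i : b.ι) : ⟪b.X i, V⟫ = ⟪b.e i, V⟫ :=
  S.inner_projP_of_p hV _

theorem inner_T {V : E} (hV : S.θ V = V) (i : b.ι) : ⟪b.T i, V⟫ = ⟪b.e i, V⟫ :=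
  S.inner_projK_of_k hV _

theorem sum_X {V : E} (hV : S.θ V = -V) : ∑ i, ⟪b.X i, V⟫ • b.X i = V := by
  conv_rhs => rw [← S.projP_of_p hV, ← b.e.sum_repr' V, map_sum]
  simp only [map_smul, ← b.inner_X hV, X]

theorem sum_T {V : E} (hV : S.θ V = V) : ∑ i, ⟪b.T i, V⟫ • b.T i = V := by
  conv_rhs => rw [← S.projK_of_k hV, ← b.e.sum_repr' V, map_sum]
  simp only [map_smul, ← b.inner_T hV, T]

include h𝔞 in
theorem X_mem (i : b.ι) (hi : b.A i = 0) : b.X i ∈ 𝔞 :=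
  h𝔞.max _ (b.θ_X i) fun y hy => by rw [b.br_X h𝔞 hy, hi, inner_zero_left, zero_smul]

include h𝔞 in
theorem inner_X_of_mem {V : E} (hV : V ∈ 𝔞) {i : b.ι} (hi : b.A i ≠ 0) : ⟪b.X i, V⟫ = 0 := by
  have h1 := S.inner_br_p (h𝔞.θ_eq _ (b.A_mem i)) (b.T i) V
  rw [b.br_T h𝔞 (b.A_mem i), h𝔞.comm _ (b.A_mem i) _ hV, inner_zero_right, inner_smul_left] at h1
  simpa [hi] using h1

include h𝔞 in
/-- Coefficients of elements of `𝔭` that commute with `H ∈ 𝔞`. -/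
theorem inner_X_eq_zero {H V : E} (hH : H ∈ 𝔞) (hHV : S.br H V = 0) {i : b.ι}
    (hi : ⟪b.A i, H⟫ ≠ 0) : ⟪b.X i, V⟫ = 0 := by
  have h1 := S.inner_br_p (h𝔞.θ_eq _ hH) (b.T i) V
  rw [b.br_T h𝔞 hH, hHV, inner_zero_right, inner_smul_left] at h1
  simpa [hi] using h1

include h𝔞 in
/-- Coefficients of elements of `𝔨` that commute with `H ∈ 𝔞`. -/
theorem inner_T_eq_zero {H V : E} (hH : H ∈ 𝔞) (hHV : S.br H V = 0) {i : b.ι}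
    (hi : ⟪b.A i, H⟫ ≠ 0) : ⟪b.T i, V⟫ = 0 := by
  have h1 := S.inner_br_p (h𝔞.θ_eq _ hH) (b.X i) V
  rw [b.br_X h𝔞 hH, hHV, inner_zero_right, inner_smul_left] at h1
  simpa [hi] using h1

include h𝔞 b in
/-- A regular element of `𝔞`. -/
theorem exists_regular : ∃ H ∈ 𝔞, ∀ V, S.θ V = -V → S.br H V = 0 → V ∈ 𝔞 := by
  -- Finitely many nonzero functionals have a common point where none of them vanishes.
  obtain ⟨H, hH, h⟩ := Module.Dual.exists_forall_mem_ne_zero_of_forall_exists 𝔞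
    (fun i : {i // b.A i ≠ 0} => (innerSL ℝ (b.A i)).toLinearMap)
    (fun i => ⟨b.A i, b.A_mem i, by simpa using i.2⟩)
  refine ⟨H, hH, fun V hV hHV => ?_⟩
  rw [← b.sum_X hV]
  refine Submodule.sum_mem _ fun i _ => ?_
  by_cases hi : b.A i = 0
  · exact Submodule.smul_mem _ _ (b.X_mem h𝔞 i hi)
  · rw [b.inner_X_eq_zero h𝔞 hH hHV (h ⟨i, hi⟩), zero_smul]
    exact Submodule.zero_mem _

/-- The operator norm of `ad H`. -/
theorem norm_br_lt_iff {H : E} (hH : H ∈ 𝔞) {r : ℝ} (hr : 0 < r) :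
    ‖S.br H‖ < r ↔ ∀ i, |⟪b.A i, H⟫| < r := by
  constructor
  · intro h i
    have h1 := (S.br H).le_opNorm (b.e i)
    rw [b.br_e H hH, norm_smul, b.e.orthonormal.1, mul_one, mul_one, Real.norm_eq_abs] at h1
    exact h1.trans_lt h
  · intro h
    have : ∃ M, 0 ≤ M ∧ M < r ∧ ∀ i, |⟪b.A i, H⟫| ≤ M := by
      rcases isEmpty_or_nonempty b.ι with hι | hι
      · exact ⟨0, le_rfl, hr, fun i => isEmptyElim i⟩
      · obtain ⟨j, hj⟩ := Finite.exists_max fun i => |⟪b.A i, H⟫|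
        exact ⟨_, abs_nonneg _, h j, hj⟩
    obtain ⟨M, hM0, hMr, hM⟩ := this
    refine lt_of_le_of_lt (ContinuousLinearMap.opNorm_le_bound _ hM0 fun x => ?_) hMr
    have key : ∀ y : E, ‖y‖ ^ 2 = ∑ i, ⟪b.e i, y⟫ ^ 2 := fun y => by
      rw [← b.e.sum_sq_norm_inner_right y]
      simp
    have hbr : ∀ i, ⟪b.e i, S.br H x⟫ = ⟪b.A i, H⟫ * ⟪b.e i, x⟫ := by
      intro i
      conv_lhs => rw [← b.e.sum_repr' x, map_sum]
      simp only [map_smul, b.br_e H hH, inner_sum, inner_smul_right]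
      rw [Finset.sum_eq_single i]
      · rw [real_inner_self_eq_norm_sq, b.e.orthonormal.1]; ring
      · intro j _ hj
        rw [b.e.orthonormal.2 hj.symm]; ring
      · simp
    refine le_of_sq_le_sq ?_ (by positivity)
    rw [mul_pow, key, key x, Finset.mul_sum]
    refine Finset.sum_le_sum fun i _ => ?_
    rw [hbr, mul_pow, ← sq_abs ⟪b.A i, H⟫]
    gcongr
    exact hM i

end RootBasis

end CartanData

end AkhiezerGindikin

end

/-! ### Exponentials of operators, invariance and derivations -/

noncomputable section

namespace AkhiezerGindikin

open Module Filter Topology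

section BanachAlgebra

variable {𝔸 : Type*} [NormedRing 𝔸] [NormedAlgebra ℝ 𝔸] [CompleteSpace 𝔸]

theorem exp_add_comm' {a b : 𝔸} (h : Commute a b) :
    NormedSpace.exp (a + b) = NormedSpace.exp a * NormedSpace.exp b := by
  let : NormedAlgebra ℚ 𝔸 := NormedAlgebra.restrictScalars ℚ ℝ 𝔸
  exact NormedSpace.exp_add_of_commute h

theorem exp_mul_exp_neg (a : 𝔸) : NormedSpace.exp a * NormedSpace.exp (-a) = 1 := by
  rw [← exp_add_comm' (Commute.neg_right (Commute.refl a)), add_neg_cancel, NormedSpace.exp_zero]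

theorem exp_neg_mul_exp (a : 𝔸) : NormedSpace.exp (-a) * NormedSpace.exp a = 1 := by
  rw [← exp_add_comm' (Commute.neg_left (Commute.refl a)), neg_add_cancel, NormedSpace.exp_zero]

theorem semiconjBy_exp {x a b : 𝔸} (h : SemiconjBy x a b) :
    SemiconjBy x (NormedSpace.exp a) (NormedSpace.exp b) := by
  let : NormedAlgebra ℚ 𝔸 := NormedAlgebra.restrictScalars ℚ ℝ 𝔸
  exact h.exp_right

theorem contDiff_exp {m : WithTop ℕ∞} : ContDiff ℝ m (NormedSpace.exp : 𝔸 → 𝔸) :=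
  contDiff_iff_contDiffAt.2 fun x => (NormedSpace.exp_analytic (𝕂 := ℝ) x).contDiffAt

theorem hasFDerivAt_exp_zero' :
    HasFDerivAt (NormedSpace.exp : 𝔸 → 𝔸) (ContinuousLinearEquiv.refl ℝ 𝔸 : 𝔸 →L[ℝ] 𝔸) 0 :=
  hasFDerivAt_exp_zero (𝕂 := ℝ)

/-- The local inverse of the exponential map. -/
def logOne : 𝔸 → 𝔸 :=
  (contDiff_exp (𝔸 := 𝔸) (m := ω)).contDiffAt.localInverse hasFDerivAt_exp_zero' (by simp)

theorem contDiffAt_logOne {m : WithTop ℕ∞} : ContDiffAt ℝ m (logOne : 𝔸 → 𝔸) 1 := by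
  have := (contDiff_exp (𝔸 := 𝔸) (m := ω)).contDiffAt.to_localInverse
    hasFDerivAt_exp_zero' (by simp)
  rw [NormedSpace.exp_zero] at this
  exact this.of_le le_top

theorem logOne_one : logOne (1 : 𝔸) = 0 := by
  have := (contDiff_exp (𝔸 := 𝔸) (m := ω)).contDiffAt.localInverse_apply_image
    hasFDerivAt_exp_zero' (by simp)
  rwa [NormedSpace.exp_zero] at this

theorem eventually_exp_logOne : ∀ᶠ x in 𝓝 (1 : 𝔸), NormedSpace.exp (logOne x) = x := by
  have := ((contDiff_exp (𝔸 := 𝔸) (m := ω)).contDiffAt.hasStrictFDerivAt'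
    hasFDerivAt_exp_zero' (by simp)).eventually_right_inverse
  rwa [NormedSpace.exp_zero] at this

theorem eventually_logOne_exp : ∀ᶠ x in 𝓝 (0 : 𝔸), logOne (NormedSpace.exp x) = x :=
  ((contDiff_exp (𝔸 := 𝔸) (m := ω)).contDiffAt.hasStrictFDerivAt'
    hasFDerivAt_exp_zero' (by simp)).eventually_left_inverse

theorem tendsto_logOne : Tendsto (logOne : 𝔸 → 𝔸) (𝓝 1) (𝓝 0) := by
  have := (contDiffAt_logOne (𝔸 := 𝔸) (m := 0)).continuousAt.tendsto
  rwa [logOne_one] at this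

theorem hasDerivAt_exp_smul (a : 𝔸) (t : ℝ) :
    HasDerivAt (fun s : ℝ => NormedSpace.exp (s • a)) (NormedSpace.exp (t • a) * a) t :=
  hasDerivAt_exp_smul_const a t

theorem hasDerivAt_exp_smul' (a : 𝔸) (t : ℝ) :
    HasDerivAt (fun s : ℝ => NormedSpace.exp (s • a)) (a * NormedSpace.exp (t • a)) t :=
  hasDerivAt_exp_smul_const' a t

/-- Uniform closeness of one-parameter groups to `1`. -/
theorem eventually_exp_smul_sub_one {δ : ℝ} (hδ : 0 < δ) :
    ∀ᶠ a in 𝓝 (0 : 𝔸), ∀ t : ℝ, |t| ≤ 1 → ‖NormedSpace.exp (t • a) - 1‖ ≤ δ := by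
  have h : Tendsto (fun a : 𝔸 => ‖NormedSpace.exp a - 1‖) (𝓝 0) (𝓝 0) := by
    have : Continuous fun a : 𝔸 => ‖NormedSpace.exp a - 1‖ :=
      ((contDiff_exp (𝔸 := 𝔸) (m := 0)).continuous.sub continuous_const).norm
    simpa [NormedSpace.exp_zero] using this.tendsto 0
  obtain ⟨r, hr, hr'⟩ := Metric.eventually_nhds_iff_ball.1 (h.eventually_le_const hδ)
  filter_upwards [Metric.ball_mem_nhds 0 hr] with a ha t ht
  refine hr' _ ?_
  rw [mem_ball_zero_iff] at ha ⊢
  rw [norm_smul, Real.norm_eq_abs]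
  exact lt_of_le_of_lt (mul_le_of_le_one_left (norm_nonneg _) ht) ha

end BanachAlgebra

section Operators

variable {V W : Type*} [NormedAddCommGroup V] [NormedSpace ℝ V] [CompleteSpace V]
  [NormedAddCommGroup W] [NormedSpace ℝ W] [CompleteSpace W]

theorem hasDerivAt_exp_smul_apply (D : V →L[ℝ] V) (x : V) (t : ℝ) :
    HasDerivAt (fun s : ℝ => NormedSpace.exp (s • D) x) (NormedSpace.exp (t • D) (D x)) t :=
  by
  simpa using (hasDerivAt_exp_smul D t).clm_apply (hasDerivAt_const t x)

theorem hasDerivAt_exp_smul_apply' (D : V →L[ℝ] V) (x : V) (t : ℝ) :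
    HasDerivAt (fun s : ℝ => NormedSpace.exp (s • D) x) (D (NormedSpace.exp (t • D) x)) t :=
  by
  simpa using (hasDerivAt_exp_smul' D t).clm_apply (hasDerivAt_const t x)

theorem exp_apply_of_eq_zero {D : V →L[ℝ] V} {x : V} (h : D x = 0) : NormedSpace.exp D x = x := by
  have h1 : ∀ t : ℝ, HasDerivAt (fun s : ℝ => NormedSpace.exp (s • D) x) 0 t := fun t => by
    simpa [h] using hasDerivAt_exp_smul_apply D x t
  have := is_const_of_deriv_eq_zero (fun t => (h1 t).differentiableAt) (fun t => (h1 t).deriv) 1 0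
  simpa [NormedSpace.exp_zero] using this

theorem exp_neg_exp_apply (D : V →L[ℝ] V) (x : V) :
    NormedSpace.exp (-D) (NormedSpace.exp D x) = x := by
  rw [← mul_apply_eq_comp, exp_neg_mul_exp]; rfl

theorem exp_exp_neg_apply (D : V →L[ℝ] V) (x : V) :
    NormedSpace.exp D (NormedSpace.exp (-D) x) = x := by
  rw [← mul_apply_eq_comp, exp_mul_exp_neg]; rfl

/-- The curve s ↦ exp(-sA) P exp(sB) x has zero derivative. Most exponential identities below come
from the same device: undo the flow and check that the result is constant. -/
theorem exp_intertwine {A : W →L[ℝ] W} {B : V →L[ℝ] V} {P : V →L[ℝ] W}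
    (h : ∀ x, A (P x) = P (B x)) (x : V) :
    NormedSpace.exp A (P x) = P (NormedSpace.exp B x) := by
  have h1 : ∀ t : ℝ, HasDerivAt (fun s : ℝ => NormedSpace.exp (s • (-A))
      (P (NormedSpace.exp (s • B) x))) 0 t := by
    intro t
    have h2 := (hasDerivAt_exp_smul (-A) t).clm_apply
      (P.hasFDerivAt.comp_hasDerivAt t (hasDerivAt_exp_smul_apply' B x t))
    refine h2.congr_deriv ?_
    simp [h]
  have := is_const_of_deriv_eq_zero (fun t => (h1 t).differentiableAt) (fun t => (h1 t).deriv) 1 0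
  simp only [one_smul, zero_smul, NormedSpace.exp_zero] at this
  change _ = P x at this
  rw [← this, exp_exp_neg_apply]

theorem exp_apply_eigenvector {D : V →L[ℝ] V} {x : V} {c : ℝ} (h : D x = c • x) :
    NormedSpace.exp D x = Real.exp c • x := by
  have := exp_intertwine (A := D) (B := c • ContinuousLinearMap.id ℝ ℝ)
    (P := (ContinuousLinearMap.id ℝ ℝ).smulRight x) (by intro y; simp [h, smul_smul, mul_comm]) 1
  simp only [ContinuousLinearMap.smulRight_apply, ContinuousLinearMap.id_apply, one_smul] at this
  rw [this]
  congr 1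
  have h2 := (hasDerivAt_exp_smul_apply (c • ContinuousLinearMap.id ℝ ℝ) (1 : ℝ))
  have h1 : ∀ t : ℝ, HasDerivAt (fun s : ℝ => Real.exp (-(s * c)) *
      (NormedSpace.exp (s • (c • ContinuousLinearMap.id ℝ ℝ)) (1 : ℝ))) 0 t := by
    intro t
    have h3 := (((hasDerivAt_id t).mul_const c).neg.exp).mul
      (hasDerivAt_exp_smul_apply' (c • ContinuousLinearMap.id ℝ ℝ) (1 : ℝ) t)
    refine h3.congr_deriv ?_
    simp; ring
  have := is_const_of_deriv_eq_zero (fun t => (h1 t).differentiableAt) (fun t => (h1 t).deriv) 1 0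
  simp only [one_smul, zero_smul, NormedSpace.exp_zero, one_mul, zero_mul, neg_zero,
    Real.exp_zero] at this
  rw [Real.exp_neg] at this
  field_simp at this
  simpa using this

/-- The derivative of the pullback of a bilinear map by a one-parameter group. -/
theorem hasDerivAt_exp_bilin (D : V →L[ℝ] V) (β : V →L[ℝ] V →L[ℝ] V) (x y : V) (t : ℝ) :
    HasDerivAt (fun s : ℝ => NormedSpace.exp (s • (-D))
      (β (NormedSpace.exp (s • D) x) (NormedSpace.exp (s • D) y)))
      (NormedSpace.exp (t • (-D))
        (β (D (NormedSpace.exp (t • D) x)) (NormedSpace.exp (t • D) y) +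
          β (NormedSpace.exp (t • D) x) (D (NormedSpace.exp (t • D) y)) -
          D (β (NormedSpace.exp (t • D) x) (NormedSpace.exp (t • D) y)))) t := by
  have h2 := (hasDerivAt_exp_smul (-D) t).clm_apply
    ((β.hasFDerivAt.comp_hasDerivAt t (hasDerivAt_exp_smul_apply' D x t)).clm_apply
      (hasDerivAt_exp_smul_apply' D y t))
  refine h2.congr_deriv ?_
  simp only [mul_apply_eq_comp, neg_apply, map_neg, map_sub, map_add, Function.comp_apply]
  abel

theorem exp_derivation {D : V →L[ℝ] V} {β : V →L[ℝ] V →L[ℝ] V}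
    (h : ∀ x y, D (β x y) = β (D x) y + β x (D y)) (x y : V) :
    NormedSpace.exp D (β x y) = β (NormedSpace.exp D x) (NormedSpace.exp D y) := by
  have h1 : ∀ t : ℝ, HasDerivAt (fun s : ℝ => NormedSpace.exp (s • (-D))
      (β (NormedSpace.exp (s • D) x) (NormedSpace.exp (s • D) y))) 0 t := fun t => by
    refine (hasDerivAt_exp_bilin D β x y t).congr_deriv ?_
    rw [h, sub_self, map_zero]
  have := is_const_of_deriv_eq_zero (fun t => (h1 t).differentiableAt) (fun t => (h1 t).deriv) 1 0
  simp only [one_smul, zero_smul, NormedSpace.exp_zero] at this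
  change _ = β x y at this
  rw [← this, exp_exp_neg_apply]

omit [CompleteSpace V] in
-- A closed curve cannot move steadily in the direction v: the mean value inequality for F t - t v
-- bounds ‖v‖ by the deviation of the velocity from v.
theorem norm_le_of_hasDerivAt_of_eq {F : ℝ → V} {F' : ℝ → V} (h : ∀ t, HasDerivAt F (F' t) t)
    (h01 : F 1 = F 0) {v : V} {C : ℝ} (hC : ∀ t ∈ Set.Ico (0 : ℝ) 1, ‖F' t - v‖ ≤ C) :
    ‖v‖ ≤ C := by
  have h1 := norm_image_sub_le_of_norm_deriv_le_segment_01' (f := fun t => F t - t • v)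
    (f' := fun t => F' t - v) (C := C)
    (fun t _ => ((h t).sub (by simpa using (hasDerivAt_id t).smul_const v)).hasDerivWithinAt) hC
  simpa [h01] using h1

/-- A fixed vector of `exp D`, for small `D`, is killed by `D`. -/
theorem eventually_eq_zero_of_exp_eq :
    ∀ᶠ D : V →L[ℝ] V in 𝓝 0, ∀ x, NormedSpace.exp D x = x → D x = 0 := by
  filter_upwards [eventually_exp_smul_sub_one (𝔸 := V →L[ℝ] V) (δ := 2⁻¹) (by norm_num)]
    with D hD x hx
  have h1 := norm_le_of_hasDerivAt_of_eq (fun t => hasDerivAt_exp_smul_apply D x t)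
    (by simpa [NormedSpace.exp_zero] using hx) (v := D x) (C := 2⁻¹ * ‖D x‖) (fun t ht => by
      have h3 : NormedSpace.exp (t • D) (D x) - D x = (NormedSpace.exp (t • D) - 1) (D x) := by
        simp
      rw [h3]
      refine ((NormedSpace.exp (t • D) - 1).le_opNorm _).trans ?_
      gcongr
      exact hD t (by rw [abs_of_nonneg ht.1]; exact ht.2.le))
  have : ‖D x‖ ≤ 0 := by linarith [norm_nonneg (D x)]
  simpa using this

/-- If `exp D` preserves a bilinear map and `D` is small, then `D` is a derivation. -/
theorem eventually_derivation_of_exp :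
    ∀ᶠ D : V →L[ℝ] V in 𝓝 0, ∀ β : V →L[ℝ] V →L[ℝ] V,
      (∀ x y, NormedSpace.exp D (β x y) = β (NormedSpace.exp D x) (NormedSpace.exp D y)) →
      ∀ x y, D (β x y) = β (D x) y + β x (D y) := by
  have hδ := eventually_exp_smul_sub_one (𝔸 := V →L[ℝ] V) (δ := 1 / 10) (by norm_num)
  filter_upwards [hδ] with D hD β hβ
  -- γ is the failure of the Leibniz rule. It is the velocity at time 0 of the pullback of β by
  -- exp(tD), a curve that returns to β at time 1.
  let γ : V →L[ℝ] V →L[ℝ] V := β.comp D + (β.flip.comp D).flip -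
    (ContinuousLinearMap.compL ℝ V V V D).comp β
  have hγ : ∀ x y, γ x y = β (D x) y + β x (D y) - D (β x y) := fun x y => by simp [γ]
  -- For exp(tD) within 1/10 of 1 the velocity stays within ‖γ‖/2 of γ. The bound ‖γ‖ ≤ ‖γ‖/2 then
  -- gives γ = 0.
  have key : ∀ x y, ‖γ x y‖ ≤ (1 / 2 * ‖γ‖) * ‖x‖ * ‖y‖ := by
    intro x y
    refine norm_le_of_hasDerivAt_of_eq (fun t => hasDerivAt_exp_bilin D β x y t) ?_ ?_
    · simp only [one_smul, zero_smul, NormedSpace.exp_zero, ← hβ, exp_neg_exp_apply]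
      simp
    · intro t ht
      have ht' : |t| ≤ 1 := by rw [abs_of_nonneg ht.1]; exact ht.2.le
      set c := NormedSpace.exp (t • D)
      set a := NormedSpace.exp (t • (-D))
      have hc : ‖c - 1‖ ≤ 1 / 10 := hD t ht'
      have ha : ‖a - 1‖ ≤ 1 / 10 := by
        have := hD (-t) (by rwa [abs_neg])
        simpa [a] using this
      have hcx : ∀ z, ‖c z - z‖ ≤ 1 / 10 * ‖z‖ := fun z =>
        ((c - 1).le_opNorm z).trans (by gcongr)
      have hcx' : ∀ z, ‖c z‖ ≤ 11 / 10 * ‖z‖ := fun z => by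
        have := norm_add_le (c z - z) z
        rw [sub_add_cancel] at this
        linarith [hcx z]
      have hax : ∀ z, ‖a z - z‖ ≤ 1 / 10 * ‖z‖ := fun z =>
        ((a - 1).le_opNorm z).trans (by gcongr)
      rw [← hγ]
      have e : a (γ (c x) (c y)) - γ x y = (a (γ (c x) (c y)) - γ (c x) (c y)) +
        γ (c x - x) (c y) + γ x (c y - y) := by
        simp only [map_sub, sub_apply]; abel
      rw [e]
      have hg : ∀ z w, ‖γ z w‖ ≤ ‖γ‖ * ‖z‖ * ‖w‖ := γ.le_opNorm₂
      have e1 : ‖a (γ (c x) (c y)) - γ (c x) (c y)‖ ≤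
          1 / 10 * (‖γ‖ * (11 / 10 * ‖x‖) * (11 / 10 * ‖y‖)) :=
        (hax _).trans (by gcongr; exact (hg _ _).trans (by gcongr <;> exact hcx' _))
      have e2 : ‖γ (c x - x) (c y)‖ ≤ ‖γ‖ * (1 / 10 * ‖x‖) * (11 / 10 * ‖y‖) :=
        (hg _ _).trans (by gcongr; exacts [hcx _, hcx' _])
      have e3 : ‖γ x (c y - y)‖ ≤ ‖γ‖ * ‖x‖ * (1 / 10 * ‖y‖) :=
        (hg _ _).trans (by gcongr; exact hcx _)
      have := norm_add₃_le (a := a (γ (c x) (c y)) - γ (c x) (c y)) (b := γ (c x - x) (c y))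
        (c := γ x (c y - y))
      have h0 : 0 ≤ ‖γ‖ * ‖x‖ * ‖y‖ := by positivity
      nlinarith
  have hγ0 : γ = 0 := by
    have := γ.opNorm_le_bound₂ (by positivity) key
    have h0 := norm_nonneg γ
    exact (norm_le_zero_iff (a := γ)).1 (by linarith)
  intro x y
  have := hγ x y
  rw [hγ0] at this
  simp only [zero_apply] at this
  exact (sub_eq_zero.1 this.symm).symm

end Operators

end AkhiezerGindikin

end

/-! ### The adjoint group: compactness of K, conjugacy in 𝔭, Cartan decomposition -/

noncomputable section

namespace AkhiezerGindikin

open Module Filter Topology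

local notation "⟪" x ", " y "⟫" => inner ℝ x y

section SymmetricExp

variable {E : Type*} [NormedAddCommGroup E] [InnerProductSpace ℝ E] [FiniteDimensional ℝ E]
  [CompleteSpace E]

omit [FiniteDimensional ℝ E] [CompleteSpace E] in
theorem clm_ext_orthonormalBasis {ι : Type*} [Fintype ι] (e : OrthonormalBasis ι ℝ E)
    {f g : E →L[ℝ] E} (h : ∀ i, f (e i) = g (e i)) : f = g :=
  ContinuousLinearMap.coe_injective (e.toBasis.ext fun i => by simpa using h i)

/-- The logarithm of a positive eigenvalue of `exp D`, for a symmetric operator `D`. -/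
theorem apply_eq_log_smul {D : E →L[ℝ] E} (hD : ∀ x y, ⟪D x, y⟫ = ⟪x, D y⟫) {y : E} {c : ℝ}
    (hy : NormedSpace.exp D y = c • y) : D y = Real.log c • y := by
  have hs : (D : E →ₗ[ℝ] E).IsSymmetric := hD
  set e := hs.eigenvectorBasis rfl
  set μ := hs.eigenvalues rfl
  have he : ∀ i, D (e i) = μ i • e i := fun i => hs.apply_eigenvectorBasis rfl i
  have h1 : ∀ i, ⟪e i, y⟫ = 0 ∨ μ i = Real.log c := by
    intro i
    have h2 : NormedSpace.exp D y = ∑ i, (⟪e i, y⟫ * Real.exp (μ i)) • e i := by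
      conv_lhs => rw [← e.sum_repr' y, map_sum]
      simp only [map_smul, exp_apply_eigenvector (he _), smul_smul]
    have h3 := congrArg (fun z => ⟪e i, z⟫) (h2.symm.trans hy)
    simp only [inner_sum, inner_smul_right] at h3
    rw [Finset.sum_eq_single i (fun j _ hj => by rw [e.orthonormal.2 hj.symm, mul_zero])
      (by simp), real_inner_self_eq_norm_sq, e.orthonormal.1] at h3
    by_cases h0 : ⟪e i, y⟫ = 0
    · exact Or.inl h0
    · right
      have : Real.exp (μ i) = c := by
        have h4 : ⟪e i, y⟫ * (Real.exp (μ i) - c) = 0 := by linear_combination h3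
        exact sub_eq_zero.1 ((mul_eq_zero.1 h4).resolve_left h0)
      rw [← this, Real.log_exp]
  conv_lhs => rw [← e.sum_repr' y, map_sum]
  conv_rhs => rw [← e.sum_repr' y, Finset.smul_sum]
  refine Finset.sum_congr rfl fun i _ => ?_
  rw [map_smul, he, smul_smul, smul_smul]
  rcases h1 i with h | h
  · rw [h]; simp
  · rw [h, mul_comm]

/-- An eigenbasis of D consists of eigenvectors of exp D = exp D', and the real logarithm recovers
the eigenvalues of D'. -/
theorem symmetric_exp_injective {D D' : E →L[ℝ] E} (hD : ∀ x y, ⟪D x, y⟫ = ⟪x, D y⟫)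
    (hD' : ∀ x y, ⟪D' x, y⟫ = ⟪x, D' y⟫) (h : NormedSpace.exp D = NormedSpace.exp D') :
    D = D' := by
  have hs : (D : E →ₗ[ℝ] E).IsSymmetric := hD
  refine clm_ext_orthonormalBasis (hs.eigenvectorBasis rfl) fun i => ?_
  have he : D (hs.eigenvectorBasis rfl i) = hs.eigenvalues rfl i • hs.eigenvectorBasis rfl i :=
    hs.apply_eigenvectorBasis rfl i
  rw [apply_eq_log_smul hD' (by rw [← h, exp_apply_eigenvector he]), he, Real.log_exp]

theorem symmetric_exp {D : E →L[ℝ] E} (hD : ∀ x y, ⟪D x, y⟫ = ⟪x, D y⟫) (x y : E) :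
    ⟪NormedSpace.exp D x, y⟫ = ⟪x, NormedSpace.exp D y⟫ := by
  have hs : (D : E →ₗ[ℝ] E).IsSymmetric := hD
  set e := hs.eigenvectorBasis rfl
  have he : ∀ i, NormedSpace.exp D (e i) = Real.exp (hs.eigenvalues rfl i) • e i :=
    fun i => exp_apply_eigenvector (hs.apply_eigenvectorBasis rfl i)
  have key : ∀ z i, ⟪NormedSpace.exp D z, e i⟫ = Real.exp (hs.eigenvalues rfl i) * ⟪z, e i⟫ := by
    intro z i
    conv_lhs => rw [← e.sum_repr' z, map_sum]
    simp only [map_smul, he, sum_inner, inner_smul_left]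
    rw [Finset.sum_eq_single i (fun j _ hj => by rw [e.orthonormal.2 hj]; simp) (by simp),
      real_inner_self_eq_norm_sq, e.orthonormal.1, real_inner_comm]
    simp [mul_comm]
  rw [← e.sum_inner_mul_inner, ← e.sum_inner_mul_inner]
  refine Finset.sum_congr rfl fun i _ => ?_
  rw [key, real_inner_comm (NormedSpace.exp D y) (e i), key, real_inner_comm y (e i)]
  ring

end SymmetricExp

variable {E : Type*} [NormedAddCommGroup E] [InnerProductSpace ℝ E]

namespace CartanData

variable (S : CartanData E)

/-- Automorphisms that preserve the form `⟪x, θ y⟫`. -/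
structure IsAut (g : E →L[ℝ] E) : Prop where
  br : ∀ x y, g (S.br x y) = S.br (g x) (g y)
  inner : ∀ x y, ⟪g x, S.θ (g y)⟫ = ⟪x, S.θ y⟫

/-- Automorphisms that commute with `θ` and fix the vector `H`. -/
structure IsKAut (H : E) (g : E →L[ℝ] E) : Prop extends S.IsAut g where
  θ : ∀ x, g (S.θ x) = S.θ (g x)
  fix : g H = H

theorem IsAut.one : S.IsAut 1 := ⟨fun _ _ => rfl, fun _ _ => rfl⟩

theorem IsKAut.one (H : E) : S.IsKAut H 1 := ⟨IsAut.one S, fun _ => rfl, rfl⟩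

variable {S}

theorem IsAut.mul {g h : E →L[ℝ] E} (hg : S.IsAut g) (hh : S.IsAut h) : S.IsAut (g * h) :=
  ⟨fun x y => by simp only [mul_apply_eq_comp, hh.br, hg.br],
    fun x y => by simp only [mul_apply_eq_comp, hh.inner, hg.inner]⟩

theorem IsKAut.mul {H : E} {g h : E →L[ℝ] E} (hg : S.IsKAut H g) (hh : S.IsKAut H h) :
    S.IsKAut H (g * h) :=
  ⟨hg.toIsAut.mul hh.toIsAut, fun x => by simp only [mul_apply_eq_comp, hh.θ, hg.θ],
    by simp only [mul_apply_eq_comp, hh.fix, hg.fix]⟩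

theorem IsAut.of_inverse {g h : E →L[ℝ] E} (hg : S.IsAut g) (hgh : g * h = 1)
    (hhg : h * g = 1) : S.IsAut h := by
  have h1 : ∀ x, g (h x) = x := fun x => DFunLike.congr_fun hgh x
  have h2 : ∀ x, h (g x) = x := fun x => DFunLike.congr_fun hhg x
  constructor
  · intro x y
    conv_lhs => rw [← h1 x, ← h1 y, ← hg.br, h2]
  · intro x y
    rw [← hg.inner, h1, h1]

theorem IsKAut.of_inverse {H : E} {g h : E →L[ℝ] E} (hg : S.IsKAut H g) (hgh : g * h = 1)
    (hhg : h * g = 1) : S.IsKAut H h := by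
  have h1 : ∀ x, g (h x) = x := fun x => DFunLike.congr_fun hgh x
  have h2 : ∀ x, h (g x) = x := fun x => DFunLike.congr_fun hhg x
  refine ⟨hg.toIsAut.of_inverse hgh hhg, fun x => ?_, ?_⟩
  · conv_lhs => rw [← h1 x, ← hg.θ, h2]
  · conv_lhs => rw [← hg.fix, h2]

theorem IsKAut.inner_map {H : E} {g : E →L[ℝ] E} (hg : S.IsKAut H g) (x y : E) :
    ⟪g x, g y⟫ = ⟪x, y⟫ := by
  have := hg.inner x (S.θ y)
  rwa [← hg.θ, S.θ_θ] at this

theorem IsKAut.norm_map {H : E} {g : E →L[ℝ] E} (hg : S.IsKAut H g) (x : E) : ‖g x‖ = ‖x‖ := by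
  rw [norm_eq_sqrt_real_inner, norm_eq_sqrt_real_inner, hg.inner_map]

theorem IsKAut.opNorm_le {H : E} {g : E →L[ℝ] E} (hg : S.IsKAut H g) : ‖g‖ ≤ 1 :=
  ContinuousLinearMap.opNorm_le_bound _ zero_le_one fun x => by rw [hg.norm_map, one_mul]

theorem IsAut.injective {g : E →L[ℝ] E} (hg : S.IsAut g) : Function.Injective g := by
  refine (injective_iff_map_eq_zero g).2 fun x hx => ?_
  have := hg.inner x (S.θ x)
  rw [hx, inner_zero_left, S.θ_θ] at this
  exact inner_self_eq_zero.1 this.symm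

theorem IsAut.exists_inverse [FiniteDimensional ℝ E] {g : E →L[ℝ] E} (hg : S.IsAut g) :
    ∃ h : E →L[ℝ] E, g * h = 1 ∧ h * g = 1 := by
  let e := (LinearEquiv.ofInjectiveEndo (g : E →ₗ[ℝ] E) hg.injective).toContinuousLinearEquiv
  have he : ∀ x, e x = g x := fun x => rfl
  refine ⟨(e.symm : E →L[ℝ] E), ?_, ?_⟩
  · ext x
    simp [← he]
  · ext x
    simp [← he]

variable (S)

theorem isClosed_isAut : IsClosed {g : E →L[ℝ] E | S.IsAut g} := by
  have : {g : E →L[ℝ] E | S.IsAut g} = (⋂ x, ⋂ y, {g | g (S.br x y) = S.br (g x) (g y)}) ∩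
      ⋂ x, ⋂ y, {g | ⟪g x, S.θ (g y)⟫ = ⟪x, S.θ y⟫} := by
    ext g
    simp only [Set.mem_ofPred_eq, Set.mem_inter_iff, Set.mem_iInter]
    exact ⟨fun h => ⟨h.br, h.inner⟩, fun h => ⟨h.1, h.2⟩⟩
  rw [this]
  refine IsClosed.inter ?_ ?_ <;>
  refine isClosed_iInter fun x => isClosed_iInter fun y => isClosed_eq ?_ ?_ <;> fun_prop

theorem isClosed_isKAut (H : E) : IsClosed {g : E →L[ℝ] E | S.IsKAut H g} := by
  have : {g : E →L[ℝ] E | S.IsKAut H g} = ({g | S.IsAut g} ∩ ⋂ x, {g | g (S.θ x) = S.θ (g x)}) ∩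
      {g | g H = H} := by
    ext g
    simp only [Set.mem_ofPred_eq, Set.mem_inter_iff, Set.mem_iInter]
    exact ⟨fun h => ⟨⟨h.toIsAut, h.θ⟩, h.fix⟩, fun h => ⟨h.1.1, h.1.2, h.2⟩⟩
  rw [this]
  refine (S.isClosed_isAut.inter (isClosed_iInter fun x => isClosed_eq ?_ ?_)).inter
    (isClosed_eq ?_ ?_) <;> fun_prop

variable [FiniteDimensional ℝ E] [CompleteSpace E]

omit [CompleteSpace E] in
theorem isCompact_isKAut (H : E) : IsCompact {g : E →L[ℝ] E | S.IsKAut H g} := by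
  refine Metric.isCompact_of_isClosed_isBounded (S.isClosed_isKAut H) ?_
  refine (Metric.isBounded_closedBall (x := 0) (r := 1)).subset fun g hg => ?_
  rw [mem_closedBall_zero_iff]
  exact IsKAut.opNorm_le hg

omit [FiniteDimensional ℝ E] in
theorem isAut_exp (x : E) : S.IsAut (NormedSpace.exp (S.br x)) := by
  refine ⟨exp_derivation fun y z => S.jacobi x y z, fun y z => ?_⟩
  have h1 : ∀ t : ℝ, HasDerivAt (fun s : ℝ => ⟪NormedSpace.exp (s • S.br x) y,
      S.θ (NormedSpace.exp (s • S.br x) z)⟫) 0 t := by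
    intro t
    refine ((hasDerivAt_exp_smul_apply' (S.br x) y t).inner ℝ
      (S.θ.hasFDerivAt.comp_hasDerivAt t (hasDerivAt_exp_smul_apply' (S.br x) z t))).congr_deriv ?_
    rw [S.θ_br, S.inner_br, Function.comp_apply, add_neg_cancel]
  have := is_const_of_deriv_eq_zero (fun t => (h1 t).differentiableAt) (fun t => (h1 t).deriv) 1 0
  simpa [NormedSpace.exp_zero] using this

omit [FiniteDimensional ℝ E] in
theorem θ_exp (x y : E) :
    S.θ (NormedSpace.exp (S.br x) y) = NormedSpace.exp (S.br (S.θ x)) (S.θ y) :=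
  (exp_intertwine (P := S.θ) (fun z => (S.θ_br x z).symm) y).symm

/-- The elements of `𝔨` that commute with `H`. -/
def kCent (H : E) : Set E := {T | S.θ T = T ∧ S.br H T = 0}

/-- The group generated by the exponentials of the elements of `𝔨` that commute with `H`. -/
def adK (H : E) : Submonoid (E →L[ℝ] E) :=
  Submonoid.closure ((fun T => NormedSpace.exp (S.br T)) '' S.kCent H)

variable {S}

omit [FiniteDimensional ℝ E] [CompleteSpace E] in
theorem exp_mem_adK {H T : E} (hT : S.θ T = T) (hHT : S.br H T = 0) :
    NormedSpace.exp (S.br T) ∈ S.adK H :=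
  Submonoid.subset_closure ⟨T, ⟨hT, hHT⟩, rfl⟩

omit [FiniteDimensional ℝ E] [CompleteSpace E] in
theorem kCent_subset (H : E) : S.kCent H ⊆ S.kCent 0 := fun T hT => ⟨hT.1, by simp⟩

omit [FiniteDimensional ℝ E] [CompleteSpace E] in
theorem adK_le (H : E) : S.adK H ≤ S.adK 0 :=
  Submonoid.closure_mono (Set.image_mono (kCent_subset H))

omit [FiniteDimensional ℝ E] in
theorem isKAut_of_mem {H : E} {g : E →L[ℝ] E} (hg : g ∈ S.adK H) : S.IsKAut H g := by
  induction hg using Submonoid.closure_induction with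
  | mem g hg =>
    obtain ⟨T, hT, rfl⟩ := hg
    refine ⟨S.isAut_exp T, fun x => ?_, exp_apply_of_eq_zero ?_⟩
    · rw [S.θ_exp, hT.1]
    · rw [S.br_swap, hT.2, neg_zero]
  | one => exact IsKAut.one S H
  | mul g h _ _ hg hh => exact hg.mul hh

omit [FiniteDimensional ℝ E] in
theorem exists_inverse_of_mem {H : E} {g : E →L[ℝ] E} (hg : g ∈ S.adK H) :
    ∃ h ∈ S.adK H, g * h = 1 ∧ h * g = 1 := by
  induction hg using Submonoid.closure_induction with
  | mem g hg =>
    obtain ⟨T, hT, rfl⟩ := hg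
    refine ⟨NormedSpace.exp (S.br (-T)), exp_mem_adK ?_ ?_, ?_, ?_⟩
    · rw [map_neg, hT.1]
    · rw [map_neg, hT.2, neg_zero]
    · simp only [map_neg]; exact exp_mul_exp_neg _
    · simp only [map_neg]; exact exp_neg_mul_exp _
  | one => exact ⟨1, Submonoid.one_mem _, by simp, by simp⟩
  | mul g h _ _ hg hh =>
    obtain ⟨g', hg', e1, e2⟩ := hg
    obtain ⟨h', hh', e3, e4⟩ := hh
    refine ⟨h' * g', Submonoid.mul_mem _ hh' hg', ?_, ?_⟩
    · rw [mul_assoc, ← mul_assoc h, e3, one_mul, e1]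
    · rw [mul_assoc, ← mul_assoc g', e2, one_mul, e4]

variable (S)

omit [FiniteDimensional ℝ E] in
-- The logarithm of an automorphism near 1 is a derivation, hence ad X for some X. Uniqueness of
-- small logarithms turns commutation with θ into θX = X, and a small logarithm kills the vectors
-- fixed by its exponential, so [X, H] = 0.
theorem eventually_mem_adK (H : E) :
    ∀ᶠ g in 𝓝 (1 : E →L[ℝ] E), S.IsKAut H g → g ∈ S.adK H := by
  have hθ : Tendsto (fun g : E →L[ℝ] E => S.θ * logOne g * S.θ) (𝓝 1) (𝓝 0) := by
    have : Tendsto (fun D : E →L[ℝ] E => S.θ * D * S.θ) (𝓝 0) (𝓝 (S.θ * 0 * S.θ)) :=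
      Continuous.tendsto (by fun_prop) 0
    rw [mul_zero, zero_mul] at this
    exact this.comp tendsto_logOne
  filter_upwards [eventually_exp_logOne, tendsto_logOne.eventually eventually_derivation_of_exp,
    tendsto_logOne.eventually eventually_eq_zero_of_exp_eq,
    hθ.eventually eventually_logOne_exp] with g h1 h2 h3 h4 hg
  set D := logOne g with hD
  obtain ⟨X, hX⟩ := S.derivation D (h2 S.br (by rw [h1]; exact hg.br))
  have hDX : D = S.br X := ContinuousLinearMap.ext hX
  have h5 : S.θ * D * S.θ = S.br (S.θ X) := by
    ext y
    rw [mul_apply_eq_comp, mul_apply_eq_comp, hDX, S.θ_br, S.θ_θ]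
  have h6 : NormedSpace.exp (S.br (S.θ X)) = g := by
    ext y
    have := S.θ_exp X (S.θ y)
    rw [S.θ_θ, ← hDX, h1, hg.θ, S.θ_θ] at this
    exact this.symm
  rw [h5, h6, ← hD, hDX] at h4
  have h7 : S.θ X = X := (S.eq_of_br_eq h4).symm
  rw [← h1, hDX]
  refine exp_mem_adK h7 ?_
  rw [S.br_swap, ← hDX, h3 H (by rw [h1, hg.fix]), neg_zero]

omit [FiniteDimensional ℝ E] in
-- By `eventually_mem_adK` this subgroup is open in the compact group of θ-commuting automorphisms
-- that fix H, and open subgroups are closed. Elements of K are isometries, so left translation by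
-- an inverse keeps the distances needed to reach a neighbourhood of 1.
theorem isClosed_adK (H : E) : IsClosed (S.adK H : Set (E →L[ℝ] E)) := by
  refine isClosed_of_closure_subset fun g hg => ?_
  have hgK : S.IsKAut H g := closure_minimal (fun z hz => isKAut_of_mem hz) (S.isClosed_isKAut H) hg
  obtain ⟨r, hr, hr'⟩ := Metric.eventually_nhds_iff.1 (S.eventually_mem_adK H)
  obtain ⟨z, hz, hzg⟩ := Metric.mem_closure_iff.1 hg r hr
  obtain ⟨z', hz', e1, e2⟩ := exists_inverse_of_mem hz
  have h1 : z' * g ∈ S.adK H := by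
    refine hr' ?_ ((isKAut_of_mem hz').mul hgK)
    rw [dist_eq_norm] at hzg ⊢
    have : z' * g - 1 = z' * (g - z) := by rw [mul_sub, e2]
    rw [this]
    refine lt_of_le_of_lt (norm_mul_le _ _) (lt_of_le_of_lt ?_ hzg)
    exact mul_le_of_le_one_left (norm_nonneg _) (isKAut_of_mem hz').opNorm_le
  have := Submonoid.mul_mem _ hz h1
  rwa [← mul_assoc, e1, one_mul] at this

theorem isCompact_adK (H : E) : IsCompact (S.adK H : Set (E →L[ℝ] E)) :=
  (S.isCompact_isKAut H).of_isClosed_subset (S.isClosed_adK H) fun _ hg => isKAut_of_mem hg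

omit [FiniteDimensional ℝ E] in
-- The complement of an open subgroup is a union of cosets, so its limit points are also outside the
-- subgroup.
theorem isClosed_diff_adK (H : E) :
    IsClosed ({g : E →L[ℝ] E | S.IsKAut H g} \ (S.adK H : Set (E →L[ℝ] E))) := by
  refine isClosed_of_closure_subset fun g hg => ?_
  have hgK : S.IsKAut H g := closure_minimal (fun z hz => hz.1) (S.isClosed_isKAut H) hg
  refine ⟨hgK, fun hgA => ?_⟩
  obtain ⟨r, hr, hr'⟩ := Metric.eventually_nhds_iff.1 (S.eventually_mem_adK H)
  obtain ⟨z, hz, hzg⟩ := Metric.mem_closure_iff.1 hg r hr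
  obtain ⟨g', hg', e1, e2⟩ := exists_inverse_of_mem hgA
  have h1 : g' * z ∈ S.adK H := by
    refine hr' ?_ ((isKAut_of_mem hg').mul hz.1)
    rw [dist_comm, dist_eq_norm] at hzg
    rw [dist_eq_norm]
    have : g' * z - 1 = g' * (z - g) := by rw [mul_sub, e2]
    rw [this]
    refine lt_of_le_of_lt (norm_mul_le _ _) (lt_of_le_of_lt ?_ hzg)
    exact mul_le_of_le_one_left (norm_nonneg _) (isKAut_of_mem hg').opNorm_le
  have := Submonoid.mul_mem _ hgA h1
  rw [← mul_assoc, e1, one_mul] at this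
  exact hz.2 this

variable {S} {𝔞 : Submodule ℝ E}

/-- Elements of `𝔭` that commute with `H` are conjugate to elements of `𝔞` by elements of `K`
that fix `H`. -/
theorem IsMaxAbelian.exists_adK_mem (h𝔞 : S.IsMaxAbelian 𝔞) {H : E} (hH : H ∈ 𝔞) {X : E}
    (hX : S.θ X = -X) (hHX : S.br H X = 0) : ∃ z ∈ S.adK H, z X ∈ 𝔞 := by
  obtain ⟨b⟩ := S.nonempty_rootBasis h𝔞
  obtain ⟨Hr, hHr, hreg⟩ := b.exists_regular h𝔞
  -- Cartan's argument: maximise the pairing with a regular element over the compact centralizer.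
  obtain ⟨z, hz, hmax⟩ := (S.isCompact_adK H).exists_isMaxOn ⟨1, Submonoid.one_mem _⟩
    (f := fun z => ⟪z X, Hr⟫) (by fun_prop)
  refine ⟨z, hz, ?_⟩
  have hzK := isKAut_of_mem hz
  set Y := z X with hY
  have hYp : S.θ Y = -Y := by rw [hY, ← hzK.θ, hX, map_neg]
  have hHY : S.br H Y = 0 := by rw [← hzK.fix, hY, ← hzK.br, hHX, map_zero]
  -- T lies in 𝔨 and commutes with H, so exp(tT) is an admissible variation. The derivative of the
  -- pairing along it is ‖T‖², hence T = 0 and Y ∈ 𝔞 by regularity of Hr.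
  set T := S.br Hr Y with hT
  have hTk : S.θ T = T := S.br_pp (h𝔞.θ_eq _ hHr) hYp
  have hHT : S.br H T = 0 := by
    rw [hT, S.jacobi, hHY, h𝔞.comm _ hH _ hHr]; simp
  have hder : HasDerivAt (fun t : ℝ => ⟪NormedSpace.exp (t • S.br T) Y, Hr⟫) ⟪S.br T Y, Hr⟫ 0 := by
    have := (hasDerivAt_exp_smul_apply (S.br T) Y 0).inner ℝ (hasDerivAt_const (0 : ℝ) Hr)
    simpa [NormedSpace.exp_zero] using this
  have hloc : IsLocalMax (fun t : ℝ => ⟪NormedSpace.exp (t • S.br T) Y, Hr⟫) 0 := by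
    refine Eventually.of_forall fun t => ?_
    have h1 : NormedSpace.exp (t • S.br T) * z ∈ S.adK H := by
      refine Submonoid.mul_mem _ ?_ hz
      rw [← map_smul]
      exact exp_mem_adK (by rw [map_smul, hTk]) (by rw [map_smul, hHT, smul_zero])
    have := hmax h1
    simpa [NormedSpace.exp_zero] using this
  have h0 := hloc.hasDerivAt_eq_zero hder
  rw [S.br_swap, inner_neg_left, S.inner_br_p hYp, S.br_swap Y, inner_neg_right, neg_neg,
    ← hT] at h0
  exact hreg Y hYp (inner_self_eq_zero.1 h0)

/-- Elements of `𝔞` that are conjugate under `K` are conjugate under the normalizer of `𝔞`. -/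
theorem IsMaxAbelian.exists_normalizer (h𝔞 : S.IsMaxAbelian 𝔞) {H₁ H₂ : E} (h₁ : H₁ ∈ 𝔞)
    (h₂ : H₂ ∈ 𝔞) {k : E →L[ℝ] E} (hk : k ∈ S.adK 0) (hk12 : k H₂ = H₁) :
    ∃ w ∈ S.adK 0, (∀ x ∈ 𝔞, w x ∈ 𝔞) ∧ w H₁ = H₂ := by
  obtain ⟨b⟩ := S.nonempty_rootBasis h𝔞
  obtain ⟨Hr, hHr, hreg⟩ := b.exists_regular h𝔞
  have hkK := isKAut_of_mem hk
  -- k Hr commutes with k H₂ = H₁, so an element z fixing H₁ brings it back into 𝔞. The inverse w of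
  -- zk sends H₁ to H₂, and it preserves 𝔞 because wx commutes with the regular element Hr = w(z(k
  -- Hr)).
  obtain ⟨z, hz, hzX⟩ := h𝔞.exists_adK_mem h₁ (X := k Hr)
    (by rw [← hkK.θ, h𝔞.θ_eq _ hHr, map_neg])
    (by rw [← hk12, ← hkK.br, h𝔞.comm _ h₂ _ hHr, map_zero])
  have hzk : z * k ∈ S.adK 0 := Submonoid.mul_mem _ (adK_le H₁ hz) hk
  obtain ⟨w, hw, e1, e2⟩ := exists_inverse_of_mem hzk
  have hwK := isKAut_of_mem hw
  have hw1 : ∀ x, w (z (k x)) = x := fun x => DFunLike.congr_fun e2 x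
  refine ⟨w, hw, fun x hx => hreg _ ?_ ?_, ?_⟩
  · rw [← hwK.θ, h𝔞.θ_eq _ hx, map_neg]
  · rw [← hw1 Hr, ← hwK.br, h𝔞.comm _ hzX _ hx, map_zero]
  · have := hw1 H₂
    rwa [hk12, (isKAut_of_mem hz).fix] at this

variable (S)

/-- Positive automorphisms are exponentials of elements of `𝔭`. -/
theorem exists_exp_of_positive {g : E →L[ℝ] E} (hg : S.IsAut g)
    (hs : ∀ x y, ⟪g x, y⟫ = ⟪x, g y⟫) (hp : ∀ x, 0 ≤ ⟪g x, x⟫) :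
    ∃ P, S.θ P = -P ∧ g = NormedSpace.exp (S.br P) := by
  have hs' : (g : E →ₗ[ℝ] E).IsSymmetric := hs
  set e := hs'.eigenvectorBasis rfl
  set c := hs'.eigenvalues rfl
  have he : ∀ i, g (e i) = c i • e i := fun i => hs'.apply_eigenvectorBasis rfl i
  have hc : ∀ i, 0 < c i := by
    intro i
    have h1 := hp (e i)
    rw [he, inner_smul_left, real_inner_self_eq_norm_sq, e.orthonormal.1] at h1
    refine lt_of_le_of_ne (by simpa using h1) fun h => ?_
    have h2 := he i
    rw [← h, zero_smul] at h2
    have := hg.injective (h2.trans (map_zero g).symm)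
    have h3 := e.orthonormal.1 i
    rw [this, norm_zero] at h3
    exact zero_ne_one h3
  -- The spectral logarithm of g. It is a derivation because g multiplies [e i, e j] by c i * c j,
  -- and the logarithm turns this product into a sum.
  let D : E →L[ℝ] E := ∑ i, Real.log (c i) • (innerSL ℝ (e i)).smulRight (e i)
  have hDapp : ∀ x, D x = ∑ i, Real.log (c i) • ⟪e i, x⟫ • e i := fun x => by
    simp [D, sum_apply]
  have hD : ∀ i, D (e i) = Real.log (c i) • e i := by
    intro i
    rw [hDapp, Finset.sum_eq_single i (fun j _ hj => by rw [e.orthonormal.2 hj]; simp) (by simp),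
      real_inner_self_eq_norm_sq, e.orthonormal.1]
    simp
  have hDs : ∀ x y, ⟪D x, y⟫ = ⟪x, D y⟫ := by
    intro x y
    rw [hDapp, hDapp, sum_inner, inner_sum]
    refine Finset.sum_congr rfl fun i _ => ?_
    simp only [real_inner_smul_left, real_inner_smul_right, real_inner_comm x (e i)]
    ring
  have hexp : NormedSpace.exp D = g :=
    clm_ext_orthonormalBasis e fun i => by
      rw [exp_apply_eigenvector (hD i), Real.exp_log (hc i), he]
  have hder : ∀ x y, D (S.br x y) = S.br (D x) y + S.br x (D y) := by
    have hee : ∀ i j, D (S.br (e i) (e j)) = S.br (D (e i)) (e j) + S.br (e i) (D (e j)) := by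
      intro i j
      have h1 : NormedSpace.exp D (S.br (e i) (e j)) = (c i * c j) • S.br (e i) (e j) := by
        rw [hexp, hg.br, he, he]
        simp [smul_smul, mul_comm]
      rw [apply_eq_log_smul hDs h1, Real.log_mul (hc i).ne' (hc j).ne', hD, hD]
      simp [add_smul]
    intro x y
    rw [← e.sum_repr' x, ← e.sum_repr' y]
    simp only [map_sum, map_smul, sum_apply, smul_apply, hee, smul_add,
      Finset.sum_add_distrib]
  obtain ⟨P, hP⟩ := S.derivation D hder
  have hDP : D = S.br P := ContinuousLinearMap.ext hP
  refine ⟨P, S.eq_of_br_eq ?_, by rw [← hexp, hDP]⟩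
  ext y
  refine ext_inner_left ℝ fun x => ?_
  have h1 := hDs x y
  rw [hDP, S.inner_br] at h1
  simp only [map_neg, neg_apply, inner_neg_right]
  linarith

/-- The Cartan decomposition of automorphisms, with a `K`-component that need not be in the
identity component. -/
theorem IsAut.exists_polar {S : CartanData E} {g : E →L[ℝ] E} (hg : S.IsAut g) :
    ∃ k P, S.IsKAut 0 k ∧ S.θ P = -P ∧ g = k * NormedSpace.exp (S.br P) := by
  obtain ⟨h, hgh, hhg⟩ := hg.exists_inverse
  have hh := hg.of_inverse hgh hhg
  have hgh' : ∀ x, g (h x) = x := fun x => DFunLike.congr_fun hgh x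
  -- the adjoint of `g`
  let a : E →L[ℝ] E := S.θ * h * S.θ
  have ha : ∀ x y, ⟪a x, y⟫ = ⟪x, g y⟫ := by
    intro x y
    have h1 := hg.inner (h (S.θ x)) y
    rw [hgh'] at h1
    rw [← S.inner_θ_left, S.θ_θ] at h1
    rw [h1]
    exact S.inner_θ_left _ _
  have haA : S.IsAut a := by
    constructor
    · intro x y
      simp only [a, mul_apply_eq_comp, S.θ_br, hh.br]
    · intro x y
      simp only [a, mul_apply_eq_comp, S.θ_θ]
      rw [S.inner_θ_left, hh.inner, S.inner_θ_left, S.θ_θ]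
  obtain ⟨Q, hQ, hQe⟩ := S.exists_exp_of_positive (haA.mul hg)
    (fun x y => by
      simp only [mul_apply_eq_comp]
      rw [ha, real_inner_comm (g y), ← ha, real_inner_comm])
    (fun x => by
      simp only [mul_apply_eq_comp]
      rw [ha]
      exact real_inner_self_nonneg)
  -- The positive operator g*g is exp(ad Q), so halving Q gives its square root, the positive factor
  -- of g.
  set P : E := (2⁻¹ : ℝ) • Q with hP
  have hPp : S.θ P = -P := by rw [hP, map_smul, hQ, smul_neg]
  have hQP : S.br Q = S.br P + S.br P := by
    rw [← map_add, hP, ← add_smul]; norm_num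
  rw [hQP, exp_add_comm' (Commute.refl _)] at hQe
  set p := NormedSpace.exp (S.br P)
  set p' := NormedSpace.exp (-S.br P) with hp'
  have e1 : p * p' = 1 := exp_mul_exp_neg _
  have e2 : p' * p = 1 := exp_neg_mul_exp _
  have hpA : S.IsAut p := S.isAut_exp P
  have hp'A : S.IsAut p' := hpA.of_inverse e1 e2
  have hp's : ∀ x y, ⟪p' x, y⟫ = ⟪x, p' y⟫ :=
    symmetric_exp fun x y => by
      simp only [neg_apply, inner_neg_left, inner_neg_right, S.inner_br_p hPp]
  have hkA : S.IsAut (g * p') := hg.mul hp'A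
  have hko : ∀ x y, ⟪(g * p') x, (g * p') y⟫ = ⟪x, y⟫ := by
    intro x y
    simp only [mul_apply_eq_comp]
    rw [← ha, ← mul_apply_eq_comp a, hQe, mul_apply_eq_comp, ← mul_apply_eq_comp p p', e1,
      real_inner_comm]
    change ⟪p' y, p x⟫ = _
    rw [hp's, ← mul_apply_eq_comp p' p, e2]
    exact real_inner_comm _ _
  refine ⟨g * p', P, ⟨hkA, fun x => ?_, map_zero _⟩, hPp, by rw [mul_assoc, e2, mul_one]⟩
  -- An invertible operator that preserves both ⟪x, y⟫ and ⟪x, θy⟫ commutes with θ.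
  have h2 : ∀ y, ⟪(g * p') y, S.θ ((g * p') (S.θ x)) - (g * p') x⟫ = 0 := by
    intro y
    rw [inner_sub_right, hkA.inner, S.θ_θ, hko, sub_self]
  obtain ⟨r, hr, -⟩ := hkA.exists_inverse
  have h3 := h2 (r (S.θ ((g * p') (S.θ x)) - (g * p') x))
  rw [← mul_apply_eq_comp (g * p') r, hr] at h3
  have h4 := sub_eq_zero.1 (inner_self_eq_zero.1 h3)
  rw [← h4, S.θ_θ]

/-- The positive automorphisms. -/
theorem isClosed_exp_p :
    IsClosed {g : E →L[ℝ] E | ∃ P, S.θ P = -P ∧ g = NormedSpace.exp (S.br P)} := by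
  have : {g : E →L[ℝ] E | ∃ P, S.θ P = -P ∧ g = NormedSpace.exp (S.br P)} =
      ({g | S.IsAut g} ∩ ⋂ x, ⋂ y, {g | ⟪g x, y⟫ = ⟪x, g y⟫}) ∩ ⋂ x, {g | 0 ≤ ⟪g x, x⟫} := by
    ext g
    simp only [Set.mem_ofPred_eq, Set.mem_inter_iff, Set.mem_iInter]
    constructor
    · rintro ⟨P, hP, rfl⟩
      refine ⟨⟨S.isAut_exp P, symmetric_exp fun x y => S.inner_br_p hP x y⟩, fun x => ?_⟩
      have h2 : NormedSpace.exp (S.br P) = NormedSpace.exp (S.br ((2⁻¹ : ℝ) • P)) *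
          NormedSpace.exp (S.br ((2⁻¹ : ℝ) • P)) := by
        rw [← exp_add_comm' (Commute.refl _), ← map_add, ← add_smul]; norm_num
      have hP' : S.θ ((2⁻¹ : ℝ) • P) = -((2⁻¹ : ℝ) • P) := by rw [map_smul, hP, smul_neg]
      rw [h2, mul_apply_eq_comp, symmetric_exp fun x y => S.inner_br_p hP' x y]
      exact real_inner_self_nonneg
    · rintro ⟨⟨h1, h2⟩, h3⟩
      exact S.exists_exp_of_positive h1 h2 h3
  rw [this]
  refine (S.isClosed_isAut.inter (isClosed_iInter fun x => isClosed_iInter fun y =>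
    isClosed_eq ?_ ?_)).inter (isClosed_iInter fun x => isClosed_le ?_ ?_) <;> fun_prop

/-- The adjoint of k is its inverse, so the condition reads k*g ∈ exp(ad 𝔭) for some k ∈ C. This is
the projection of a closed set along the compact factor C. -/
theorem isClosed_mul_exp_p {C : Set (E →L[ℝ] E)} (hC : IsCompact C)
    (hCK : ∀ k ∈ C, S.IsKAut 0 k) :
    IsClosed {g : E →L[ℝ] E | ∃ k ∈ C, ∃ P, S.θ P = -P ∧ g = k * NormedSpace.exp (S.br P)} := by
  have hadj : ∀ k ∈ C, ContinuousLinearMap.adjoint k * k = 1 ∧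
      k * ContinuousLinearMap.adjoint k = 1 := by
    intro k hk
    have h1 : ContinuousLinearMap.adjoint k * k = 1 := by
      ext x
      refine ext_inner_right ℝ fun y => ?_
      rw [mul_apply_eq_comp, ContinuousLinearMap.adjoint_inner_left, (hCK k hk).inner_map]
      rfl
    obtain ⟨h, hkh, -⟩ := (hCK k hk).exists_inverse
    have h2 : ContinuousLinearMap.adjoint k = h := by
      rw [← mul_one (ContinuousLinearMap.adjoint k), ← hkh, ← mul_assoc, h1, one_mul]
    exact ⟨h1, by rw [h2, hkh]⟩
  have h1 : {g : E →L[ℝ] E | ∃ k ∈ C, ∃ P, S.θ P = -P ∧ g = k * NormedSpace.exp (S.br P)} =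
      Prod.snd '' {q : C × (E →L[ℝ] E) | ContinuousLinearMap.adjoint (q.1 : E →L[ℝ] E) * q.2 ∈
        {g : E →L[ℝ] E | ∃ P, S.θ P = -P ∧ g = NormedSpace.exp (S.br P)}} := by
    ext g
    simp only [Set.mem_ofPred_eq, Set.mem_image, Prod.exists, exists_eq_right, Subtype.exists,
      exists_prop]
    constructor
    · rintro ⟨k, hk, P, hP, rfl⟩
      exact ⟨k, hk, P, hP, by rw [← mul_assoc, (hadj k hk).1, one_mul]⟩
    · rintro ⟨k, hk, P, hP, h⟩
      exact ⟨k, hk, P, hP, by rw [← h, ← mul_assoc, (hadj k hk).2, one_mul]⟩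
  rw [h1]
  have : CompactSpace C := isCompact_iff_compactSpace.1 hC
  refine isClosedMap_snd_of_compactSpace _ (S.isClosed_exp_p.preimage ?_)
  refine Continuous.mul ?_ continuous_snd
  exact (ContinuousLinearMap.adjoint (𝕜 := ℝ) (E := E) (F := E)).continuous.comp
    (continuous_subtype_val.comp continuous_fst)

/-- The Cartan decomposition `G = K exp 𝔭` of the adjoint group. -/
theorem exists_cartan_decomposition {g : E →L[ℝ] E}
    (hg : g ∈ Submonoid.closure (Set.range fun X => NormedSpace.exp (S.br X))) :
    ∃ k ∈ S.adK 0, ∃ P, S.θ P = -P ∧ g = k * NormedSpace.exp (S.br P) := by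
  -- One-parameter groups join the generators to 1. Along a path the K-factor of the polar
  -- decomposition cannot jump out of the open and closed subgroup `adK 0`: the sets M and N below
  -- are closed, disjoint, and cover the path.
  have hpath : ∃ γ : ℝ → E →L[ℝ] E, Continuous γ ∧ γ 0 = 1 ∧ γ 1 = g ∧ ∀ t, S.IsAut (γ t) := by
    induction hg using Submonoid.closure_induction with
    | mem g hg =>
      obtain ⟨X, rfl⟩ := hg
      refine ⟨fun t => NormedSpace.exp (t • S.br X), ?_, by simp [NormedSpace.exp_zero], by simp,
        fun t => ?_⟩
      · exact (contDiff_exp (m := 0)).continuous.comp (by fun_prop)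
      · change S.IsAut (NormedSpace.exp (t • S.br X))
        rw [← map_smul]
        exact S.isAut_exp _
    | one => exact ⟨fun _ => 1, continuous_const, rfl, rfl, fun _ => IsAut.one S⟩
    | mul g h _ _ hg hh =>
      obtain ⟨γ, h1, h2, h3, h4⟩ := hg
      obtain ⟨δ, h1', h2', h3', h4'⟩ := hh
      exact ⟨fun t => γ t * δ t, h1.mul h1', by simp [h2, h2'], by simp [h3, h3'],
        fun t => (h4 t).mul (h4' t)⟩
  obtain ⟨γ, hγc, hγ0, hγ1, hγA⟩ := hpath
  set M := {g : E →L[ℝ] E | ∃ k ∈ (S.adK 0 : Set (E →L[ℝ] E)), ∃ P, S.θ P = -P ∧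
    g = k * NormedSpace.exp (S.br P)}
  set N := {g : E →L[ℝ] E | ∃ k ∈ {g : E →L[ℝ] E | S.IsKAut 0 g} \ (S.adK 0 : Set (E →L[ℝ] E)),
    ∃ P, S.θ P = -P ∧ g = k * NormedSpace.exp (S.br P)}
  have hM : IsClosed M := S.isClosed_mul_exp_p (S.isCompact_adK 0) fun k hk => isKAut_of_mem hk
  have hN : IsClosed N := S.isClosed_mul_exp_p
    ((S.isCompact_isKAut 0).of_isClosed_subset (S.isClosed_diff_adK 0) Set.sdiff_subset)
    fun k hk => hk.1
  -- The polar decomposition is unique: g*g = exp(2 ad P) determines P, and then k.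
  have hdisj : Disjoint M N := by
    refine Set.disjoint_left.2 ?_
    rintro g ⟨k, hk, P, hP, e⟩ ⟨k', hk', P', hP', e'⟩
    have hsym : ∀ P : E, S.θ P = -P → ∀ x y, ⟪NormedSpace.exp (S.br P) x, y⟫ =
        ⟪x, NormedSpace.exp (S.br P) y⟫ := fun P hP => symmetric_exp fun x y => S.inner_br_p hP x y
    have hgg : ∀ k P, S.IsKAut 0 k → S.θ P = -P → g = k * NormedSpace.exp (S.br P) →
        ∀ x y, ⟪g x, g y⟫ = ⟪NormedSpace.exp (S.br ((2 : ℝ) • P)) x, y⟫ := by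
      intro k P hk hP e x y
      rw [e, mul_apply_eq_comp, mul_apply_eq_comp, hk.inner_map, ← hsym P hP, two_smul, map_add,
        exp_add_comm' (Commute.refl _), mul_apply_eq_comp]
    have h2 : NormedSpace.exp (S.br ((2 : ℝ) • P)) = NormedSpace.exp (S.br ((2 : ℝ) • P')) := by
      ext x
      refine ext_inner_right ℝ fun y => ?_
      rw [← hgg k P (isKAut_of_mem hk) hP e, ← hgg k' P' hk'.1 hP' e']
    have h2P : ∀ P : E, S.θ P = -P → S.θ ((2 : ℝ) • P) = -((2 : ℝ) • P) := fun P hP => by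
      rw [map_smul, hP, smul_neg]
    have h3 := S.eq_of_br_eq (symmetric_exp_injective (fun x y => S.inner_br_p (h2P P hP) x y)
      (fun x y => S.inner_br_p (h2P P' hP') x y) h2)
    have h4 : P = P' := smul_right_injective E (two_ne_zero (α := ℝ)) h3
    refine hk'.2 ?_
    have h5 : k' = k := by
      have h6 : k' * NormedSpace.exp (S.br P) = k * NormedSpace.exp (S.br P) := by
        rw [← e, e', h4]
      have h7 := congrArg (· * NormedSpace.exp (-S.br P)) h6
      simpa only [mul_assoc, exp_mul_exp_neg, mul_one] using h7
    rwa [h5]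
  have hcover : ∀ t, γ t ∈ M ∪ N := by
    intro t
    obtain ⟨k, P, hk, hP, e⟩ := (hγA t).exists_polar
    by_cases h : k ∈ S.adK 0
    · exact Or.inl ⟨k, h, P, hP, e⟩
    · exact Or.inr ⟨k, ⟨hk, h⟩, P, hP, e⟩
  have h0 : γ 0 ∈ M := by
    rw [hγ0]
    exact ⟨1, Submonoid.one_mem _, 0, by simp, by simp [NormedSpace.exp_zero]⟩
  have h1 : γ 1 ∈ M := by
    by_contra h1
    have hu : (Set.univ : Set ℝ) ⊆ γ ⁻¹' M ∪ γ ⁻¹' N := fun t _ => hcover t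
    obtain ⟨t, -, ht1, ht2⟩ := isPreconnected_closed_iff.1 (isPreconnected_univ (α := ℝ)) _ _
      (hM.preimage hγc) (hN.preimage hγc) hu ⟨0, trivial, h0⟩
      ⟨1, trivial, (hcover 1).resolve_left h1⟩
    exact Set.disjoint_left.1 hdisj ht1 ht2
  rw [hγ1] at h1
  exact h1

end CartanData

end AkhiezerGindikin

end

/-! ### Root vectors and reflections -/

noncomputable section

namespace AkhiezerGindikin

open Module Filter Topology

local notation "⟪" x ", " y "⟫" => inner ℝ x y

section Operators

variable {V : Type*} [NormedAddCommGroup V] [NormedSpace ℝ V] [CompleteSpace V]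

/-- The rotation generated by an operator with `D ^ 2 = -c ^ 2` on `y`. -/
theorem exp_pi_apply {D : V →L[ℝ] V} {y : V} {c : ℝ} (hc : c ≠ 0)
    (h : D (D y) = -(c ^ 2 • y)) : NormedSpace.exp ((Real.pi / c) • D) y = -y := by
  have h1 : ∀ t : ℝ, HasDerivAt (fun s : ℝ => NormedSpace.exp (s • (-D))
      (Real.cos (s * c) • y + (Real.sin (s * c) / c) • D y)) 0 t := by
    intro t
    have hl : HasDerivAt (fun s : ℝ => s * c) c t := by simpa using (hasDerivAt_id t).mul_const c
    have h2 := (hasDerivAt_exp_smul (-D) t).clm_apply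
      ((hl.cos.smul_const y).add ((hl.sin.div_const c).smul_const (D y)))
    refine h2.congr_deriv ?_
    simp only [mul_apply_eq_comp, neg_apply, Pi.add_apply, map_add, map_smul, h, map_neg, smul_neg,
      smul_smul]
    rw [show Real.cos (t * c) * c / c = Real.cos (t * c) by field_simp,
      show Real.sin (t * c) / c * c ^ 2 = Real.sin (t * c) * c by field_simp]
    simp only [neg_mul, neg_smul]
    abel
  have h3 := is_const_of_deriv_eq_zero (fun t => (h1 t).differentiableAt)
    (fun t => (h1 t).deriv) (Real.pi / c) 0
  have h4 : Real.pi / c * c = Real.pi := by field_simp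
  simp only [h4, Real.cos_pi, Real.sin_pi, zero_div, zero_smul, add_zero, zero_mul,
    Real.cos_zero, Real.sin_zero, NormedSpace.exp_zero, one_smul, neg_smul, map_neg] at h3
  change _ = y at h3
  rw [smul_neg, neg_eq_iff_eq_neg] at h3
  have h5 := exp_exp_neg_apply ((Real.pi / c) • D) y
  rw [h3, map_neg] at h5
  rw [← neg_neg (NormedSpace.exp ((Real.pi / c) • D) y), h5]

end Operators

variable {E : Type*} [NormedAddCommGroup E] [InnerProductSpace ℝ E]

namespace CartanData

variable (S : CartanData E) (𝔞 : Submodule ℝ E)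

/-- The components `X ∈ 𝔭`, `T ∈ 𝔨` of a root vector, for the root represented by `A ∈ 𝔞`. -/
structure IsRootPair (A X T : E) : Prop where
  A_mem : A ∈ 𝔞
  θ_X : S.θ X = -X
  θ_T : S.θ T = T
  br_X : ∀ H ∈ 𝔞, S.br H X = ⟪A, H⟫ • T
  br_T : ∀ H ∈ 𝔞, S.br H T = ⟪A, H⟫ • X

variable {S 𝔞}

theorem RootBasis.isRootPair (b : S.RootBasis 𝔞) (h𝔞 : S.IsMaxAbelian 𝔞) (i : b.ι) :
    S.IsRootPair 𝔞 (b.A i) (b.X i) (b.T i) :=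
  ⟨b.A_mem i, b.θ_X i, b.θ_T i, fun _ hH => b.br_X h𝔞 hH i, fun _ hH => b.br_T h𝔞 hH i⟩

theorem eq_of_forall_inner {x y : E} (hx : x ∈ 𝔞) (hy : y ∈ 𝔞)
    (h : ∀ H ∈ 𝔞, ⟪x, H⟫ = ⟪y, H⟫) : x = y := by
  rw [← sub_eq_zero]
  have := h _ (𝔞.sub_mem hx hy)
  rw [← sub_eq_zero, ← inner_sub_left] at this
  exact inner_self_eq_zero.1 this

namespace IsRootPair

variable {A X T : E} (hp : S.IsRootPair 𝔞 A X T) (h𝔞 : S.IsMaxAbelian 𝔞)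

include hp h𝔞

/-- The symmetric operator ad A exchanges X and T with the same factor ⟪A, A⟫. -/
theorem norm_eq (hA : A ≠ 0) : ⟪T, T⟫ = ⟪X, X⟫ := by
  have h := S.inner_br_p (h𝔞.θ_eq _ hp.A_mem) X T
  rw [hp.br_X _ hp.A_mem, hp.br_T _ hp.A_mem, inner_smul_left, inner_smul_right] at h
  exact mul_left_cancel₀ (inner_self_ne_zero.2 hA) h

/-- [T, X] lies in 𝔭 and commutes with 𝔞, since [y, [T, X]] is a multiple of [X, X] + [T, T] = 0.
Maximality puts it in 𝔞, where pairing with each H identifies it. -/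
theorem br_T_X : S.br T X = ⟪T, T⟫ • A := by
  have hmem : S.br T X ∈ 𝔞 := by
    refine h𝔞.max _ (S.br_kp hp.θ_T hp.θ_X) fun y hy => ?_
    rw [S.jacobi, hp.br_X _ hy, hp.br_T _ hy]
    simp [S.br_self]
  refine eq_of_forall_inner hmem (𝔞.smul_mem _ hp.A_mem) fun H hH => ?_
  rw [S.br_swap, inner_neg_left, S.inner_br_p hp.θ_X, S.br_swap, hp.br_X _ hH]
  simp [inner_smul_left, inner_smul_right, mul_comm]

omit h𝔞 in
theorem br_T_A : S.br T A = -(⟪A, A⟫ • X) := by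
  rw [S.br_swap, hp.br_T _ hp.A_mem]

theorem inner_mem_eq_zero (hA : A ≠ 0) {H : E} (hH : H ∈ 𝔞) : ⟪X, H⟫ = 0 := by
  have h1 := S.inner_br_p (h𝔞.θ_eq _ hp.A_mem) T H
  rw [hp.br_T _ hp.A_mem, h𝔞.comm _ hp.A_mem _ hH, inner_zero_right, inner_smul_left] at h1
  simpa [hA] using h1

theorem X_mem (hA : A = 0) : X ∈ 𝔞 :=
  h𝔞.max _ hp.θ_X fun y hy => by rw [hp.br_X _ hy, hA, inner_zero_left, zero_smul]

theorem T_ne_zero (hA : A ≠ 0) (hX : X ≠ 0) : T ≠ 0 := fun h => by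
  have := hp.norm_eq h𝔞 hA
  rw [h, inner_zero_left] at this
  exact hX (inner_self_eq_zero.1 this.symm)

variable [CompleteSpace E]

/-- The reflection of `𝔞` in a root is induced by an element of `K`. -/
theorem exists_reflection (hA : A ≠ 0) (hX : X ≠ 0) :
    ∃ w ∈ S.adK 0, ∀ H ∈ 𝔞, w H = H - (2 * (⟪A, H⟫ / ⟪A, A⟫)) • A := by
  have hT : T ≠ 0 := hp.T_ne_zero h𝔞 hA hX
  -- ad T rotates the plane of A and X with angular speed c, and kills the part of 𝔞 orthogonal to
  -- A. At time π/c the rotation sends A to -A.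
  set c := ‖T‖ * ‖A‖ with hc
  have hc0 : c ≠ 0 := mul_ne_zero (norm_ne_zero_iff.2 hT) (norm_ne_zero_iff.2 hA)
  have hAA : ⟪A, A⟫ ≠ 0 := inner_self_ne_zero.2 hA
  refine ⟨NormedSpace.exp (S.br ((Real.pi / c) • T)), exp_mem_adK ?_ (by simp), ?_⟩
  · rw [map_smul, hp.θ_T]
  have hwA : NormedSpace.exp (S.br ((Real.pi / c) • T)) A = -A := by
    rw [map_smul]
    refine exp_pi_apply hc0 ?_
    rw [hp.br_T_A, map_neg, map_smul, hp.br_T_X h𝔞, smul_smul, hc, mul_pow,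
      ← real_inner_self_eq_norm_sq, ← real_inner_self_eq_norm_sq, mul_comm]
  intro H hH
  set a := ⟪A, H⟫ / ⟪A, A⟫ with ha
  have h0 : NormedSpace.exp (S.br ((Real.pi / c) • T)) (H - a • A) = H - a • A := by
    refine exp_apply_of_eq_zero ?_
    have hmem : H - a • A ∈ 𝔞 := 𝔞.sub_mem hH (𝔞.smul_mem _ hp.A_mem)
    rw [map_smul, smul_apply, S.br_swap, hp.br_T _ hmem, inner_sub_right,
      inner_smul_right, ha, div_mul_cancel₀ _ hAA]
    simp
  rw [map_sub, map_smul _ a, hwA] at h0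
  have : NormedSpace.exp (S.br ((Real.pi / c) • T)) H = H - a • A + a • -A := by
    rw [← h0]; abel
  rw [this, smul_neg, mul_smul, two_smul]
  abel

end IsRootPair

/-- If `⟪X', X⟫ ≠ 0` for two root vectors then the roots agree up to sign. -/
theorem IsRootPair.eq_or_eq_neg {A X T A' X' T' : E} (hp : S.IsRootPair 𝔞 A X T)
    (hp' : S.IsRootPair 𝔞 A' X' T') (h𝔞 : S.IsMaxAbelian 𝔞) (h : ⟪X', X⟫ ≠ 0) :
    A' = A ∨ A' = -A := by
  have h1 : ∀ H ∈ 𝔞, ⟪A' - A, H⟫ * ⟪A' + A, H⟫ = 0 := by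
    intro H hH
    have e := S.inner_br_p (h𝔞.θ_eq _ hH) X' T
    have e' := S.inner_br_p (h𝔞.θ_eq _ hH) T' X
    rw [hp'.br_X _ hH, hp.br_T _ hH, real_inner_smul_left, real_inner_smul_right] at e
    rw [hp'.br_T _ hH, hp.br_X _ hH, real_inner_smul_left, real_inner_smul_right] at e'
    have : ⟪X', X⟫ * (⟪A' - A, H⟫ * ⟪A' + A, H⟫) = 0 := by
      simp only [inner_sub_left, inner_add_left]
      linear_combination ⟪A', H⟫ * e' + ⟪A, H⟫ * e
    exact (mul_eq_zero.1 this).resolve_left h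
  have hm1 : A' - A ∈ 𝔞 := 𝔞.sub_mem hp'.A_mem hp.A_mem
  have hm2 : A' + A ∈ 𝔞 := 𝔞.add_mem hp'.A_mem hp.A_mem
  by_contra! hne
  have n1 : ⟪A' - A, A' - A⟫ ≠ 0 := inner_self_ne_zero.2 (sub_ne_zero.2 hne.1)
  have n2 : ⟪A' + A, A' + A⟫ ≠ 0 :=
    inner_self_ne_zero.2 fun h => hne.2 (eq_neg_of_add_eq_zero_left h)
  -- If neither factor were zero, evaluating the product of functionals at A' - A makes A' - A and
  -- A' + A orthogonal. Evaluating it at their sum then contradicts the identity.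
  have h2 : ⟪A' + A, A' - A⟫ = 0 := (mul_eq_zero.1 (h1 _ hm1)).resolve_left n1
  have h3 := h1 _ (𝔞.add_mem hm1 hm2)
  rw [inner_add_right _ (A' - A), inner_add_right _ (A' - A), h2,
    real_inner_comm (A' + A) (A' - A), h2, zero_add, add_zero] at h3
  exact (mul_eq_zero.1 h3).elim n1 n2

variable [FiniteDimensional ℝ E] [CompleteSpace E]

variable (S 𝔞) in
/-- A strictly convex Weyl-invariant function on the part `‖ad H‖ < r` of `𝔞`, extended to `E` by
the orthogonal projection. -/
structure IsConvexInvariant (r : ℝ) (v : E → ℝ) : Prop where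
  contDiffAt : ∀ H ∈ 𝔞, ‖S.br H‖ < r → ContDiffAt ℝ 2 v H
  proj : ∀ x, v (𝔞.starProjection x) = v x
  invariant : ∀ w ∈ S.adK 0, (∀ x ∈ 𝔞, w x ∈ 𝔞) → ∀ H ∈ 𝔞, ‖S.br H‖ < r → v (w H) = v H
  convex : ∀ H ∈ 𝔞, ‖S.br H‖ < r → ∀ x ∈ 𝔞, x ≠ 0 → 0 < fderiv ℝ (fderiv ℝ v) H x x

omit [CompleteSpace E] in
theorem IsKAut.norm_br {H : E} {g : E →L[ℝ] E} (hg : S.IsKAut H g) (z : E) :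
    ‖S.br (g z)‖ = ‖S.br z‖ := by
  have key : ∀ {g : E →L[ℝ] E}, S.IsKAut H g → ∀ z, ‖S.br z‖ ≤ ‖S.br (g z)‖ := by
    intro g hg z
    refine ContinuousLinearMap.opNorm_le_bound _ (norm_nonneg _) fun x => ?_
    rw [← hg.norm_map, hg.br]
    exact ((S.br (g z)).le_opNorm _).trans_eq (by rw [hg.norm_map])
  obtain ⟨h, hgh, hhg⟩ := hg.exists_inverse
  refine le_antisymm ?_ (key hg z)
  have h1 : h (g z) = z := DFunLike.congr_fun hhg z
  have := key (hg.of_inverse hgh hhg) (g z)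
  rwa [h1] at this

end CartanData

end AkhiezerGindikin

end

/-! ### Derivatives of a convex Weyl-invariant function near the walls -/

noncomputable section

namespace AkhiezerGindikin

open Module Filter Topology

local notation "⟪" x ", " y "⟫" => inner ℝ x y

variable {E : Type*} [NormedAddCommGroup E] [InnerProductSpace ℝ E] [CompleteSpace E]

/-- The vector representing a linear form. -/
def rieszVec : (E →L[ℝ] ℝ) →L[ℝ] E :=
  LinearMap.mkContinuous
    { toFun := fun φ => (InnerProductSpace.toDual ℝ E).symm φ
      map_add' := fun x y => map_add _ x y
      map_smul' := fun c x => by simp } 1 fun φ => by simp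

theorem inner_rieszVec (φ : E →L[ℝ] ℝ) (y : E) : ⟪rieszVec φ, y⟫ = φ y :=
  InnerProductSpace.toDual_symm_apply

/-- The gradient. -/
def grad (v : E → ℝ) (x : E) : E := rieszVec (fderiv ℝ v x)

theorem inner_grad (v : E → ℝ) (x y : E) : ⟪grad v x, y⟫ = fderiv ℝ v x y := inner_rieszVec _ _

/-- The Hessian, as an operator. -/
def hess (v : E → ℝ) (x : E) : E →L[ℝ] E := rieszVec.comp (fderiv ℝ (fderiv ℝ v) x)

theorem inner_hess (v : E → ℝ) (x y z : E) :
    ⟪hess v x y, z⟫ = fderiv ℝ (fderiv ℝ v) x y z := inner_rieszVec _ _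

omit [CompleteSpace E] in
theorem differentiableAt_fderiv {v : E → ℝ} {x : E} (h : ContDiffAt ℝ 2 v x) :
    DifferentiableAt ℝ (fderiv ℝ v) x :=
  (h.fderiv_right (m := 1) (by norm_num)).differentiableAt (by simp)

theorem hasFDerivAt_grad {v : E → ℝ} {x : E} (h : ContDiffAt ℝ 2 v x) :
    HasFDerivAt (grad v) (hess v x) x :=
  rieszVec.hasFDerivAt.comp x (differentiableAt_fderiv h).hasFDerivAt

omit [CompleteSpace E] in
theorem continuousAt_hess {v : E → ℝ} {x : E} (h : ContDiffAt ℝ 2 v x) :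
    ContinuousAt (fderiv ℝ (fderiv ℝ v)) x :=
  ((h.fderiv_right (m := 1) (by norm_num)).fderiv_right (m := 0) (by norm_num)).continuousAt

theorem hess_symm {v : E → ℝ} {x : E} (h : ContDiffAt ℝ 2 v x) (y z : E) :
    ⟪hess v x y, z⟫ = ⟪y, hess v x z⟫ := by
  rw [inner_hess, real_inner_comm, inner_hess]
  exact h.isSymmSndFDerivAt (by simp) y z

omit [CompleteSpace E] in
theorem fderiv_comp_of_eventuallyEq {v : E → ℝ} {ψ : E →L[ℝ] E} {x : E}
    (hv : ContDiffAt ℝ 2 v (ψ x)) (h : ∀ᶠ y in 𝓝 x, v (ψ y) = v y) :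
    (∀ y, fderiv ℝ v x y = fderiv ℝ v (ψ x) (ψ y)) ∧
    ∀ y z, fderiv ℝ (fderiv ℝ v) x y z = fderiv ℝ (fderiv ℝ v) (ψ x) (ψ y) (ψ z) := by
  have hd : ∀ᶠ y in 𝓝 x, DifferentiableAt ℝ v (ψ y) :=
    ψ.continuous.continuousAt.eventually
      ((hv.eventually (by simp)).mono fun y hy => hy.differentiableAt (by simp))
  have h1 : fderiv ℝ v =ᶠ[𝓝 x] fun y => (fderiv ℝ v (ψ y)).comp ψ := by
    have h2 : (fun y => v (ψ y)) =ᶠ[𝓝 x] v := h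
    filter_upwards [Filter.EventuallyEq.fderiv (𝕜 := ℝ) h2, hd] with y hy hdy
    rw [← hy]
    have h3 : HasFDerivAt (fun y => v (ψ y)) ((fderiv ℝ v (ψ y)).comp ψ) y :=
      hdy.hasFDerivAt.comp y ψ.hasFDerivAt
    exact h3.fderiv
  refine ⟨fun y => by rw [h1.self_of_nhds]; rfl, fun y z => ?_⟩
  let L : (E →L[ℝ] ℝ) →L[ℝ] (E →L[ℝ] ℝ) := (ContinuousLinearMap.compL ℝ E E ℝ).flip ψ
  have h2 : HasFDerivAt (fun y => fderiv ℝ v (ψ y)) ((fderiv ℝ (fderiv ℝ v) (ψ x)).comp ψ) x :=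
    (differentiableAt_fderiv hv).hasFDerivAt.comp x ψ.hasFDerivAt
  have h3 : HasFDerivAt (fun y => (fderiv ℝ v (ψ y)).comp ψ)
      (L.comp ((fderiv ℝ (fderiv ℝ v) (ψ x)).comp ψ)) x := L.hasFDerivAt.comp x h2
  have h4 := h1.fderiv_eq.trans h3.fderiv
  rw [h4]
  rfl

/-- The coefficient of the Hessian of the `K`-invariant extension of `v` in the direction of the
root vectors for `A`. -/
def coef (v : E → ℝ) (A H : E) : ℝ :=
  open Classical in
  if ⟪A, H⟫ = 0 then fderiv ℝ (fderiv ℝ v) H A A / ⟪A, A⟫ else fderiv ℝ v H A / ⟪A, H⟫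

omit [CompleteSpace E] in
theorem coef_neg (v : E → ℝ) (A H : E) : coef v (-A) H = coef v A H := by
  simp [coef, neg_div_neg_eq]

namespace CartanData

variable [FiniteDimensional ℝ E] {S : CartanData E} {𝔞 : Submodule ℝ E}

omit [CompleteSpace E] [FiniteDimensional ℝ E] in
theorem isOpen_norm_br (r : ℝ) : IsOpen {x | ‖S.br x‖ < r} :=
  isOpen_lt (S.br.continuous.norm) continuous_const

namespace IsConvexInvariant

variable {r : ℝ} {v : E → ℝ} (hv : S.IsConvexInvariant 𝔞 r v) (h𝔞 : S.IsMaxAbelian 𝔞)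

include hv

/-- Invariance under w is available on 𝔞 only, while v is differentiated on all of E. Composing w
with the orthogonal projection to 𝔞, under which v is unchanged, makes the invariance hold on a
neighbourhood. -/
theorem fderiv_comp {w : E →L[ℝ] E} (hw : w ∈ S.adK 0) (hw𝔞 : ∀ x ∈ 𝔞, w x ∈ 𝔞) {H : E}
    (hH : H ∈ 𝔞) (hHr : ‖S.br H‖ < r) :
    (∀ y, fderiv ℝ v H y = fderiv ℝ v (w H) (w (𝔞.starProjection y))) ∧
    ∀ y z, fderiv ℝ (fderiv ℝ v) H y z =
      fderiv ℝ (fderiv ℝ v) (w H) (w (𝔞.starProjection y)) (w (𝔞.starProjection z)) := by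
  have hpH : 𝔞.starProjection H = H := Submodule.starProjection_eq_self_iff.2 hH
  have h := fderiv_comp_of_eventuallyEq (v := v) (ψ := w ∘L 𝔞.starProjection) (x := H)
    (by
      simp only [ContinuousLinearMap.comp_apply, hpH]
      exact hv.contDiffAt _ (hw𝔞 _ hH) (by rwa [(isKAut_of_mem hw).norm_br]))
    (by
      have : ∀ᶠ y in 𝓝 H, ‖S.br (𝔞.starProjection y)‖ < r :=
        𝔞.starProjection.continuous.continuousAt.eventually
          ((isOpen_norm_br r).mem_nhds (by rw [hpH]; exact hHr))
      filter_upwards [this] with y hy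
      rw [ContinuousLinearMap.comp_apply,
        hv.invariant w hw hw𝔞 _ (Submodule.starProjection_apply_mem _ _) hy, hv.proj])
  simp only [ContinuousLinearMap.comp_apply, hpH] at h
  exact h

theorem fderiv_proj {H : E} (hH : H ∈ 𝔞) (hHr : ‖S.br H‖ < r) :
    (∀ y, fderiv ℝ v H y = fderiv ℝ v H (𝔞.starProjection y)) ∧
    ∀ y z, fderiv ℝ (fderiv ℝ v) H y z =
      fderiv ℝ (fderiv ℝ v) H (𝔞.starProjection y) (𝔞.starProjection z) :=
  hv.fderiv_comp (Submonoid.one_mem _) (fun _ h => h) hH hHr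

theorem grad_mem {H : E} (hH : H ∈ 𝔞) (hHr : ‖S.br H‖ < r) : grad v H ∈ 𝔞 := by
  rw [← Submodule.starProjection_eq_self_iff]
  refine ext_inner_right ℝ fun y => ?_
  rw [Submodule.inner_starProjection_left_eq_right, inner_grad, inner_grad,
    ← (hv.fderiv_proj hH hHr).1]

theorem hess_mem {H : E} (hH : H ∈ 𝔞) (hHr : ‖S.br H‖ < r) (y : E) : hess v H y ∈ 𝔞 := by
  rw [← Submodule.starProjection_eq_self_iff]
  refine ext_inner_right ℝ fun z => ?_
  rw [Submodule.inner_starProjection_left_eq_right, inner_hess, inner_hess,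
    (hv.fderiv_proj hH hHr).2, (hv.fderiv_proj hH hHr).2 y z,
    Submodule.starProjection_eq_self_iff.2 (Submodule.starProjection_apply_mem _ _)]

variable {A X T : E} (hp : S.IsRootPair 𝔞 A X T)

include h𝔞 hp

/-- The reflection in A fixes H and reverses A, so the derivative equals its own negative. -/
theorem fderiv_root_eq_zero (hA : A ≠ 0) (hX : X ≠ 0) {H : E} (hH : H ∈ 𝔞) (hHr : ‖S.br H‖ < r)
    (hAH : ⟪A, H⟫ = 0) : fderiv ℝ v H A = 0 := by
  obtain ⟨w, hw, hwr⟩ := hp.exists_reflection h𝔞 hA hX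
  have hAA : ⟪A, A⟫ ≠ 0 := inner_self_ne_zero.2 hA
  have h := (hv.fderiv_comp hw (fun x hx => by
    rw [hwr x hx]; exact 𝔞.sub_mem hx (𝔞.smul_mem _ hp.A_mem)) hH hHr).1 A
  rw [Submodule.starProjection_eq_self_iff.2 hp.A_mem, hwr _ hH, hwr _ hp.A_mem, hAH,
    div_self hAA] at h
  simp only [zero_div, mul_zero, zero_smul, sub_zero, mul_one, two_smul, sub_add_cancel_left,
    map_neg] at h
  linarith

/-- The root vectors orthogonal to `H` are eigenvectors of the Hessian at `H`. -/
theorem hess_root (hA : A ≠ 0) (hX : X ≠ 0) {H : E} (hH : H ∈ 𝔞) (hHr : ‖S.br H‖ < r)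
    (hAH : ⟪A, H⟫ = 0) : hess v H A = coef v A H • A := by
  obtain ⟨w, hw, hwr⟩ := hp.exists_reflection h𝔞 hA hX
  have hAA : ⟪A, A⟫ ≠ 0 := inner_self_ne_zero.2 hA
  have hwA : w A = -A := by
    rw [hwr _ hp.A_mem, div_self hAA, mul_one, two_smul]; abel
  -- The reflection fixes H and Y and sends A to -A, so Hess(A, Y) = -Hess(A, Y).
  have h0 : ∀ Y ∈ 𝔞, ⟪A, Y⟫ = 0 → fderiv ℝ (fderiv ℝ v) H A Y = 0 := by
    intro Y hY hAY
    have h := (hv.fderiv_comp hw (fun x hx => by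
      rw [hwr x hx]; exact 𝔞.sub_mem hx (𝔞.smul_mem _ hp.A_mem)) hH hHr).2 A Y
    rw [Submodule.starProjection_eq_self_iff.2 hp.A_mem, Submodule.starProjection_eq_self_iff.2 hY,
      hwA, hwr _ hH, hwr _ hY, hAH, hAY] at h
    simp only [zero_div, mul_zero, zero_smul, sub_zero, map_neg, neg_apply] at h
    linarith
  refine eq_of_forall_inner (hv.hess_mem hH hHr A) (𝔞.smul_mem _ hp.A_mem) fun Y hY => ?_
  have hY' : Y = (Y - (⟪A, Y⟫ / ⟪A, A⟫) • A) + (⟪A, Y⟫ / ⟪A, A⟫) • A := by abel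
  rw [inner_hess]
  conv_lhs => rw [hY', map_add, h0 _ (𝔞.sub_mem hY (𝔞.smul_mem _ hp.A_mem)) (by
    rw [inner_sub_right, inner_smul_right, div_mul_cancel₀ _ hAA, sub_self]), zero_add, map_smul]
  rw [coef, if_pos hAH, real_inner_smul_left, smul_eq_mul]
  ring

omit hv in
-- These points are convex combinations of H and its mirror image, which have the same value of the
-- convex function ‖ad ·‖. At t = 1 the wall of A is reached.
theorem norm_br_segment (hA : A ≠ 0) (hX : X ≠ 0) {H : E} (hH : H ∈ 𝔞) (hHr : ‖S.br H‖ < r)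
    {t : ℝ} (ht0 : 0 ≤ t) (ht1 : t ≤ 1) : ‖S.br (H - (t * (⟪A, H⟫ / ⟪A, A⟫)) • A)‖ < r := by
  obtain ⟨w, hw, hwr⟩ := hp.exists_reflection h𝔞 hA hX
  have e : H - (t * (⟪A, H⟫ / ⟪A, A⟫)) • A = (1 - t / 2) • H + (t / 2) • w H := by
    rw [hwr _ hH]
    module
  have hwn : ‖S.br (w H)‖ = ‖S.br H‖ := (isKAut_of_mem hw).norm_br H
  rw [e, map_add, map_smul, map_smul]
  refine (norm_add_le _ _).trans_lt ?_
  rw [norm_smul, norm_smul, hwn, Real.norm_of_nonneg (by linarith),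
    Real.norm_of_nonneg (by linarith)]
  linarith

/-- The A-derivative of v vanishes at the foot of the perpendicular from H to the wall. The mean
value theorem on that segment turns the quotient defining `coef` into a second derivative. This
gives both positivity and continuity across the wall. -/
theorem exists_coef_eq (hA : A ≠ 0) (hX : X ≠ 0) {H : E} (hH : H ∈ 𝔞) (hHr : ‖S.br H‖ < r) :
    ∃ t ∈ Set.Icc (0 : ℝ) 1, coef v A H =
      fderiv ℝ (fderiv ℝ v) (H - (t * (⟪A, H⟫ / ⟪A, A⟫)) • A) A A / ⟪A, A⟫ := by
  have hAA : ⟪A, A⟫ ≠ 0 := inner_self_ne_zero.2 hA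
  by_cases hAH : ⟪A, H⟫ = 0
  · exact ⟨0, ⟨le_rfl, zero_le_one⟩, by simp [coef, hAH]⟩
  set a := ⟪A, H⟫ / ⟪A, A⟫ with ha
  have ha0 : a ≠ 0 := div_ne_zero hAH hAA
  have hmem : ∀ t : ℝ, H - (t * a) • A ∈ 𝔞 := fun t => 𝔞.sub_mem hH (𝔞.smul_mem _ hp.A_mem)
  have hd : ∀ t ∈ Set.Icc (0 : ℝ) 1, HasDerivAt (fun t : ℝ => fderiv ℝ v (H - (t * a) • A) A)
      (-(a * fderiv ℝ (fderiv ℝ v) (H - (t * a) • A) A A)) t := by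
    intro t ht
    have h1 := (differentiableAt_fderiv (hv.contDiffAt _ (hmem t)
      (norm_br_segment h𝔞 hp hA hX hH hHr ht.1 ht.2))).hasFDerivAt
    have h2 : HasDerivAt (fun t : ℝ => H - (t * a) • A) (-(a • A)) t := by
      simpa using (((hasDerivAt_id t).mul_const a).smul_const A).const_sub H
    have h3 : HasDerivAt (fun t : ℝ => fderiv ℝ v (H - (t * a) • A))
        (fderiv ℝ (fderiv ℝ v) (H - (t * a) • A) (-(a • A))) t :=
      HasFDerivAt.comp_hasDerivAt (f := fun t : ℝ => H - (t * a) • A) t h1 h2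
    have h4 := h3.clm_apply (hasDerivAt_const t A)
    simp only [map_zero, add_zero, map_neg, map_smul, neg_apply, smul_apply, smul_eq_mul] at h4
    exact h4
  obtain ⟨t, ht, hte⟩ := exists_hasDerivAt_eq_slope
    (fun t : ℝ => fderiv ℝ v (H - (t * a) • A) A)
    (fun t => -(a * fderiv ℝ (fderiv ℝ v) (H - (t * a) • A) A A)) zero_lt_one
    (fun t ht => (hd t ht).continuousAt.continuousWithinAt)
    (fun t ht => hd t ⟨ht.1.le, ht.2.le⟩)
  refine ⟨t, ⟨ht.1.le, ht.2.le⟩, ?_⟩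
  have h1 : fderiv ℝ v (H - (1 * a) • A) A = 0 :=
    hv.fderiv_root_eq_zero h𝔞 hp hA hX (hmem 1)
      (norm_br_segment h𝔞 hp hA hX hH hHr zero_le_one le_rfl)
      (by rw [one_mul, inner_sub_right, inner_smul_right, ha, div_mul_cancel₀ _ hAA, sub_self])
  simp only [h1, zero_mul, zero_smul, sub_zero, zero_sub, div_one, neg_inj] at hte
  rw [coef, if_neg hAH, ← hte, ha]
  field_simp

theorem coef_pos (hA : A ≠ 0) (hX : X ≠ 0) {H : E} (hH : H ∈ 𝔞) (hHr : ‖S.br H‖ < r) :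
    0 < coef v A H := by
  obtain ⟨t, ht, e⟩ := hv.exists_coef_eq h𝔞 hp hA hX hH hHr
  rw [e]
  exact div_pos (hv.convex _ (𝔞.sub_mem hH (𝔞.smul_mem _ hp.A_mem))
    (norm_br_segment h𝔞 hp hA hX hH hHr ht.1 ht.2) _ hp.A_mem hA)
    (real_inner_self_pos.2 hA)

theorem fderiv_root (hA : A ≠ 0) (hX : X ≠ 0) {H : E} (hH : H ∈ 𝔞) (hHr : ‖S.br H‖ < r) :
    ⟪grad v H, A⟫ = coef v A H * ⟪A, H⟫ := by
  rw [inner_grad]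
  by_cases hAH : ⟪A, H⟫ = 0
  · rw [hAH, mul_zero, hv.fderiv_root_eq_zero h𝔞 hp hA hX hH hHr hAH]
  · rw [coef, if_neg hAH, div_mul_cancel₀ _ hAH]

/-- Off the wall of A this is continuity of a quotient. On the wall, the intermediate point given by
`exists_coef_eq` for x tends to H with x, and the second derivative of v is continuous. -/
theorem continuousWithinAt_coef (hA : A ≠ 0) (hX : X ≠ 0) {H : E} (hH : H ∈ 𝔞)
    (hHr : ‖S.br H‖ < r) : ContinuousWithinAt (coef v A) (𝔞 : Set E) H := by
  have hC := hv.contDiffAt H hH hHr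
  have hcA : ContinuousAt (fun x : E => ⟪A, x⟫) H := by fun_prop
  by_cases hAH : ⟪A, H⟫ = 0
  · have h2 : ContinuousAt (fun x => fderiv ℝ (fderiv ℝ v) x A A / ⟪A, A⟫) H :=
      (((continuousAt_hess hC).clm_apply continuousAt_const).clm_apply
        continuousAt_const).div_const _
    rw [Metric.continuousAt_iff] at h2
    rw [Metric.continuousWithinAt_iff]
    obtain ⟨ρ, hρ, hρr⟩ := Metric.isOpen_iff.1 (isOpen_norm_br (S := S) r) H hHr
    intro ε hε
    obtain ⟨δ, hδ, h⟩ := h2 ε hε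
    -- The intermediate point is within 2‖x - H‖ of H, hence the half of δ. The radius ρ keeps x in
    -- the domain.
    refine ⟨min ρ (δ / 2), by positivity, fun x hx hxd => ?_⟩
    obtain ⟨t, ht, e⟩ := hv.exists_coef_eq h𝔞 hp hA hX hx (hρr (hxd.trans_le (min_le_left _ _)))
    rw [e, show coef v A H = fderiv ℝ (fderiv ℝ v) H A A / ⟪A, A⟫ by rw [coef, if_pos hAH]]
    refine h ?_
    have hxd' := hxd.trans_le (min_le_right _ _)
    rw [dist_eq_norm] at hxd' ⊢
    have h3 : |⟪A, x⟫| ≤ ‖A‖ * ‖x - H‖ := by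
      have := abs_real_inner_le_norm A (x - H)
      rwa [inner_sub_right, hAH, sub_zero] at this
    have hA0 : 0 < ‖A‖ := norm_pos_iff.2 hA
    have h4 : ‖(t * (⟪A, x⟫ / ⟪A, A⟫)) • A‖ ≤ ‖x - H‖ := by
      rw [norm_smul, norm_mul, norm_div, Real.norm_of_nonneg ht.1, Real.norm_eq_abs,
        real_inner_self_eq_norm_sq, Real.norm_of_nonneg (sq_nonneg _)]
      calc t * (|⟪A, x⟫| / ‖A‖ ^ 2) * ‖A‖ ≤ 1 * ((‖A‖ * ‖x - H‖) / ‖A‖ ^ 2) * ‖A‖ := by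
            gcongr
            exact ht.2
        _ = ‖x - H‖ := by field_simp
    calc ‖x - (t * (⟪A, x⟫ / ⟪A, A⟫)) • A - H‖ = ‖(x - H) - (t * (⟪A, x⟫ / ⟪A, A⟫)) • A‖ := by
          congr 1; abel
      _ ≤ ‖x - H‖ + ‖(t * (⟪A, x⟫ / ⟪A, A⟫)) • A‖ := norm_sub_le _ _
      _ < δ := by linarith
  · have h1 : ContinuousAt (fun x => fderiv ℝ v x A / ⟪A, x⟫) H :=
      ContinuousAt.div ((hC.fderiv_right (m := 1) (by norm_num)).continuousAt.clm_apply
        continuousAt_const) hcA hAH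
    refine (h1.congr ?_).continuousWithinAt
    filter_upwards [hcA.eventually_ne hAH] with x hx
    rw [coef, if_neg hx]

end IsConvexInvariant

end CartanData

end AkhiezerGindikin

end

/-! ### The candidate Hessian of the K-invariant extension and its equivariance -/

noncomputable section

namespace AkhiezerGindikin

open Module Filter Topology

local notation "⟪" x ", " y "⟫" => inner ℝ x y

variable {E : Type*} [NormedAddCommGroup E] [InnerProductSpace ℝ E]

namespace CartanData

variable {S : CartanData E} {𝔞 : Submodule ℝ E}

theorem RootBasis.X_ne_zero (b : S.RootBasis 𝔞) (h𝔞 : S.IsMaxAbelian 𝔞) {i : b.ι}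
    (hi : b.A i ≠ 0) : b.X i ≠ 0 := fun h => by
  have h1 := (b.isRootPair h𝔞 i).norm_eq h𝔞 hi
  rw [h, inner_zero_left] at h1
  have h2 := S.projK_add_projP (b.e i)
  change b.T i + b.X i = b.e i at h2
  rw [h, inner_self_eq_zero.1 h1, add_zero] at h2
  have := b.e.orthonormal.1 i
  rw [← h2, norm_zero] at this
  exact zero_ne_one this

/-- The bracket of two root vectors is a sum of two root vectors. -/
theorem IsRootPair.br_add {A X T A' X' T' : E} (hp : S.IsRootPair 𝔞 A X T)
    (hp' : S.IsRootPair 𝔞 A' X' T') (ε : ℝ) (hε : ε * ε = 1) :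
    S.IsRootPair 𝔞 (A' + ε • A) ((2⁻¹ : ℝ) • (S.br T X' + ε • S.br X T'))
      ((2⁻¹ : ℝ) • (S.br T T' + ε • S.br X X')) := by
  refine ⟨𝔞.add_mem hp'.A_mem (𝔞.smul_mem _ hp.A_mem), ?_, ?_, fun H hH => ?_, fun H hH => ?_⟩
  · rw [map_smul, map_add, map_smul, S.br_kp hp.θ_T hp'.θ_X, S.br_pk hp.θ_X hp'.θ_T]
    module
  · rw [map_smul, map_add, map_smul, S.br_kk hp.θ_T hp'.θ_T, S.br_pp hp.θ_X hp'.θ_X]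
  all_goals
    rw [map_smul, map_add, map_smul, S.jacobi, S.jacobi H X, hp.br_T _ hH, hp.br_X _ hH,
      hp'.br_T _ hH, hp'.br_X _ hH, inner_add_left, real_inner_smul_left]
    simp only [map_smul, smul_apply]
    match_scalars
    · linear_combination (-(2⁻¹ * ⟪A, H⟫)) * hε
    · ring

variable [FiniteDimensional ℝ E] [CompleteSpace E]

/-- The Hessian at `H ∈ 𝔞` of the `K`-invariant extension of `v`. -/
def hessExt (b : S.RootBasis 𝔞) (v : E → ℝ) (H : E) : E →L[ℝ] E :=
  open Classical in
  ∑ i, (if b.A i = 0 then 0 else coef v (b.A i) H) • (innerSL ℝ (b.X i)).smulRight (b.X i) +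
    (hess v H).comp 𝔞.starProjection

theorem hessExt_apply (b : S.RootBasis 𝔞) (v : E → ℝ) (H x : E) :
    open Classical in
    hessExt b v H x = ∑ i, ((if b.A i = 0 then 0 else coef v (b.A i) H) * ⟪b.X i, x⟫) • b.X i +
      hess v H (𝔞.starProjection x) := by
  simp only [hessExt, add_apply, sum_apply, smul_apply, ContinuousLinearMap.smulRight_apply,
    innerSL_apply_apply, smul_smul, ContinuousLinearMap.comp_apply]

theorem hessExt_mem (b : S.RootBasis 𝔞) (h𝔞 : S.IsMaxAbelian 𝔞) (v : E → ℝ) (H : E) {x : E}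
    (hx : x ∈ 𝔞) : hessExt b v H x = hess v H x := by
  rw [hessExt_apply, Submodule.starProjection_eq_self_iff.2 hx, Finset.sum_eq_zero, zero_add]
  intro i _
  by_cases hi : b.A i = 0
  · rw [if_pos hi]; simp
  · rw [b.inner_X_of_mem h𝔞 hx hi]; simp

omit [CompleteSpace E] in
theorem starProjection_eq_zero {x : E} (h : ∀ y ∈ 𝔞, ⟪x, y⟫ = 0) : 𝔞.starProjection x = 0 := by
  rw [Submodule.starProjection_apply_eq_zero_iff, Submodule.mem_orthogonal]
  intro y hy
  rw [real_inner_comm, h y hy]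

theorem hessExt_k (b : S.RootBasis 𝔞) (h𝔞 : S.IsMaxAbelian 𝔞) (v : E → ℝ) (H : E) {x : E}
    (hx : S.θ x = x) : hessExt b v H x = 0 := by
  rw [hessExt_apply, starProjection_eq_zero fun y hy => S.inner_k_p hx (h𝔞.θ_eq y hy), map_zero,
    add_zero]
  refine Finset.sum_eq_zero fun i _ => ?_
  rw [real_inner_comm, S.inner_k_p hx (b.θ_X i)]
  simp

/-- Only basis vectors with root A or -A have a component along X, and `coef` is even in the root.
-/
theorem hessExt_pair (b : S.RootBasis 𝔞) (h𝔞 : S.IsMaxAbelian 𝔞) (v : E → ℝ) (H : E) {A X T : E}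
    (hp : S.IsRootPair 𝔞 A X T) (hA : A ≠ 0) : hessExt b v H X = coef v A H • X := by
  rw [hessExt_apply, starProjection_eq_zero fun y hy => hp.inner_mem_eq_zero h𝔞 hA hy, map_zero,
    add_zero]
  conv_rhs => rw [← b.sum_X hp.θ_X, Finset.smul_sum]
  refine Finset.sum_congr rfl fun i _ => ?_
  rw [smul_smul]
  by_cases h0 : ⟪b.X i, X⟫ = 0
  · rw [h0]; simp
  · rcases hp.eq_or_eq_neg (b.isRootPair h𝔞 i) h𝔞 h0 with h | h
    · rw [h, if_neg hA]
    · rw [h, if_neg (neg_ne_zero.2 hA), coef_neg]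

theorem continuousWithinAt_hessExt (b : S.RootBasis 𝔞) (h𝔞 : S.IsMaxAbelian 𝔞) {r : ℝ} {v : E → ℝ}
    (hv : S.IsConvexInvariant 𝔞 r v) {H : E} (hH : H ∈ 𝔞) (hHr : ‖S.br H‖ < r) :
    ContinuousWithinAt (hessExt b v) (𝔞 : Set E) H := by
  unfold hessExt
  refine ContinuousWithinAt.add (tendsto_finsetSum _ fun i _ => ?_) ?_
  · by_cases hi : b.A i = 0
    · simp only [if_pos hi]
      exact continuousWithinAt_const
    · simp only [if_neg hi]
      exact (hv.continuousWithinAt_coef h𝔞 (b.isRootPair h𝔞 i) hi (b.X_ne_zero h𝔞 hi)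
        hH hHr).smul continuousWithinAt_const
  · refine ContinuousAt.continuousWithinAt ?_
    refine ContinuousAt.clm_comp ?_ continuousAt_const
    exact (continuousAt_const.clm_comp (continuousAt_hess (hv.contDiffAt H hH hHr)))

namespace IsConvexInvariant

variable {r : ℝ} {v : E → ℝ} (hv : S.IsConvexInvariant 𝔞 r v) (h𝔞 : S.IsMaxAbelian 𝔞)
  (b : S.RootBasis 𝔞) {H : E} (hH : H ∈ 𝔞) (hHr : ‖S.br H‖ < r)

include hv h𝔞 hH hHr

/-- This is the infinitesimal form of ∇U(exp(tT) H) = exp(tT) ∇v(H). On the basis vectors `b.T i` it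
reduces to α(∇v) = `coef` · α(H). -/
theorem br_grad (T : E) (hT : S.θ T = T) :
    hessExt b v H (S.br T H) = S.br T (grad v H) := by
  have h1 : ∀ i, hessExt b v H (S.br (b.T i) H) = S.br (b.T i) (grad v H) := by
    intro i
    rw [S.br_swap, b.br_T h𝔞 hH, S.br_swap (b.T i), b.br_T h𝔞 (hv.grad_mem hH hHr), map_neg,
      map_smul]
    by_cases hi : b.A i = 0
    · simp [hi]
    · rw [hessExt_pair b h𝔞 v H (b.isRootPair h𝔞 i) hi, smul_smul, real_inner_comm (grad v H),
        hv.fderiv_root h𝔞 (b.isRootPair h𝔞 i) hi (b.X_ne_zero h𝔞 hi) hH hHr, mul_comm]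
  rw [← b.sum_T hT]
  simp only [map_sum, map_smul, sum_apply, smul_apply, h1]

/-- For T ∈ 𝔨 with [T, H] = 0, `br_grad` gives [T, ∇v] = 0, and the exponentials of such T generate
the group. -/
theorem grad_fixed {z : E →L[ℝ] E} (hz : z ∈ S.adK H) : z (grad v H) = grad v H := by
  obtain ⟨b⟩ := S.nonempty_rootBasis h𝔞
  induction hz using Submonoid.closure_induction with
  | mem z hz =>
    obtain ⟨T, hT, rfl⟩ := hz
    refine exp_apply_of_eq_zero ?_
    rw [← hv.br_grad h𝔞 b hH hHr T hT.1, S.br_swap, hT.2, neg_zero, map_zero]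
  | one => rfl
  | mul g h _ _ hg hh => rw [mul_apply_eq_comp, hh, hg]

/-- The two components of the bracket of root vectors are eigenvectors of the Hessian. -/
theorem hessExt_br_aux {i j : b.ι} (hi : b.A i ≠ 0) (hiH : ⟪b.A i, H⟫ = 0) (hj : b.A j ≠ 0) (ε : ℝ)
    (hε : ε * ε = 1) :
    hessExt b v H ((2⁻¹ : ℝ) • (S.br (b.T i) (b.X j) + ε • S.br (b.X i) (b.T j))) =
      coef v (b.A j) H • ((2⁻¹ : ℝ) • (S.br (b.T i) (b.X j) + ε • S.br (b.X i) (b.T j))) := by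
  have hpi := b.isRootPair h𝔞 i
  have hpj := b.isRootPair h𝔞 j
  have hXi := b.X_ne_zero h𝔞 hi
  have hXj := b.X_ne_zero h𝔞 hj
  have hp := hpi.br_add hpj ε hε
  have hess_i := hv.hess_root h𝔞 hpi hi hXi hH hHr hiH
  set Y := (2⁻¹ : ℝ) • (S.br (b.T i) (b.X j) + ε • S.br (b.X i) (b.T j)) with hY
  have hCD := hv.contDiffAt H hH hHr
  by_cases hY0 : Y = 0
  · rw [hY0, map_zero, smul_zero]
  by_cases hB : b.A j + ε • b.A i = 0
  -- The component has weight 0, hence lies in 𝔞. Pairing with 𝔞 shows that it is a multiple of A i,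
  -- an eigenvector of the Hessian of v by reflection.
  · have hji : b.A j = -(ε • b.A i) := eq_neg_of_add_eq_zero_left hB
    have hcc : coef v (b.A j) H = coef v (b.A i) H := by
      have h2 : ε = 1 ∨ ε = -1 := by
        have : (ε - 1) * (ε + 1) = 0 := by linear_combination hε
        rcases mul_eq_zero.1 this with h | h
        · left; linarith
        · right; linarith
      rcases h2 with h | h <;> rw [hji, h] <;> simp [coef_neg]
    have hYm : Y ∈ 𝔞 := hp.X_mem h𝔞 hB
    have hYA : ∃ c : ℝ, Y = c • b.A i := by
      refine ⟨2⁻¹ * (⟪b.X j, b.X i⟫ - ε * ⟪b.T j, b.T i⟫),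
        eq_of_forall_inner hYm (𝔞.smul_mem _ hpi.A_mem) fun H' hH' => ?_⟩
      rw [hY, real_inner_smul_left, inner_add_left, real_inner_smul_left, real_inner_smul_left,
        S.inner_br_k hpi.θ_T, S.inner_br_p hpi.θ_X, S.br_swap (b.T i), S.br_swap (b.X i),
        hpi.br_T _ hH', hpi.br_X _ hH', inner_neg_right, inner_neg_right, real_inner_smul_right,
        real_inner_smul_right]
      ring
    obtain ⟨c, hc⟩ := hYA
    rw [hessExt_mem b h𝔞 v H hYm, hcc, hc, map_smul, hess_i, smul_comm]
  · rw [hessExt_pair b h𝔞 v H hp hB]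
    congr 1
    by_cases hjH : ⟪b.A j, H⟫ = 0
    -- All three roots A i, A j and A j + εA i vanish on H, so all three vectors are eigenvectors of
    -- the symmetric Hessian. Either the eigenvalues of A i and A j agree, or A i ⊥ A j and pairing
    -- with A j identifies the third eigenvalue.
    · have hBH : ⟪b.A j + ε • b.A i, H⟫ = 0 := by
        rw [inner_add_left, hjH, real_inner_smul_left, hiH]; simp
      have h1 := hv.hess_root h𝔞 hp hB hY0 hH hHr hBH
      have h2 := hv.hess_root h𝔞 hpj hj hXj hH hHr hjH
      rw [map_add, map_smul, hess_i, h2] at h1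
      have hne : ⟪b.A j, b.A j⟫ ≠ 0 := inner_self_ne_zero.2 hj
      by_cases hc : coef v (b.A i) H = coef v (b.A j) H
      · rw [hc, smul_comm, ← smul_add] at h1
        exact (smul_left_injective ℝ hB h1).symm
      · have h3 := hess_symm hCD (b.A i) (b.A j)
        rw [hess_i, h2, real_inner_smul_left, real_inner_smul_right] at h3
        have h4 : ⟪b.A i, b.A j⟫ = 0 := by
          have : (coef v (b.A i) H - coef v (b.A j) H) * ⟪b.A i, b.A j⟫ = 0 := by
            linear_combination h3
          exact (mul_eq_zero.1 this).resolve_left (sub_ne_zero.2 hc)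
        have h5 := congrArg (fun x => ⟪x, b.A j⟫) h1
        simp only [inner_add_left, real_inner_smul_left, h4, mul_zero, add_zero] at h5
        exact (mul_right_cancel₀ hne h5).symm
    -- Both coefficients are quotients. The denominators agree since A i vanishes on H, and the
    -- numerators since the derivative of v along A i is zero there.
    · have hBH : ⟪b.A j + ε • b.A i, H⟫ = ⟪b.A j, H⟫ := by
        rw [inner_add_left, real_inner_smul_left, hiH]; simp
      rw [coef, if_neg (by rw [hBH]; exact hjH), coef, if_neg hjH, hBH, map_add, map_smul,
        hv.fderiv_root_eq_zero h𝔞 hpi hi hXi hH hHr hiH, smul_zero, add_zero]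

/-- Only the `b.T i` with α_i(H) = 0 contribute to T. Bracketing with such a `b.T i` moves the root
of X_j by ±α_i, which leaves the eigenvalue of `hessExt` unchanged by `hessExt_br_aux`. -/
theorem hessExt_br {T : E} (hT : S.θ T = T) (hHT : S.br H T = 0) (x : E) :
    hessExt b v H (S.br T x) = S.br T (hessExt b v H x) := by
  have hCD := hv.contDiffAt H hH hHr
  have key : ∀ i, ⟪b.A i, H⟫ = 0 → ∀ j,
      hessExt b v H (S.br (b.T i) (b.X j)) = S.br (b.T i) (hessExt b v H (b.X j)) := by
    intro i hiH j
    have hpi := b.isRootPair h𝔞 i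
    have hpj := b.isRootPair h𝔞 j
    by_cases hj : b.A j = 0
    · have hXj := b.X_mem h𝔞 j hj
      have hm := hv.hess_mem hH hHr (b.X j)
      rw [hessExt_mem b h𝔞 v H hXj, S.br_swap, S.br_swap (b.T i), hpi.br_T _ hXj, hpi.br_T _ hm,
        map_neg, map_smul]
      by_cases hi : b.A i = 0
      · simp [hi]
      · rw [hessExt_pair b h𝔞 v H hpi hi, ← hess_symm hCD,
          hv.hess_root h𝔞 hpi hi (b.X_ne_zero h𝔞 hi) hH hHr hiH, real_inner_smul_left, smul_smul,
          mul_comm]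
    · rw [hessExt_pair b h𝔞 v H hpj hj, map_smul]
      by_cases hi : b.A i = 0
      · have hp : S.IsRootPair 𝔞 (b.A j) (S.br (b.T i) (b.X j)) (S.br (b.T i) (b.T j)) := by
          refine ⟨hpj.A_mem, S.br_kp hpi.θ_T hpj.θ_X, S.br_kk hpi.θ_T hpj.θ_T, fun H' hH' => ?_,
            fun H' hH' => ?_⟩ <;>
          rw [S.jacobi, hpi.br_T _ hH', hi] <;> simp [hpj.br_X _ hH', hpj.br_T _ hH']
        exact hessExt_pair b h𝔞 v H hp hj
      · have h1 := hv.hessExt_br_aux h𝔞 b hH hHr hi hiH hj 1 (by norm_num)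
        have h2 := hv.hessExt_br_aux h𝔞 b hH hHr hi hiH hj (-1) (by norm_num)
        -- The bracket is the half sum of its components for the roots A j + A i and A j - A i.
        have e : S.br (b.T i) (b.X j) =
            (2⁻¹ : ℝ) • (S.br (b.T i) (b.X j) + (1 : ℝ) • S.br (b.X i) (b.T j)) +
            (2⁻¹ : ℝ) • (S.br (b.T i) (b.X j) + (-1 : ℝ) • S.br (b.X i) (b.T j)) := by module
        conv_lhs => rw [e, map_add, h1, h2, ← smul_add, ← e]
  have hp : ∀ x, S.θ x = -x → hessExt b v H (S.br T x) = S.br T (hessExt b v H x) := by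
    intro x hx
    rw [← b.sum_X hx, ← b.sum_T hT]
    simp only [map_sum, map_smul, sum_apply, smul_apply]
    refine Finset.sum_congr rfl fun j _ => ?_
    refine congrArg _ (Finset.sum_congr rfl fun i _ => ?_)
    by_cases hi : ⟪b.A i, H⟫ = 0
    · rw [key i hi]
    · rw [b.inner_T_eq_zero h𝔞 hH hHT hi, zero_smul, zero_smul]
  rw [← S.projK_add_projP x, map_add, map_add, hp _ (S.θ_projP x), map_add, map_add,
    hessExt_k b h𝔞 v H (S.br_kk hT (S.θ_projK x)), hessExt_k b h𝔞 v H (S.θ_projK x), map_zero]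

theorem hessExt_adK {z : E →L[ℝ] E} (hz : z ∈ S.adK H) (x : E) :
    hessExt b v H (z x) = z (hessExt b v H x) := by
  induction hz using Submonoid.closure_induction generalizing x with
  | mem z hz =>
    obtain ⟨T, hT, rfl⟩ := hz
    exact (exp_intertwine (fun x => (hv.hessExt_br h𝔞 b hH hHr hT.1 hT.2 x).symm) x).symm
  | one => rfl
  | mul g h _ _ hg hh => rw [mul_apply_eq_comp, mul_apply_eq_comp, hg, hh]

end IsConvexInvariant

end CartanData

end AkhiezerGindikin

end

/-! ### Coordinates of 𝔭 near a point of 𝔞 -/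

noncomputable section

namespace AkhiezerGindikin

open Module Filter Topology

local notation "⟪" x ", " y "⟫" => inner ℝ x y

variable {E : Type*} [NormedAddCommGroup E] [InnerProductSpace ℝ E] [FiniteDimensional ℝ E]
  [CompleteSpace E]

namespace CartanData

variable {S : CartanData E} {𝔞 : Submodule ℝ E}

/-- Points of `𝔭` near `H ∈ 𝔞`, in terms of the orbit of `H` and of its centralizer. -/
theorem IsMaxAbelian.exists_param (h𝔞 : S.IsMaxAbelian 𝔞) {H : E} (hH : H ∈ 𝔞) :
    ∃ C > 0, ∀ ε > 0, ∀ᶠ X in 𝓝 H, S.θ X = -X → ∃ T w Y, S.θ T = T ∧ w ∈ S.adK H ∧ Y ∈ 𝔞 ∧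
      X = NormedSpace.exp (S.br T) (w (H + Y)) ∧ ‖T‖ ≤ C * ‖X - H‖ ∧ ‖Y‖ ≤ C * ‖X - H‖ ∧
      ‖X - H - (S.br T H + w Y)‖ ≤ ε * ‖X - H‖ := by
  classical
  obtain ⟨b⟩ := S.nonempty_rootBasis h𝔞
  -- τ inverts T ↦ [T, H] on the roots with α(H) ≠ 0, and σ collects the rest, which commutes with
  -- H. Together [τY, H] + σY is the 𝔭-component of Y.
  set τ : E →L[ℝ] E := (-∑ i, (if ⟪b.A i, H⟫ = 0 then 0 else ⟪b.A i, H⟫⁻¹) •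
    (innerSL ℝ (b.X i)).smulRight (b.T i)) ∘L S.projP with hτ
  set σ : E →L[ℝ] E := (∑ i, (if ⟪b.A i, H⟫ = 0 then (1 : ℝ) else 0) •
    (innerSL ℝ (b.X i)).smulRight (b.X i)) ∘L S.projP with hσ
  have τ_apply : ∀ Y, τ Y = -∑ i, (if ⟪b.A i, H⟫ = 0 then 0 else ⟪b.A i, H⟫⁻¹) •
      ⟪b.X i, S.projP Y⟫ • b.T i := fun Y => by
    simp only [hτ, ContinuousLinearMap.comp_apply, neg_apply, sum_apply, smul_apply,
      ContinuousLinearMap.smulRight_apply, innerSL_apply_apply]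
  have σ_apply : ∀ Y, σ Y = ∑ i, (if ⟪b.A i, H⟫ = 0 then (1 : ℝ) else 0) •
      ⟪b.X i, S.projP Y⟫ • b.X i := fun Y => by
    simp only [hσ, ContinuousLinearMap.comp_apply, sum_apply, smul_apply,
      ContinuousLinearMap.smulRight_apply, innerSL_apply_apply]
  have θτ : ∀ Y, S.θ (τ Y) = τ Y := fun Y => by
    simp only [τ_apply, map_neg, map_sum, map_smul, b.θ_T]
  have θσ : ∀ Y, S.θ (σ Y) = -σ Y := fun Y => by
    simp only [σ_apply, map_sum, map_smul, b.θ_X, smul_neg, Finset.sum_neg_distrib]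
  have Hσ : ∀ Y, S.br H (σ Y) = 0 := fun Y => by
    simp only [σ_apply, map_sum, map_smul, b.br_X h𝔞 hH]
    refine Finset.sum_eq_zero fun i _ => ?_
    split_ifs with h <;> simp [h]
  have Hτ : ∀ Y, S.br (τ Y) H + σ Y = S.projP Y := fun Y => by
    rw [S.br_swap, τ_apply, σ_apply, map_neg, neg_neg, map_sum, ← Finset.sum_add_distrib]
    conv_rhs => rw [← b.sum_X (S.θ_projP Y)]
    refine Finset.sum_congr rfl fun i _ => ?_
    rw [map_smul, map_smul, b.br_T h𝔞 hH]
    split_ifs with h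
    · simp
    · rw [zero_smul, add_zero, smul_comm, smul_smul ⟪b.A i, H⟫⁻¹, inv_mul_cancel₀ h, one_smul]
  -- The last term fills in the 𝔨-directions, so that Θ has the identity as derivative at 0 and the
  -- inverse function theorem applies on E. When Θ Y ∈ 𝔭 the 𝔨-part of Y vanishes and the term
  -- disappears.
  set Θ : E → E := fun Y => NormedSpace.exp (S.br (τ Y)) (H + σ Y) + (Y - S.projP Y) with hΘ
  have hΘ0 : Θ 0 = H := by simp [hΘ]
  have hd : HasFDerivAt Θ ((ContinuousLinearEquiv.refl ℝ E : E ≃L[ℝ] E) : E →L[ℝ] E) 0 := by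
    have h0 := hasFDerivAt_exp_zero' (𝔸 := E →L[ℝ] E)
    rw [← map_zero (S.br.comp τ)] at h0
    have h1 : HasFDerivAt (fun Y => NormedSpace.exp (S.br (τ Y)))
        ((ContinuousLinearMap.id ℝ (E →L[ℝ] E)).comp (S.br.comp τ)) 0 :=
      h0.comp (0 : E) (S.br.comp τ).hasFDerivAt
    have h2 : HasFDerivAt (fun Y => H + σ Y) σ 0 := σ.hasFDerivAt.const_add H
    have h3 : HasFDerivAt (fun Y => Y - S.projP Y) (ContinuousLinearMap.id ℝ E - S.projP) 0 :=
      (hasFDerivAt_id _).sub S.projP.hasFDerivAt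
    refine ((h1.clm_apply h2).add h3).congr_fderiv ?_
    ext Y
    have := Hτ Y
    simp only [map_zero, NormedSpace.exp_zero, add_zero, add_apply, sub_apply,
      ContinuousLinearMap.comp_apply, ContinuousLinearMap.flip_apply,
      ContinuousLinearMap.id_apply, ContinuousLinearEquiv.coe_coe,
      ContinuousLinearEquiv.refl_apply]
    rw [show (1 : E →L[ℝ] E) (σ Y) = σ Y from rfl, add_comm (σ Y), this, add_sub_cancel]
  have hc : ContDiff ℝ 1 Θ := by
    refine ContDiff.add (ContDiff.clm_apply ?_ (by fun_prop)) (by fun_prop)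
    exact contDiff_exp.comp (S.br.comp τ).contDiff
  have hmap := (hc.contDiffAt.hasStrictFDerivAt' hd one_ne_zero).map_nhds_eq_of_equiv
  rw [hΘ0] at hmap
  -- The factor 2 comes from ‖Y‖ ≤ 2‖Θ Y - H‖, valid for small Y by the choice 2⁻¹ in `hd1`. It also
  -- explains ε / 2 in `hd2`.
  refine ⟨2 * (‖τ‖ + ‖σ‖ + 1), by positivity, fun ε hε => ?_⟩
  rw [← hmap, eventually_map]
  have hd' := (hasFDerivAt_iff_isLittleO_nhds_zero.1 hd)
  have hd1 := Asymptotics.isLittleO_iff.1 hd' (c := 2⁻¹) (by norm_num)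
  have hd2 := Asymptotics.isLittleO_iff.1 hd' (c := ε / 2) (by positivity)
  filter_upwards [hd1, hd2] with Y h1 h2 hY
  simp only [zero_add, hΘ0, ContinuousLinearEquiv.coe_coe, ContinuousLinearEquiv.refl_apply]
    at h1 h2
  have hYP : S.projP Y = Y := by
    have e1 : S.θ (NormedSpace.exp (S.br (τ Y)) (H + σ Y)) =
        -(NormedSpace.exp (S.br (τ Y)) (H + σ Y)) := by
      rw [S.θ_exp, θτ, map_add, h𝔞.θ_eq _ hH, θσ, ← neg_add, map_neg]
    have e2 : S.θ (Y - S.projP Y) = Y - S.projP Y := by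
      rw [← eq_sub_of_add_eq (S.projK_add_projP Y), S.θ_projK]
    have e3 : S.θ (Θ Y) = -Θ Y := hY
    rw [hΘ, map_add, e1, e2, neg_add, add_right_inj] at e3
    have : (2 : ℝ) • (Y - S.projP Y) = 0 := by
      rw [two_smul]
      nth_rewrite 1 [e3]
      exact neg_add_cancel _
    exact (sub_eq_zero.1 ((smul_eq_zero.1 this).resolve_left two_ne_zero)).symm
  -- σY commutes with H, so it is moved into 𝔞 by an element that fixes H.
  obtain ⟨z, hz, hza⟩ := h𝔞.exists_adK_mem hH (θσ Y) (Hσ Y)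
  obtain ⟨w, hw, e1, e2⟩ := exists_inverse_of_mem hz
  have hwz : w (z (σ Y)) = σ Y := DFunLike.congr_fun e2 _
  have hwH := (isKAut_of_mem hw).fix
  have hYn : ‖Y‖ ≤ 2 * ‖Θ Y - H‖ := by
    have := norm_sub_norm_le Y (Y - (Θ Y - H))
    rw [sub_sub_cancel, norm_sub_rev Y] at this
    linarith
  refine ⟨τ Y, w, z (σ Y), θτ Y, hw, hza, ?_, ?_, ?_, ?_⟩
  · rw [map_add, hwz, hwH]
    simp [hΘ, hYP]
  · calc ‖τ Y‖ ≤ ‖τ‖ * (2 * ‖Θ Y - H‖) := (τ.le_opNorm Y).trans (by gcongr)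
      _ ≤ _ := by nlinarith [norm_nonneg σ, norm_nonneg (Θ Y - H),
          mul_nonneg (norm_nonneg σ) (norm_nonneg (Θ Y - H))]
  · rw [(isKAut_of_mem hz).norm_map]
    calc ‖σ Y‖ ≤ ‖σ‖ * (2 * ‖Θ Y - H‖) := (σ.le_opNorm Y).trans (by gcongr)
      _ ≤ _ := by nlinarith [norm_nonneg τ, norm_nonneg (Θ Y - H),
          mul_nonneg (norm_nonneg τ) (norm_nonneg (Θ Y - H))]
  · rw [hwz, Hτ, hYP]
    refine h2.trans ?_
    calc ε / 2 * ‖Y‖ ≤ ε / 2 * (2 * ‖Θ Y - H‖) := by gcongr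
      _ = _ := by ring

end CartanData

end AkhiezerGindikin

end

/-! ### First derivative of the K-invariant extension -/

noncomputable section

namespace AkhiezerGindikin

open Module Filter Topology

local notation "⟪" x ", " y "⟫" => inner ℝ x y

set_option linter.unusedSectionVars false

variable {E : Type*} [NormedAddCommGroup E] [InnerProductSpace ℝ E] [FiniteDimensional ℝ E]
  [CompleteSpace E]

theorem fderiv_eq_innerSL_grad (U : E → ℝ) (x : E) : fderiv ℝ U x = innerSL ℝ (grad U x) := by
  ext y
  rw [innerSL_apply_apply, inner_grad]

theorem grad_eq_of_hasFDerivAt {U : E → ℝ} {x y : E} (h : HasFDerivAt U (innerSL ℝ y) x) :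
    grad U x = y := by
  refine ext_inner_right ℝ fun z => ?_
  rw [inner_grad, h.fderiv, innerSL_apply_apply]

namespace CartanData

variable {S : CartanData E} {𝔞 : Submodule ℝ E}

omit [FiniteDimensional ℝ E] [CompleteSpace E] in
-- Both Φ and L factor through the projection to 𝔭, so the differentiability estimate is needed on 𝔭
-- only, up to the norm of that projection.
theorem hasFDerivAt_of_p {F : Type*} [NormedAddCommGroup F] [NormedSpace ℝ F] {Φ : E → F}
    {L : E →L[ℝ] F} {H : E} (hΦ : ∀ᶠ X in 𝓝 H, Φ X = Φ (S.projP X))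
    (hL : ∀ X, L X = L (S.projP X))
    (hH : S.θ H = -H)
    (h : ∀ ε > 0, ∀ᶠ X in 𝓝 H, S.θ X = -X → ‖Φ X - Φ H - L (X - H)‖ ≤ ε * ‖X - H‖) :
    HasFDerivAt Φ L H := by
  rw [hasFDerivAt_iff_isLittleO, Asymptotics.isLittleO_iff]
  intro c hc
  have hpH := S.projP_of_p hH
  have hcont : Tendsto S.projP (𝓝 H) (𝓝 H) := by
    have := S.projP.continuous.tendsto H
    rwa [hpH] at this
  filter_upwards [hΦ, hcont.eventually (h (c / (‖S.projP‖ + 1)) (by positivity))] with X h1 h2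
  have h3 := h2 (S.θ_projP X)
  have e : S.projP X - H = S.projP (X - H) := by rw [map_sub, hpH]
  rw [h1, hL (X - H), ← e]
  refine h3.trans ?_
  rw [e, div_mul_eq_mul_div, div_le_iff₀ (by positivity), mul_assoc]
  refine mul_le_mul_of_nonneg_left ?_ hc.le
  nlinarith [S.projP.le_opNorm (X - H), norm_nonneg (X - H)]

omit [FiniteDimensional ℝ E] [CompleteSpace E] in
theorem IsKAut.projP {H : E} {g : E →L[ℝ] E} (hg : S.IsKAut H g) (x : E) :
    S.projP (g x) = g (S.projP x) := by
  rw [projP_apply, projP_apply, map_smul, map_sub, hg.θ]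

theorem eventually_norm_exp_br_sub_le {ε : ℝ} (hε : 0 < ε) :
    ∀ᶠ T in 𝓝 (0 : E), ‖NormedSpace.exp (S.br T) - 1 - S.br T‖ ≤ ε * ‖T‖ := by
  have h0 := hasFDerivAt_exp_zero' (𝔸 := E →L[ℝ] E)
  rw [← map_zero S.br] at h0
  have h1 := hasFDerivAt_iff_isLittleO_nhds_zero.1 (h0.comp (0 : E) S.br.hasFDerivAt)
  filter_upwards [Asymptotics.isLittleO_iff.1 h1 hε] with T hT
  simpa using hT

/-- `U` is the `K`-invariant extension of `v`, made invariant under translations by `𝔨`. -/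
structure IsInvariantExt (S : CartanData E) (𝔞 : Submodule ℝ E) (r : ℝ) (v U : E → ℝ) : Prop where
  eq : ∀ k ∈ S.adK 0, ∀ H ∈ 𝔞, ‖S.br H‖ < r → U (k H) = v H
  proj : ∀ X, U (S.projP X) = U X

/-- The elements whose `𝔭`-component lies in the domain. -/
def tube (S : CartanData E) (r : ℝ) : Set E := {X | ‖S.br (S.projP X)‖ < r}

omit [FiniteDimensional ℝ E] [CompleteSpace E] in
theorem isOpen_tube (r : ℝ) : IsOpen (S.tube r) := (isOpen_norm_br r).preimage S.projP.continuous

omit [FiniteDimensional ℝ E] [CompleteSpace E] in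
theorem mem_tube_of_p {r : ℝ} {X : E} (hX : S.θ X = -X) : X ∈ S.tube r ↔ ‖S.br X‖ < r := by
  rw [tube, Set.mem_ofPred_eq, S.projP_of_p hX]

omit [FiniteDimensional ℝ E] [CompleteSpace E] in
theorem IsKAut.mem_tube {r : ℝ} {H : E} {g : E →L[ℝ] E} (hg : S.IsKAut H g)
    (hn : ∀ z, ‖S.br (g z)‖ = ‖S.br z‖) {X : E} : g X ∈ S.tube r ↔ X ∈ S.tube r := by
  rw [tube, Set.mem_ofPred_eq, Set.mem_ofPred_eq, hg.projP, hn]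

/-- Points of the tube, in terms of `𝔞`. -/
theorem IsMaxAbelian.exists_affine (h𝔞 : S.IsMaxAbelian 𝔞) (X : E) :
    ∃ k ∈ S.adK 0, ∃ k' ∈ S.adK 0, k * k' = 1 ∧ k' * k = 1 ∧
      k' (X - S.projK X) ∈ 𝔞 := by
  obtain ⟨z, hz, hza⟩ := h𝔞.exists_adK_mem 𝔞.zero_mem (S.θ_projP X) (by simp)
  obtain ⟨w, hw, e1, e2⟩ := exists_inverse_of_mem hz
  refine ⟨w, hw, z, hz, e2, e1, ?_⟩
  rwa [← eq_sub_of_add_eq' (S.projK_add_projP X)]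

namespace IsInvariantExt

variable {r : ℝ} {v U : E → ℝ} (hU : S.IsInvariantExt 𝔞 r v U) (h𝔞 : S.IsMaxAbelian 𝔞)

include hU h𝔞 in
theorem map_adK {k : E →L[ℝ] E} (hk : k ∈ S.adK 0) {X : E} (hX : X ∈ S.tube r) :
    U (k X) = U X := by
  have hkK := isKAut_of_mem hk
  obtain ⟨w, hw, z, hz, e1, e2, hza⟩ := h𝔞.exists_affine X
  rw [← eq_sub_of_add_eq' (S.projK_add_projP X)] at hza
  have hwz : w (z (S.projP X)) = S.projP X := DFunLike.congr_fun e1 _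
  have hn : ‖S.br (z (S.projP X))‖ < r := by
    rw [(isKAut_of_mem hz).norm_br]; exact hX
  rw [← hU.proj (k X), ← hU.proj X, hkK.projP, ← hwz, hU.eq w hw _ hza hn]
  exact hU.eq (k * w) (Submonoid.mul_mem _ hk hw) _ hza hn

include hU in
theorem sub_k {c : E} (hc : S.θ c = c) (X : E) : U (X - c) = U X := by
  rw [← hU.proj, map_sub, S.projP_of_k hc, sub_zero, hU.proj]

include hU in
theorem grad_sub_k {c : E} (hc : S.θ c = c) (X : E) : grad U (X - c) = grad U X := by
  have h := fderiv_comp_sub (𝕜 := ℝ) (f := U) (x := X) c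
  rw [grad, ← h]
  simp only [hU.sub_k hc]
  rfl

include hU in
theorem grad_proj (X : E) : grad U (S.projP X) = grad U X := by
  rw [eq_sub_of_add_eq' (S.projK_add_projP X), hU.grad_sub_k (S.θ_projK X)]

/-- The first derivative of the extension on `𝔞`. -/
theorem hasFDerivAt (hU : S.IsInvariantExt 𝔞 r v U) (h𝔞 : S.IsMaxAbelian 𝔞)
    (hv : S.IsConvexInvariant 𝔞 r v) {H : E} (hH : H ∈ 𝔞) (hHr : ‖S.br H‖ < r) :
    HasFDerivAt U (innerSL ℝ (grad v H)) H := by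
  have hγ := hv.grad_mem hH hHr
  have hγp := h𝔞.θ_eq _ hγ
  refine hasFDerivAt_of_p (Eventually.of_forall fun X => (hU.proj X).symm) (fun X => ?_)
    (h𝔞.θ_eq _ hH) fun ε hε => ?_
  · rw [innerSL_apply_apply, innerSL_apply_apply, real_inner_comm, real_inner_comm (S.projP X),
      S.inner_projP_of_p hγp]
  obtain ⟨C, hC, hpar⟩ := h𝔞.exists_param hH
  have hd := (hv.contDiffAt H hH hHr).differentiableAt (by norm_num)
  have hd' := Asymptotics.isLittleO_iff.1 (hasFDerivAt_iff_isLittleO_nhds_zero.1 hd.hasFDerivAt)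
    (c := ε / (2 * C)) (by positivity)
  obtain ⟨δ, hδ, hd''⟩ := Metric.eventually_nhds_iff.1 hd'
  filter_upwards [hpar (ε / (2 * (‖grad v H‖ + 1))) (by positivity),
    Metric.ball_mem_nhds H (div_pos hδ hC), (isOpen_norm_br r).mem_nhds hHr] with X h1 h2 h3 hX
  obtain ⟨T, w, Y, hT, hw, hY, e, hTn, hYn, he⟩ := h1 hX
  have hk : NormedSpace.exp (S.br T) * w ∈ S.adK 0 :=
    Submonoid.mul_mem _ (exp_mem_adK hT (by simp)) (adK_le _ hw)
  have hwK := isKAut_of_mem hw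
  have hHY : ‖S.br (H + Y)‖ < r := by
    rw [← (isKAut_of_mem hk).norm_br, mul_apply_eq_comp, ← e]; exact h3
  have hUX : U X = v (H + Y) := by
    rw [e]; exact hU.eq _ hk _ (𝔞.add_mem hH hY) hHY
  have hUH : U H = v H := hU.eq 1 (Submonoid.one_mem _) _ hH hHr
  have hYδ : dist Y 0 < δ := by
    rw [dist_zero_right]
    refine hYn.trans_lt ?_
    rw [Metric.mem_ball, dist_eq_norm, lt_div_iff₀ hC] at h2
    linarith
  have hm := hd'' hYδ
  rw [← inner_grad] at hm
  -- The gradient lies in the abelian 𝔞, hence is orthogonal to the K-orbit of H. It is also fixed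
  -- by w, so only the derivative of v in the direction Y survives.
  have e1 : ⟪grad v H, S.br T H⟫ = 0 := by
    rw [S.br_swap, inner_neg_right, real_inner_comm, S.inner_br_p (h𝔞.θ_eq _ hH),
      h𝔞.comm _ hH _ hγ, inner_zero_right, neg_zero]
  have e2 : ⟪grad v H, w Y⟫ = ⟪grad v H, Y⟫ := by
    conv_lhs => rw [← hv.grad_fixed h𝔞 hH hHr hw]
    exact hwK.inner_map _ _
  rw [hUX, hUH, innerSL_apply_apply]
  have e3 : v (H + Y) - v H - ⟪grad v H, X - H⟫ =
      (v (H + Y) - v H - ⟪grad v H, Y⟫) - ⟪grad v H, X - H - (S.br T H + w Y)⟫ := by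
    rw [inner_sub_right _ (X - H), inner_add_right, e1, e2]; ring
  rw [e3]
  refine (norm_sub_le _ _).trans ?_
  have h4 : ‖⟪grad v H, X - H - (S.br T H + w Y)⟫‖ ≤ ε / 2 * ‖X - H‖ := by
    refine (norm_inner_le_norm _ _).trans ?_
    calc ‖grad v H‖ * ‖X - H - (S.br T H + w Y)‖
        ≤ (‖grad v H‖ + 1) * (ε / (2 * (‖grad v H‖ + 1)) * ‖X - H‖) := by gcongr; linarith
      _ = _ := by field_simp
  have h5 : ‖v (H + Y) - v H - ⟪grad v H, Y⟫‖ ≤ ε / 2 * ‖X - H‖ := by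
    refine hm.trans ?_
    calc ε / (2 * C) * ‖Y‖ ≤ ε / (2 * C) * (C * ‖X - H‖) := by gcongr
      _ = _ := by field_simp
  linarith

/-- The first derivative of the extension. -/
theorem hasFDerivAt_adK (hU : S.IsInvariantExt 𝔞 r v U) (h𝔞 : S.IsMaxAbelian 𝔞)
    (hv : S.IsConvexInvariant 𝔞 r v) {X : E} (hX : X ∈ S.tube r) {k k' : E →L[ℝ] E}
    (hk : k ∈ S.adK 0) (hk' : k' ∈ S.adK 0) (h1 : k * k' = 1) (h1' : k' * k = 1) (c : E) (hc : S.θ c = c)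
    (hXc : k' (X - c) ∈ 𝔞) : HasFDerivAt U (innerSL ℝ (k (grad v (k' (X - c))))) X := by
  have hk'K := isKAut_of_mem hk'
  have hXc' : S.projP X = X - c := by
    have hp : S.θ (X - c) = -(X - c) := by
      have h2 : X - c = k (k' (X - c)) := (DFunLike.congr_fun h1 _).symm
      rw [h2, ← (isKAut_of_mem hk).θ, h𝔞.θ_eq _ hXc, map_neg]
    have := S.projP_of_p hp
    rwa [map_sub, S.projP_of_k hc, sub_zero] at this
  have hn : ‖S.br (k' (X - c))‖ < r := by rw [hk'K.norm_br, ← hXc']; exact hX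
  have h2 := hU.hasFDerivAt h𝔞 hv hXc hn
  have h3 : HasFDerivAt (fun Y => k' (Y - c)) k' X :=
    k'.hasFDerivAt.comp X ((hasFDerivAt_id X).sub_const c)
  have h4 := h2.comp X h3
  refine (h4.congr_of_eventuallyEq ?_).congr_fderiv ?_
  · filter_upwards [(isOpen_tube r).mem_nhds hX] with Y hY
    rw [Function.comp_apply, hU.map_adK h𝔞 hk', hU.sub_k hc]
    rw [tube, Set.mem_ofPred_eq, map_sub, S.projP_of_k hc, sub_zero]
    exact hY
  · ext Y
    rw [ContinuousLinearMap.comp_apply, innerSL_apply_apply, innerSL_apply_apply,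
      ← hk'K.inner_map (k _) Y]
    congr 2
    exact (DFunLike.congr_fun h1' _).symm

end IsInvariantExt

end CartanData

end AkhiezerGindikin

end

/-! ### Second derivative of the extension and its continuity -/

noncomputable section

namespace AkhiezerGindikin

open Module Filter Topology

local notation "⟪" x ", " y "⟫" => inner ℝ x y

set_option linter.unusedSectionVars false

variable {E : Type*} [NormedAddCommGroup E] [InnerProductSpace ℝ E] [FiniteDimensional ℝ E]
  [CompleteSpace E]

namespace CartanData

variable {S : CartanData E} {𝔞 : Submodule ℝ E}

namespace IsInvariantExt

variable {r : ℝ} {v U : E → ℝ} (hU : S.IsInvariantExt 𝔞 r v U) (h𝔞 : S.IsMaxAbelian 𝔞)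
  (hv : S.IsConvexInvariant 𝔞 r v)

include hU h𝔞 hv

theorem differentiableAt {X : E} (hX : X ∈ S.tube r) : DifferentiableAt ℝ U X := by
  obtain ⟨k, hk, k', hk', e, e', ha⟩ := h𝔞.exists_affine X
  exact (hU.hasFDerivAt_adK h𝔞 hv hX hk hk' e e' _ (S.θ_projK X) ha).differentiableAt

theorem grad_map {k : E →L[ℝ] E} (hk : k ∈ S.adK 0) {X : E} (hX : X ∈ S.tube r) :
    grad U (k X) = k (grad U X) := by
  obtain ⟨z, hz, z', hz', e, e', ha⟩ := h𝔞.exists_affine X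
  obtain ⟨k', hk', f, f'⟩ := exists_inverse_of_mem hk
  have hkK := isKAut_of_mem hk
  have h1 := grad_eq_of_hasFDerivAt (hU.hasFDerivAt_adK h𝔞 hv hX hz hz' e e' _ (S.θ_projK X) ha)
  have h2 : (z' * k') (k X - k (S.projK X)) = z' (X - S.projK X) := by
    rw [← map_sub, mul_apply_eq_comp]
    exact congrArg z' (DFunLike.congr_fun f' _)
  have h3 := grad_eq_of_hasFDerivAt (hU.hasFDerivAt_adK h𝔞 hv
    ((hkK.mem_tube hkK.norm_br).2 hX) (Submonoid.mul_mem _ hk hz) (Submonoid.mul_mem _ hz' hk')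
    (by rw [mul_assoc, ← mul_assoc z, e, one_mul, f])
    (by rw [mul_assoc, ← mul_assoc k', f', one_mul, e'])
    (k (S.projK X)) (by rw [← hkK.θ, S.θ_projK]) (by rw [h2]; exact ha))
  rw [h3, h2, h1, mul_apply_eq_comp]

theorem grad_adK {k : E →L[ℝ] E} (hk : k ∈ S.adK 0) {H : E} (hH : H ∈ 𝔞) (hHr : ‖S.br H‖ < r) :
    grad U (k H) = k (grad v H) := by
  rw [hU.grad_map h𝔞 hv hk ((mem_tube_of_p (h𝔞.θ_eq _ hH)).2 hHr),
    grad_eq_of_hasFDerivAt (hU.hasFDerivAt h𝔞 hv hH hHr)]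

/-- The second derivative of the extension on `𝔞`. -/
theorem hasFDerivAt_grad (b : S.RootBasis 𝔞) {H : E} (hH : H ∈ 𝔞) (hHr : ‖S.br H‖ < r) :
    HasFDerivAt (grad U) (hessExt b v H) H := by
  refine hasFDerivAt_of_p (Eventually.of_forall fun X => (hU.grad_proj X).symm) (fun X => ?_)
    (h𝔞.θ_eq _ hH) fun ε hε => ?_
  · conv_lhs => rw [← S.projK_add_projP X, map_add, hessExt_k b h𝔞 v H (S.θ_projK X), zero_add]
  obtain ⟨C, hC, hpar⟩ := h𝔞.exists_param hH
  set γ := grad v H with hγ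
  set D := hessExt b v H with hD
  -- The denominator is one more than the sum of the factors in the four error bounds `n1` to `n4`.
  set η := ε / (C * (‖γ‖ + ‖hess v H‖ + 1) + ‖D‖ + 1) with hη
  have hη0 : 0 < η := by positivity
  have hd := Asymptotics.isLittleO_iff.1
    (hasFDerivAt_iff_isLittleO_nhds_zero.1 (AkhiezerGindikin.hasFDerivAt_grad (hv.contDiffAt H hH hHr)))
    (c := η) hη0
  have hc1 : ∀ᶠ T in 𝓝 (0 : E), ‖NormedSpace.exp (S.br T) - 1‖ < η := by
    have h1 : Continuous fun T : E => ‖NormedSpace.exp (S.br T) - 1‖ :=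
      (((contDiff_exp (m := 0)).continuous.comp S.br.continuous).sub continuous_const).norm
    have h2 := h1.tendsto 0
    simp only [map_zero, NormedSpace.exp_zero, sub_self, norm_zero] at h2
    exact h2.eventually_lt_const hη0
  obtain ⟨δ, hδ, hd'⟩ := Metric.eventually_nhds_iff.1
    (hd.and (hc1.and (eventually_norm_exp_br_sub_le (S := S) hη0)))
  filter_upwards [hpar η hη0, Metric.ball_mem_nhds H (div_pos hδ hC),
    (isOpen_norm_br r).mem_nhds hHr] with X h1 h2 h3 hX
  obtain ⟨T, w, Y, hT, hw, hY, e, hTn, hYn, he⟩ := h1 hX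
  have hκ : NormedSpace.exp (S.br T) ∈ S.adK 0 := exp_mem_adK hT (by simp)
  have hk : NormedSpace.exp (S.br T) * w ∈ S.adK 0 := Submonoid.mul_mem _ hκ (adK_le _ hw)
  have hHY : ‖S.br (H + Y)‖ < r := by
    rw [← (isKAut_of_mem hk).norm_br, mul_apply_eq_comp, ← e]; exact h3
  have small : ∀ Z : E, ‖Z‖ ≤ C * ‖X - H‖ → dist Z 0 < δ := fun Z hZ => by
    rw [dist_zero_right]
    refine hZ.trans_lt ?_
    rw [Metric.mem_ball, dist_eq_norm, lt_div_iff₀ hC] at h2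
    linarith
  have f1 := (hd' (small Y hYn)).1
  obtain ⟨f2, f3⟩ := (hd' (small T hTn)).2
  have hUX : grad U X = NormedSpace.exp (S.br T) (w (grad v (H + Y))) := by
    rw [← mul_apply_eq_comp, ← hU.grad_adK h𝔞 hv hk (𝔞.add_mem hH hY) hHY, mul_apply_eq_comp, ← e]
  have hUH : grad U H = γ := grad_eq_of_hasFDerivAt (hU.hasFDerivAt h𝔞 hv hH hHr)
  set ρ := grad v (H + Y) - grad v H - hess v H Y with hρ
  set R := NormedSpace.exp (S.br T) - 1 - S.br T with hR
  set err := X - H - (S.br T H + w Y) with herr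
  have g1 : D (S.br T H) = S.br T γ := hv.br_grad h𝔞 b hH hHr T hT
  have g2 : D (w Y) = w (hess v H Y) := by
    rw [hD, hv.hessExt_adK h𝔞 b hH hHr hw, hessExt_mem b h𝔞 v H hY]
  have g3 : w γ = γ := hv.grad_fixed h𝔞 hH hHr hw
  -- By equivariance ∇U(X) = exp(ad T) w ∇v(H + Y). Its linear terms [T, γ] and w(Hess v · Y) are D
  -- applied to [T, H] and to wY, so only remainders are left.
  have key : grad U X - grad U H - D (X - H) = R γ +
      (NormedSpace.exp (S.br T) - 1) (w (hess v H Y)) + NormedSpace.exp (S.br T) (w ρ) - D err := by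
    have k1 : X - H = S.br T H + w Y + err := by rw [herr]; abel
    have k2 : grad v (H + Y) = γ + hess v H Y + ρ := by rw [hρ, hγ]; abel
    rw [hUX, hUH, k1, k2, hR]
    simp only [map_add, g1, g2, g3, sub_apply, one_apply_eq_self]
    abel
  have n1 : ‖R γ‖ ≤ η * (C * ‖X - H‖) * ‖γ‖ := by
    refine (R.le_opNorm γ).trans ?_
    gcongr
    exact f3.trans (by gcongr)
  have n2 : ‖(NormedSpace.exp (S.br T) - 1) (w (hess v H Y))‖ ≤
      η * (‖hess v H‖ * (C * ‖X - H‖)) := by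
    refine (ContinuousLinearMap.le_opNorm _ _).trans ?_
    rw [(isKAut_of_mem hw).norm_map]
    refine mul_le_mul f2.le (((hess v H).le_opNorm Y).trans ?_) (norm_nonneg _) hη0.le
    gcongr
  have n3 : ‖NormedSpace.exp (S.br T) (w ρ)‖ ≤ η * (C * ‖X - H‖) := by
    rw [(isKAut_of_mem hκ).norm_map, (isKAut_of_mem hw).norm_map]
    exact f1.trans (by gcongr)
  have n4 : ‖D err‖ ≤ ‖D‖ * (η * ‖X - H‖) := (D.le_opNorm _).trans (by gcongr)
  have n5 : η * (C * (‖γ‖ + ‖hess v H‖ + 1) + ‖D‖ + 1) = ε := by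
    rw [hη]; exact div_mul_cancel₀ _ (by positivity)
  rw [key]
  refine (norm_sub_le _ _).trans ?_
  have n6 := norm_add₃_le (a := R γ) (b := (NormedSpace.exp (S.br T) - 1) (w (hess v H Y)))
    (c := NormedSpace.exp (S.br T) (w ρ))
  rw [← n5]
  nlinarith [mul_nonneg hη0.le (norm_nonneg (X - H))]

theorem hasFDerivAt_grad_adK (b : S.RootBasis 𝔞) {X : E} (hX : X ∈ S.tube r) {k k' : E →L[ℝ] E}
    (hk : k ∈ S.adK 0) (hk' : k' ∈ S.adK 0) (h1 : k * k' = 1) {c : E} (hc : S.θ c = c)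
    (hXc : k' (X - c) ∈ 𝔞) :
    HasFDerivAt (grad U) (k.comp ((hessExt b v (k' (X - c))).comp k')) X := by
  have hk'K := isKAut_of_mem hk'
  have mem : ∀ Y ∈ S.tube r, k' (Y - c) ∈ S.tube r := fun Y hY => by
    rw [hk'K.mem_tube hk'K.norm_br, tube, Set.mem_ofPred_eq, map_sub, S.projP_of_k hc, sub_zero]
    exact hY
  have h2 := hU.hasFDerivAt_grad h𝔞 hv b hXc ((mem_tube_of_p (h𝔞.θ_eq _ hXc)).1 (mem X hX))
  have h3 : HasFDerivAt (fun Y => k' (Y - c)) k' X :=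
    k'.hasFDerivAt.comp X ((hasFDerivAt_id X).sub_const c)
  refine (k.hasFDerivAt.comp X (h2.comp X h3)).congr_of_eventuallyEq ?_
  filter_upwards [(isOpen_tube r).mem_nhds hX] with Y hY
  rw [Function.comp_apply, Function.comp_apply, ← hU.grad_map h𝔞 hv hk (mem Y hY),
    ← mul_apply_eq_comp, h1, one_apply_eq_self, hU.grad_sub_k hc]

theorem differentiableAt_grad {X : E} (hX : X ∈ S.tube r) : DifferentiableAt ℝ (grad U) X := by
  obtain ⟨b⟩ := S.nonempty_rootBasis h𝔞
  obtain ⟨k, hk, k', hk', e, -, ha⟩ := h𝔞.exists_affine X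
  exact (hU.hasFDerivAt_grad_adK h𝔞 hv b hX hk hk' e (S.θ_projK X) ha).differentiableAt

/-- At a nearby point whose 𝔭-component is κw(H + Y), the derivative is the conjugate by κw of
`hessExt` at H + Y. Here κ is close to 1 and `hessExt` is continuous along 𝔞. The factor w need not
be close to 1, but it commutes with `hessExt` at H. -/
theorem continuousAt_fderiv_grad_aux {H : E} (hH : H ∈ 𝔞) (hHr : ‖S.br H‖ < r) :
    ContinuousAt (fderiv ℝ (grad U)) H := by
  obtain ⟨b⟩ := S.nonempty_rootBasis h𝔞
  obtain ⟨C, hC, hpar⟩ := h𝔞.exists_param hH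
  set D := hessExt b v H with hD
  have hHp := S.projP_of_p (h𝔞.θ_eq _ hH)
  rw [Metric.continuousAt_iff']
  intro ε hε
  have c1 := Metric.continuousWithinAt_iff.1 (continuousWithinAt_hessExt b h𝔞 hv hH hHr) (ε / 2)
    (by positivity)
  obtain ⟨δ₁, hδ₁, c1⟩ := c1
  have c2 : ∀ᶠ T in 𝓝 (0 : E), ‖NormedSpace.exp (S.br T) - 1‖ < ε / (4 * (‖D‖ + 1)) := by
    have h1 : Continuous fun T : E => ‖NormedSpace.exp (S.br T) - 1‖ :=
      (((contDiff_exp (m := 0)).continuous.comp S.br.continuous).sub continuous_const).norm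
    have h2 := h1.tendsto 0
    simp only [map_zero, NormedSpace.exp_zero, sub_self, norm_zero] at h2
    exact h2.eventually_lt_const (by positivity)
  obtain ⟨δ₂, hδ₂, c2⟩ := Metric.eventually_nhds_iff.1 c2
  have hcont : Tendsto S.projP (𝓝 H) (𝓝 H) := by
    have := S.projP.continuous.tendsto H
    rwa [hHp] at this
  filter_upwards [hcont.eventually (hpar 1 one_pos),
    hcont (Metric.ball_mem_nhds H (div_pos (lt_min hδ₁ hδ₂) hC)),
    (isOpen_tube r).mem_nhds ((mem_tube_of_p (h𝔞.θ_eq _ hH)).2 hHr)] with X h1 h2 h3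
  obtain ⟨T, w, Y, hT, hw, hY, e, hTn, hYn, -⟩ := h1 (S.θ_projP X)
  have hκ : NormedSpace.exp (S.br T) ∈ S.adK 0 := exp_mem_adK hT (by simp)
  obtain ⟨w', hw', ww', w'w⟩ := exists_inverse_of_mem hw
  obtain ⟨κ', hκ', κκ', κ'κ⟩ := exists_inverse_of_mem hκ
  set κ := NormedSpace.exp (S.br T) with hκdef
  have small : ∀ Z : E, ‖Z‖ ≤ C * ‖S.projP X - H‖ → ‖Z‖ < min δ₁ δ₂ := fun Z hZ => by
    refine hZ.trans_lt ?_
    rw [Set.mem_preimage, Metric.mem_ball, dist_eq_norm, lt_div_iff₀ hC] at h2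
    linarith
  have hXc : (w' * κ') (X - S.projK X) = H + Y := by
    rw [← eq_sub_of_add_eq' (S.projK_add_projP X), e, mul_apply_eq_comp, ← mul_apply_eq_comp κ',
      κ'κ, one_apply_eq_self, ← mul_apply_eq_comp w', w'w, one_apply_eq_self]
  have h4 := (hU.hasFDerivAt_grad_adK h𝔞 hv b h3 (Submonoid.mul_mem _ hκ (adK_le _ hw))
    (Submonoid.mul_mem _ (adK_le _ hw') hκ')
    (by rw [mul_assoc, ← mul_assoc w, ww', one_mul, κκ']) (S.θ_projK X)
    (by rw [hXc]; exact 𝔞.add_mem hH hY)).fderiv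
  rw [hXc] at h4
  have h5 := (hU.hasFDerivAt_grad h𝔞 hv b hH hHr).fderiv
  set M := hessExt b v (H + Y) with hM
  have hMD : ‖M - D‖ < ε / 2 := by
    rw [← dist_eq_norm]
    refine c1 (𝔞.add_mem hH hY) ?_
    rw [dist_eq_norm, add_sub_cancel_left]
    exact (small Y hYn).trans_le (min_le_left _ _)
  have hκ1 : ‖κ - 1‖ < ε / (4 * (‖D‖ + 1)) := by
    refine c2 ?_
    rw [dist_zero_right]
    exact (small T hTn).trans_le (min_le_right _ _)
  -- This removes the factor w, over which there is no control beyond w ∈ `adK H`.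
  have hwD : w * D * w' = D := by
    have : w * D = D * w :=
      ContinuousLinearMap.ext fun x => (hv.hessExt_adK h𝔞 b hH hHr hw x).symm
    rw [this, mul_assoc, ww', mul_one]
  have key : (κ * w).comp (M.comp (w' * κ')) - D =
      κ * (w * (M - D) * w') * κ' + ((κ - 1) * D * κ' - D * (κ' * (κ - 1))) := by
    have k1 : (κ * w).comp (M.comp (w' * κ')) = κ * (w * M * w') * κ' := rfl
    have k2 : w * (M - D) * w' = w * M * w' - D := by rw [mul_sub, sub_mul, hwD]
    rw [k1, k2, mul_sub κ', κ'κ, mul_one]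
    noncomm_ring
  have one_le : ∀ {H : E} {z : E →L[ℝ] E}, z ∈ S.adK H → ‖z‖ ≤ 1 := fun hz =>
    (isKAut_of_mem hz).opNorm_le
  have mulle : ∀ {x y : E →L[ℝ] E} {a : ℝ}, ‖x‖ ≤ 1 → ‖y‖ ≤ a → ‖x * y‖ ≤ a :=
    fun {x y a} hx hy => (norm_mul_le _ _).trans
      ((mul_le_of_le_one_left (norm_nonneg _) hx).trans hy)
  have mulle' : ∀ {x y : E →L[ℝ] E} {a : ℝ}, ‖x‖ ≤ 1 → ‖y‖ ≤ a → ‖y * x‖ ≤ a :=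
    fun {x y a} hx hy => (norm_mul_le _ _).trans
      ((mul_le_of_le_one_right (norm_nonneg _) hx).trans hy)
  have n1 : ‖κ * (w * (M - D) * w') * κ'‖ ≤ ‖M - D‖ :=
    mulle' (one_le hκ') (mulle (one_le hκ) (mulle' (one_le hw') (mulle (one_le hw) le_rfl)))
  have n2 : ‖(κ - 1) * D * κ'‖ ≤ ‖κ - 1‖ * ‖D‖ := mulle' (one_le hκ') (norm_mul_le _ _)
  have n3 : ‖D * (κ' * (κ - 1))‖ ≤ ‖D‖ * ‖κ - 1‖ :=
    (norm_mul_le _ _).trans (by gcongr; exact mulle (one_le hκ') le_rfl)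
  have n4 : ‖D‖ * ‖κ - 1‖ ≤ ε / 4 := by
    rw [lt_div_iff₀ (by positivity)] at hκ1
    nlinarith [norm_nonneg D, norm_nonneg (κ - 1)]
  rw [dist_eq_norm, h4, h5, key]
  have n5 := norm_add_le (κ * (w * (M - D) * w') * κ') ((κ - 1) * D * κ' - D * (κ' * (κ - 1)))
  have n6 := norm_sub_le ((κ - 1) * D * κ') (D * (κ' * (κ - 1)))
  linarith

theorem continuousAt_fderiv_grad {X : E} (hX : X ∈ S.tube r) :
    ContinuousAt (fderiv ℝ (grad U)) X := by
  obtain ⟨k, hk, k', hk', e, -, ha⟩ := h𝔞.exists_affine X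
  have hc := S.θ_projK X
  set c := S.projK X with hcdef
  have hk'K := isKAut_of_mem hk'
  have mem : ∀ Y ∈ S.tube r, k' (Y - c) ∈ S.tube r := fun Y hY => by
    rw [hk'K.mem_tube hk'K.norm_br, tube, Set.mem_ofPred_eq, map_sub, S.projP_of_k hc, sub_zero]
    exact hY
  have h1 := hU.continuousAt_fderiv_grad_aux h𝔞 hv ha
    ((mem_tube_of_p (h𝔞.θ_eq _ ha)).1 (mem X hX))
  have h2 : ContinuousAt (fun Y => k' (Y - c)) X := by fun_prop
  have h3 : ContinuousAt (fun Y => fderiv ℝ (grad U) (k' (Y - c))) X :=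
    ContinuousAt.comp (f := fun Y => k' (Y - c)) h1 h2
  have h4 : ContinuousAt (fun Y => k.comp ((fderiv ℝ (grad U) (k' (Y - c))).comp k')) X :=
    continuousAt_const.clm_comp (h3.clm_comp continuousAt_const)
  refine h4.congr ?_
  filter_upwards [(isOpen_tube r).mem_nhds hX] with Z hZ
  have h5 : HasFDerivAt (fun Y => k' (Y - c)) k' Z :=
    k'.hasFDerivAt.comp Z ((hasFDerivAt_id Z).sub_const c)
  have h6 := (k.hasFDerivAt.comp Z
    ((hU.differentiableAt_grad h𝔞 hv (mem Z hZ)).hasFDerivAt.comp Z h5))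
  refine (h6.congr_of_eventuallyEq ?_).fderiv.symm
  filter_upwards [(isOpen_tube r).mem_nhds hZ] with Y hY
  rw [Function.comp_apply, Function.comp_apply, ← hU.grad_map h𝔞 hv hk (mem Y hY),
    ← mul_apply_eq_comp, e, one_apply_eq_self, hU.grad_sub_k hc]

/-- The extension is twice continuously differentiable. -/
theorem contDiffOn : ContDiffOn ℝ 2 U (S.tube r) := by
  have hopen := isOpen_tube (S := S) r
  have h1 : ContDiffOn ℝ 1 (grad U) (S.tube r) := by
    rw [show (1 : WithTop ℕ∞) = 0 + 1 from (zero_add 1).symm,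
      contDiffOn_succ_iff_fderiv_of_isOpen hopen]
    refine ⟨fun X hX => (hU.differentiableAt_grad h𝔞 hv hX).differentiableWithinAt, by simp, ?_⟩
    rw [contDiffOn_zero]
    exact fun X hX => (hU.continuousAt_fderiv_grad h𝔞 hv hX).continuousWithinAt
  rw [show (2 : WithTop ℕ∞) = 1 + 1 by norm_num, contDiffOn_succ_iff_fderiv_of_isOpen hopen]
  refine ⟨fun X hX => (hU.differentiableAt h𝔞 hv hX).differentiableWithinAt, by simp, ?_⟩
  exact ((innerSL ℝ (E := E)).contDiff.comp_contDiffOn h1).congr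
    fun X _ => fderiv_eq_innerSL_grad U X

end IsInvariantExt

end CartanData

end AkhiezerGindikin

end

/-! ### Derivative of the exponential map and coordinates of the second kind -/

noncomputable section

namespace AkhiezerGindikin

open Module Filter Topology

local notation "⟪" x ", " y "⟫" => inner ℝ x y

set_option linter.unusedSectionVars false

section Intertwine

variable {𝔸 : Type*} [NormedRing 𝔸] [NormedAlgebra ℝ 𝔸] [CompleteSpace 𝔸]
  {V : Type*} [NormedAddCommGroup V] [NormedSpace ℝ V] [CompleteSpace V]

/-- The exponential of a bracket is a conjugation. -/
theorem exp_mul_of_bracket {j : V →L[ℝ] 𝔸} {a : 𝔸} {D : V →L[ℝ] V}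
    (h : ∀ z, a * j z - j z * a = j (D z)) (z : V) :
    NormedSpace.exp a * j z = j (NormedSpace.exp D z) * NormedSpace.exp a := by
  have h1 : ∀ t : ℝ, HasDerivAt (fun s : ℝ => NormedSpace.exp (s • (-a)) *
      j (NormedSpace.exp (s • D) z) * NormedSpace.exp (s • a)) 0 t := fun t => by
    have d1 := hasDerivAt_exp_smul (-a) t
    have d2 := j.hasFDerivAt.comp_hasDerivAt t (hasDerivAt_exp_smul_apply' D z t)
    have d3 := hasDerivAt_exp_smul' a t
    refine ((d1.mul d2).mul d3).congr_deriv ?_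
    simp only [Function.comp_apply, Pi.mul_apply]
    rw [← h]
    noncomm_ring
  have h2 := is_const_of_deriv_eq_zero (fun t => (h1 t).differentiableAt)
    (fun t => (h1 t).deriv) 0 1
  simp only [zero_smul, NormedSpace.exp_zero, one_smul, one_mul, mul_one, one_apply_eq_self] at h2
  rw [h2, ← mul_assoc, ← mul_assoc, exp_mul_exp_neg, one_mul]

theorem exists_exp_mul_of_bracket {j : V →L[ℝ] 𝔸} {a : 𝔸} {D : V →L[ℝ] V}
    (h : ∀ z, a * j z - j z * a = j (D z)) (z : V) :
    ∃ w, NormedSpace.exp a * j z = j w * NormedSpace.exp a :=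
  ⟨_, exp_mul_of_bracket h z⟩

end Intertwine

section Analytic

variable {𝔸 : Type*} [NormedRing 𝔸] [NormedAlgebra ℝ 𝔸] [CompleteSpace 𝔸]

theorem hasFDerivAt_exp (z : 𝔸) :
    HasFDerivAt (NormedSpace.exp : 𝔸 → 𝔸) (fderiv ℝ NormedSpace.exp z) z :=
  ((contDiff_exp (m := 1)).differentiable one_ne_zero z).hasFDerivAt

theorem contDiff_fderiv_exp : ContDiff ℝ 1 (fderiv ℝ (NormedSpace.exp : 𝔸 → 𝔸)) :=
  (contDiff_exp (m := 2)).fderiv_right (by norm_num)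

theorem fderiv_exp_self (z : 𝔸) : fderiv ℝ NormedSpace.exp z z = z * NormedSpace.exp z := by
  have h1 : HasDerivAt (fun s : ℝ => s • z) z 1 := by simpa using (hasDerivAt_id (1 : ℝ)).smul_const z
  have h2 := hasFDerivAt_exp ((1 : ℝ) • z)
  have h3 := h2.comp_hasDerivAt (1 : ℝ) h1
  have h4 := hasDerivAt_exp_smul' z 1
  have := h3.unique h4
  simpa using this

/-- The derivative in z of the identity `fderiv_exp_self`. -/
theorem fderiv_fderiv_exp_self (z w : 𝔸) :
    fderiv ℝ (fderiv ℝ NormedSpace.exp) z w z + fderiv ℝ NormedSpace.exp z w =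
      w * NormedSpace.exp z + z * fderiv ℝ NormedSpace.exp z w := by
  have h1 : HasFDerivAt (fderiv ℝ (NormedSpace.exp : 𝔸 → 𝔸)) _ z :=
    (contDiff_fderiv_exp.differentiable one_ne_zero z).hasFDerivAt
  have h2 := h1.clm_apply (hasFDerivAt_id z)
  have h3 := (hasFDerivAt_id z).mul' (hasFDerivAt_exp z)
  have h4 : (fun x => fderiv ℝ (NormedSpace.exp : 𝔸 → 𝔸) x (id x)) =
      fun x => id x * NormedSpace.exp x := funext fun x => fderiv_exp_self x
  rw [h4] at h2
  have := DFunLike.congr_fun (h2.unique h3) w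
  simp at this
  rw [add_comm, this, add_comm]

theorem fderiv_fderiv_exp_symm (z v w : 𝔸) :
    fderiv ℝ (fderiv ℝ NormedSpace.exp) z v w = fderiv ℝ (fderiv ℝ NormedSpace.exp) z w v :=
  ((contDiff_exp (𝔸 := 𝔸) (m := 2)).contDiffAt (x := z)).isSymmSndFDerivAt (by simp) v w

/-- Symmetry of the second derivative of exp combined with `fderiv_fderiv_exp_self` yields the usual
formula for the left logarithmic derivative of exp, in differentiated form. -/
theorem hasDerivAt_fderiv_exp (a v : 𝔸) (s : ℝ) :
    HasDerivAt (fun s : ℝ => NormedSpace.exp (s • (-a)) * fderiv ℝ NormedSpace.exp (s • a) (s • v))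
      (NormedSpace.exp (s • (-a)) * v * NormedSpace.exp (s • a)) s := by
  have h1 : HasFDerivAt (fderiv ℝ (NormedSpace.exp : 𝔸 → 𝔸))
      (fderiv ℝ (fderiv ℝ NormedSpace.exp) (s • a)) (s • a) :=
    (contDiff_fderiv_exp.differentiable one_ne_zero _).hasFDerivAt
  have ha : ∀ a : 𝔸, HasDerivAt (fun s : ℝ => s • a) a s := fun a => by
    simpa using (hasDerivAt_id s).smul_const a
  have h0 : HasDerivAt (fun s : ℝ => fderiv ℝ (NormedSpace.exp : 𝔸 → 𝔸) (s • a))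
      (fderiv ℝ (fderiv ℝ NormedSpace.exp) (s • a) a) s := h1.comp_hasDerivAt s (ha a)
  have h2 := h0.clm_apply (ha v)
  have h3 := (hasDerivAt_exp_smul (-a) s).mul h2
  refine h3.congr_deriv ?_
  have h4 := fderiv_fderiv_exp_self (s • a) v
  rw [map_smul, fderiv_fderiv_exp_symm] at h4
  simp only [map_smul]
  rw [h4, smul_mul_assoc]
  simp only [mul_add, mul_neg, neg_mul, mul_smul_comm, mul_assoc, smul_neg]
  abel

variable [FiniteDimensional ℝ 𝔸] {h : Submodule ℝ 𝔸}

/-- Commutation with a is an operator of h itself, and conjugation by exp is the exponential of that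
operator. -/
theorem conj_exp_mem (hh : ∀ x ∈ h, ∀ y ∈ h, x * y - y * x ∈ h) {a v : 𝔸} (ha : a ∈ h)
    (hv : v ∈ h) : NormedSpace.exp (-a) * v * NormedSpace.exp a ∈ h := by
  let D : h →L[ℝ] h := LinearMap.toContinuousLinearMap
    { toFun := fun z => ⟨(-a) * z - z * (-a), hh _ (h.neg_mem ha) _ z.2⟩
      map_add' := fun x y => Subtype.ext (by push_cast; noncomm_ring)
      map_smul' := fun c x => Subtype.ext (by
        simp only [Submodule.coe_smul, mul_smul_comm, smul_mul_assoc, RingHom.id_apply, smul_sub]) }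
  obtain ⟨w, hw⟩ := exists_exp_mul_of_bracket (j := h.subtypeL) (a := -a) (D := D)
    (fun z => rfl) ⟨v, hv⟩
  simp only [Submodule.subtypeL_apply] at hw
  rw [hw, mul_assoc, exp_neg_mul_exp, mul_one]
  exact w.2

theorem conj_exp_mem' (hh : ∀ x ∈ h, ∀ y ∈ h, x * y - y * x ∈ h) {a v : 𝔸} (ha : a ∈ h)
    (hv : v ∈ h) : NormedSpace.exp a * v * NormedSpace.exp (-a) ∈ h := by
  simpa using conj_exp_mem hh (h.neg_mem ha) hv

/-- The logarithmic derivative of the exponential map of a Lie algebra. -/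
theorem exp_neg_mul_fderiv_exp_mem (hh : ∀ x ∈ h, ∀ y ∈ h, x * y - y * x ∈ h) {a v : 𝔸}
    (ha : a ∈ h) (hv : v ∈ h) :
    NormedSpace.exp (-a) * fderiv ℝ NormedSpace.exp a v ∈ h := by
  obtain ⟨f, hf⟩ := h.subtype.exists_leftInverse_of_injective (Submodule.ker_subtype h)
  -- Q vanishes exactly on h. The curve s ↦ exp(-sa) Dexp_{sa}(sv) starts at 0 and has velocity in
  -- h, so Q is zero along it.
  let Q : 𝔸 →L[ℝ] 𝔸 := LinearMap.toContinuousLinearMap (LinearMap.id - h.subtype ∘ₗ f)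
  have hQ : ∀ x, Q x = x - f x := fun x => rfl
  have hQ0 : ∀ x ∈ h, Q x = 0 := fun x hx => by
    have := LinearMap.congr_fun hf ⟨x, hx⟩
    simp only [LinearMap.comp_apply, Submodule.subtype_apply, LinearMap.id_apply] at this
    rw [hQ, this, sub_self]
  have h1 : ∀ t : ℝ, HasDerivAt (fun s : ℝ => Q (NormedSpace.exp (s • (-a)) *
      fderiv ℝ NormedSpace.exp (s • a) (s • v))) 0 t := fun t => by
    refine (Q.hasFDerivAt.comp_hasDerivAt t (hasDerivAt_fderiv_exp a v t)).congr_deriv ?_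
    refine hQ0 _ ?_
    rw [smul_neg]
    exact conj_exp_mem hh (h.smul_mem t ha) hv
  have h2 := is_const_of_deriv_eq_zero (fun t => (h1 t).differentiableAt)
    (fun t => (h1 t).deriv) 1 0
  simp only [one_smul, zero_smul, map_zero, mul_zero] at h2
  rw [hQ, sub_eq_zero] at h2
  rw [h2]
  exact (f _).2

end Analytic

section Split

variable {𝔸 : Type*} [NormedRing 𝔸] [NormedAlgebra ℝ 𝔸] [CompleteSpace 𝔸]

/-- A linear decomposition of a Lie subalgebra `h` of `𝔸`, as a sum of three linear maps, and a
projection onto `h`. -/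
structure Splitting (h : Submodule ℝ 𝔸) where
  P : 𝔸 →L[ℝ] 𝔸
  P_mem : ∀ x, P x ∈ h
  P_of_mem : ∀ x ∈ h, P x = x
  ρ₁ : 𝔸 →L[ℝ] 𝔸
  ρ₂ : 𝔸 →L[ℝ] 𝔸
  ρ₃ : 𝔸 →L[ℝ] 𝔸
  ρ₁_mem : ∀ x, ρ₁ x ∈ h
  ρ₂_mem : ∀ x, ρ₂ x ∈ h
  ρ₃_mem : ∀ x, ρ₃ x ∈ h
  sum_eq : ∀ x, ρ₁ x + ρ₂ x + ρ₃ x = P x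

namespace Splitting

variable {h : Submodule ℝ 𝔸} (r : Splitting h)

/-- The corresponding coordinates of the second kind. -/
def prodExp (x : 𝔸) : 𝔸 :=
  NormedSpace.exp (x - r.P x) * (NormedSpace.exp (r.ρ₁ x) * NormedSpace.exp (r.ρ₂ x) *
    NormedSpace.exp (r.ρ₃ x))

theorem prodExp_zero : r.prodExp 0 = 1 := by simp [prodExp]

theorem contDiff_prodExp {m : WithTop ℕ∞} : ContDiff ℝ m r.prodExp := by
  unfold prodExp
  refine ContDiff.mul (contDiff_exp.comp (by fun_prop))
    (((contDiff_exp.comp r.ρ₁.contDiff).mul (contDiff_exp.comp r.ρ₂.contDiff)).mul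
      (contDiff_exp.comp r.ρ₃.contDiff))

theorem hasFDerivAt_prodExp_zero :
    HasFDerivAt r.prodExp (ContinuousLinearEquiv.refl ℝ 𝔸 : 𝔸 →L[ℝ] 𝔸) 0 := by
  have h1 : ∀ L : 𝔸 →L[ℝ] 𝔸, HasFDerivAt (fun x => NormedSpace.exp (L x)) L 0 := fun L => by
    have h0 := hasFDerivAt_exp_zero' (𝔸 := 𝔸)
    rw [← map_zero L] at h0
    exact h0.comp (0 : 𝔸) L.hasFDerivAt
  have h2 := (h1 (ContinuousLinearMap.id ℝ 𝔸 - r.P)).mul'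
    (((h1 r.ρ₁).mul' (h1 r.ρ₂)).mul' (h1 r.ρ₃))
  refine h2.congr_fderiv ?_
  ext x
  have := r.sum_eq x
  simp
  rw [← this]
  abel

/-- The inverse coordinates. -/
def coord : 𝔸 → 𝔸 :=
  (r.contDiff_prodExp (m := ω)).contDiffAt.localInverse r.hasFDerivAt_prodExp_zero (by simp)

theorem contDiffAt_coord {m : WithTop ℕ∞} : ContDiffAt ℝ m r.coord 1 := by
  have := (r.contDiff_prodExp (m := ω)).contDiffAt.to_localInverse
    r.hasFDerivAt_prodExp_zero (by simp)
  rw [prodExp_zero] at this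
  exact this.of_le le_top

theorem coord_one : r.coord 1 = 0 := by
  have := (r.contDiff_prodExp (m := ω)).contDiffAt.localInverse_apply_image
    r.hasFDerivAt_prodExp_zero (by simp)
  rwa [prodExp_zero] at this

theorem eventually_prodExp_coord : ∀ᶠ x in 𝓝 (1 : 𝔸), r.prodExp (r.coord x) = x := by
  have := ((r.contDiff_prodExp (m := ω)).contDiffAt.hasStrictFDerivAt'
    r.hasFDerivAt_prodExp_zero (by simp)).eventually_right_inverse
  rwa [prodExp_zero] at this

/-- The left logarithmic derivative of fg is Ad(g⁻¹) of that of f plus that of g, and Ad(exp(-c))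
preserves h for c ∈ h. -/
theorem mul_logDeriv_mem [FiniteDimensional ℝ 𝔸] (hh : ∀ x ∈ h, ∀ y ∈ h, x * y - y * x ∈ h)
    {f g : ℝ → 𝔸} {f' g' : 𝔸} {t : ℝ} (hf : HasDerivAt f f' t) (hg : HasDerivAt g g' t) {β c : 𝔸}
    (hβ : β ∈ h) (hfβ : f' = f t * β) (hc : c ∈ h) (hgc : g t = NormedSpace.exp c) {β' : 𝔸}
    (hβ' : β' ∈ h) (hgβ' : g' = g t * β') :
    ∃ β'' ∈ h, HasDerivAt (fun s => f s * g s) (f t * g t * β'') t := by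
  refine ⟨NormedSpace.exp (-c) * β * NormedSpace.exp c + β',
    h.add_mem (conj_exp_mem hh hc hβ) hβ', (hf.mul hg).congr_deriv ?_⟩
  rw [hfβ, hgβ', mul_add, hgc]
  congr 1
  · simp only [← mul_assoc]
    rw [mul_assoc (f t) _ (NormedSpace.exp (-c)), exp_mul_exp_neg, mul_one]
  · rw [mul_assoc]

theorem exp_logDeriv_mem [FiniteDimensional ℝ 𝔸] (hh : ∀ x ∈ h, ∀ y ∈ h, x * y - y * x ∈ h)
    {c : ℝ → 𝔸} {c' : 𝔸} {t : ℝ} (hc : HasDerivAt c c' t) (hm : c t ∈ h) (hm' : c' ∈ h) :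
    ∃ β ∈ h, HasDerivAt (fun s => NormedSpace.exp (c s)) (NormedSpace.exp (c t) * β) t := by
  refine ⟨_, exp_neg_mul_fderiv_exp_mem hh hm hm', ?_⟩
  rw [← mul_assoc, exp_mul_exp_neg, one_mul]
  exact (hasFDerivAt_exp (c t)).comp_hasDerivAt t hc

/-- A curve in `𝔸` near `1` that is tangent to `h` stays in the exponential image of `h`. -/
theorem eventually_coord_mem [FiniteDimensional ℝ 𝔸]
    (hh : ∀ x ∈ h, ∀ y ∈ h, x * y - y * x ∈ h) :
    ∃ N ∈ 𝓝 (1 : 𝔸), ∀ m : ℝ → 𝔸, m 0 = 1 →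
      (∀ t ∈ Set.Icc (0 : ℝ) 1, m t ∈ N ∧ ∃ b ∈ h, HasDerivAt m (m t * b) t) →
      ∀ t ∈ Set.Icc (0 : ℝ) 1, r.coord (m t) ∈ h := by
  set Q : 𝔸 →L[ℝ] 𝔸 := ContinuousLinearMap.id ℝ 𝔸 - r.P with hQ
  have hQx : ∀ x, Q x = x - r.P x := fun x => rfl
  have hQ0 : ∀ x ∈ h, Q x = 0 := fun x hx => by rw [hQx, r.P_of_mem x hx, sub_self]
  have hQQ : ∀ x, Q (Q x) = Q x := fun x => by
    rw [hQx x, map_sub, hQ0 _ (r.P_mem x), sub_zero, hQx]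
  -- smallness of the complementary coordinate
  have hsm : ∀ᶠ y in 𝓝 (0 : 𝔸), ∀ v, ‖NormedSpace.exp (-y) * fderiv ℝ NormedSpace.exp y v - v‖ ≤
      (2 * (‖Q‖ + 1))⁻¹ * ‖v‖ := by
    let G : 𝔸 → (𝔸 →L[ℝ] 𝔸) := fun y =>
      (ContinuousLinearMap.mul ℝ 𝔸 (NormedSpace.exp (-y))).comp (fderiv ℝ NormedSpace.exp y)
    have hG : Continuous G := by
      refine Continuous.clm_comp ?_ contDiff_fderiv_exp.continuous
      exact (ContinuousLinearMap.mul ℝ 𝔸).continuous.comp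
        ((contDiff_exp (m := 0)).continuous.comp continuous_neg)
    have hG0 : G 0 = ContinuousLinearMap.id ℝ 𝔸 := by
      ext v
      simp only [G, ContinuousLinearMap.comp_apply, hasFDerivAt_exp_zero'.fderiv]
      simp
    have := (hG.tendsto 0).eventually (Metric.closedBall_mem_nhds (G 0)
      (show 0 < (2 * (‖Q‖ + 1))⁻¹ by positivity))
    filter_upwards [this] with y hy v
    rw [hG0, dist_eq_norm] at hy
    have := (G y - ContinuousLinearMap.id ℝ 𝔸).le_opNorm v
    exact this.trans (by gcongr)
  have hcont : ContinuousAt r.coord 1 := (r.contDiffAt_coord (m := 0)).continuousAt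
  have hQc : Tendsto (fun x => Q (r.coord x)) (𝓝 1) (𝓝 0) := by
    have := Q.continuous.continuousAt.comp hcont
    rw [ContinuousAt, Function.comp_apply, coord_one, map_zero] at this
    exact this
  have hdiff : ∀ᶠ x in 𝓝 (1 : 𝔸), DifferentiableAt ℝ r.coord x :=
    ((r.contDiffAt_coord (m := 1)).eventually (by simp)).mono fun x hx =>
      hx.differentiableAt one_ne_zero
  have hN := (r.eventually_prodExp_coord.eventually_nhds.and hdiff).and (hQc.eventually hsm)
  refine ⟨_, hN, fun m hm0 hm t ht => ?_⟩
  -- The coordinate transverse to h does not move. This local argument uses only that h is closed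
  -- under brackets, not that it is the Lie algebra of a closed subgroup.
  have key : ∀ t ∈ Set.Icc (0 : ℝ) 1, HasDerivAt (fun s => Q (r.coord (m s))) 0 t := by
    intro t ht
    obtain ⟨⟨⟨hi, hd⟩, hs⟩, b, hb, hmb⟩ := hm t ht
    set X : ℝ → 𝔸 := fun s => r.coord (m s) with hX
    obtain ⟨X', hX'⟩ : ∃ X', HasDerivAt X X' t := ⟨_, hd.hasFDerivAt.comp_hasDerivAt t hmb⟩
    have hρ : ∀ ρ : 𝔸 →L[ℝ] 𝔸, (∀ x, ρ x ∈ h) → ∃ β ∈ h,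
        HasDerivAt (fun s => NormedSpace.exp (ρ (X s))) (NormedSpace.exp (ρ (X t)) * β) t :=
      fun ρ hρ => exp_logDeriv_mem hh (ρ.hasFDerivAt.comp_hasDerivAt t hX') (hρ _) (hρ _)
    obtain ⟨β₁, hβ₁, d₁⟩ := hρ r.ρ₁ r.ρ₁_mem
    obtain ⟨β₂, hβ₂, d₂⟩ := hρ r.ρ₂ r.ρ₂_mem
    obtain ⟨β₃, hβ₃, d₃⟩ := hρ r.ρ₃ r.ρ₃_mem
    obtain ⟨β₄, hβ₄, d₄⟩ := mul_logDeriv_mem hh d₁ d₂ hβ₁ rfl (r.ρ₂_mem _) rfl hβ₂ rfl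
    obtain ⟨β, hβ, d₅⟩ := mul_logDeriv_mem hh d₄ d₃ hβ₄ rfl (r.ρ₃_mem _) rfl hβ₃ rfl
    have dQ : HasDerivAt (fun s => Q (X s)) (Q X') t := Q.hasFDerivAt.comp_hasDerivAt t hX'
    have dE := (hasFDerivAt_exp (Q (X t))).comp_hasDerivAt t dQ
    have d₆ := dE.mul d₅
    have hmE : m =ᶠ[𝓝 t] fun s => NormedSpace.exp (Q (X s)) * (NormedSpace.exp (r.ρ₁ (X s)) *
        NormedSpace.exp (r.ρ₂ (X s)) * NormedSpace.exp (r.ρ₃ (X s))) := by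
      have := hmb.continuousAt.eventually hi
      filter_upwards [this] with s hs using hs.symm
    have e1 := hmb.unique (d₆.congr_of_eventuallyEq hmE)
    simp only [Function.comp_apply] at e1
    rw [hmE.self_of_nhds] at e1
    set y := Q (X t) with hy
    set w₁ := r.ρ₁ (X t)
    set w₂ := r.ρ₂ (X t)
    set w₃ := r.ρ₃ (X t)
    set D := fderiv ℝ NormedSpace.exp y (Q X') with hD
    set w := NormedSpace.exp w₁ * NormedSpace.exp w₂ * NormedSpace.exp w₃ with hw
    set wi := NormedSpace.exp (-w₃) * (NormedSpace.exp (-w₂) * NormedSpace.exp (-w₁)) with hwi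
    have hwwi : w * wi = 1 := by
      rw [hw, hwi, ← mul_assoc, mul_assoc _ _ (NormedSpace.exp (-w₃)), exp_mul_exp_neg, mul_one,
        ← mul_assoc, mul_assoc _ _ (NormedSpace.exp (-w₂)), exp_mul_exp_neg, mul_one,
        exp_mul_exp_neg]
    -- Comparing the velocity of m with that of the product of exponentials isolates the logarithmic
    -- derivative of the transverse factor. It is conjugated into h, because w is a product of
    -- exponentials of elements of h.
    have e2 : NormedSpace.exp (-y) * D = w * (b - β) * wi := by
      have e3 : D * w = NormedSpace.exp y * (w * (b - β)) := by
        have : D * w = NormedSpace.exp y * w * b - NormedSpace.exp y * (w * β) := by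
          rw [e1]; abel
        rw [this, mul_sub, mul_sub, mul_assoc]
      calc NormedSpace.exp (-y) * D = NormedSpace.exp (-y) * (D * w * wi) := by
            rw [mul_assoc, hwwi, mul_one]
        _ = NormedSpace.exp (-y) * NormedSpace.exp y * (w * (b - β) * wi) := by
            rw [e3]; simp only [mul_assoc]
        _ = _ := by rw [exp_neg_mul_exp, one_mul]
    have e4 : NormedSpace.exp (-y) * D ∈ h := by
      rw [e2, hw, hwi]
      have := conj_exp_mem' hh (r.ρ₁_mem (X t)) (conj_exp_mem' hh (r.ρ₂_mem (X t))
        (conj_exp_mem' hh (r.ρ₃_mem (X t)) (h.sub_mem hb hβ)))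
      simpa only [mul_assoc] using this
    have e5 := hs (Q X')
    have e6 : Q (NormedSpace.exp (-y) * D - Q X') = -Q X' := by
      rw [map_sub, hQ0 _ e4, hQQ, zero_sub]
    -- Near 0 the logarithmic derivative of exp is close to the identity. So Q X' is close to an
    -- element of h, which Q kills; the radius (2(‖Q‖ + 1))⁻¹ is chosen to produce the factor 1/2.
    have e7 : ‖Q X'‖ ≤ 2⁻¹ * ‖Q X'‖ := by
      rw [← norm_neg, ← e6]
      calc _ ≤ ‖Q‖ * ((2 * (‖Q‖ + 1))⁻¹ * ‖Q X'‖) := (Q.le_opNorm _).trans (by gcongr)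
        _ ≤ (‖Q‖ + 1) * ((2 * (‖Q‖ + 1))⁻¹ * ‖Q X'‖) := by gcongr; linarith
        _ = 2⁻¹ * ‖Q X'‖ := by field_simp
        _ = _ := by rw [e6, norm_neg]
    have e8 : Q X' = 0 := by
      rw [← norm_le_zero_iff]; linarith [norm_nonneg (Q X')]
    rwa [e8] at dQ
  have h1 := constant_of_has_deriv_right_zero (f := fun s => Q (r.coord (m s))) (a := 0) (b := 1)
    (fun t ht => (key t ht).continuousAt.continuousWithinAt)
    (fun t ht => (key t (Set.Ico_subset_Icc_self ht)).hasDerivWithinAt) t ht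
  simp only [hm0, coord_one, map_zero] at h1
  rw [hQx, sub_eq_zero] at h1
  rw [h1]
  exact r.P_mem _

/-- Products of two exponentials of small elements of `h`, in the given coordinates. -/
theorem eventually_exp_mul_exp [FiniteDimensional ℝ 𝔸]
    (hh : ∀ x ∈ h, ∀ y ∈ h, x * y - y * x ∈ h) :
    ∀ᶠ p in 𝓝 (0 : 𝔸 × 𝔸), p.1 ∈ h → p.2 ∈ h →
      let c := r.coord (NormedSpace.exp p.1 * NormedSpace.exp p.2)
      NormedSpace.exp p.1 * NormedSpace.exp p.2 =
        NormedSpace.exp (r.ρ₁ c) * NormedSpace.exp (r.ρ₂ c) * NormedSpace.exp (r.ρ₃ c) := by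
  obtain ⟨N, hN, H⟩ := r.eventually_coord_mem hh
  have hm : Tendsto (fun p : 𝔸 × 𝔸 => p.1 * p.2) (𝓝 (1, 1)) (𝓝 1) := by
    have : Tendsto (fun p : 𝔸 × 𝔸 => p.1 * p.2) (𝓝 (1, 1)) (𝓝 (1 * 1)) :=
      continuous_mul.tendsto _
    rwa [mul_one] at this
  obtain ⟨δ, hδ, hδN⟩ := Metric.eventually_nhds_iff.1 (hm.eventually hN)
  have hev := eventually_exp_smul_sub_one (𝔸 := 𝔸) (half_pos hδ)
  have hin : Tendsto (fun p : 𝔸 × 𝔸 => NormedSpace.exp p.1 * NormedSpace.exp p.2) (𝓝 0) (𝓝 1) := by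
    have hc := (contDiff_exp (𝔸 := 𝔸) (m := 0)).continuous
    have : Tendsto (fun p : 𝔸 × 𝔸 => NormedSpace.exp p.1 * NormedSpace.exp p.2) (𝓝 0)
        (𝓝 (NormedSpace.exp (0 : 𝔸 × 𝔸).1 * NormedSpace.exp (0 : 𝔸 × 𝔸).2)) :=
      ((hc.comp continuous_fst).mul (hc.comp continuous_snd)).tendsto 0
    simpa using this
  have hev' : ∀ᶠ p in 𝓝 (0 : 𝔸 × 𝔸), (∀ t : ℝ, |t| ≤ 1 → ‖NormedSpace.exp (t • p.1) - 1‖ ≤ δ / 2) ∧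
      (∀ t : ℝ, |t| ≤ 1 → ‖NormedSpace.exp (t • p.2) - 1‖ ≤ δ / 2) :=
    ((continuous_fst.tendsto (0 : 𝔸 × 𝔸)).eventually hev).and
      ((continuous_snd.tendsto (0 : 𝔸 × 𝔸)).eventually hev)
  filter_upwards [hev', hin.eventually r.eventually_prodExp_coord] with p hp hpc h1 h2
  -- This curve joins 1 to the product, stays near 1, and is tangent to h at every time.
  have hmem := H (fun t => NormedSpace.exp (t • p.1) * NormedSpace.exp (t • p.2)) (by simp)
    (fun t ht => ⟨hδN (y := (_, _)) ?_, ?_⟩) 1 (by simp)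
  · simp only [one_smul] at hmem
    intro c
    have : r.P c = c := r.P_of_mem c hmem
    rw [← hpc]
    change r.prodExp c = _
    rw [prodExp, this, sub_self, NormedSpace.exp_zero, one_mul]
  · have ht' : |t| ≤ 1 := abs_le.2 ⟨by linarith [ht.1], ht.2⟩
    rw [Prod.dist_eq, dist_eq_norm, dist_eq_norm]
    exact max_lt (by linarith [hp.1 t ht']) (by linarith [hp.2 t ht'])
  · refine mul_logDeriv_mem hh (hasDerivAt_exp_smul p.1 t) (hasDerivAt_exp_smul p.2 t) h1 rfl
      (h.smul_mem t h2) rfl h2 rfl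

end Splitting

end Split

end AkhiezerGindikin

end

/-! ### The complexified Lie algebra and uniqueness of the polar decomposition -/

noncomputable section

namespace AkhiezerGindikin

open Module Filter Topology

local notation "⟪" x ", " y "⟫" => inner ℝ x y

set_option linter.unusedSectionVars false

variable {E : Type*} [NormedAddCommGroup E] [InnerProductSpace ℝ E] {𝔸 : Type*}
  [NormedRing 𝔸] [NormedAlgebra ℂ 𝔸] [CompleteSpace 𝔸]

/-- The complexification `E ⊕ i E` of `E`. -/
def Cx (E : Type*) : Type _ := E × E

namespace Cx

instance : NormedAddCommGroup (Cx E) := inferInstanceAs (NormedAddCommGroup (E × E))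

instance : NormedSpace ℝ (Cx E) := inferInstanceAs (NormedSpace ℝ (E × E))

instance [CompleteSpace E] : CompleteSpace (Cx E) := inferInstanceAs (CompleteSpace (E × E))

instance [FiniteDimensional ℝ E] : FiniteDimensional ℝ (Cx E) :=
  inferInstanceAs (FiniteDimensional ℝ (E × E))

/-- The real part. -/
def re : Cx E →L[ℝ] E := ContinuousLinearMap.fst ℝ E E

/-- The imaginary part. -/
def im : Cx E →L[ℝ] E := ContinuousLinearMap.snd ℝ E E

/-- The inclusion of `E`. -/
def inl : E →L[ℝ] Cx E := ContinuousLinearMap.inl ℝ E E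

/-- The inclusion of `i E`. -/
def inr : E →L[ℝ] Cx E := ContinuousLinearMap.inr ℝ E E

/-- The element `x + i y`. -/
def mk (x y : E) : Cx E := (x, y)

@[simp] theorem re_mk (x y : E) : re (mk x y) = x := rfl

@[simp] theorem im_mk (x y : E) : im (mk x y) = y := rfl

@[ext] theorem ext {z w : Cx E} (h : re z = re w) (h' : im z = im w) : z = w := Prod.ext h h'

theorem inl_apply (x : E) : inl x = mk x 0 := rfl

theorem inr_apply (x : E) : inr x = mk 0 x := rfl

@[simp] theorem re_inl (x : E) : re (inl x) = x := rfl

@[simp] theorem im_inl (x : E) : im (inl x) = 0 := rfl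

@[simp] theorem re_inr (x : E) : re (inr x) = 0 := rfl

@[simp] theorem im_inr (x : E) : im (inr x) = x := rfl

theorem mk_re_im (z : Cx E) : mk (re z) (im z) = z := rfl

theorem inl_add_inr (z : Cx E) : inl (E := E) (re z) + inr (E := E) (im z) = z := by ext <;> simp

/-- The complex linear extension of an operator. -/
def diag (a : E →L[ℝ] E) : Cx E →L[ℝ] Cx E := inl.comp (a.comp re) + inr.comp (a.comp im)

theorem diag_apply (a : E →L[ℝ] E) (z : Cx E) : diag a z = mk (a (re z)) (a (im z)) := by
  ext <;> simp [diag]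

theorem diag_one : diag (1 : E →L[ℝ] E) = 1 := ContinuousLinearMap.ext fun z => by
  rw [diag_apply]; rfl

theorem diag_mul (a b : E →L[ℝ] E) : diag (a * b) = diag a * diag b :=
  ContinuousLinearMap.ext fun z => by
    rw [mul_apply_eq_comp]; ext <;> simp [diag_apply, mul_apply_eq_comp]

/-- The complex conjugation. -/
def conj : Cx E →L[ℝ] Cx E := (inl : E →L[ℝ] Cx E).comp re - (inr : E →L[ℝ] Cx E).comp im

theorem conj_apply (z : Cx E) : conj z = mk (re z) (-im z) := by
  ext <;> simp [conj]

end Cx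

section Rotation

/-- The operator `i A` on the complexification of `E`. -/
def rot (A : E →L[ℝ] E) : Cx E →L[ℝ] Cx E :=
  Cx.inr.comp (A.comp Cx.re) - Cx.inl.comp (A.comp Cx.im)

theorem rot_apply (A : E →L[ℝ] E) (z : Cx E) : rot A z = Cx.mk (-A (Cx.im z)) (A (Cx.re z)) := by
  ext <;> simp [rot]

variable [FiniteDimensional ℝ E] [CompleteSpace E]

theorem exp_rot_apply {A : E →L[ℝ] E} {x : E} {c : ℝ} (h : A x = c • x) :
    NormedSpace.exp (rot A) (Cx.mk x 0) = Cx.mk (Real.cos c • x) (Real.sin c • x) := by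
  have h1 : ∀ t : ℝ, HasDerivAt (fun s : ℝ => NormedSpace.exp (s • (-rot A))
      (Cx.mk (Real.cos (s * c) • x) (Real.sin (s * c) • x))) 0 t := fun t => by
    have d0 : HasDerivAt (fun s : ℝ => s * c) c t := by simpa using (hasDerivAt_id t).mul_const c
    have d1 : HasDerivAt (fun s : ℝ => Cx.mk (Real.cos (s * c) • x) (Real.sin (s * c) • x))
        (Cx.mk ((-Real.sin (t * c) * c) • x) ((Real.cos (t * c) * c) • x)) t :=
      (d0.cos.smul_const x).prodMk (d0.sin.smul_const x)
    refine ((hasDerivAt_exp_smul (-rot A) t).clm_apply d1).congr_deriv ?_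
    rw [mul_apply_eq_comp, ← map_add, neg_apply, rot_apply]
    rw [← map_zero (NormedSpace.exp (t • (-rot A)))]
    congr 1
    ext <;> simp [h, smul_smul]
  have h2 := is_const_of_deriv_eq_zero (fun t => (h1 t).differentiableAt)
    (fun t => (h1 t).deriv) 1 0
  simp only [one_smul, zero_smul, one_mul, zero_mul, Real.cos_zero, Real.sin_zero,
    NormedSpace.exp_zero, one_apply_eq_self] at h2
  have h3 : NormedSpace.exp (rot A) (NormedSpace.exp (-rot A)
      (Cx.mk (Real.cos c • x) (Real.sin c • x))) = Cx.mk (Real.cos c • x) (Real.sin c • x) := DFunLike.congr_fun (exp_mul_exp_neg (rot A)) _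
  rw [← h3, h2]

/-- Expand an eigenvector of A in an eigenbasis of B. Wherever the overlap is nonzero, the cosines
and sines of the two eigenvalues agree, and both lie in (-π, π), where the angle is determined. -/
theorem rot_exp_injective {A B : E →L[ℝ] E} (hA : ∀ x y, ⟪A x, y⟫ = ⟪x, A y⟫)
    (hB : ∀ x y, ⟪B x, y⟫ = ⟪x, B y⟫) (hA' : ‖A‖ < Real.pi) (hB' : ‖B‖ < Real.pi)
    (h : NormedSpace.exp (rot A) = NormedSpace.exp (rot B)) : A = B := by
  have hAs : (A : E →ₗ[ℝ] E).IsSymmetric := fun x y => hA x y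
  have hBs : (B : E →ₗ[ℝ] E).IsSymmetric := fun x y => hB x y
  set e := hAs.eigenvectorBasis rfl
  set f := hBs.eigenvectorBasis rfl
  set l := hAs.eigenvalues rfl
  set m := hBs.eigenvalues rfl
  have he : ∀ i, A (e i) = l i • e i := fun i => hAs.apply_eigenvectorBasis rfl i
  have hf : ∀ i, B (f i) = m i • f i := fun i => hBs.apply_eigenvectorBasis rfl i
  have bound : ∀ {A : E →L[ℝ] E} {x : E} {c : ℝ}, ‖A‖ < Real.pi → ‖x‖ = 1 → A x = c • x →
      |c| < Real.pi := fun {A x c} h1 h2 h3 => by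
    have := A.le_opNorm x
    rw [h3, norm_smul, h2, mul_one, mul_one, Real.norm_eq_abs] at this
    linarith
  have hl : ∀ i, |l i| < Real.pi := fun i => bound hA' (e.orthonormal.1 i) (he i)
  have hm : ∀ i, |m i| < Real.pi := fun i => bound hB' (f.orthonormal.1 i) (hf i)
  refine clm_ext_orthonormalBasis e fun i => ?_
  have h1 := exp_rot_apply (he i)
  have h2 : NormedSpace.exp (rot B) (Cx.mk (e i) 0) =
      Cx.mk (∑ j, (⟪f j, e i⟫ * Real.cos (m j)) • f j)
        (∑ j, (⟪f j, e i⟫ * Real.sin (m j)) • f j) := by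
    have : Cx.mk (e i) 0 = ∑ j, ⟪f j, e i⟫ • Cx.mk (f j) 0 := by
      simp only [← Cx.inl_apply]
      conv_lhs => rw [← f.sum_repr' (e i), map_sum]
      simp only [map_smul]
    rw [this, map_sum]
    simp only [map_smul, exp_rot_apply (hf _)]
    ext <;> simp [smul_smul]
  rw [← h, h1] at h2
  have key : ∀ j, ⟪f j, e i⟫ ≠ 0 → m j = l i := by
    intro j hj
    have c1 := congrArg (fun z => ⟪f j, Cx.re z⟫) h2
    have c2 := congrArg (fun z => ⟪f j, Cx.im z⟫) h2
    simp only [Cx.re_mk, Cx.im_mk, inner_smul_right, inner_sum, f.inner_eq_ite, mul_ite, mul_one, mul_zero,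
      Finset.sum_ite_eq, Finset.mem_univ, if_true] at c1 c2
    rw [mul_comm] at c1 c2
    have c3 := mul_left_cancel₀ hj c1
    have c4 := mul_left_cancel₀ hj c2
    have c5 : Complex.exp (m j * Complex.I) = Complex.exp (l i * Complex.I) := by
      rw [Complex.exp_mul_I, Complex.exp_mul_I, ← Complex.ofReal_cos, ← Complex.ofReal_sin,
        ← Complex.ofReal_cos, ← Complex.ofReal_sin, c3, c4]
    have hlog : ∀ {x : ℝ}, |x| < Real.pi → Complex.log (Complex.exp (x * Complex.I)) =
        x * Complex.I := fun {x} hx => by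
      rw [abs_lt] at hx
      exact Complex.log_exp (by simpa using hx.1) (by simpa using hx.2.le)
    have c6 := congrArg Complex.log c5
    rw [hlog (hm j), hlog (hl i)] at c6
    exact_mod_cast mul_right_cancel₀ Complex.I_ne_zero c6
  rw [he i]
  conv_rhs => rw [← f.sum_repr' (e i), map_sum]
  conv_lhs => rw [← f.sum_repr' (e i), Finset.smul_sum]
  refine Finset.sum_congr rfl fun j _ => ?_
  by_cases hj : ⟪f j, e i⟫ = 0
  · rw [hj]; simp
  · rw [map_smul, hf, key j hj, smul_comm]

/-- M sends an eigenvector of B with eigenvalue m to an eigenvector of exp(-B) with eigenvalue exp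
m. The logarithm of a symmetric exponential then makes it an eigenvector of -B with eigenvalue m. -/
theorem anticomm_of_exp {B M : E →L[ℝ] E} (hB : ∀ x y, ⟪B x, y⟫ = ⟪x, B y⟫)
    (h : ∀ x, M (NormedSpace.exp B x) = NormedSpace.exp (-B) (M x)) (x : E) :
    M (B x) = -B (M x) := by
  have hBs : (B : E →ₗ[ℝ] E).IsSymmetric := fun x y => hB x y
  set f := hBs.eigenvectorBasis rfl
  set m := hBs.eigenvalues rfl
  have hf : ∀ i, B (f i) = m i • f i := fun i => hBs.apply_eigenvectorBasis rfl i
  have hB' : ∀ x y, ⟪(-B) x, y⟫ = ⟪x, (-B) y⟫ := fun x y => by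
    rw [neg_apply, neg_apply, inner_neg_left, inner_neg_right, hB]
  have : M * B = -(B * M) := by
    refine clm_ext_orthonormalBasis f fun i => ?_
    have h1 := h (f i)
    rw [exp_apply_eigenvector (hf i), map_smul] at h1
    have h2 := apply_eq_log_smul hB' h1.symm
    rw [Real.log_exp] at h2
    rw [mul_apply_eq_comp, neg_apply, mul_apply_eq_comp, hf, map_smul, ← h2]
    rfl
  exact DFunLike.congr_fun this x

end Rotation

namespace CartanData

/-- The adjoint representation of the complexification of `E`. -/
def adC (S : CartanData E) (z : Cx E) : Cx E →L[ℝ] Cx E :=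
  Cx.diag (S.br (Cx.re z)) + rot (S.br (Cx.im z))

theorem adC_apply (S : CartanData E) (z w : Cx E) :
    S.adC z w = Cx.mk (S.br (Cx.re z) (Cx.re w) - S.br (Cx.im z) (Cx.im w))
      (S.br (Cx.re z) (Cx.im w) + S.br (Cx.im z) (Cx.re w)) := by
  ext
  · simp [adC, rot_apply, Cx.diag_apply, sub_eq_add_neg]
  · simp [adC, rot_apply, Cx.diag_apply]

/-- The complex linear extension of the Cartan involution. -/
def θC (S : CartanData E) : Cx E →L[ℝ] Cx E := Cx.diag S.θ

variable {S : CartanData E}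

theorem θC_apply (z : Cx E) : S.θC z = Cx.mk (S.θ (Cx.re z)) (S.θ (Cx.im z)) :=
  Cx.diag_apply _ _

theorem θC_adC (z w : Cx E) : S.θC (S.adC z w) = S.adC (S.θC z) (S.θC w) := by
  ext <;> simp [adC_apply, θC_apply, S.θ_br]

theorem conj_adC (z w : Cx E) : Cx.conj (S.adC z w) = S.adC (Cx.conj z) (Cx.conj w) := by
  ext
  · simp [adC_apply, Cx.conj_apply]
  · simp [adC_apply, Cx.conj_apply, add_comm]

/-- A realisation of `E` as a totally real Lie algebra of matrices. -/
structure Realization (S : CartanData E) (𝔸 : Type*) [NormedRing 𝔸] [NormedAlgebra ℂ 𝔸] where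
  toMat : E →L[ℝ] 𝔸
  map_br : ∀ x y, toMat (S.br x y) = toMat x * toMat y - toMat y * toMat x
  eq_zero : ∀ x y, toMat x + Complex.I • toMat y = 0 → x = 0 ∧ y = 0

namespace Realization

/-- The realisation of the complexification. -/
def toMatC (ι : S.Realization 𝔸) : (Cx E) →L[ℝ] 𝔸 :=
  ι.toMat.comp Cx.re +
    Complex.I • (ι.toMat.comp Cx.im)

variable (ι : S.Realization 𝔸)

theorem toMatC_apply (z : Cx E) : ι.toMatC z = ι.toMat (Cx.re z) + Complex.I • ι.toMat (Cx.im z) := rfl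

theorem toMatC_injective : Function.Injective ι.toMatC := by
  refine (injective_iff_map_eq_zero ι.toMatC).2 fun z hz => ?_
  obtain ⟨h1, h2⟩ := ι.eq_zero _ _ hz
  exact Cx.ext (by simpa using h1) (by simpa using h2)

theorem toMatC_adC (z w : Cx E) :
    ι.toMatC (S.adC z w) = ι.toMatC z * ι.toMatC w - ι.toMatC w * ι.toMatC z := by
  simp only [toMatC_apply, adC_apply, Cx.re_mk, Cx.im_mk, map_sub, map_add, ι.map_br]
  simp only [mul_add, add_mul, smul_mul_assoc, mul_smul_comm, smul_smul, smul_sub, smul_add,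
    Complex.I_mul_I, neg_smul, one_smul]
  abel

theorem I_smul_toMatC (z : Cx E) : Complex.I • ι.toMatC z = ι.toMatC (Cx.mk (-Cx.im z) (Cx.re z)) := by
  simp only [toMatC_apply, Cx.re_mk, Cx.im_mk, smul_add, smul_smul, Complex.I_mul_I, neg_smul, one_smul, map_neg]
  abel

/-- The group `G`, as a set of matrices. -/
def gpG : Submonoid (𝔸) := Submonoid.closure (Set.range fun x => NormedSpace.exp (ι.toMat x))

/-- The group `K^ℂ`, as a set of matrices. -/
def gpKC : Submonoid (𝔸) :=
  Submonoid.closure ((fun z => NormedSpace.exp (ι.toMatC z)) '' {z | S.θC z = z})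

/-- The conjugation by `x` is the operator `T` on the complexification of `E`. -/
def IsAd (x : 𝔸) (T : (Cx E) →L[ℝ] (Cx E)) : Prop :=
  ∀ z, x * ι.toMatC z = ι.toMatC (T z) * x

variable {ι}

theorem IsAd.mul {x y : 𝔸} {T T' : (Cx E) →L[ℝ] (Cx E)} (h : ι.IsAd x T) (h' : ι.IsAd y T') :
    ι.IsAd (x * y) (T * T') := fun z => by
  rw [mul_assoc, h', ← mul_assoc, h, mul_assoc]
  rfl

theorem IsAd.one : ι.IsAd 1 1 := fun z => by
  rw [one_mul, mul_one, one_apply_eq_self]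

theorem IsAd.eq {x y : 𝔸} {T T' : (Cx E) →L[ℝ] (Cx E)} (h : ι.IsAd x T) (h' : ι.IsAd x T')
    (hx : x * y = 1) : T = T' := by
  refine ContinuousLinearMap.ext fun z => ι.toMatC_injective ?_
  have h1 : ι.toMatC (T z) * x = ι.toMatC (T' z) * x := by rw [← h, ← h']
  have h2 := congrArg (· * y) h1
  simpa only [mul_assoc, hx, mul_one] using h2

theorem IsAd.map_adC {x y : 𝔸} {T : (Cx E) →L[ℝ] (Cx E)} (h : ι.IsAd x T)
    (hx : x * y = 1) (z w : Cx E) : T (S.adC z w) = S.adC (T z) (T w) := by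
  refine ι.toMatC_injective ?_
  have h1 : ι.toMatC (T (S.adC z w)) * x = ι.toMatC (S.adC (T z) (T w)) * x := by
    rw [← h, ι.toMatC_adC, ι.toMatC_adC, mul_sub, sub_mul, ← mul_assoc, ← mul_assoc, h, h,
      mul_assoc, h, mul_assoc _ x, h]
    simp only [mul_assoc]
  have h2 := congrArg (· * y) h1
  simpa only [mul_assoc, hx, mul_one] using h2

variable [CompleteSpace E]

theorem isAd_exp (ι : S.Realization 𝔸) (z : Cx E) :
    ι.IsAd (NormedSpace.exp (ι.toMatC z)) (NormedSpace.exp (S.adC z)) := fun w =>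
  exp_mul_of_bracket (a := ι.toMatC z) (j := ι.toMatC) (D := S.adC z) (fun w => (ι.toMatC_adC z w).symm) w

theorem exp_diag (A : E →L[ℝ] E) :
    NormedSpace.exp (Cx.diag A) = Cx.diag (NormedSpace.exp A) := by
  refine ContinuousLinearMap.ext fun z => ?_
  rw [← Cx.inl_add_inr z, map_add, map_add,
    exp_intertwine (P := Cx.inl) (A := Cx.diag A) (B := A) fun x => by ext <;> simp [Cx.diag_apply],
    exp_intertwine (P := Cx.inr) (A := Cx.diag A) (B := A) fun x => by ext <;> simp [Cx.diag_apply]]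
  ext <;> simp [Cx.diag_apply]

theorem exists_isAd_of_gpG {g : 𝔸} (hg : g ∈ ι.gpG) :
    ∃ a ∈ Submonoid.closure (Set.range fun X => NormedSpace.exp (S.br X)),
      ι.IsAd g (Cx.diag a) := by
  induction hg using Submonoid.closure_induction with
  | mem g hg =>
    obtain ⟨x, rfl⟩ := hg
    refine ⟨_, Submonoid.subset_closure ⟨x, rfl⟩, ?_⟩
    have h := ι.isAd_exp (Cx.mk x 0)
    have h1 : S.adC (Cx.mk x 0) = Cx.diag (S.br x) :=
      ContinuousLinearMap.ext fun w => by ext <;> simp [adC_apply, Cx.diag_apply]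
    rw [h1, exp_diag, toMatC_apply] at h
    simpa using h
  | one => exact ⟨1, Submonoid.one_mem _, by rw [Cx.diag_one]; exact IsAd.one⟩
  | mul g g' _ _ h h' =>
    obtain ⟨a, ha, h⟩ := h
    obtain ⟨a', ha', h'⟩ := h'
    exact ⟨a * a', Submonoid.mul_mem _ ha ha', by rw [Cx.diag_mul]; exact h.mul h'⟩

/-- For z fixed by the complexified involution, ad z commutes with that involution, hence so does
its exponential. -/
theorem exists_isAd_of_gpKC {k : 𝔸} (hk : k ∈ ι.gpKC) :
    ∃ T, ι.IsAd k T ∧ T * S.θC = S.θC * T := by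
  induction hk using Submonoid.closure_induction with
  | mem k hk =>
    obtain ⟨z, hz, rfl⟩ := hk
    refine ⟨_, ι.isAd_exp z, ContinuousLinearMap.ext fun w => ?_⟩
    refine exp_intertwine (P := S.θC) (fun w => ?_) w
    rw [θC_adC, hz]
  | one => exact ⟨1, IsAd.one, by rw [one_mul, mul_one]⟩
  | mul g g' _ _ h h' =>
    obtain ⟨T, hT, h⟩ := h
    obtain ⟨T', hT', h'⟩ := h'
    exact ⟨T * T', hT.mul hT', by rw [mul_assoc, h', ← mul_assoc, h, mul_assoc]⟩

variable [FiniteDimensional ℝ E]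

/-- The polar decomposition `G exp(i𝔞) K^ℂ` determines the `𝔞`-component up to the Weyl group. -/
theorem exists_normalizer {𝔞 : Submodule ℝ E} (h𝔞 : S.IsMaxAbelian 𝔞) {g k : 𝔸}
    (hg : g ∈ ι.gpG) (hk : k ∈ ι.gpKC) {H₁ H₂ : E} (h₁ : H₁ ∈ 𝔞) (h₂ : H₂ ∈ 𝔞)
    (hr₁ : ‖S.br H₁‖ < Real.pi / 2) (hr₂ : ‖S.br H₂‖ < Real.pi / 2)
    (h : g * NormedSpace.exp (ι.toMatC (Cx.mk 0 H₁)) * k = NormedSpace.exp (ι.toMatC (Cx.mk 0 H₂))) :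
    ∃ w ∈ S.adK 0, (∀ x ∈ 𝔞, w x ∈ 𝔞) ∧ w H₁ = H₂ := by
  obtain ⟨a, ha, hga⟩ := exists_isAd_of_gpG hg
  obtain ⟨Tk, hkT, hkθ⟩ := exists_isAd_of_gpKC hk
  obtain ⟨κ, hκ, P, hP, rfl⟩ := S.exists_cartan_decomposition ha
  obtain ⟨κ', hκ', κκ', κ'κ⟩ := exists_inverse_of_mem hκ
  have hκK := isKAut_of_mem hκ
  have hκ'K := isKAut_of_mem hκ'
  have p₁ := h𝔞.θ_eq _ h₁
  have p₂ := h𝔞.θ_eq _ h₂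
  set D : (E →L[ℝ] E) → ((Cx E) →L[ℝ] (Cx E)) := Cx.diag with hD
  have Dmul : ∀ a b, D (a * b) = D a * D b := Cx.diag_mul
  have Done : D 1 = 1 := Cx.diag_one
  set Θ := S.θC with hΘ
  have ΘΘ : Θ * Θ = 1 := ContinuousLinearMap.ext fun z => by
    rw [mul_apply_eq_comp, hΘ, θC_apply, θC_apply]
    simp [S.θ_θ, Cx.mk_re_im]
  set Γ := (Cx.conj : Cx E →L[ℝ] Cx E) with hΓ
  have ΓΓ : Γ * Γ = 1 := ContinuousLinearMap.ext fun z => by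
    rw [mul_apply_eq_comp, hΓ, Cx.conj_apply, Cx.conj_apply]
    simp [Cx.mk_re_im]
  have adC_i : ∀ H, S.adC (Cx.mk 0 H) = rot (S.br H) := fun H =>
    ContinuousLinearMap.ext fun w => by rw [adC_apply, rot_apply]; simp
  have hΘT : ∀ H, S.θ H = -H → Θ * NormedSpace.exp (S.adC (Cx.mk 0 H)) =
      NormedSpace.exp (-S.adC (Cx.mk 0 H)) * Θ := fun H hH => by
    refine ContinuousLinearMap.ext fun w => (exp_intertwine (P := Θ) (fun w => ?_) w).symm
    rw [hΘ, θC_adC, θC_apply (Cx.mk 0 H), Cx.re_mk, Cx.im_mk, map_zero, hH, neg_apply]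
    ext <;> simp [adC_apply]
  have hΘT' : ∀ H, S.θ H = -H → Θ * NormedSpace.exp (-S.adC (Cx.mk 0 H)) =
      NormedSpace.exp (S.adC (Cx.mk 0 H)) * Θ := fun H hH => by
    refine ContinuousLinearMap.ext fun w => (exp_intertwine (P := Θ) (fun w => ?_) w).symm
    rw [neg_apply, map_neg, hΘ, θC_adC, θC_apply (Cx.mk 0 H), Cx.re_mk, Cx.im_mk, map_zero, hH]
    ext <;> simp [adC_apply]
  have hΓT : ∀ H, Γ * NormedSpace.exp (S.adC (Cx.mk 0 H)) =
      NormedSpace.exp (-S.adC (Cx.mk 0 H)) * Γ := fun H => by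
    refine ContinuousLinearMap.ext fun w => (exp_intertwine (P := Γ) (fun w => ?_) w).symm
    rw [hΓ, conj_adC, Cx.conj_apply (Cx.mk 0 H), neg_apply]
    ext <;> simp [adC_apply]
  have hΓD : ∀ a, Γ * D a = D a * Γ := fun a =>
    ContinuousLinearMap.ext fun w => by
      rw [mul_apply_eq_comp, mul_apply_eq_comp, hΓ, Cx.conj_apply, Cx.conj_apply]
      simp [hD, Cx.diag_apply]
  have hΘκ : ∀ {κ : E →L[ℝ] E}, S.IsKAut 0 κ → Θ * D κ = D κ * Θ := fun {κ} hκ =>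
    ContinuousLinearMap.ext fun w => by
      rw [mul_apply_eq_comp, mul_apply_eq_comp, hΘ, θC_apply, θC_apply]
      simp [hD, Cx.diag_apply, hκ.θ]
  set p := NormedSpace.exp (S.br P) with hp
  set p' := NormedSpace.exp (-S.br P) with hp'
  have pp' : p * p' = 1 := exp_mul_exp_neg _
  have p'p : p' * p = 1 := exp_neg_mul_exp _
  have hΘp' : Θ * D p' = D p * Θ := ContinuousLinearMap.ext fun w => by
    have : ∀ x, S.θ (p' x) = p (S.θ x) := fun x => by
      rw [hp', ← map_neg, S.θ_exp, map_neg, hP, neg_neg]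
    rw [mul_apply_eq_comp, mul_apply_eq_comp, hΘ, θC_apply, θC_apply]
    simp [hD, Cx.diag_apply, this]
  set T₁ := NormedSpace.exp (S.adC (Cx.mk 0 H₁)) with hT₁
  set T₁' := NormedSpace.exp (-S.adC (Cx.mk 0 H₁)) with hT₁'
  set T₂ := NormedSpace.exp (S.adC (Cx.mk 0 H₂)) with hT₂
  set T₂' := NormedSpace.exp (-S.adC (Cx.mk 0 H₂)) with hT₂'
  have a1 : T₁ * T₁' = 1 := exp_mul_exp_neg _
  have a2 : T₁' * T₁ = 1 := exp_neg_mul_exp _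
  have a3 : T₂ * T₂' = 1 := exp_mul_exp_neg _
  have a4 : T₂' * T₂ = 1 := exp_neg_mul_exp _
  have e1 : D κ * D p * T₁ * Tk = T₂ := by
    have := (hga.mul (ι.isAd_exp (Cx.mk 0 H₁))).mul hkT
    rw [h] at this
    rw [← Dmul]
    exact this.eq (ι.isAd_exp (Cx.mk 0 H₂)) (exp_mul_exp_neg _)
  have b1 : D κ' * D κ = 1 := by rw [← Dmul, κ'κ, Done]
  have b2 : D κ * D κ' = 1 := by rw [← Dmul, κκ', Done]
  have b3 : D p' * D p = 1 := by rw [← Dmul, p'p, Done]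
  have b4 : D p * D p' = 1 := by rw [← Dmul, pp', Done]
  -- cancellation in the ring of operators
  have cl : ∀ {x y : (Cx E) →L[ℝ] (Cx E)}, x * y = 1 → ∀ z, x * (y * z) = z := fun h z => by
    rw [← mul_assoc, h, one_mul]
  have e2 : Tk = T₁' * (D p' * (D κ' * T₂)) := by
    rw [← e1]
    simp only [mul_assoc, cl b1, cl b3, cl a2]
  -- Ad k is unchanged under conjugation by Θ, whereas the same conjugation inverts T₁, T₂ and p and
  -- fixes κ. Comparing the two expressions eliminates k.
  have e3 : T₁' * (D p' * (D κ' * T₂)) = T₁ * (D p * (D κ' * T₂')) := by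
    have h1 : Tk = Θ * (Tk * Θ) := by rw [hkθ, cl ΘΘ]
    have h2 : Θ * (Tk * Θ) = T₁ * (D p * (D κ' * T₂')) := by
      rw [e2]
      calc Θ * (T₁' * (D p' * (D κ' * T₂)) * Θ)
          = (Θ * T₁') * (D p' * (D κ' * (T₂ * Θ))) := by simp only [mul_assoc]
        _ = T₁ * ((Θ * D p') * (D κ' * (T₂ * Θ))) := by
          rw [hΘT' H₁ p₁, mul_assoc, ← mul_assoc Θ]
        _ = T₁ * (D p * ((Θ * D κ') * (T₂ * Θ))) := by
          rw [hΘp', mul_assoc (D p), ← mul_assoc Θ]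
        _ = T₁ * (D p * (D κ' * ((Θ * T₂) * Θ))) := by
          rw [hΘκ hκ'K]; simp only [mul_assoc]
        _ = _ := by rw [hΘT H₂ p₂, mul_assoc T₂', ΘΘ, mul_one]
    rw [← h2, ← h1, e2]
  have e4 : D p * (T₁ * T₁) * D p = D κ' * (T₂ * T₂) * D κ := by
    have h1 := congrArg (fun x => D p * (T₁ * (x * (T₂ * D κ)))) e3
    simp only [mul_assoc, cl a1, cl b4, cl a4, b1, mul_one] at h1 ⊢
    exact h1.symm
  have hΓΓ' : ∀ {x y : (Cx E) →L[ℝ] (Cx E)}, Γ * x = y * Γ → Γ * x * Γ = y := fun {x y} h => by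
    rw [h, mul_assoc, ΓΓ, mul_one]
  -- Complex conjugation inverts exp(iH₁) and exp(iH₂) but fixes the real operators p and κ. The
  -- right sides of this and of `e4` are mutually inverse, which gives `e6`.
  have e5 : D p * (T₁' * T₁') * D p = D κ' * (T₂' * T₂') * D κ := by
    have c1 : Γ * (D p * (T₁ * T₁) * D p) = D p * (T₁' * T₁') * D p * Γ := by
      simp only [← mul_assoc, hΓD]
      rw [mul_assoc (D p) Γ, hΓT, ← mul_assoc, mul_assoc _ Γ T₁, hΓT, ← mul_assoc,
        mul_assoc _ Γ (D p), hΓD, ← mul_assoc]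
    have c2 : Γ * (D κ' * (T₂ * T₂) * D κ) = D κ' * (T₂' * T₂') * D κ * Γ := by
      simp only [← mul_assoc, hΓD]
      rw [mul_assoc (D κ') Γ, hΓT, ← mul_assoc, mul_assoc _ Γ T₂, hΓT, ← mul_assoc,
        mul_assoc _ Γ (D κ), hΓD, ← mul_assoc]
    rw [← hΓΓ' c1, ← hΓΓ' c2, e4]
  have e6 : T₁ * T₁ * (D p * D p) = D p' * D p' * (T₁ * T₁) := by
    have h1 : (D p * (T₁ * T₁) * D p) * (D p * (T₁' * T₁') * D p) = 1 := by
      rw [e4, e5]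
      simp only [mul_assoc, cl b2, cl a3, b1]
    have h2 := congrArg (fun x => D p' * (x * (D p' * (T₁ * T₁)))) h1
    simp only [mul_assoc, cl b3, cl b4, cl a2, a2, one_mul, mul_one] at h2
    simpa only [mul_assoc] using h2
  -- the positive part is trivial
  set R := T₁ * T₁ with hR
  have hRad : ι.IsAd (NormedSpace.exp (ι.toMatC (Cx.mk 0 H₁)) * NormedSpace.exp (ι.toMatC (Cx.mk 0 H₁))) R :=
    (ι.isAd_exp (Cx.mk 0 H₁)).mul (ι.isAd_exp (Cx.mk 0 H₁))
  have hRinv : (NormedSpace.exp (ι.toMatC (Cx.mk 0 H₁)) * NormedSpace.exp (ι.toMatC (Cx.mk 0 H₁))) *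
      (NormedSpace.exp (-ι.toMatC (Cx.mk 0 H₁)) * NormedSpace.exp (-ι.toMatC (Cx.mk 0 H₁))) = 1 := by
    have h1 : NormedSpace.exp (ι.toMatC (Cx.mk 0 H₁)) * NormedSpace.exp (-ι.toMatC (Cx.mk 0 H₁)) = 1 :=
      exp_mul_exp_neg _
    rw [mul_assoc, ← mul_assoc (NormedSpace.exp (ι.toMatC (Cx.mk 0 H₁))) (NormedSpace.exp (-_)),
      h1, one_mul, h1]
  have hexp2 : ∀ B : E →L[ℝ] E, NormedSpace.exp B * NormedSpace.exp B =
      NormedSpace.exp ((2 : ℝ) • B) := fun B => by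
    rw [two_smul, exp_add_comm' (Commute.refl B)]
  have hRR : ∀ H, NormedSpace.exp (S.adC (Cx.mk 0 H)) * NormedSpace.exp (S.adC (Cx.mk 0 H)) =
      NormedSpace.exp (rot (S.br ((2 : ℝ) • H))) := fun H => by
    rw [adC_i, ← exp_add_comm' (Commute.refl _)]
    congr 1
    refine ContinuousLinearMap.ext fun w => ?_
    rw [add_apply, rot_apply, rot_apply, map_smul, smul_apply, smul_apply]
    ext
    · simp [two_smul]
    · simp [two_smul]
  have hBsym : ∀ x y, ⟪((2 : ℝ) • S.br P) x, y⟫ = ⟪x, ((2 : ℝ) • S.br P) y⟫ := fun x y => by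
    rw [smul_apply, smul_apply, real_inner_smul_left, real_inner_smul_right, S.inner_br_p hP]
  -- R conjugates exp(2 ad P) to its inverse, so it should anticommute with ad P. `anticomm_of_exp`
  -- concerns operators of E, so it is applied to the real and imaginary blocks of R.
  have e7 : ∀ M : (Cx E) →L[ℝ] E, (∀ a : E →L[ℝ] E, ∀ z, M (D a z) = a (M z)) →
      ∀ N : E →L[ℝ] (Cx E), (∀ a : E →L[ℝ] E, ∀ x, N (a x) = D a (N x)) →
      ∀ x, M (R (N (((2 : ℝ) • S.br P) x))) = -((2 : ℝ) • S.br P) (M (R (N x))) := by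
    intro M hM N hN
    refine anticomm_of_exp (M := (M.comp R).comp N) hBsym fun x => ?_
    have h1 := DFunLike.congr_fun e6 (N x)
    rw [← Dmul, ← Dmul, hp, hp', hexp2, hexp2, smul_neg] at h1
    simp only [mul_apply_eq_comp] at h1
    simp only [ContinuousLinearMap.comp_apply]
    rw [hN, h1, hM]
  have e8 : ∀ z, R (D (S.br P) z) = -D (S.br P) (R z) := by
    have two : ∀ {x y : E}, (2 : ℝ) • x = -((2 : ℝ) • y) → x = -y := fun {x y} h => by
      rw [← smul_neg] at h
      exact smul_right_injective E two_ne_zero h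
    have c1 : ∀ N : E →L[ℝ] (Cx E), (∀ a : E →L[ℝ] E, ∀ x, N (a x) = D a (N x)) →
        ∀ x, R (N (S.br P x)) = -D (S.br P) (R (N x)) := fun N hN x => by
      have m1 := e7 Cx.re (fun a z => by simp [hD, Cx.diag_apply]) N hN x
      have m2 := e7 Cx.im (fun a z => by simp [hD, Cx.diag_apply]) N hN x
      simp only [smul_apply, map_smul] at m1 m2
      refine Cx.ext ((two m1).trans ?_) ((two m2).trans ?_) <;> simp [hD, Cx.diag_apply]
    intro z
    have k1 : ∀ (a : E →L[ℝ] E) (x : E), Cx.inl (a x) = D a (Cx.inl x) := fun a x => by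
      ext <;> simp [hD, Cx.diag_apply]
    have k2 : ∀ (a : E →L[ℝ] E) (x : E), Cx.inr (a x) = D a (Cx.inr x) := fun a x => by
      ext <;> simp [hD, Cx.diag_apply]
    rw [← Cx.inl_add_inr z]
    simp only [map_add, neg_add]
    rw [← c1 _ k1, ← c1 _ k2, k1, k2]
  have hPad : S.adC (Cx.mk P 0) = D (S.br P) :=
    ContinuousLinearMap.ext fun w => by rw [adC_apply]; simp [hD, Cx.diag_apply]
  have RR' : R * (T₁' * T₁') = 1 := by
    rw [hR, mul_assoc, cl a1, a1]
  -- R is an automorphism of the bracket, so R ad P R⁻¹ = ad(RP). By `e8` this is -ad P, and the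
  -- centre is trivial.
  have e9 : R (Cx.mk P 0) = -(Cx.mk P 0) := by
    have c1 : ∀ w, S.adC (R (Cx.mk P 0) + (Cx.mk P 0)) w = 0 := fun w => by
      have c2 := hRad.map_adC hRinv (Cx.mk P 0) ((T₁' * T₁') w)
      have c3 : R ((T₁' * T₁') w) = w := DFunLike.congr_fun RR' w
      rw [hPad, e8, c3, ← hPad] at c2
      have : S.adC (R (Cx.mk P 0) + (Cx.mk P 0)) w = S.adC (R (Cx.mk P 0)) w + S.adC (Cx.mk P 0) w := by
        simp only [adC_apply]
        ext <;> simp <;> abel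
      rw [this, ← c2, neg_add_cancel]
    have c4 : R (Cx.mk P 0) + (Cx.mk P 0) = 0 := by
      refine Cx.ext ?_ ?_
      · rw [map_zero]
        refine S.center _ fun y => ?_
        have := congrArg Cx.re (c1 (Cx.mk y 0))
        rw [adC_apply] at this
        simpa using this
      · rw [map_zero]
        refine S.center _ fun y => ?_
        have := congrArg Cx.im (c1 (Cx.mk y 0))
        rw [adC_apply] at this
        simpa using this
    exact eq_neg_of_add_eq_zero_left c4
  have hn2 : ∀ H, ‖S.br H‖ < Real.pi / 2 → ‖S.br ((2 : ℝ) • H)‖ < Real.pi := fun H hH => by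
    rw [map_smul, norm_smul]; norm_num; linarith
  obtain ⟨b⟩ := S.nonempty_rootBasis h𝔞
  -- On the weight vector of α the real part of R is cos 2α(H₁), and cos 2α(H₁) + 1 = 2cos²α(H₁) is
  -- nonzero as |α(H₁)| < π/2.
  have hP0 : P = 0 := by
    classical
    rw [hR, hT₁, hRR] at e9
    have c1 : ∀ i, ⟪b.e i, P⟫ = 0 := fun i => by
      have d1 : P = ∑ j, ⟪b.e j, P⟫ • b.e j := (b.e.sum_repr' P).symm
      have d2 : ((Cx.mk P 0) : Cx E) = ∑ j, ⟪b.e j, P⟫ • Cx.mk (b.e j) 0 := by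
        simp only [← Cx.inl_apply, ← map_smul, ← map_sum, ← d1]
      have d3 : ∀ j, ((2 : ℝ) • S.br H₁) (b.e j) = (2 * ⟪b.A j, H₁⟫) • b.e j := fun j => by
        rw [smul_apply, b.br_e _ h₁, smul_smul]
      have d4 := congrArg (fun z => ⟪b.e i, Cx.re z⟫) e9
      rw [d2, map_sum] at d4
      rw [map_smul S.br] at d4
      simp only [map_smul, exp_rot_apply (d3 _)] at d4
      simp only [map_sum, map_smul, map_neg, Cx.re_mk, inner_neg_right, inner_sum,
        real_inner_smul_right, b.e.inner_eq_ite, mul_ite, mul_one, mul_zero, Finset.sum_ite_eq,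
        Finset.mem_univ, if_true] at d4
      have d5 : |⟪b.A i, H₁⟫| < Real.pi / 2 :=
        (b.norm_br_lt_iff h₁ (by positivity)).1 hr₁ i
      have d6 : Real.cos (2 * ⟪b.A i, H₁⟫) + 1 ≠ 0 := by
        rw [Real.cos_two_mul]
        have : 0 < Real.cos ⟪b.A i, H₁⟫ := by
          rw [abs_lt] at d5
          exact Real.cos_pos_of_mem_Ioo ⟨by linarith [d5.1], d5.2⟩
        have := pow_pos this 2
        intro h; nlinarith
      have d7 : ⟪b.e i, P⟫ * (Real.cos (2 * ⟪b.A i, H₁⟫) + 1) = 0 := by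
        linarith
      exact (mul_eq_zero.1 d7).resolve_right d6
    rw [← b.e.sum_repr' P]
    exact Finset.sum_eq_zero fun i _ => by rw [c1 i, zero_smul]
  have hDp : D p = 1 := by rw [hp, hP0, map_zero, NormedSpace.exp_zero, Done]
  rw [hDp, one_mul, mul_one, hR, hT₁, hRR, hT₂, hRR] at e4
  have e10 : D κ' * NormedSpace.exp (rot (S.br ((2 : ℝ) • H₂))) * D κ =
      NormedSpace.exp (rot (S.br ((2 : ℝ) • κ' H₂))) := by
    have c1 : D κ' * NormedSpace.exp (rot (S.br ((2 : ℝ) • H₂))) =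
        NormedSpace.exp (rot (S.br ((2 : ℝ) • κ' H₂))) * D κ' := by
      refine ContinuousLinearMap.ext fun w => (exp_intertwine (P := D κ') (fun w => ?_) w).symm
      rw [rot_apply, rot_apply]
      simp [hD, Cx.diag_apply, hκ'K.br]
    rw [c1, mul_assoc, b1, mul_one]
  rw [e10] at e4
  have hκ'H : S.θ (κ' H₂) = -κ' H₂ := by rw [← hκ'K.θ, p₂, map_neg]
  have sym : ∀ H, S.θ H = -H → ∀ x y, ⟪S.br ((2 : ℝ) • H) x, y⟫ = ⟪x, S.br ((2 : ℝ) • H) y⟫ :=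
    fun H hH => S.inner_br_p (by rw [map_smul, hH, smul_neg])
  -- Here the bound π/2 enters again: doubled, it keeps both spectra in (-π, π).
  have e11 := rot_exp_injective (sym _ p₁) (sym _ hκ'H) (hn2 _ hr₁)
    (hn2 _ (by rw [hκ'K.norm_br]; exact hr₂)) e4
  have e12 : H₁ = κ' H₂ := smul_right_injective E two_ne_zero (S.eq_of_br_eq e11)
  exact h𝔞.exists_normalizer h₁ h₂ hκ' e12.symm

end Realization

end CartanData

end AkhiezerGindikin

end

/-! ### Positivity of the Levi form -/

noncomputable section

namespace AkhiezerGindikin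

open Module Filter Topology

local notation "⟪" x ", " y "⟫" => inner ℝ x y

set_option linter.unusedSectionVars false

variable {E : Type*} [NormedAddCommGroup E] [InnerProductSpace ℝ E]

/-- The multiplication by `i`. -/
def Cx.mulI : Cx E →L[ℝ] Cx E := rot 1

theorem Cx.mulI_apply (z : Cx E) : Cx.mulI z = Cx.mk (-Cx.im z) (Cx.re z) := rot_apply _ _

theorem cos_pos_of_abs_lt {a : ℝ} (ha : |a| < Real.pi / 2) : 0 < Real.cos a :=
  Real.cos_pos_of_mem_Ioo (abs_lt.1 ha)

theorem sin_mul_self_pos {a : ℝ} (ha : |a| < Real.pi / 2) (h0 : a ≠ 0) : 0 < Real.sin a * a := by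
  have := abs_lt.1 ha
  rcases lt_or_gt_of_ne h0 with h | h
  · exact mul_pos_of_neg_of_neg (Real.sin_neg_of_neg_of_neg_pi_lt h (by linarith [Real.pi_pos])) h
  · exact mul_pos (Real.sin_pos_of_pos_of_lt_pi h (by linarith [Real.pi_pos])) h

theorem sin_ne_zero_of_abs_lt {a : ℝ} (ha : |a| < Real.pi / 2) (h0 : a ≠ 0) : Real.sin a ≠ 0 :=
  fun h => by simpa [h] using sin_mul_self_pos ha h0

namespace CartanData

variable (S : CartanData E)

/-- The conjugation by `exp(iH)` on the complexification. -/
def adExpI (H : E) : Cx E →L[ℝ] Cx E := NormedSpace.exp (S.adC (Cx.mk 0 H))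

/-- The image of the complexification of `𝔨` under the conjugation by `exp(iH)`. -/
def kTilde (H : E) : Submodule ℝ (Cx E) :=
  (LinearMap.ker ((S.θC - 1 : Cx E →L[ℝ] Cx E) : Cx E →ₗ[ℝ] Cx E)).map (S.adExpI H : Cx E →ₗ[ℝ] Cx E)

variable {S}

theorem mem_kTilde {H : E} {z : Cx E} :
    z ∈ S.kTilde H ↔ ∃ κ, S.θC κ = κ ∧ S.adExpI H κ = z := by
  simp [kTilde, sub_eq_zero]

theorem adC_mulI_left (z w : Cx E) : S.adC (Cx.mulI z) w = Cx.mulI (S.adC z w) := by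
  ext
  · simp [adC_apply, Cx.mulI_apply]; abel
  · simp [adC_apply, Cx.mulI_apply]; abel

theorem adC_mulI_right (z w : Cx E) : S.adC z (Cx.mulI w) = Cx.mulI (S.adC z w) := by
  ext
  · simp [adC_apply, Cx.mulI_apply]; abel
  · simp [adC_apply, Cx.mulI_apply]; abel

theorem mulI_mulI (z : Cx E) : Cx.mulI (Cx.mulI z) = -z := by
  ext <;> simp [Cx.mulI_apply]

theorem θC_mulI (z : Cx E) : S.θC (Cx.mulI z) = Cx.mulI (S.θC z) := by
  ext <;> simp [θC_apply, Cx.mulI_apply]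

variable [FiniteDimensional ℝ E] [CompleteSpace E]

theorem adExpI_mulI (H : E) (z : Cx E) :
    S.adExpI H (Cx.mulI z) = Cx.mulI (S.adExpI H z) :=
  exp_intertwine (fun w => adC_mulI_right _ w) z

theorem mulI_mem_kTilde {H : E} {z : Cx E} (hz : z ∈ S.kTilde H) :
    Cx.mulI z ∈ S.kTilde H := by
  obtain ⟨κ, hκ, rfl⟩ := mem_kTilde.1 hz
  exact mem_kTilde.2 ⟨Cx.mulI κ, by rw [θC_mulI, hκ], adExpI_mulI H κ⟩

theorem adC_mk_zero (H : E) : S.adC (Cx.mk 0 H) = rot (S.br H) :=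
  ContinuousLinearMap.ext fun w => by rw [adC_apply, rot_apply]; ext <;> simp

namespace RootBasis

variable {𝔞 : Submodule ℝ E} (b : S.RootBasis 𝔞) (h𝔞 : S.IsMaxAbelian 𝔞) {H : E} (hH : H ∈ 𝔞)

include h𝔞 hH

/-- T is the half sum of e and θe, on which exp(i ad H) acts by exp(±iα(H)). -/
theorem adExpI_T (i : b.ι) : S.adExpI H (Cx.mk (b.T i) 0) =
    Cx.mk (Real.cos ⟪b.A i, H⟫ • b.T i) (Real.sin ⟪b.A i, H⟫ • b.X i) := by
  have h1 := exp_rot_apply (b.br_e H hH i)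
  have h2 := exp_rot_apply (A := S.br H) (x := S.θ (b.e i)) (c := -⟪b.A i, H⟫)
    (by rw [b.br_θe h𝔞 hH, neg_smul])
  have h3 : Cx.mk (b.T i) 0 = (2⁻¹ : ℝ) • (Cx.mk (b.e i) 0 + Cx.mk (S.θ (b.e i)) 0) := by
    ext <;> simp [T, projK_apply]
  rw [h3, adExpI, adC_mk_zero, map_smul, map_add, h1, h2, Real.cos_neg, Real.sin_neg]
  ext
  · simp only [map_smul, map_add, Cx.re_mk, T, projK_apply]
    module
  · simp only [map_smul, map_add, Cx.im_mk, X, projP_apply]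
    module

theorem mk_mem_kTilde (i : b.ι) :
    Cx.mk (Real.cos ⟪b.A i, H⟫ • b.T i) (Real.sin ⟪b.A i, H⟫ • b.X i) ∈ S.kTilde H :=
  mem_kTilde.2 ⟨Cx.mk (b.T i) 0, by ext <;> simp [θC_apply, b.θ_T], b.adExpI_T h𝔞 hH i⟩

theorem mk_mem_kTilde' (i : b.ι) :
    Cx.mk (-(Real.sin ⟪b.A i, H⟫ • b.X i)) (Real.cos ⟪b.A i, H⟫ • b.T i) ∈ S.kTilde H := by
  have := mulI_mem_kTilde (b.mk_mem_kTilde h𝔞 hH i)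
  rwa [Cx.mulI_apply] at this

end RootBasis

/-- The complexification is spanned by the conjugate of `𝔨^ℂ` and by `𝔭^ℂ`. -/
theorem exists_kTilde_add_p {𝔞 : Submodule ℝ E} (b : S.RootBasis 𝔞) (h𝔞 : S.IsMaxAbelian 𝔞) {H : E} (hH : H ∈ 𝔞)
    (hHr : ‖S.br H‖ < Real.pi / 2) (z : Cx E) :
    ∃ κ ∈ S.kTilde H, ∃ P₁ P₂, S.θ P₁ = -P₁ ∧ S.θ P₂ = -P₂ ∧ z = κ + Cx.mk P₁ P₂ := by
  have hcos : ∀ i, Real.cos ⟪b.A i, H⟫ ≠ 0 := fun i =>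
    (cos_pos_of_abs_lt ((b.norm_br_lt_iff hH (by positivity)).1 hHr i)).ne'
  -- Expand t in the `b.T i` and divide the vectors cos α(H) T + i sin α(H) X of `kTilde` by the
  -- nonzero cosine. What is left lies in i𝔭.
  have key : ∀ t, S.θ t = t → ∃ κ ∈ S.kTilde H, ∃ P, S.θ P = -P ∧ Cx.mk t 0 = κ + Cx.mk 0 P := by
    intro t ht
    refine ⟨∑ i, ((⟪b.T i, t⟫ / Real.cos ⟪b.A i, H⟫) •
      Cx.mk (Real.cos ⟪b.A i, H⟫ • b.T i) (Real.sin ⟪b.A i, H⟫ • b.X i)),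
      Submodule.sum_mem _ fun i _ => Submodule.smul_mem _ _ (b.mk_mem_kTilde h𝔞 hH i),
      -∑ i, ((⟪b.T i, t⟫ / Real.cos ⟪b.A i, H⟫) • Real.sin ⟪b.A i, H⟫ • b.X i), ?_, ?_⟩
    · simp only [map_neg, map_sum, map_smul, b.θ_X, smul_neg, Finset.sum_neg_distrib]
    · ext
      · simp only [map_add, map_sum, map_smul, Cx.re_mk, add_zero, smul_smul,
          div_mul_cancel₀ _ (hcos _)]
        exact (b.sum_T ht).symm
      · simp only [map_add, map_sum, map_smul, Cx.im_mk, add_neg_cancel]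
  obtain ⟨κ₁, h₁, P₁, hP₁, e₁⟩ := key _ (S.θ_projK (Cx.re z))
  obtain ⟨κ₂, h₂, P₂, hP₂, e₂⟩ := key _ (S.θ_projK (Cx.im z))
  refine ⟨κ₁ + Cx.mulI κ₂, Submodule.add_mem _ h₁ (mulI_mem_kTilde h₂),
    S.projP (Cx.re z) - P₂, S.projP (Cx.im z) + P₁, ?_, ?_, ?_⟩
  · rw [map_sub, S.θ_projP, hP₂]; abel
  · rw [map_add, S.θ_projP, hP₁]; abel
  · have e₃ := congrArg Cx.mulI e₂
    rw [map_add, Cx.mulI_apply, Cx.mulI_apply (Cx.mk 0 P₂), Cx.re_mk, Cx.im_mk, Cx.re_mk, Cx.im_mk,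
      neg_zero] at e₃
    have a1 := congrArg Cx.re e₁
    have a2 := congrArg Cx.im e₁
    have a3 := congrArg Cx.re e₃
    have a4 := congrArg Cx.im e₃
    simp only [map_add, Cx.re_mk, Cx.im_mk] at a1 a2 a3 a4
    have c1 := S.projK_add_projP (Cx.re z)
    have c2 := S.projK_add_projP (Cx.im z)
    ext
    · simp only [map_add, Cx.re_mk]
      rw [sub_eq_zero.1 (by rw [sub_eq_add_neg]; exact a3.symm : Cx.re (Cx.mulI κ₂) - P₂ = 0),
        ← add_zero (Cx.re κ₁), ← a1]
      conv_lhs => rw [← c1]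
      abel
    · simp only [map_add, Cx.im_mk]
      rw [eq_neg_of_add_eq_zero_left a2.symm, ← add_zero (Cx.im (Cx.mulI κ₂)), ← a4]
      conv_lhs => rw [← c2]
      abel

section Levi

variable {𝔞 : Submodule ℝ E}

/-- Positivity of the Levi form, from the invariance properties of the second derivative. -/
theorem levi_pos (h𝔞 : S.IsMaxAbelian 𝔞) {v : E → ℝ}
    (hv : S.IsConvexInvariant 𝔞 (Real.pi / 2) v) {H : E} (hH : H ∈ 𝔞)
    (hHr : ‖S.br H‖ < Real.pi / 2) (Q : Cx E →ₗ[ℝ] Cx E →ₗ[ℝ] ℝ) (L : Cx E →ₗ[ℝ] ℝ)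
    (hQ_g : ∀ x w, Q (Cx.mk x 0) w = 0) (hQ_k : ∀ w, ∀ κ ∈ S.kTilde H, Q w κ = 0)
    (hQ_symm : ∀ z w, Q z w - Q w z = L (S.adC z w))
    (hL_g : ∀ x, L (Cx.mk x 0) = 0) (hL_k : ∀ κ ∈ S.kTilde H, L κ = 0)
    (hL_p : ∀ P, S.θ P = -P → S.br H P = 0 → L (Cx.mk 0 P) = ⟪grad v H, P⟫)
    (hQ_p : ∀ P, S.θ P = -P → S.br H P = 0 → P ≠ 0 → 0 < Q (Cx.mk 0 P) (Cx.mk 0 P))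
    {z : Cx E} (hz : z ∉ S.kTilde H) :
    0 < Q z z + Q (Cx.mulI z) (Cx.mulI z) := by
  obtain ⟨b⟩ := S.nonempty_rootBasis h𝔞
  set γ := grad v H with hγ
  have hγ𝔞 : γ ∈ 𝔞 := hv.grad_mem hH hHr
  have hγp := h𝔞.θ_eq _ hγ𝔞
  have habs : ∀ i, |⟪b.A i, H⟫| < Real.pi / 2 := (b.norm_br_lt_iff hH (by positivity)).1 hHr
  have hcos : ∀ i, 0 < Real.cos ⟪b.A i, H⟫ := fun i => cos_pos_of_abs_lt (habs i)
  have hsin : ∀ i, ⟪b.A i, H⟫ ≠ 0 → Real.sin ⟪b.A i, H⟫ ≠ 0 := fun i =>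
    sin_ne_zero_of_abs_lt (habs i)
  -- `L` on `i𝔨` and `i𝔭`
  have L_T : ∀ T, S.θ T = T → L (Cx.mk 0 T) = 0 := by
    intro T hT
    have h1 : ∀ i, L (Cx.mk 0 (b.T i)) = 0 := fun i => by
      have h2 := hL_k _ (b.mk_mem_kTilde' h𝔞 hH i)
      have h3 : Cx.mk (-(Real.sin ⟪b.A i, H⟫ • b.X i)) (Real.cos ⟪b.A i, H⟫ • b.T i) =
          Cx.mk (-(Real.sin ⟪b.A i, H⟫ • b.X i)) 0 + Real.cos ⟪b.A i, H⟫ • Cx.mk 0 (b.T i) := by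
        ext <;> simp
      rw [h3, map_add, hL_g, zero_add, map_smul, smul_eq_mul] at h2
      exact (mul_eq_zero.1 h2).resolve_left (hcos i).ne'
    have h2 : Cx.mk 0 T = ∑ i, ⟪b.T i, T⟫ • Cx.mk 0 (b.T i) := by
      simp only [← Cx.inr_apply, ← map_smul, ← map_sum, b.sum_T hT]
    rw [h2, map_sum]
    exact Finset.sum_eq_zero fun i _ => by rw [map_smul, h1, smul_zero]
  have L_X : ∀ P, S.θ P = -P → L (Cx.mk 0 P) = ⟪γ, P⟫ := by
    intro P hP
    -- If α(H) ≠ 0 both sides vanish. The left one does because cos α(H) T + i sin α(H) X and T are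
    -- killed by L, the right one because γ lies in 𝔞.
    have h1 : ∀ i, L (Cx.mk 0 (b.X i)) = ⟪γ, b.X i⟫ := fun i => by
      by_cases hi : ⟪b.A i, H⟫ = 0
      · exact hL_p _ (b.θ_X i) (by rw [b.br_X h𝔞 hH, hi, zero_smul])
      · have h2 := hL_k _ (b.mk_mem_kTilde h𝔞 hH i)
        have h3 : Cx.mk (Real.cos ⟪b.A i, H⟫ • b.T i) (Real.sin ⟪b.A i, H⟫ • b.X i) =
            Cx.mk (Real.cos ⟪b.A i, H⟫ • b.T i) 0 + Real.sin ⟪b.A i, H⟫ • Cx.mk 0 (b.X i) := by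
          ext <;> simp
        rw [h3, map_add, hL_g, zero_add, map_smul, smul_eq_mul] at h2
        have hA : b.A i ≠ 0 := fun h => hi (by rw [h, inner_zero_left])
        rw [real_inner_comm, b.inner_X_of_mem h𝔞 hγ𝔞 hA]
        exact (mul_eq_zero.1 h2).resolve_left (hsin i hi)
    have h2 : Cx.mk 0 P = ∑ i, ⟪b.X i, P⟫ • Cx.mk 0 (b.X i) := by
      simp only [← Cx.inr_apply, ← map_smul, ← map_sum, b.sum_X hP]
    rw [h2, map_sum]
    conv_rhs => rw [← b.sum_X hP, inner_sum]
    exact Finset.sum_congr rfl fun i _ => by rw [map_smul, h1, inner_smul_right, smul_eq_mul]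
  -- the second derivative along `i𝔭`
  have main : ∀ P, S.θ P = -P → P ≠ 0 → 0 < Q (Cx.mk 0 P) (Cx.mk 0 P) := by
    classical
    intro P hP hP0
    set q : b.ι → ℝ := fun i => ⟪b.X i, P⟫ with hq
    set P₀ : E := ∑ i, (if ⟪b.A i, H⟫ = 0 then q i else 0) • b.X i with hP₀
    set P₁ : E := ∑ i, (if ⟪b.A i, H⟫ = 0 then 0 else q i) • b.X i with hP₁
    -- The cotangent comes from the vectors cos α(H) T + i sin α(H) X of `kTilde`, divided by the
    -- sine. With this T, -T + iP₁ lies in `kTilde`. The terms with α(H) = 0 vanish by division by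
    -- zero.
    set T : E := -∑ i, (Real.cos ⟪b.A i, H⟫ / Real.sin ⟪b.A i, H⟫ * q i) • b.T i with hT
    have sum01 : P = P₀ + P₁ := by
      rw [hP₀, hP₁, ← Finset.sum_add_distrib]
      conv_lhs => rw [← b.sum_X hP]
      refine Finset.sum_congr rfl fun i _ => ?_
      split_ifs <;> simp [hq]
    have hP₀p : S.θ P₀ = -P₀ := by
      simp only [hP₀, map_sum, map_smul, b.θ_X, smul_neg, Finset.sum_neg_distrib]
    have hP₁p : S.θ P₁ = -P₁ := by
      simp only [hP₁, map_sum, map_smul, b.θ_X, smul_neg, Finset.sum_neg_distrib]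
    have hTk : S.θ T = T := by
      simp only [hT, map_neg, map_sum, map_smul, b.θ_T]
    have hHP₀ : S.br H P₀ = 0 := by
      rw [hP₀, map_sum]
      refine Finset.sum_eq_zero fun i _ => ?_
      rw [map_smul, b.br_X h𝔞 hH]
      split_ifs with h
      · rw [h, zero_smul, smul_zero]
      · rw [zero_smul]
    -- An element of K that fixes H, and therefore γ, conjugates P₀ into the abelian 𝔞.
    have hγP₀ : S.br P₀ γ = 0 := by
      obtain ⟨w, hw, hwa⟩ := h𝔞.exists_adK_mem hH hP₀p hHP₀
      have hwK := isKAut_of_mem hw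
      refine hwK.toIsAut.injective ?_
      rw [hwK.br, map_zero, hv.grad_fixed h𝔞 hH hHr hw, h𝔞.comm _ hwa _ hγ𝔞]
    have hκ : Cx.mk (-T) P₁ ∈ S.kTilde H := by
      have h1 : Cx.mk (-T) P₁ = ∑ i, (if ⟪b.A i, H⟫ = 0 then 0 else
          q i / Real.sin ⟪b.A i, H⟫) •
            Cx.mk (Real.cos ⟪b.A i, H⟫ • b.T i) (Real.sin ⟪b.A i, H⟫ • b.X i) := by
        ext
        · simp only [map_sum, map_smul, Cx.re_mk, hT, neg_neg]
          refine Finset.sum_congr rfl fun i _ => ?_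
          split_ifs with h
          · simp [h]
          · rw [smul_smul]; congr 1; ring
        · simp only [map_sum, map_smul, Cx.im_mk, hP₁]
          refine Finset.sum_congr rfl fun i _ => ?_
          split_ifs with h
          · simp
          · rw [smul_smul, div_mul_cancel₀ _ (hsin i h)]
      rw [h1]
      exact Submodule.sum_mem _ fun i _ => Submodule.smul_mem _ _ (b.mk_mem_kTilde h𝔞 hH i)
    set κ := Cx.mk (-T) P₁ with hκdef
    have e1 : Cx.mk 0 P = Cx.mk 0 P₀ + Cx.mk T 0 + κ := by
      ext
      · simp [hκdef]
      · simp [hκdef, sum01]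
    -- Write iP = iP₀ + T + κ. Each remaining term has T or κ in the slot where Q does not vanish,
    -- and exchanging the slots costs L of a bracket.
    have e2 : Q (Cx.mk 0 P) (Cx.mk 0 P) = Q (Cx.mk 0 P₀) (Cx.mk 0 P₀) +
        L (S.adC (Cx.mk 0 P₀) (Cx.mk T 0)) + L (S.adC κ (Cx.mk 0 P₀ + Cx.mk T 0)) := by
      rw [← hQ_symm, ← hQ_symm, e1]
      simp only [map_add, LinearMap.add_apply, hQ_g, hQ_k _ κ hκ]
      ring
    have e3 : S.adC (Cx.mk 0 P₀) (Cx.mk T 0) = Cx.mk 0 (S.br P₀ T) := by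
      rw [adC_apply]; ext <;> simp
    have e4 : S.adC κ (Cx.mk 0 P₀ + Cx.mk T 0) =
        Cx.mk (-S.br P₁ P₀) 0 + Cx.mk 0 (S.br P₁ T) + Cx.mk 0 (S.br P₀ T) := by
      rw [adC_apply, S.br_swap P₀ T]
      ext
      · simp [hκdef, S.br_self]
      · simp [hκdef]; abel
    have e5 : ⟪γ, S.br P₀ T⟫ = 0 := by
      rw [real_inner_comm, S.inner_br_p hP₀p, hγP₀, inner_zero_right]
    have e6 : ⟪γ, S.br P₁ T⟫ = ∑ i, Real.cos ⟪b.A i, H⟫ / Real.sin ⟪b.A i, H⟫ * ⟪b.A i, γ⟫ *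
        (q i) ^ 2 := by
      rw [real_inner_comm, S.inner_br_p hP₁p, S.br_swap, inner_neg_right, hT, inner_neg_left,
        neg_neg, sum_inner]
      refine Finset.sum_congr rfl fun i _ => ?_
      rw [real_inner_smul_left, ← S.inner_br_p hγp, b.br_T h𝔞 hγ𝔞, real_inner_smul_left]
      by_cases hi : ⟪b.A i, H⟫ = 0
      · simp [hi]
      · have : ⟪b.X i, P₁⟫ = q i := by
          simp only [hq]
          conv_rhs => rw [sum01]
          rw [inner_add_right, b.inner_X_eq_zero h𝔞 hH hHP₀ hi, zero_add]
        rw [this]; ring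
    have e7 : Q (Cx.mk 0 P) (Cx.mk 0 P) = Q (Cx.mk 0 P₀) (Cx.mk 0 P₀) +
        ∑ i, Real.cos ⟪b.A i, H⟫ / Real.sin ⟪b.A i, H⟫ * ⟪b.A i, γ⟫ * (q i) ^ 2 := by
      rw [e2, e3, e4, map_add, map_add, hL_g, L_X _ (S.br_pk hP₀p hTk), L_X _ (S.br_pk hP₁p hTk),
        e5, e6]
      ring
    -- α(γ) = `coef` · α(H) with `coef` > 0 by convexity, while the cosine and α(H) sin α(H) are
    -- positive for |α(H)| < π/2.
    have pos : ∀ i, ⟪b.A i, H⟫ ≠ 0 →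
        0 < Real.cos ⟪b.A i, H⟫ / Real.sin ⟪b.A i, H⟫ * ⟪b.A i, γ⟫ := fun i hi => by
      have hA : b.A i ≠ 0 := fun h => hi (by rw [h, inner_zero_left])
      have hX := b.X_ne_zero h𝔞 hA
      have hp := b.isRootPair h𝔞 i
      have h1 := hv.coef_pos h𝔞 hp hA hX hH hHr
      have h2 := hv.fderiv_root h𝔞 hp hA hX hH hHr
      rw [real_inner_comm γ, hγ, h2]
      have h3 := sin_mul_self_pos (habs i) hi
      have h4 : Real.cos ⟪b.A i, H⟫ / Real.sin ⟪b.A i, H⟫ * (coef v (b.A i) H * ⟪b.A i, H⟫) =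
          Real.cos ⟪b.A i, H⟫ * coef v (b.A i) H * (Real.sin ⟪b.A i, H⟫ * ⟪b.A i, H⟫) /
            (Real.sin ⟪b.A i, H⟫) ^ 2 := by
        have := hsin i hi
        field_simp
      rw [h4]
      have := hsin i hi
      have := hcos i
      positivity
    have nonneg : ∀ i, 0 ≤ Real.cos ⟪b.A i, H⟫ / Real.sin ⟪b.A i, H⟫ * ⟪b.A i, γ⟫ * (q i) ^ 2 :=
      fun i => by
        by_cases hi : ⟪b.A i, H⟫ = 0
        · simp [hi]
        · exact mul_nonneg (pos i hi).le (sq_nonneg _)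
    rw [e7]
    by_cases h0 : P₀ = 0
    · have : P₁ ≠ 0 := fun h => hP0 (by rw [sum01, h0, h, add_zero])
      obtain ⟨i, -, hi⟩ := Finset.exists_ne_zero_of_sum_ne_zero (hP₁ ▸ this)
      have hi0 : ⟪b.A i, H⟫ ≠ 0 := fun h => hi (by rw [if_pos h, zero_smul])
      have hqi : q i ≠ 0 := fun h => hi (by rw [if_neg hi0, h, zero_smul])
      have h1 : Cx.mk (0 : E) 0 = 0 := rfl
      rw [h0, h1, map_zero, zero_add]
      exact Finset.sum_pos' (fun i _ => nonneg i)
        ⟨i, Finset.mem_univ i, mul_pos (pos i hi0) (by positivity)⟩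
    · exact add_pos_of_pos_of_nonneg (hQ_p _ hP₀p hHP₀ h0) (Finset.sum_nonneg fun i _ => nonneg i)
  -- reduction to `𝔭^ℂ`
  obtain ⟨κ, hκ, P₁, P₂, hP₁, hP₂, rfl⟩ := exists_kTilde_add_p b h𝔞 hH hHr z
  have hIκ := mulI_mem_kTilde hκ
  set W := Cx.mk P₁ P₂ with hW
  -- The cross terms are L([κ, W]) and L([iκ, iW]) = -L([κ, W]), which cancel.
  have r1 : Q (κ + W) (κ + W) + Q (Cx.mulI (κ + W)) (Cx.mulI (κ + W)) =
      Q W W + Q (Cx.mulI W) (Cx.mulI W) := by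
    have h1 := hQ_symm κ W
    have h2 := hQ_symm (Cx.mulI κ) (Cx.mulI W)
    rw [hQ_k _ κ hκ] at h1
    rw [hQ_k _ _ hIκ, adC_mulI_left, adC_mulI_right, mulI_mulI, map_neg] at h2
    simp only [map_add, LinearMap.add_apply, hQ_k _ κ hκ, hQ_k _ _ hIκ]
    linarith
  -- The real parts drop out in the first slot. The mixed terms become L on i[𝔭, 𝔭] ⊂ i𝔨, which is
  -- zero.
  have r2 : Q W W + Q (Cx.mulI W) (Cx.mulI W) =
      Q (Cx.mk 0 P₁) (Cx.mk 0 P₁) + Q (Cx.mk 0 P₂) (Cx.mk 0 P₂) := by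
    have h1 : W = Cx.mk P₁ 0 + Cx.mk 0 P₂ := by ext <;> simp [hW]
    have h2 : Cx.mulI W = Cx.mk (-P₂) 0 + Cx.mk 0 P₁ := by
      rw [Cx.mulI_apply]; ext <;> simp [hW]
    have h3 : ∀ A B, S.θ A = -A → S.θ B = -B → Q (Cx.mk 0 A) (Cx.mk B 0) = 0 := fun A B hA hB => by
      have h4 := hQ_symm (Cx.mk 0 A) (Cx.mk B 0)
      have h5 : S.adC (Cx.mk 0 A) (Cx.mk B 0) = Cx.mk 0 (S.br A B) := by
        rw [adC_apply]; ext <;> simp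
      rw [hQ_g, h5, L_T _ (S.br_pp hA hB), sub_zero] at h4
      exact h4
    rw [h2, h1]
    simp only [map_add, LinearMap.add_apply, hQ_g, h3 _ _ hP₂ hP₁,
      h3 P₁ (-P₂) hP₁ (by rw [map_neg, hP₂])]
    ring
  rw [r1, r2]
  have nn : ∀ P, S.θ P = -P → 0 ≤ Q (Cx.mk 0 P) (Cx.mk 0 P) := fun P hP => by
    by_cases h : P = 0
    · have h1 : Cx.mk (0 : E) 0 = 0 := rfl
      rw [h, h1, map_zero]
    · exact (main P hP h).le
  by_cases h1 : P₁ = 0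
  · have h2 : P₂ ≠ 0 := fun h2 => hz (by
      have : W = 0 := by rw [hW, h1, h2]; rfl
      rw [this, add_zero]; exact hκ)
    exact add_pos_of_nonneg_of_pos (nn _ hP₁) (main _ hP₂ h2)
  · exact add_pos_of_pos_of_nonneg (main _ hP₁ h1) (nn _ hP₂)

end Levi

end CartanData

end AkhiezerGindikin

end

/-! ### Second derivatives on the group and the splitting of the complexified algebra -/

noncomputable section

namespace AkhiezerGindikin

open Module Filter Topology

local notation "⟪" x ", " y "⟫" => inner ℝ x y

set_option linter.unusedSectionVars false

section Calculus

variable {V : Type*} [NormedAddCommGroup V] [NormedSpace ℝ V]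

theorem differentiableAt_fderiv' {φ : V → ℝ} {x : V} (h : ContDiffAt ℝ 2 φ x) :
    DifferentiableAt ℝ (fderiv ℝ φ) x :=
  (h.fderiv_right (m := 1) (by norm_num)).differentiableAt (by norm_num)

theorem eventually_differentiableAt {φ : V → ℝ} {x : V} (h : ContDiffAt ℝ 2 φ x) :
    ∀ᶠ y in 𝓝 x, DifferentiableAt ℝ φ y :=
  (h.eventually (by simp)).mono fun _ hy => hy.differentiableAt (by norm_num)

/-- The second derivative along a line. -/
theorem deriv_deriv_line {φ : V → ℝ} {x : V} (h : ContDiffAt ℝ 2 φ x) (z : V) :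
    deriv (deriv fun t : ℝ => φ (x + t • z)) 0 = fderiv ℝ (fderiv ℝ φ) x z z := by
  have hline : ∀ t : ℝ, HasDerivAt (fun s : ℝ => x + s • z) z t := fun t => by
    simpa using ((hasDerivAt_id t).smul_const z).const_add x
  have hcont : Tendsto (fun t : ℝ => x + t • z) (𝓝 0) (𝓝 x) := by
    have := (hline 0).continuousAt.tendsto
    simpa using this
  have h1 : deriv (fun t : ℝ => φ (x + t • z)) =ᶠ[𝓝 0] fun t => fderiv ℝ φ (x + t • z) z := by
    filter_upwards [hcont.eventually (eventually_differentiableAt h)] with t ht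
    exact (ht.hasFDerivAt.comp_hasDerivAt t (hline t)).deriv
  rw [h1.deriv_eq]
  have h2 : HasFDerivAt (fderiv ℝ φ) (fderiv ℝ (fderiv ℝ φ) x) (x + (0 : ℝ) • z) := by
    rw [zero_smul, add_zero]; exact (differentiableAt_fderiv' h).hasFDerivAt
  have h3 : HasDerivAt (fun t : ℝ => fderiv ℝ φ (x + t • z)) (fderiv ℝ (fderiv ℝ φ) x z) 0 :=
    h2.comp_hasDerivAt (0 : ℝ) (hline 0)
  have h4 : HasDerivAt (fun t : ℝ => fderiv ℝ φ (x + t • z) z)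
      (fderiv ℝ (fderiv ℝ φ) x z z) 0 :=
    (ContinuousLinearMap.apply ℝ ℝ z).hasFDerivAt.comp_hasDerivAt (0 : ℝ) h3
  exact h4.deriv

variable {𝔸 : Type*} [NormedRing 𝔸] [NormedAlgebra ℝ 𝔸] [CompleteSpace 𝔸]

/-- The mixed second derivative of `F(exp(sa) exp(tb))` at the origin. -/
def qForm (F : 𝔸 → ℝ) (a b : 𝔸) : ℝ := fderiv ℝ (fderiv ℝ F) 1 a b + fderiv ℝ F 1 (a * b)

variable {F : 𝔸 → ℝ} (hF : ContDiffAt ℝ 2 F 1)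

theorem tendsto_exp_smul (a : 𝔸) :
    Tendsto (fun s : ℝ => NormedSpace.exp (s • a)) (𝓝 0) (𝓝 1) := by
  have := (hasDerivAt_exp_smul a 0).continuousAt.tendsto
  simpa using this

include hF

theorem hasDerivAt_fderiv_exp_smul (a b : 𝔸) :
    HasDerivAt (fun s : ℝ => fderiv ℝ F (NormedSpace.exp (s • a)) (NormedSpace.exp (s • a) * b))
      (qForm F a b) 0 := by
  have h1 : HasDerivAt (fun s : ℝ => NormedSpace.exp (s • a)) a 0 := by
    simpa using hasDerivAt_exp_smul a 0
  have h2 : HasFDerivAt (fderiv ℝ F) (fderiv ℝ (fderiv ℝ F) 1) (NormedSpace.exp ((0 : ℝ) • a)) := by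
    rw [zero_smul, NormedSpace.exp_zero]; exact (differentiableAt_fderiv' hF).hasFDerivAt
  have h3 : HasDerivAt (fun s : ℝ => fderiv ℝ F (NormedSpace.exp (s • a)))
      (fderiv ℝ (fderiv ℝ F) 1 a) 0 := h2.comp_hasDerivAt (0 : ℝ) h1
  have h4 := h3.clm_apply (h1.mul_const b)
  simp only [zero_smul, NormedSpace.exp_zero, one_mul] at h4
  exact h4

theorem eventually_hasDerivAt_exp_mul_exp (a b : 𝔸) :
    ∀ᶠ s : ℝ in 𝓝 0, HasDerivAt
      (fun t : ℝ => F (NormedSpace.exp (s • a) * NormedSpace.exp (t • b)))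
      (fderiv ℝ F (NormedSpace.exp (s • a)) (NormedSpace.exp (s • a) * b)) 0 := by
  filter_upwards [(tendsto_exp_smul a).eventually (eventually_differentiableAt hF)] with s hs
  have h1 : HasDerivAt (fun t : ℝ => NormedSpace.exp (t • b)) b 0 := by
    simpa using hasDerivAt_exp_smul b 0
  have h2 : HasFDerivAt F (fderiv ℝ F (NormedSpace.exp (s • a)))
      (NormedSpace.exp (s • a) * NormedSpace.exp ((0 : ℝ) • b)) := by
    rw [zero_smul, NormedSpace.exp_zero, mul_one]; exact hs.hasFDerivAt
  exact h2.comp_hasDerivAt (0 : ℝ) (h1.const_mul _)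

theorem deriv_exp_smul (a : 𝔸) :
    deriv (fun t : ℝ => F (NormedSpace.exp (t • a))) =ᶠ[𝓝 0]
      fun s => fderiv ℝ F (NormedSpace.exp (s • a)) (NormedSpace.exp (s • a) * a) := by
  filter_upwards [(tendsto_exp_smul a).eventually (eventually_differentiableAt hF)] with s hs
  exact (hs.hasFDerivAt.comp_hasDerivAt s (hasDerivAt_exp_smul a s)).deriv

theorem deriv_exp_smul_zero (a : 𝔸) :
    deriv (fun t : ℝ => F (NormedSpace.exp (t • a))) 0 = fderiv ℝ F 1 a := by
  rw [(deriv_exp_smul hF a).self_of_nhds]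
  simp

theorem deriv_deriv_exp_smul (a : 𝔸) :
    deriv (deriv fun t : ℝ => F (NormedSpace.exp (t • a))) 0 = qForm F a a := by
  rw [(deriv_exp_smul hF a).deriv_eq, (hasDerivAt_fderiv_exp_smul hF a a).deriv]

/-- Independence of s makes the t-derivative at 0 constant in s. The companion for the right factor
has that t-derivative equal to zero. -/
theorem qForm_eq_zero_of_left {a b : 𝔸} (h : ∀ᶠ p : ℝ × ℝ in 𝓝 (0, 0),
    F (NormedSpace.exp (p.1 • a) * NormedSpace.exp (p.2 • b)) = F (NormedSpace.exp (p.2 • b))) :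
    qForm F a b = 0 := by
  rw [← (hasDerivAt_fderiv_exp_smul hF a b).deriv]
  have h1 : (fun s : ℝ => fderiv ℝ F (NormedSpace.exp (s • a)) (NormedSpace.exp (s • a) * b))
      =ᶠ[𝓝 0] fun _ => fderiv ℝ F 1 b := by
    filter_upwards [h.curry_nhds, eventually_hasDerivAt_exp_mul_exp hF a b] with s h2 h3
    rw [← h3.deriv, ← deriv_exp_smul_zero hF]
    exact EventuallyEq.deriv_eq h2
  rw [h1.deriv_eq, deriv_const]

theorem qForm_eq_zero_of_right {a b : 𝔸} (h : ∀ᶠ p : ℝ × ℝ in 𝓝 (0, 0),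
    F (NormedSpace.exp (p.1 • a) * NormedSpace.exp (p.2 • b)) = F (NormedSpace.exp (p.1 • a))) :
    qForm F a b = 0 := by
  rw [← (hasDerivAt_fderiv_exp_smul hF a b).deriv]
  have h1 : (fun s : ℝ => fderiv ℝ F (NormedSpace.exp (s • a)) (NormedSpace.exp (s • a) * b))
      =ᶠ[𝓝 0] fun _ => 0 := by
    filter_upwards [h.curry_nhds, eventually_hasDerivAt_exp_mul_exp hF a b] with s h2 h3
    rw [← h3.deriv, EventuallyEq.deriv_eq h2, deriv_const]
  rw [h1.deriv_eq, deriv_const]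

/-- The second derivative of F is symmetric, so only the first-order contributions of ab and ba
survive. -/
theorem qForm_sub (a b : 𝔸) : qForm F a b - qForm F b a = fderiv ℝ F 1 (a * b - b * a) := by
  have h := hF.isSymmSndFDerivAt (by simp) a b
  rw [qForm, qForm, map_sub, h]
  ring

omit hF in
/-- Second derivatives of a function that is given by `F` in exponential coordinates. -/
theorem fderiv_fderiv_of_eventuallyEq_exp (hF : ContDiffAt ℝ 2 F 1) {ψ : V → ℝ} {M : V →L[ℝ] 𝔸}
    (h : ψ =ᶠ[𝓝 0] fun z => F (NormedSpace.exp (M z))) :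
    ContDiffAt ℝ 2 ψ 0 ∧ ∀ z, fderiv ℝ (fderiv ℝ ψ) 0 z z = qForm F (M z) (M z) := by
  have h1 : ContDiffAt ℝ 2 ψ 0 := by
    refine ContDiffAt.congr_of_eventuallyEq ?_ h
    refine ContDiffAt.comp (g := F) (f := fun z => NormedSpace.exp (M z)) (0 : V) ?_
      (contDiff_exp.comp M.contDiff).contDiffAt
    rwa [map_zero, NormedSpace.exp_zero]
  refine ⟨h1, fun z => ?_⟩
  rw [← deriv_deriv_line h1, ← deriv_deriv_exp_smul hF]
  refine EventuallyEq.deriv_eq (EventuallyEq.deriv ?_)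
  have hc : Tendsto (fun t : ℝ => (0 : V) + t • z) (𝓝 0) (𝓝 0) := by
    have : Continuous fun t : ℝ => (0 : V) + t • z := by fun_prop
    simpa using this.tendsto 0
  filter_upwards [hc.eventually h] with t ht
  rw [ht, zero_add, map_smul]

end Calculus

section Inverse

variable {𝔸 : Type*} [NormedRing 𝔸] [NormedAlgebra ℝ 𝔸] [CompleteSpace 𝔸]

theorem exists_inverse_of_mem_closure {s : Set 𝔸} (hs : ∀ a ∈ s, -a ∈ s) {x : 𝔸}
    (hx : x ∈ Submonoid.closure (NormedSpace.exp '' s)) :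
    ∃ y ∈ Submonoid.closure (NormedSpace.exp '' s), x * y = 1 ∧ y * x = 1 := by
  induction hx using Submonoid.closure_induction with
  | mem x hx =>
    obtain ⟨a, ha, rfl⟩ := hx
    exact ⟨_, Submonoid.subset_closure ⟨_, hs a ha, rfl⟩, exp_mul_exp_neg a, exp_neg_mul_exp a⟩
  | one => exact ⟨1, Submonoid.one_mem _, mul_one 1, mul_one 1⟩
  | mul x y _ _ ihx ihy =>
    obtain ⟨x', hx', e1, e2⟩ := ihx
    obtain ⟨y', hy', f1, f2⟩ := ihy
    refine ⟨y' * x', Submonoid.mul_mem _ hy' hx', ?_, ?_⟩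
    · rw [mul_assoc, ← mul_assoc y, f1, one_mul, e1]
    · rw [mul_assoc, ← mul_assoc x', e2, one_mul, f2]

end Inverse

variable {E : Type*} [NormedAddCommGroup E] [InnerProductSpace ℝ E] [FiniteDimensional ℝ E]
  [CompleteSpace E] {𝔸 : Type*}
  [NormedRing 𝔸] [NormedAlgebra ℂ 𝔸] [CompleteSpace 𝔸]
  [FiniteDimensional ℝ 𝔸]

namespace CartanData

variable {S : CartanData E} {𝔞 : Submodule ℝ E}

/-- The complexification is `𝔤 + i Z_𝔭(H) + Ad(exp(iH)) 𝔨^ℂ`. -/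
theorem exists_right_inverse (b : S.RootBasis 𝔞) (h𝔞 : S.IsMaxAbelian 𝔞) {H : E} (hH : H ∈ 𝔞)
    (hHr : ‖S.br H‖ < Real.pi / 2) :
    ∃ (s₁ s₂ : Cx E →ₗ[ℝ] E) (s₃ : Cx E →ₗ[ℝ] Cx E),
      (∀ z, S.θ (s₂ z) = -s₂ z ∧ S.br H (s₂ z) = 0) ∧ (∀ z, s₃ z ∈ S.kTilde H) ∧
      ∀ z, Cx.mk (s₁ z) 0 + Cx.mk 0 (s₂ z) + s₃ z = z := by
  let Z : Submodule ℝ E := LinearMap.ker ((S.θ + 1 : E →L[ℝ] E) : E →ₗ[ℝ] E) ⊓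
    LinearMap.ker ((S.br H : E →L[ℝ] E) : E →ₗ[ℝ] E)
  have hZ : ∀ y, y ∈ Z ↔ S.θ y = -y ∧ S.br H y = 0 := fun y => by
    simp [Z, add_eq_zero_iff_eq_neg]
  let Φ : (E × Z × S.kTilde H) →ₗ[ℝ] Cx E :=
    LinearMap.coprod (Cx.inl : E →L[ℝ] Cx E).toLinearMap
      (LinearMap.coprod ((Cx.inr : E →L[ℝ] Cx E).toLinearMap.comp Z.subtype) (S.kTilde H).subtype)
  have hΦ : ∀ p, Φ p = Cx.mk p.1 0 + Cx.mk 0 (p.2.1 : E) + p.2.2 := fun p => by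
    simp [Φ, Cx.inl_apply, Cx.inr_apply, add_assoc]
  have m1 : ∀ x, Cx.mk x 0 ∈ LinearMap.range Φ := fun x => ⟨(x, 0, 0), by
    rw [hΦ]; ext <;> simp⟩
  have m2 : ∀ y, S.θ y = -y → S.br H y = 0 → Cx.mk 0 y ∈ LinearMap.range Φ := fun y h1 h2 =>
    ⟨(0, ⟨y, (hZ y).2 ⟨h1, h2⟩⟩, 0), by rw [hΦ]; ext <;> simp⟩
  have m3 : ∀ κ ∈ S.kTilde H, κ ∈ LinearMap.range Φ := fun κ h => ⟨(0, 0, ⟨κ, h⟩), by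
    rw [hΦ]; ext <;> simp⟩
  -- For α(H) = 0 the vector iX is in i Z_𝔭(H). Otherwise sin α(H) ≠ 0 and iX is a combination of
  -- the `kTilde` vector and of T ∈ 𝔤.
  have m4 : ∀ P, S.θ P = -P → Cx.mk 0 P ∈ LinearMap.range Φ := by
    intro P hP
    have h2 : Cx.mk 0 P = ∑ i, ⟪b.X i, P⟫ • Cx.mk 0 (b.X i) := by
      simp only [← Cx.inr_apply, ← map_smul, ← map_sum, b.sum_X hP]
    rw [h2]
    refine Submodule.sum_mem _ fun i _ => Submodule.smul_mem _ _ ?_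
    by_cases hi : ⟪b.A i, H⟫ = 0
    · exact m2 _ (b.θ_X i) (by rw [b.br_X h𝔞 hH, hi, zero_smul])
    · have hs := sin_ne_zero_of_abs_lt ((b.norm_br_lt_iff hH (by positivity)).1 hHr i) hi
      have h3 : Cx.mk 0 (b.X i) = (Real.sin ⟪b.A i, H⟫)⁻¹ •
          (Cx.mk (Real.cos ⟪b.A i, H⟫ • b.T i) (Real.sin ⟪b.A i, H⟫ • b.X i) -
            Cx.mk (Real.cos ⟪b.A i, H⟫ • b.T i) 0) := by
        ext <;> simp [smul_smul, hs]
      rw [h3]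
      exact Submodule.smul_mem _ _ (Submodule.sub_mem _ (m3 _ (b.mk_mem_kTilde h𝔞 hH i)) (m1 _))
  have hsurj : LinearMap.range Φ = ⊤ := by
    refine eq_top_iff.2 fun z _ => ?_
    obtain ⟨κ, hκ, P₁, P₂, -, hP₂, rfl⟩ := exists_kTilde_add_p b h𝔞 hH hHr z
    have : Cx.mk P₁ P₂ = Cx.mk P₁ 0 + Cx.mk 0 P₂ := by ext <;> simp
    rw [this]
    exact Submodule.add_mem _ (m3 _ hκ) (Submodule.add_mem _ (m1 _) (m4 _ hP₂))
  obtain ⟨s, hs⟩ := LinearMap.exists_rightInverse_of_surjective Φ hsurj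
  refine ⟨(LinearMap.fst ℝ _ _).comp s,
    (Z.subtype.comp (LinearMap.fst ℝ _ _)).comp ((LinearMap.snd ℝ _ _).comp s),
    ((S.kTilde H).subtype.comp (LinearMap.snd ℝ _ _)).comp ((LinearMap.snd ℝ _ _).comp s),
    fun z => (hZ _).1 (s z).2.1.2, fun z => (s z).2.2.2, fun z => ?_⟩
  have := DFunLike.congr_fun hs z
  rw [LinearMap.comp_apply, hΦ] at this
  exact this

namespace Realization

variable (ι : S.Realization 𝔸)

/-- The Lie algebra `𝔤^ℂ` of matrices. -/
def rangeC : Submodule ℝ (𝔸) := LinearMap.range (ι.toMatC : Cx E →ₗ[ℝ] 𝔸)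

theorem toMatC_mem (z : Cx E) : ι.toMatC z ∈ ι.rangeC := ⟨z, rfl⟩

theorem rangeC_bracket : ∀ x ∈ ι.rangeC, ∀ y ∈ ι.rangeC, x * y - y * x ∈ ι.rangeC := by
  rintro _ ⟨z, rfl⟩ _ ⟨w, rfl⟩
  exact ⟨S.adC z w, ι.toMatC_adC z w⟩

theorem exists_splitting (h𝔞 : S.IsMaxAbelian 𝔞) {H : E} (hH : H ∈ 𝔞)
    (hHr : ‖S.br H‖ < Real.pi / 2) :
    ∃ (r : Splitting ι.rangeC) (σ : 𝔸 →L[ℝ] E), (∀ m, ∃ x, r.ρ₁ m = ι.toMatC (Cx.mk x 0)) ∧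
      (∀ m, r.ρ₂ m = ι.toMatC (Cx.mk 0 (σ m)) ∧ S.θ (σ m) = -σ m ∧ S.br H (σ m) = 0) ∧
      ∀ m, ∃ κ ∈ S.kTilde H, r.ρ₃ m = ι.toMatC κ := by
  obtain ⟨b⟩ := S.nonempty_rootBasis h𝔞
  obtain ⟨s₁, s₂, s₃, h₂, h₃, hs⟩ := exists_right_inverse b h𝔞 hH hHr
  obtain ⟨π, hπ⟩ := LinearMap.exists_leftInverse_of_injective (ι.toMatC : Cx E →ₗ[ℝ] 𝔸)
    (LinearMap.ker_eq_bot.2 ι.toMatC_injective)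
  have hπ' : ∀ z, π (ι.toMatC z) = z := fun z => DFunLike.congr_fun hπ z
  let J : Cx E →ₗ[ℝ] 𝔸 := ι.toMatC
  let r : Splitting ι.rangeC :=
    { P := LinearMap.toContinuousLinearMap (J.comp π)
      P_mem := fun x => ⟨π x, rfl⟩
      P_of_mem := by
        rintro _ ⟨z, rfl⟩
        exact congrArg ι.toMatC (hπ' z)
      ρ₁ := LinearMap.toContinuousLinearMap
        (J.comp ((Cx.inl : E →L[ℝ] Cx E).toLinearMap.comp (s₁.comp π)))
      ρ₂ := LinearMap.toContinuousLinearMap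
        (J.comp ((Cx.inr : E →L[ℝ] Cx E).toLinearMap.comp (s₂.comp π)))
      ρ₃ := LinearMap.toContinuousLinearMap (J.comp (s₃.comp π))
      ρ₁_mem := fun x => ⟨_, rfl⟩
      ρ₂_mem := fun x => ⟨_, rfl⟩
      ρ₃_mem := fun x => ⟨_, rfl⟩
      sum_eq := fun x => by
        have := congrArg ι.toMatC (hs (π x))
        rw [map_add, map_add] at this
        exact this }
  exact ⟨r, LinearMap.toContinuousLinearMap (s₂.comp π), fun m => ⟨s₁ (π m), rfl⟩,
    fun m => ⟨rfl, h₂ (π m)⟩, fun m => ⟨s₃ (π m), h₃ (π m), rfl⟩⟩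

end Realization

end CartanData

end AkhiezerGindikin

end

/-! ### The invariant function in local coordinates -/

noncomputable section

namespace AkhiezerGindikin

open Module Filter Topology

local notation "⟪" x ", " y "⟫" => inner ℝ x y

set_option linter.unusedSectionVars false

variable {E : Type*} [NormedAddCommGroup E] [InnerProductSpace ℝ E] [FiniteDimensional ℝ E]
  [CompleteSpace E] {𝔸 : Type*}
  [NormedRing 𝔸] [NormedAlgebra ℂ 𝔸] [CompleteSpace 𝔸]
  [FiniteDimensional ℝ 𝔸]

namespace CartanData

variable {S : CartanData E} {𝔞 : Submodule ℝ E}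

namespace Realization

variable (ι : S.Realization 𝔸)

theorem toMatC_mk_zero (x : E) : ι.toMatC (Cx.mk x 0) = ι.toMat x := by
  rw [toMatC_apply, Cx.re_mk, Cx.im_mk, map_zero, smul_zero, add_zero]

theorem exp_toMat_mem_gpG (x : E) : NormedSpace.exp (ι.toMatC (Cx.mk x 0)) ∈ ι.gpG := by
  rw [toMatC_mk_zero]
  exact Submonoid.subset_closure ⟨x, rfl⟩

theorem exp_toMatC_mem_gpKC {κ : Cx E} (hκ : S.θC κ = κ) :
    NormedSpace.exp (ι.toMatC κ) ∈ ι.gpKC :=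
  Submonoid.subset_closure ⟨κ, hκ, rfl⟩

theorem exists_inverse_of_gpKC {k : 𝔸} (hk : k ∈ ι.gpKC) :
    ∃ k' ∈ ι.gpKC, k * k' = 1 ∧ k' * k = 1 := by
  have e : ι.gpKC = Submonoid.closure (NormedSpace.exp '' (ι.toMatC '' {z | S.θC z = z})) := by
    rw [gpKC, Set.image_image]
  rw [e] at hk ⊢
  refine exists_inverse_of_mem_closure ?_ hk
  rintro _ ⟨z, hz, rfl⟩
  exact ⟨-z, by rw [Set.mem_setOf_eq, map_neg, hz], map_neg _ _⟩

/-- Elements of `AdK` come from matrices in `K`. -/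
theorem exists_isAd_of_adK {z : E →L[ℝ] E} (hz : z ∈ S.adK 0) :
    ∃ k ∈ ι.gpG, ∃ k' ∈ ι.gpKC, k * k' = 1 ∧ ι.IsAd k (Cx.diag z) := by
  induction hz using Submonoid.closure_induction with
  | mem z hz =>
    obtain ⟨T, hT, rfl⟩ := hz
    have h1 := ι.isAd_exp (Cx.mk T 0)
    have h2 : S.adC (Cx.mk T 0) = Cx.diag (S.br T) := ContinuousLinearMap.ext fun w => by
      rw [adC_apply, Cx.diag_apply]; simp
    rw [h2, exp_diag] at h1
    refine ⟨_, ι.exp_toMat_mem_gpG T, _, ι.exp_toMatC_mem_gpKC (κ := -Cx.mk T 0) ?_, ?_, h1⟩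
    · rw [map_neg, θC_apply, Cx.re_mk, Cx.im_mk, map_zero, hT.1]
    · rw [map_neg]; exact exp_mul_exp_neg _
  | one => exact ⟨1, Submonoid.one_mem _, 1, Submonoid.one_mem _, mul_one 1, by
      rw [Cx.diag_one]; exact IsAd.one⟩
  | mul z w _ _ ihz ihw =>
    obtain ⟨k, hk, k', hk', e, h⟩ := ihz
    obtain ⟨l, hl, l', hl', f, g⟩ := ihw
    refine ⟨k * l, Submonoid.mul_mem _ hk hl, l' * k', Submonoid.mul_mem _ hl' hk', ?_, ?_⟩
    · rw [mul_assoc, ← mul_assoc l, f, one_mul, e]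
    · rw [Cx.diag_mul]; exact h.mul g

/-- κ is Ad(exp iH) of an element of 𝔨^ℂ, so its exponential passes to the right of exp(iH) as an
element of K^ℂ. -/
theorem exp_kTilde_mul {H : E} {κ : Cx E} (hκ : κ ∈ S.kTilde H) :
    ∃ k ∈ ι.gpKC, NormedSpace.exp (ι.toMatC κ) * NormedSpace.exp (ι.toMatC (Cx.mk 0 H)) =
      NormedSpace.exp (ι.toMatC (Cx.mk 0 H)) * k := by
  obtain ⟨κ', hκ', rfl⟩ := mem_kTilde.1 hκ
  exact ⟨_, ι.exp_toMatC_mem_gpKC hκ', (semiconjBy_exp (ι.isAd_exp (Cx.mk 0 H) κ')).symm⟩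

theorem exp_toMatC_mul_of_br {H Q : E} (hQ : S.br H Q = 0) :
    NormedSpace.exp (ι.toMatC (Cx.mk 0 Q)) * NormedSpace.exp (ι.toMatC (Cx.mk 0 H)) =
      NormedSpace.exp (ι.toMatC (Cx.mk 0 (H + Q))) := by
  have h1 : ι.toMatC (S.adC (Cx.mk 0 Q) (Cx.mk 0 H)) = 0 := by
    rw [adC_apply]
    simp only [Cx.re_mk, Cx.im_mk, map_zero, zero_apply, S.br_swap Q H, hQ]
    simp [toMatC_apply]
  rw [ι.toMatC_adC, sub_eq_zero] at h1
  have h2 : Cx.mk 0 (H + Q) = Cx.mk 0 Q + Cx.mk 0 H := by ext <;> simp [add_comm]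
  rw [h2, map_add]
  exact (exp_add_comm' h1).symm

variable {r : ℝ} {v U : E → ℝ}

/-- The points `exp(i(H + Q))` with `H + Q` in `𝔭`. -/
theorem exists_eq_of_p (h𝔞 : S.IsMaxAbelian 𝔞) (hU : S.IsInvariantExt 𝔞 r v U) {P : E}
    (hP : S.θ P = -P) (hPr : ‖S.br P‖ < r) :
    ∃ g ∈ ι.gpG, ∃ k ∈ ι.gpKC, ∃ H ∈ 𝔞, ‖S.br H‖ < r ∧
      NormedSpace.exp (ι.toMatC (Cx.mk 0 P)) = g * NormedSpace.exp (ι.toMatC (Cx.mk 0 H)) * k ∧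
      U P = v H := by
  obtain ⟨z, hz, hza⟩ := h𝔞.exists_adK_mem 𝔞.zero_mem hP (by simp)
  obtain ⟨w, hw, e1, e2⟩ := exists_inverse_of_mem hz
  obtain ⟨k, hk, k', hk', f, hA⟩ := ι.exists_isAd_of_adK hw
  have hwz : w (z P) = P := DFunLike.congr_fun e2 P
  have hn : ‖S.br (z P)‖ < r := by rw [(isKAut_of_mem hz).norm_br]; exact hPr
  refine ⟨k, hk, k', hk', z P, hza, hn, ?_, ?_⟩
  · have h1 := semiconjBy_exp (hA (Cx.mk 0 (z P)))
    rw [Cx.diag_apply, Cx.re_mk, Cx.im_mk, map_zero, hwz] at h1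
    rw [h1.eq, mul_assoc, f, mul_one]
  · rw [← hU.eq w hw _ hza hn, hwz]

section Local

variable {φ : 𝔸 → ℝ}
  (hφ : ∀ g ∈ ι.gpG, ∀ k ∈ ι.gpKC, ∀ H ∈ 𝔞, ‖S.br H‖ < Real.pi / 2 →
    φ (g * NormedSpace.exp (ι.toMatC (Cx.mk 0 H)) * k) = v H)
  (h𝔞 : S.IsMaxAbelian 𝔞) (hv : S.IsConvexInvariant 𝔞 (Real.pi / 2) v)
  (hU : S.IsInvariantExt 𝔞 (Real.pi / 2) v U) {H : E} (hH : H ∈ 𝔞) (hHr : ‖S.br H‖ < Real.pi / 2)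

include hφ h𝔞 hU hH hHr

/-- The coordinates split exp(p.1) exp(p.2) into a factor in G, a factor exp(iσ) with σ ∈ Z_𝔭(H),
and the exponential of an element of `kTilde`. The last passes through exp(iH) into K^ℂ, the middle
one merges with it into exp(i(H + σ)), and H + σ is K-conjugate into 𝔞. Two exponential factors are
allowed because the mixed form `qForm` needs both. -/
theorem eventually_local (s : Splitting ι.rangeC) {σ : 𝔸 →L[ℝ] E}
    (h₁ : ∀ m, ∃ x, s.ρ₁ m = ι.toMatC (Cx.mk x 0))
    (h₂ : ∀ m, s.ρ₂ m = ι.toMatC (Cx.mk 0 (σ m)) ∧ S.θ (σ m) = -σ m ∧ S.br H (σ m) = 0)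
    (h₃ : ∀ m, ∃ κ ∈ S.kTilde H, s.ρ₃ m = ι.toMatC κ) :
    ∀ᶠ p in 𝓝 (0 : 𝔸 × 𝔸), p.1 ∈ ι.rangeC → p.2 ∈ ι.rangeC →
      (∀ g ∈ ι.gpG, ∀ k ∈ ι.gpKC, φ (g * (NormedSpace.exp p.1 * NormedSpace.exp p.2 *
        NormedSpace.exp (ι.toMatC (Cx.mk 0 H))) * k) =
        U (H + σ (s.coord (NormedSpace.exp p.1 * NormedSpace.exp p.2)))) := by
  have hc : Tendsto (fun p : 𝔸 × 𝔸 => H + σ (s.coord (NormedSpace.exp p.1 *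
      NormedSpace.exp p.2))) (𝓝 0) (𝓝 H) := by
    have c1 : Continuous fun p : 𝔸 × 𝔸 => NormedSpace.exp p.1 * NormedSpace.exp p.2 :=
      ((contDiff_exp (m := 0)).continuous.comp continuous_fst).mul
        ((contDiff_exp (m := 0)).continuous.comp continuous_snd)
    have c2 : Tendsto (fun p : 𝔸 × 𝔸 => NormedSpace.exp p.1 * NormedSpace.exp p.2) (𝓝 0)
        (𝓝 1) := by
      have := c1.tendsto 0
      simpa [NormedSpace.exp_zero] using this
    have c3 : Tendsto s.coord (𝓝 1) (𝓝 0) := by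
      have := (s.contDiffAt_coord (m := 0)).continuousAt.tendsto
      rwa [s.coord_one] at this
    have c4 := ((σ.continuous.tendsto 0).comp (c3.comp c2)).const_add H
    rw [map_zero, add_zero] at c4
    exact c4
  filter_upwards [s.eventually_exp_mul_exp ι.rangeC_bracket,
    hc ((isOpen_norm_br (S := S) (Real.pi / 2)).mem_nhds hHr)] with p hp1 hp2 m1 m2 g hg k hk
  have e := hp1 m1 m2
  set c := s.coord (NormedSpace.exp p.1 * NormedSpace.exp p.2) with hcdef
  obtain ⟨x, hx⟩ := h₁ c
  obtain ⟨hσ, hσp, hσH⟩ := h₂ c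
  obtain ⟨κ, hκ, hκ'⟩ := h₃ c
  obtain ⟨k₁, hk₁, e₁⟩ := ι.exp_kTilde_mul hκ
  obtain ⟨g₂, hg₂, k₂, hk₂, H', hH', hn, e₂, e₃⟩ := ι.exists_eq_of_p h𝔞 hU
    (P := H + σ c) (by rw [map_add, h𝔞.θ_eq _ hH, hσp, neg_add]) hp2
  have e₄ := ι.exp_toMatC_mul_of_br hσH
  have key : g * (NormedSpace.exp p.1 * NormedSpace.exp p.2 *
      NormedSpace.exp (ι.toMatC (Cx.mk 0 H))) * k =
      (g * NormedSpace.exp (ι.toMatC (Cx.mk x 0)) * g₂) *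
        NormedSpace.exp (ι.toMatC (Cx.mk 0 H')) * (k₂ * (k₁ * k)) := by
    rw [e, hx, hσ, hκ']
    calc _ = g * NormedSpace.exp (ι.toMatC (Cx.mk x 0)) *
          (NormedSpace.exp (ι.toMatC (Cx.mk 0 (σ c))) * (NormedSpace.exp (ι.toMatC κ) *
            NormedSpace.exp (ι.toMatC (Cx.mk 0 H)))) * k := by simp only [mul_assoc]
      _ = g * NormedSpace.exp (ι.toMatC (Cx.mk x 0)) *
          ((NormedSpace.exp (ι.toMatC (Cx.mk 0 (σ c))) *
            NormedSpace.exp (ι.toMatC (Cx.mk 0 H))) * k₁) * k := by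
        rw [e₁]; simp only [mul_assoc]
      _ = _ := by rw [e₄, e₂]; simp only [mul_assoc]
  rw [key, e₃]
  exact hφ _ (Submonoid.mul_mem _ (Submonoid.mul_mem _ hg (ι.exp_toMat_mem_gpG x)) hg₂) _
    (Submonoid.mul_mem _ hk₂ (Submonoid.mul_mem _ hk₁ hk)) _ hH' hn

include hv

/-- Near `exp(iH)` the function is given by a function `F` with positive Levi form. -/
theorem exists_local :
    ∃ F : 𝔸 → ℝ, ContDiffAt ℝ 2 F 1 ∧
      (∀ᶠ w in 𝓝 (0 : Cx E), ∀ g ∈ ι.gpG, ∀ k ∈ ι.gpKC,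
        φ (g * (NormedSpace.exp (ι.toMatC w) * NormedSpace.exp (ι.toMatC (Cx.mk 0 H))) * k) =
          F (NormedSpace.exp (ι.toMatC w))) ∧
      ∀ z, z ∉ S.kTilde H → 0 < qForm F (ι.toMatC z) (ι.toMatC z) +
        qForm F (ι.toMatC (Cx.mulI z)) (ι.toMatC (Cx.mulI z)) := by
  obtain ⟨s, σ, h₁, h₂, h₃⟩ := ι.exists_splitting h𝔞 hH hHr
  have hloc := ι.eventually_local hφ h𝔞 hU hH hHr s h₁ h₂ h₃
  set F : 𝔸 → ℝ := fun A => U (H + σ (s.coord A)) with hFdef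
  have hHp := h𝔞.θ_eq _ hH
  have hUH : ContDiffAt ℝ 2 U H := (hU.contDiffOn h𝔞 hv).contDiffAt
    ((isOpen_tube _).mem_nhds ((mem_tube_of_p hHp).2 hHr))
  have hF : ContDiffAt ℝ 2 F 1 := by
    have h1 : ContDiffAt ℝ 2 (fun A : 𝔸 => H + σ (s.coord A)) 1 :=
      contDiffAt_const.add (σ.contDiff.contDiffAt.comp (1 : 𝔸) s.contDiffAt_coord)
    refine ContDiffAt.comp (g := U) (1 : 𝔸) ?_ h1
    rwa [s.coord_one, map_zero, add_zero]
  set j := ι.toMatC with hj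
  set x₀ := NormedSpace.exp (j (Cx.mk 0 H)) with hx₀
  -- the two parameter family
  have hcont : ∀ a b : 𝔸, Tendsto (fun p : ℝ × ℝ => (p.1 • a, p.2 • b)) (𝓝 (0, 0))
      (𝓝 (0 : 𝔸 × 𝔸)) := fun a b => by
    have h : Continuous fun p : ℝ × ℝ => (p.1 • a, p.2 • b) := by fun_prop
    have := h.tendsto (0, 0)
    simp only [zero_smul] at this
    exact this
  have smul_mem : ∀ (t : ℝ) (z : Cx E), t • j z ∈ ι.rangeC := fun t z =>
    ι.rangeC.smul_mem t (ι.toMatC_mem z)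
  have two : ∀ z w : Cx E, ∀ᶠ p : ℝ × ℝ in 𝓝 (0, 0),
      ∀ g ∈ ι.gpG, ∀ k ∈ ι.gpKC, φ (g * (NormedSpace.exp (p.1 • j z) * NormedSpace.exp (p.2 • j w) *
        x₀) * k) = F (NormedSpace.exp (p.1 • j z) * NormedSpace.exp (p.2 • j w)) := fun z w => by
    filter_upwards [(hcont (j z) (j w)).eventually hloc] with p hp
    exact hp (smul_mem _ _) (smul_mem _ _)
  have one : ∀ z : Cx E, ∀ᶠ t : ℝ in 𝓝 0, ∀ g ∈ ι.gpG, ∀ k ∈ ι.gpKC,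
      φ (g * (NormedSpace.exp (t • j z) * x₀) * k) = F (NormedSpace.exp (t • j z)) := fun z => by
    have h : Tendsto (fun t : ℝ => (t, (0 : ℝ))) (𝓝 0) (𝓝 (0, 0)) :=
      (by fun_prop : Continuous fun t : ℝ => (t, (0 : ℝ))).tendsto 0
    filter_upwards [h.eventually (two z z)] with t ht g hg k hk
    have := ht g hg k hk
    simpa [NormedSpace.exp_zero] using this
  have fst_t : Tendsto (fun p : ℝ × ℝ => p.1) (𝓝 (0, 0)) (𝓝 0) := continuous_fst.tendsto (0, 0)
  have snd_t : Tendsto (fun p : ℝ × ℝ => p.2) (𝓝 (0, 0)) (𝓝 0) := continuous_snd.tendsto (0, 0)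
  have expG : ∀ (t : ℝ) (x : E), NormedSpace.exp (t • j (Cx.mk x 0)) ∈ ι.gpG := fun t x => by
    have := ι.exp_toMat_mem_gpG (t • x)
    have e : Cx.mk (t • x) 0 = t • Cx.mk x 0 := by ext <;> simp
    rwa [e, map_smul] at this
  have one_G := Submonoid.one_mem ι.gpG
  have one_K := Submonoid.one_mem ι.gpKC
  have expK : ∀ (t : ℝ), ∀ κ ∈ S.kTilde H, ∃ k ∈ ι.gpKC, NormedSpace.exp (t • j κ) * x₀ = x₀ * k :=
    fun t κ hκ => by
      rw [← map_smul]; exact ι.exp_kTilde_mul (Submodule.smul_mem _ t hκ)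
  have F_one : ∀ᶠ t : ℝ in 𝓝 0, F 1 = φ x₀ := by
    filter_upwards [(one 0)] with t ht
    have := ht 1 one_G 1 one_K
    simpa [NormedSpace.exp_zero] using this.symm
  have hQ_g : ∀ x w, qForm F (j (Cx.mk x 0)) (j w) = 0 := fun x w => by
    refine qForm_eq_zero_of_left hF ?_
    filter_upwards [two (Cx.mk x 0) w, snd_t.eventually (one w)] with p h1 h2
    rw [← h1 1 one_G 1 one_K, ← h2 _ (expG p.1 x) 1 one_K]
    simp only [one_mul, mul_one, mul_assoc]
  have hQ_k : ∀ w, ∀ κ ∈ S.kTilde H, qForm F (j w) (j κ) = 0 := fun w κ hκ => by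
    refine qForm_eq_zero_of_right hF ?_
    filter_upwards [two w κ, fst_t.eventually (one w)] with p h1 h2
    obtain ⟨k, hk, e⟩ := expK p.2 κ hκ
    rw [← h1 1 one_G 1 one_K, ← h2 1 one_G k hk]
    simp only [one_mul, mul_one, mul_assoc, e]
  have hL_g : ∀ x, fderiv ℝ F 1 (j (Cx.mk x 0)) = 0 := fun x => by
    rw [← deriv_exp_smul_zero hF]
    have : (fun t : ℝ => F (NormedSpace.exp (t • j (Cx.mk x 0)))) =ᶠ[𝓝 0] fun _ => F 1 := by
      filter_upwards [one (Cx.mk x 0), one 0, F_one] with t h1 h2 h3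
      rw [h3, ← h1 1 one_G 1 one_K]
      have h4 := h2 _ (expG t x) 1 one_K
      simp only [map_zero, smul_zero, NormedSpace.exp_zero, one_mul, mul_one] at h4 ⊢
      rw [h4, h3]
    rw [this.deriv_eq, deriv_const]
  have hL_k : ∀ κ ∈ S.kTilde H, fderiv ℝ F 1 (j κ) = 0 := fun κ hκ => by
    rw [← deriv_exp_smul_zero hF]
    have : (fun t : ℝ => F (NormedSpace.exp (t • j κ))) =ᶠ[𝓝 0] fun _ => F 1 := by
      filter_upwards [one κ, one 0, F_one] with t h1 h2 h3
      obtain ⟨k, hk, e⟩ := expK t κ hκ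
      rw [h3, ← h1 1 one_G 1 one_K]
      have h4 := h2 1 one_G k hk
      simp only [map_zero, smul_zero, NormedSpace.exp_zero, one_mul, mul_one] at h4 ⊢
      rw [e, h4, h3]
    rw [this.deriv_eq, deriv_const]
  -- the directions in `i Z_𝔭(H)`
  have line : ∀ P, S.θ P = -P → S.br H P = 0 →
      (fun t : ℝ => F (NormedSpace.exp (t • j (Cx.mk 0 P)))) =ᶠ[𝓝 0] fun t => U (H + t • P) := by
    intro P hP hHP
    have hc : Tendsto (fun t : ℝ => H + t • P) (𝓝 0) (𝓝 H) := by
      have := (by fun_prop : Continuous fun t : ℝ => H + t • P).tendsto 0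
      simpa using this
    filter_upwards [one (Cx.mk 0 P), hc ((isOpen_norm_br (S := S) (Real.pi / 2)).mem_nhds hHr)]
      with t h1 h2
    have e : t • j (Cx.mk 0 P) = j (Cx.mk 0 (t • P)) := by
      rw [← map_smul]; congr 1; ext <;> simp
    rw [← h1 1 one_G 1 one_K, one_mul, mul_one, e, hx₀,
      ι.exp_toMatC_mul_of_br (by rw [map_smul, hHP, smul_zero])]
    obtain ⟨g, hg, k, hk, H', hH', hn, e₂, e₃⟩ := ι.exists_eq_of_p h𝔞 hU
      (P := H + t • P) (by rw [map_add, hHp, map_smul, hP, neg_add, smul_neg]) h2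
    rw [e₂, e₃, hφ g hg k hk H' hH' hn]
  have hL_p : ∀ P, S.θ P = -P → S.br H P = 0 → fderiv ℝ F 1 (j (Cx.mk 0 P)) = ⟪grad v H, P⟫ := by
    intro P hP hHP
    rw [← deriv_exp_smul_zero hF, (line P hP hHP).deriv_eq]
    have h1 : HasDerivAt (fun t : ℝ => H + t • P) P 0 := by
      simpa using ((hasDerivAt_id (0 : ℝ)).smul_const P).const_add H
    have h2 : HasFDerivAt U (innerSL ℝ (grad v H)) (H + (0 : ℝ) • P) := by
      rw [zero_smul, add_zero]; exact hU.hasFDerivAt h𝔞 hv hH hHr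
    exact (h2.comp_hasDerivAt (0 : ℝ) h1).deriv
  have hQ_p : ∀ P, S.θ P = -P → S.br H P = 0 → P ≠ 0 →
      0 < qForm F (j (Cx.mk 0 P)) (j (Cx.mk 0 P)) := by
    intro P hP hHP hP0
    rw [← deriv_deriv_exp_smul hF, (line P hP hHP).deriv.deriv_eq]
    -- Conjugating P into 𝔞 by an element that fixes H turns the second derivative of U into one of
    -- v, where convexity applies.
    obtain ⟨z, hz, hza⟩ := h𝔞.exists_adK_mem hH hP hHP
    have hzK := isKAut_of_mem hz
    have hc : Tendsto (fun t : ℝ => H + t • z P) (𝓝 0) (𝓝 H) := by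
      have := (by fun_prop : Continuous fun t : ℝ => H + t • z P).tendsto 0
      simpa using this
    have h1 : (fun t : ℝ => U (H + t • P)) =ᶠ[𝓝 0] fun t => v (H + t • z P) := by
      filter_upwards [hc ((isOpen_norm_br (S := S) (Real.pi / 2)).mem_nhds hHr)] with t ht
      have h2 : H + t • z P = z (H + t • P) := by rw [map_add, map_smul, hzK.fix]
      have h3 : H + t • z P ∈ 𝔞 := 𝔞.add_mem hH (𝔞.smul_mem t hza)
      have h4 : S.θ (H + t • P) = -(H + t • P) := by
        rw [map_add, hHp, map_smul, hP, neg_add, smul_neg]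
      have h5 : ‖S.br (H + t • P)‖ < Real.pi / 2 := by
        rw [← hzK.norm_br, ← h2]; exact ht
      rw [← hU.eq 1 (Submonoid.one_mem _) _ h3 ht, one_apply_eq_self, h2,
        hU.map_adK h𝔞 (adK_le _ hz) ((mem_tube_of_p h4).2 h5)]
    rw [h1.deriv.deriv_eq, deriv_deriv_line (hv.contDiffAt H hH hHr)]
    exact hv.convex H hH hHr _ hza fun h => hP0 (hzK.toIsAut.injective (by rw [h, map_zero]))
  refine ⟨F, hF, ?_, fun z hz => ?_⟩
  · have hc : Tendsto (fun w : Cx E => (j w, (0 : 𝔸))) (𝓝 0) (𝓝 0) := by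
      have := (by fun_prop : Continuous fun w : Cx E => (j w, (0 : 𝔸))).tendsto 0
      simp only [map_zero] at this
      exact this
    filter_upwards [hc.eventually hloc] with w hw g hg k hk
    have := hw (ι.toMatC_mem w) (ι.rangeC.zero_mem) g hg k hk
    simpa only [NormedSpace.exp_zero, mul_one] using this
  · let Q : Cx E →ₗ[ℝ] Cx E →ₗ[ℝ] ℝ := LinearMap.mk₂ ℝ (fun z w => qForm F (j z) (j w))
      (fun a b c => by simp only [qForm, map_add, add_mul, add_apply]; ring)
      (fun t a b => by
        simp only [qForm, map_smul, smul_mul_assoc, smul_apply, smul_add])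
      (fun a b c => by simp only [qForm, map_add, mul_add]; ring)
      (fun t a b => by simp only [qForm, map_smul, mul_smul_comm, smul_add])
    exact levi_pos h𝔞 hv hH hHr Q ((fderiv ℝ F 1).comp j : Cx E →L[ℝ] ℝ) hQ_g hQ_k
      (fun z w => by
        refine (qForm_sub hF _ _).trans ?_
        rw [← ι.toMatC_adC]; rfl)
      hL_g hL_k hL_p hQ_p hz

/-- Strict plurisubharmonicity, in exponential coordinates on the group. -/
theorem contDiffAt_and_levi_pos {g k : 𝔸} (hg : g ∈ ι.gpG) (hk : k ∈ ι.gpKC) {ψ : Cx E → ℝ}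
    (hψ : ∀ z, ψ z = φ (g * NormedSpace.exp (ι.toMatC (Cx.mk 0 H)) * k *
      NormedSpace.exp (ι.toMatC z))) :
    ContDiffAt ℝ 2 ψ 0 ∧ ∀ z, S.θC z ≠ z → 0 < fderiv ℝ (fderiv ℝ ψ) 0 z z +
      fderiv ℝ (fderiv ℝ ψ) 0 (Cx.mulI z) (Cx.mulI z) := by
  obtain ⟨F, hF, hloc, hpos⟩ := ι.exists_local hφ h𝔞 hv hU hH hHr
  obtain ⟨T, hT, hTθ⟩ := exists_isAd_of_gpKC hk
  obtain ⟨k', -, -, hk'⟩ := ι.exists_inverse_of_gpKC hk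
  set x₀ := NormedSpace.exp (ι.toMatC (Cx.mk 0 H)) with hx₀
  -- With M = Ad(x₀ k) one has x₀ k exp(z) = exp(Mz) x₀ k, which carries the coordinate to the left
  -- of exp(iH), where `exists_local` applies. M is complex linear, and Mz ∈ `kTilde` only when z ∈
  -- 𝔨^ℂ.
  have hAd : ι.IsAd (x₀ * k) (S.adExpI H * T) := (ι.isAd_exp (Cx.mk 0 H)).mul hT
  set M := S.adExpI H * T with hM
  have hψ' : ψ =ᶠ[𝓝 0] fun z => F (NormedSpace.exp ((ι.toMatC.comp M) z)) := by
    have hc : Tendsto M (𝓝 0) (𝓝 0) := by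
      have := M.continuous.tendsto 0
      rwa [map_zero] at this
    filter_upwards [hc.eventually hloc] with z hz
    rw [hψ, ContinuousLinearMap.comp_apply, ← hz g hg k hk]
    have h1 := (semiconjBy_exp (hAd z)).eq
    congr 1
    rw [mul_assoc g, mul_assoc g, h1]
    simp only [mul_assoc]
  obtain ⟨h1, h2⟩ := fderiv_fderiv_of_eventuallyEq_exp hF hψ'
  have T_inj : ∀ z, T z = 0 → z = 0 := fun z hz => by
    refine ι.toMatC_injective ?_
    have h3 := hT z
    rw [hz, map_zero, zero_mul] at h3
    rw [map_zero, ← one_mul (ι.toMatC z), ← hk', mul_assoc, h3, mul_zero]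
  have T_mulI : ∀ z, T (Cx.mulI z) = Cx.mulI (T z) := fun z => by
    have h3 : ι.toMatC (T (Cx.mulI z)) * k = ι.toMatC (Cx.mulI (T z)) * k := by
      rw [← hT, Cx.mulI_apply, Cx.mulI_apply, ← ι.I_smul_toMatC, ← ι.I_smul_toMatC,
        mul_smul_comm, hT, smul_mul_assoc]
    obtain ⟨k'', -, hk'', -⟩ := ι.exists_inverse_of_gpKC hk
    refine ι.toMatC_injective ?_
    rw [← mul_one (ι.toMatC (T _)), ← mul_one (ι.toMatC (Cx.mulI _)), ← hk'', ← mul_assoc, h3,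
      mul_assoc]
  refine ⟨h1, fun z hz => ?_⟩
  have h3 : M (Cx.mulI z) = Cx.mulI (M z) := by
    rw [hM, mul_apply_eq_comp, mul_apply_eq_comp, T_mulI, adExpI_mulI]
  rw [h2, h2, ContinuousLinearMap.comp_apply, ContinuousLinearMap.comp_apply, h3]
  refine hpos _ fun hmem => hz ?_
  obtain ⟨κ, hκ, e⟩ := mem_kTilde.1 hmem
  have h4 : κ = T z := by
    have h5 := congrArg (fun w => (NormedSpace.exp (-S.adC (Cx.mk 0 H)) : Cx E →L[ℝ] Cx E) w) e
    rw [hM, mul_apply_eq_comp, adExpI, exp_neg_exp_apply, exp_neg_exp_apply] at h5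
    exact h5
  rw [h4] at hκ
  have h6 : T (S.θC z) = S.θC (T z) := DFunLike.congr_fun hTθ z
  exact sub_eq_zero.1 (T_inj _ (by rw [map_sub, h6, hκ, sub_self]))

end Local

end Realization

end CartanData

end AkhiezerGindikin

end

/-! ### Cartan data from the Killing form; existence of the K-invariant extension -/

noncomputable section

namespace AkhiezerGindikin

open Module Filter Topology

local notation "⟪" x ", " y "⟫" => inner ℝ x y

set_option linter.unusedSectionVars false

section Existence

/-- A real Lie algebra with a Cartan involution, with the inner product `-B(x, θ y)`. -/
theorem exists_cartanData {L : Type} [LieRing L] [LieAlgebra ℝ L] [FiniteDimensional ℝ L]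
    {θ : L →ₗ⁅ℝ⁆ L} (hθ : IsCartanInvolution θ) :
    ∃ (E : Type) (_ : NormedAddCommGroup E) (_ : InnerProductSpace ℝ E) (_ : FiniteDimensional ℝ E)
      (S : CartanData E) (e : E ≃ₗ[ℝ] L),
      (∀ x y, e (S.br x y) = ⁅e x, e y⁆) ∧ ∀ x, e (S.θ x) = θ (e x) := by
  have hinv : ∀ x y : L, killingForm ℝ L (θ x) (θ y) = killingForm ℝ L x y := fun x y =>
    LieAlgebra.killingForm_of_equiv_apply (e := { θ with
      invFun := θ
      left_inv := hθ.involutive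
      right_inv := hθ.involutive } ) x y
  have hsymm : ∀ x y : L, killingForm ℝ L x y = killingForm ℝ L y x := fun x y =>
    LieModule.traceForm_comm ℝ L L x y
  let core : InnerProductSpace.Core ℝ L :=
    { inner := fun x y => -killingForm ℝ L x (θ y)
      conj_inner_symm := fun x y => by
        show -killingForm ℝ L y (θ x) = -killingForm ℝ L x (θ y)
        rw [← hinv, hθ.involutive, hsymm]
      re_inner_nonneg := fun x => by
        show 0 ≤ -killingForm ℝ L x (θ x)
        by_cases hx : x = 0
        · simp [hx]
        · exact (neg_pos.2 (hθ.killing_neg x hx)).le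
      add_left := fun x y z => by
        show -killingForm ℝ L (x + y) (θ z) = -killingForm ℝ L x (θ z) + -killingForm ℝ L y (θ z)
        rw [map_add, LinearMap.add_apply, neg_add]
      smul_left := fun x y c => by
        show -killingForm ℝ L (c • x) (θ y) = c * -killingForm ℝ L x (θ y)
        rw [map_smul, LinearMap.smul_apply, smul_eq_mul, mul_neg]
      definite := fun x hx => by
        by_contra h
        exact absurd (show -killingForm ℝ L x (θ x) = 0 from hx)
          (neg_pos.2 (hθ.killing_neg x h)).ne' }
  let i1 : NormedAddCommGroup L := core.toNormedAddCommGroup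
  let i2 : InnerProductSpace ℝ L := InnerProductSpace.ofCore core.toCore
  have hinner : ∀ x y : L, (inner ℝ x y : ℝ) = -killingForm ℝ L x (θ y) := fun x y => rfl
  have hlie : ∀ x y z : L, killingForm ℝ L ⁅x, y⁆ z = -killingForm ℝ L y ⁅x, z⁆ := fun x y z => by
    rw [← lie_skew x y, map_neg, LinearMap.neg_apply]
    exact congrArg Neg.neg (LieModule.traceForm_apply_lie_apply ℝ L L y x z)
  have hnondeg : ∀ x : L, killingForm ℝ L x = 0 → x = 0 := fun x hx => by
    by_contra h
    have := hθ.killing_neg x h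
    rw [hx, LinearMap.zero_apply] at this
    exact lt_irrefl _ this
  -- Definiteness of -B(x, θx) makes the Killing form nondegenerate, so all derivations are inner.
  have : LieAlgebra.IsKilling ℝ L := by
    refine ⟨?_⟩
    refine (LieSubmodule.eq_bot_iff _).2 fun x hx => hnondeg x ?_
    ext y
    rw [hsymm]
    exact (LieIdeal.mem_killingCompl ℝ L ⊤).1 hx y (LieSubmodule.mem_top y)
  let S : CartanData L :=
    { br := LinearMap.toContinuousLinearMap
        ((LinearMap.toContinuousLinearMap : (L →ₗ[ℝ] L) ≃ₗ[ℝ] (L →L[ℝ] L)).toLinearMap.comp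
          (LieAlgebra.ad ℝ L : L →ₗ[ℝ] Module.End ℝ L))
      br_self := fun x => lie_self x
      jacobi := fun x y z => leibniz_lie x y z
      θ := LinearMap.toContinuousLinearMap (θ : L →ₗ[ℝ] L)
      θ_θ := hθ.involutive
      θ_br := fun x y => LieHom.map_lie θ x y
      inner_θ := fun x y => by
        rw [hinner, hinner]
        exact congrArg Neg.neg (hinv x (θ y))
      inner_br := fun x y z => by
        rw [hinner, hinner]
        show -killingForm ℝ L ⁅x, y⁆ (θ z) = - -killingForm ℝ L y (θ ⁅θ x, z⁆)
        rw [LieHom.map_lie, hθ.involutive, hlie]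
      center := fun x hx => hnondeg x (by
        have h1 : LieAlgebra.ad ℝ L x = 0 := LinearMap.ext fun y => hx y
        ext y
        rw [killingForm_apply_apply, h1, LinearMap.zero_comp, map_zero, LinearMap.zero_apply])
      derivation := fun D hD => by
        let D' : LieDerivation ℝ L L :=
          { toLinearMap := D
            leibniz' := fun x y => by
              have h1 : D ⁅x, y⁆ = ⁅D x, y⁆ + ⁅x, D y⁆ := hD x y
              rw [h1, ← lie_skew y (D x), sub_neg_eq_add, add_comm] }
        obtain ⟨x, hx⟩ := LieDerivation.IsKilling.exists_eq_ad D'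
        refine ⟨x, fun y => ?_⟩
        have := DFunLike.congr_fun hx y
        rw [LieDerivation.ad_apply_apply] at this
        exact this.symm }
  exact ⟨L, i1, i2, inferInstance, S, LinearEquiv.refl ℝ L, fun x y => rfl, fun x => rfl⟩

variable {E : Type*} [NormedAddCommGroup E] [InnerProductSpace ℝ E] [FiniteDimensional ℝ E]
  [CompleteSpace E]

/-- Conjugate the 𝔭-component into 𝔞 by some chosen element of K and evaluate v. The choice is
immaterial, since K-conjugate points of 𝔞 are conjugate under the normalizer of 𝔞, which preserves
v. -/
theorem CartanData.IsConvexInvariant.exists_ext {S : CartanData E} {𝔞 : Submodule ℝ E}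
    (h𝔞 : S.IsMaxAbelian 𝔞) {r : ℝ} {v : E → ℝ} (hv : S.IsConvexInvariant 𝔞 r v) :
    ∃ U, S.IsInvariantExt 𝔞 r v U := by
  have h : ∀ X, ∃ z ∈ S.adK 0, z (S.projP X) ∈ 𝔞 := fun X =>
    h𝔞.exists_adK_mem 𝔞.zero_mem (S.θ_projP X) (by simp)
  choose z hz hz𝔞 using fun X => h X
  have hproj : ∀ X, S.projP (S.projP X) = S.projP X := fun X => S.projP_of_p (S.θ_projP X)
  refine ⟨fun X => v (z (S.projP X) (S.projP X)), fun k hk H hH hHr => ?_, fun X => ?_⟩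
  · have hkK := CartanData.isKAut_of_mem hk
    have h1 : S.projP (k H) = k H := by rw [hkK.projP, S.projP_of_p (h𝔞.θ_eq _ hH)]
    have h2 := hz𝔞 (k H)
    have h3 := hz𝔞 (S.projP (k H))
    rw [hproj] at h3
    simp only [h1] at h3 ⊢
    obtain ⟨w, hw, hw𝔞, hwH⟩ := h𝔞.exists_normalizer h3 hH
      (Submonoid.mul_mem _ (hz (k H)) hk) rfl
    have h4 : ‖S.br (z (k H) (k H))‖ < r := by
      rw [(CartanData.isKAut_of_mem (hz _)).norm_br, hkK.norm_br]
      exact hHr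
    rw [← hv.invariant w hw hw𝔞 _ h3 h4, hwH]
  · simp only [hproj]

end Existence

end AkhiezerGindikin

end

/-! ### Dictionary between the matrix groups and the abstract model -/

noncomputable section

namespace AkhiezerGindikin

open Module Filter Topology

local notation "⟪" x ", " y "⟫" => inner ℝ x y

set_option linter.unusedSectionVars false

variable {E : Type*} [NormedAddCommGroup E] [InnerProductSpace ℝ E] [FiniteDimensional ℝ E]
  [CompleteSpace E] {n : ℕ}

open CartanData

/-- `ι` realises `E` as the Lie algebra `𝔤` with the involution `θ`. -/
structure IsModel (𝔤 : LieSubalgebra ℝ (Mat n)) (θ : 𝔤 →ₗ⁅ℝ⁆ 𝔤) {S : CartanData E}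
    (ι : S.Realization (Mat n)) : Prop where
  mem : ∀ x, ι.toMat x ∈ 𝔤
  surj : ∀ A ∈ 𝔤, ∃ x, ι.toMat x = A
  θ_eq : ∀ x (Y : 𝔤), (Y : Mat n) = ι.toMat x → (θ Y : Mat n) = ι.toMat (S.θ x)

theorem exists_isModel {𝔤 : LieSubalgebra ℝ (Mat n)} {θ : 𝔤 →ₗ⁅ℝ⁆ 𝔤}
    (hreal : IsTotallyReal 𝔤) {S : CartanData E} (e : E ≃ₗ[ℝ] 𝔤)
    (he : ∀ x y, e (S.br x y) = ⁅e x, e y⁆) (hθ : ∀ x, e (S.θ x) = θ (e x)) :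
    ∃ ι : S.Realization (Mat n), IsModel 𝔤 θ ι := by
  let f : E →ₗ[ℝ] Mat n := 𝔤.toSubmodule.subtype.comp e.toLinearMap
  have hf : ∀ x, f x = (e x : Mat n) := fun x => rfl
  have hinj : ∀ x, f x = 0 → x = 0 := fun x hx => by
    rw [hf] at hx
    exact e.map_eq_zero_iff.1 (Subtype.ext hx)
  refine ⟨⟨LinearMap.toContinuousLinearMap f, fun x y => ?_, fun x y h => ?_⟩, fun x => (e x).2,
    fun A hA => ⟨e.symm ⟨A, hA⟩, ?_⟩, fun x Y hY => ?_⟩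
  · show (e (S.br x y) : Mat n) = (e x : Mat n) * (e y : Mat n) - (e y : Mat n) * (e x : Mat n)
    rw [he]; rfl
  · have h1 : f x + Complex.I • f y = 0 := h
    have h2 : f y = 0 := by
      refine hreal _ (e y).2 ?_
      rw [eq_neg_of_add_eq_zero_right h1]
      exact 𝔤.neg_mem (e x).2
    rw [h2, smul_zero, add_zero] at h1
    exact ⟨hinj x h1, hinj y h2⟩
  · show ((e (e.symm ⟨A, hA⟩) : 𝔤) : Mat n) = A
    rw [e.apply_symm_apply]
  · show (θ Y : Mat n) = (e (S.θ x) : Mat n)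
    rw [hθ, show Y = e x from Subtype.ext hY]

namespace IsModel

variable {𝔤 : LieSubalgebra ℝ (Mat n)} {θ : 𝔤 →ₗ⁅ℝ⁆ 𝔤} {S : CartanData E}
  {ι : S.Realization (Mat n)} (hm : IsModel 𝔤 θ ι)

theorem toMat_injective (ι : S.Realization (Mat n)) : Function.Injective ι.toMat := by
  refine (injective_iff_map_eq_zero ι.toMat).2 fun x hx => (ι.eq_zero x 0 ?_).1
  rw [hx, map_zero, smul_zero, add_zero]

include hm

theorem mem_kPart {x : E} : ι.toMat x ∈ kPart 𝔤 θ ↔ S.θ x = x := by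
  rw [AkhiezerGindikin.mem_kPart]
  constructor
  · rintro ⟨Y, hY, e⟩
    have := hm.θ_eq x Y e
    rw [hY, e] at this
    exact (toMat_injective ι this).symm
  · intro h
    refine ⟨⟨_, hm.mem x⟩, Subtype.ext ?_, rfl⟩
    rw [hm.θ_eq x _ rfl, h]

theorem mem_pPart {x : E} : ι.toMat x ∈ pPart 𝔤 θ ↔ S.θ x = -x := by
  rw [AkhiezerGindikin.mem_pPart]
  constructor
  · rintro ⟨Y, hY, e⟩
    have := hm.θ_eq x Y e
    rw [hY] at this
    have h2 : ι.toMat (S.θ x) = ι.toMat (-x) := by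
      rw [← this, map_neg, ← e]; rfl
    exact toMat_injective ι h2
  · intro h
    refine ⟨⟨_, hm.mem x⟩, Subtype.ext ?_, rfl⟩
    rw [hm.θ_eq x _ rfl, h, map_neg]; rfl

theorem pPart_surj {A : Mat n} (hA : A ∈ pPart 𝔤 θ) : ∃ x, ι.toMat x = A ∧ S.θ x = -x := by
  obtain ⟨Y, -, rfl⟩ := (AkhiezerGindikin.mem_pPart 𝔤 θ).1 hA
  obtain ⟨x, hx⟩ := hm.surj _ Y.2
  exact ⟨x, hx, hm.mem_pPart.1 (hx ▸ hA)⟩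

theorem kPart_surj {A : Mat n} (hA : A ∈ kPart 𝔤 θ) : ∃ x, ι.toMat x = A ∧ S.θ x = x := by
  obtain ⟨Y, -, rfl⟩ := (AkhiezerGindikin.mem_kPart 𝔤 θ).1 hA
  obtain ⟨x, hx⟩ := hm.surj _ Y.2
  exact ⟨x, hx, hm.mem_kPart.1 (hx ▸ hA)⟩

theorem mem_kC {A : Mat n} : A ∈ kC 𝔤 θ ↔ ∃ κ, S.θC κ = κ ∧ ι.toMatC κ = A := by
  constructor
  · intro h
    induction h using Submodule.span_induction with
    | mem A hA =>
      obtain ⟨x, rfl, hx⟩ := hm.kPart_surj hA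
      exact ⟨Cx.mk x 0, by ext <;> simp [θC_apply, hx], ι.toMatC_mk_zero x⟩
    | zero => exact ⟨0, map_zero _, map_zero _⟩
    | add A B _ _ hA hB =>
      obtain ⟨z, hz, rfl⟩ := hA
      obtain ⟨w, hw, rfl⟩ := hB
      exact ⟨z + w, by rw [map_add, hz, hw], map_add _ _ _⟩
    | smul c A _ hA =>
      obtain ⟨z, hz, rfl⟩ := hA
      refine ⟨c.re • z + c.im • Cx.mulI z, ?_, ?_⟩
      · rw [map_add, map_smul, map_smul, θC_mulI, hz]
      · rw [map_add, map_smul, map_smul, Cx.mulI_apply, ← ι.I_smul_toMatC]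
        conv_rhs => rw [← Complex.re_add_im c, add_smul, mul_smul]
        rfl
  · rintro ⟨κ, hκ, rfl⟩
    have h1 : S.θ (Cx.re κ) = Cx.re κ := by
      have := congrArg Cx.re hκ
      rwa [θC_apply] at this
    have h2 : S.θ (Cx.im κ) = Cx.im κ := by
      have := congrArg Cx.im hκ
      rwa [θC_apply] at this
    rw [ι.toMatC_apply]
    exact (kC 𝔤 θ).add_mem (Submodule.subset_span (hm.mem_kPart.2 h1))
      ((kC 𝔤 θ).smul_mem _ (Submodule.subset_span (hm.mem_kPart.2 h2)))

theorem mem_gC {A : Mat n} : A ∈ gC 𝔤 ↔ ∃ z, ι.toMatC z = A := by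
  constructor
  · intro h
    induction h using Submodule.span_induction with
    | mem A hA =>
      obtain ⟨x, rfl⟩ := hm.surj A hA
      exact ⟨Cx.mk x 0, ι.toMatC_mk_zero x⟩
    | zero => exact ⟨0, map_zero _⟩
    | add A B _ _ hA hB =>
      obtain ⟨z, rfl⟩ := hA
      obtain ⟨w, rfl⟩ := hB
      exact ⟨z + w, map_add _ _ _⟩
    | smul c A _ hA =>
      obtain ⟨z, rfl⟩ := hA
      refine ⟨c.re • z + c.im • Cx.mulI z, ?_⟩
      rw [map_add, map_smul, map_smul, Cx.mulI_apply, ← ι.I_smul_toMatC]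
      conv_rhs => rw [← Complex.re_add_im c, add_smul, mul_smul]
      rfl
  · rintro ⟨z, rfl⟩
    rw [ι.toMatC_apply]
    exact (gC 𝔤).add_mem (Submodule.subset_span (hm.mem _))
      ((gC 𝔤).smul_mem _ (Submodule.subset_span (hm.mem _)))

omit hm in
theorem analyticSubgroup_mem {s : Set (Mat n)} (hs : ∀ A ∈ s, -A ∈ s) {g : GL (Fin n) ℂ}
    (hg : g ∈ analyticSubgroup s) :
    (g : Mat n) ∈ Submonoid.closure ((NormedSpace.exp : Mat n → Mat n) '' s) := by
  have hinv : ∀ A : Mat n, (expGL A)⁻¹ = expGL (-A) := fun A => Units.ext rfl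
  -- Carrying the inverse along makes the inverse step of the induction a swap.
  suffices h : (g : Mat n) ∈ Submonoid.closure ((NormedSpace.exp : Mat n → Mat n) '' s) ∧
      ((g⁻¹ : GL (Fin n) ℂ) : Mat n) ∈ Submonoid.closure ((NormedSpace.exp : Mat n → Mat n) '' s) from
    h.1
  induction hg using Subgroup.closure_induction with
  | mem g hg =>
    obtain ⟨A, hA, rfl⟩ := hg
    rw [hinv]
    exact ⟨Submonoid.subset_closure ⟨A, hA, rfl⟩, Submonoid.subset_closure ⟨-A, hs A hA, rfl⟩⟩
  | one => simp
  | mul g h _ _ hg hh =>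
    rw [mul_inv_rev, Units.val_mul, Units.val_mul]
    exact ⟨Submonoid.mul_mem _ hg.1 hh.1, Submonoid.mul_mem _ hh.2 hg.2⟩
  | inv g _ hg => rw [inv_inv]; exact hg.symm

omit hm in
theorem exists_analyticSubgroup {s : Set (Mat n)} {m : Mat n}
    (h : m ∈ Submonoid.closure ((NormedSpace.exp : Mat n → Mat n) '' s)) :
    ∃ g ∈ analyticSubgroup s, (g : Mat n) = m := by
  induction h using Submonoid.closure_induction with
  | mem m hm =>
    obtain ⟨A, hA, rfl⟩ := hm
    exact ⟨expGL A, Subgroup.subset_closure ⟨A, hA, rfl⟩, rfl⟩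
  | one => exact ⟨1, Subgroup.one_mem _, rfl⟩
  | mul m m' _ _ hg hh =>
    obtain ⟨g, hg, rfl⟩ := hg
    obtain ⟨h, hh, rfl⟩ := hh
    exact ⟨g * h, Subgroup.mul_mem _ hg hh, rfl⟩

theorem gpG_eq : ι.gpG = Submonoid.closure ((NormedSpace.exp : Mat n → Mat n) '' (𝔤 : Set (Mat n))) := by
  have h : (𝔤 : Set (Mat n)) = Set.range ι.toMat := Set.ext fun A =>
    ⟨fun h => hm.surj A h, by rintro ⟨x, rfl⟩; exact hm.mem x⟩
  rw [h, ← Set.range_comp]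
  rfl

theorem gpKC_eq : ι.gpKC =
    Submonoid.closure ((NormedSpace.exp : Mat n → Mat n) '' (kC 𝔤 θ : Set (Mat n))) := by
  have h : (kC 𝔤 θ : Set (Mat n)) = ι.toMatC '' {z | S.θC z = z} := Set.ext fun A => by
    rw [SetLike.mem_coe, hm.mem_kC]; rfl
  rw [h, Set.image_image]
  rfl

theorem mem_gpG {g : GL (Fin n) ℂ} (hg : g ∈ groupG 𝔤) : (g : Mat n) ∈ ι.gpG := by
  rw [hm.gpG_eq]
  exact analyticSubgroup_mem (fun A hA => 𝔤.neg_mem hA) hg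

theorem mem_gpKC {g : GL (Fin n) ℂ} (hg : g ∈ groupKC 𝔤 θ) : (g : Mat n) ∈ ι.gpKC := by
  rw [hm.gpKC_eq]
  exact analyticSubgroup_mem (fun A hA => (kC 𝔤 θ).neg_mem hA) hg

theorem exists_groupG {m : Mat n} (h : m ∈ ι.gpG) : ∃ g ∈ groupG 𝔤, (g : Mat n) = m :=
  exists_analyticSubgroup (hm.gpG_eq ▸ h)

theorem exists_groupKC {m : Mat n} (h : m ∈ ι.gpKC) : ∃ g ∈ groupKC 𝔤 θ, (g : Mat n) = m :=
  exists_analyticSubgroup (hm.gpKC_eq ▸ h)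

theorem groupKC_le : groupKC 𝔤 θ ≤ groupGC 𝔤 := by
  refine Subgroup.closure_mono (Set.image_mono fun A hA => ?_)
  obtain ⟨κ, -, e⟩ := hm.mem_kC.1 hA
  exact hm.mem_gC.2 ⟨κ, e⟩

/-- An element of 𝔭 that commutes with 𝔞 spans together with 𝔞 an abelian subspace, so maximality
for inclusion puts it in 𝔞. -/
theorem isMaxAbelian {𝔞 : Submodule ℝ (Mat n)} (h𝔞 : IsMaximalAbelian 𝔤 θ 𝔞) :
    S.IsMaxAbelian (𝔞.comap (ι.toMat : E →ₗ[ℝ] Mat n)) where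
  θ_eq := fun x hx => hm.mem_pPart.1 (h𝔞.prop.1 hx)
  comm := fun x hx y hy => by
    refine toMat_injective ι ?_
    rw [ι.map_br, map_zero]
    exact h𝔞.prop.2 _ hx _ hy
  max := fun x hx hcomm => by
    have hcomm' : ∀ A ∈ 𝔞, ⁅A, ι.toMat x⁆ = 0 := fun A hA => by
      obtain ⟨y, rfl, -⟩ := hm.pPart_surj (h𝔞.prop.1 hA)
      have := ι.map_br y x
      rw [hcomm y hA, map_zero] at this
      exact this.symm
    have h1 : 𝔞 ⊔ Submodule.span ℝ {ι.toMat x} ≤ 𝔞 := by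
      refine h𝔞.le_of_ge ⟨sup_le h𝔞.prop.1 ?_, ?_⟩ le_sup_left
      · rw [Submodule.span_singleton_le_iff_mem]
        exact hm.mem_pPart.2 hx
      · intro A hA B hB
        obtain ⟨a, ha, a', ha', rfl⟩ := Submodule.mem_sup.1 hA
        obtain ⟨b, hb, b', hb', rfl⟩ := Submodule.mem_sup.1 hB
        obtain ⟨s, rfl⟩ := Submodule.mem_span_singleton.1 ha'
        obtain ⟨t, rfl⟩ := Submodule.mem_span_singleton.1 hb'
        have e1 := h𝔞.prop.2 a ha b hb
        have e2 := hcomm' a ha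
        have e3 := hcomm' b hb
        rw [Ring.lie_def, sub_eq_zero] at e1 e2 e3 ⊢
        simp only [mul_add, add_mul, smul_mul_assoc, mul_smul_comm, e1, e2, e3]
        rw [smul_add, smul_add, smul_comm s t]
        abel
    exact h1 (Submodule.mem_sup_right (Submodule.mem_span_singleton_self _))

theorem exists_groupK {z : E →L[ℝ] E} (hz : z ∈ S.adK 0) : ∃ k ∈ groupK 𝔤 θ, ∀ x,
    ι.toMat (z x) = (k : Mat n) * ι.toMat x * ((k⁻¹ : GL (Fin n) ℂ) : Mat n) := by
  induction hz using Submonoid.closure_induction with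
  | mem z hz =>
    obtain ⟨T, hT, rfl⟩ := hz
    refine ⟨expGL (ι.toMat T), Subgroup.subset_closure ⟨_, hm.mem_kPart.2 hT.1, rfl⟩, fun x => ?_⟩
    have h1 := exp_mul_of_bracket (a := ι.toMat T) (j := ι.toMat) (D := S.br T)
      (fun y => (ι.map_br T y).symm) x
    have h2 : ((expGL (ι.toMat T) : GL (Fin n) ℂ) : Mat n) * ι.toMat x =
      ι.toMat (NormedSpace.exp (S.br T) x) * ((expGL (ι.toMat T) : GL (Fin n) ℂ) : Mat n) := h1
    rw [h2, mul_assoc, Units.mul_inv, mul_one]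
  | one => exact ⟨1, Subgroup.one_mem _, fun x => by simp⟩
  | mul z w _ _ hz hw =>
    obtain ⟨k, hk, e⟩ := hz
    obtain ⟨l, hl, f⟩ := hw
    refine ⟨k * l, Subgroup.mul_mem _ hk hl, fun x => ?_⟩
    rw [mul_apply_eq_comp, e, f, mul_inv_rev, Units.val_mul, Units.val_mul]
    simp only [mul_assoc]

end IsModel

end AkhiezerGindikin

end

/-! ### Transfer to the matrix groups and conclusion -/

noncomputable section

namespace AkhiezerGindikin

open Module Filter Topology

local notation "⟪" x ", " y "⟫" => inner ℝ x y

set_option linter.unusedSectionVars false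

variable {E : Type*} [NormedAddCommGroup E] [InnerProductSpace ℝ E] [FiniteDimensional ℝ E]
  [CompleteSpace E] {n : ℕ}

open CartanData

/-- `Cx E` carries only a real structure together with the operator `Cx.mulI`. Second derivatives
along lines transport the Levi form through a map that intertwines this operator with multiplication
by i. -/
theorem leviForm_comp {V : Type*} [NormedAddCommGroup V] [NormedSpace ℂ V] [FiniteDimensional ℂ V]
    {ψ : Cx E → ℝ} (hψ : ContDiffAt ℝ 2 ψ 0) (M : V → Cx E) (hadd : ∀ z w, M (z + w) = M z + M w)
    (hsmul : ∀ (c : ℝ) z, M ((c : ℂ) • z) = c • M z)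
    (hM : ∀ z, M (Complex.I • z) = Cx.mulI (M z)) :
    ContDiffAt ℝ 2 (fun z => ψ (M z)) 0 ∧ ∀ z, leviForm (fun z => ψ (M z)) 0 z =
      (1 / 4 : ℝ) * (fderiv ℝ (fderiv ℝ ψ) 0 (M z) (M z) +
        fderiv ℝ (fderiv ℝ ψ) 0 (Cx.mulI (M z)) (Cx.mulI (M z))) := by
  have : FiniteDimensional ℝ V := FiniteDimensional.complexToReal V
  obtain ⟨M, rfl⟩ : ∃ M' : V →L[ℝ] Cx E, ⇑M' = M :=
    ⟨LinearMap.toContinuousLinearMap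
      { toFun := M, map_add' := hadd, map_smul' := fun c z => hsmul c z }, rfl⟩
  have h1 : ContDiffAt ℝ 2 (fun z => ψ (M z)) 0 := by
    refine ContDiffAt.comp (g := ψ) (0 : V) ?_ M.contDiff.contDiffAt
    rwa [map_zero]
  have h2 : ∀ z, fderiv ℝ (fderiv ℝ fun z => ψ (M z)) 0 z z =
      fderiv ℝ (fderiv ℝ ψ) 0 (M z) (M z) := fun z => by
    rw [← deriv_deriv_line h1, ← deriv_deriv_line hψ]
    simp only [zero_add, map_smul]
  refine ⟨h1, fun z => ?_⟩
  rw [leviForm, h2, h2, hM]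

namespace IsModel

variable {𝔤 : LieSubalgebra ℝ (Mat n)} {θ : 𝔤 →ₗ⁅ℝ⁆ 𝔤} {S : CartanData E}
  {ι : S.Realization (Mat n)} (hm : IsModel 𝔤 θ ι) {𝔞 : Submodule ℝ (Mat n)}

/-- The projection to `𝔞`. -/
def toA (ι : S.Realization (Mat n)) (𝔞 : Submodule ℝ (Mat n)) : E →L[ℝ] 𝔞 :=
  LinearMap.toContinuousLinearMap (LinearMap.codRestrict 𝔞
    ((ι.toMat : E →ₗ[ℝ] Mat n).comp
      ((𝔞.comap (ι.toMat : E →ₗ[ℝ] Mat n)).starProjection : E →ₗ[ℝ] E))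
    fun x => Submodule.starProjection_apply_mem (𝔞.comap (ι.toMat : E →ₗ[ℝ] Mat n)) x)

theorem coe_toA (x : E) : (toA ι 𝔞 x : Mat n) =
    ι.toMat ((𝔞.comap (ι.toMat : E →ₗ[ℝ] Mat n)).starProjection x) := rfl

theorem coe_toA_of_mem {x : E} (hx : ι.toMat x ∈ 𝔞) : (toA ι 𝔞 x : Mat n) = ι.toMat x := by
  rw [coe_toA, Submodule.starProjection_eq_self_iff.2 (show x ∈ 𝔞.comap _ from hx)]

theorem toA_proj (x : E) :
    toA ι 𝔞 ((𝔞.comap (ι.toMat : E →ₗ[ℝ] Mat n)).starProjection x) = toA ι 𝔞 x :=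
  Subtype.ext (coe_toA_of_mem
    (Submodule.starProjection_apply_mem (𝔞.comap (ι.toMat : E →ₗ[ℝ] Mat n)) x))

include hm

theorem exists_toA (h𝔞 : IsMaximalAbelian 𝔤 θ 𝔞) (H : 𝔞) :
    ∃ x, ι.toMat x = H ∧ toA ι 𝔞 x = H := by
  obtain ⟨x, hx⟩ := hm.surj _ (h𝔞.mem_g _ H.2)
  exact ⟨x, hx, Subtype.ext ((coe_toA_of_mem (by rw [hx]; exact H.2)).trans hx)⟩

/-- The domain `ω` in terms of the operator norm. -/
theorem toA_mem_omega (h𝔞 : IsMaximalAbelian 𝔤 θ 𝔞) {x : E} (hx : ι.toMat x ∈ 𝔞) :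
    toA ι 𝔞 x ∈ omega 𝔤 𝔞 ↔ ‖S.br x‖ < Real.pi / 2 := by
  have hA := hm.isMaxAbelian h𝔞
  obtain ⟨b⟩ := S.nonempty_rootBasis hA
  rw [b.norm_br_lt_iff hx (by positivity)]
  constructor
  · intro h i
    by_cases hi : b.A i = 0
    · rw [hi, inner_zero_left, abs_zero]; positivity
    choose g hg _ using fun H : 𝔞 => hm.exists_toA h𝔞 H
    -- The nonzero weight of the basis vector e i, read on matrices, is a restricted root.
    let α : Module.Dual ℝ 𝔞 :=
      { toFun := fun H => ⟪b.A i, g H⟫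
        map_add' := fun H K => by
          rw [← inner_add_right]; congr 1
          refine toMat_injective ι ?_
          rw [map_add, hg, hg, hg]; rfl
        map_smul' := fun c H => by
          rw [RingHom.id_apply, smul_eq_mul, ← real_inner_smul_right]; congr 1
          refine toMat_injective ι ?_
          rw [map_smul, hg, hg]; rfl }
    have hgx : ∀ y, ι.toMat y ∈ 𝔞 → g (toA ι 𝔞 y) = y := fun y hy =>
      toMat_injective ι (by rw [hg, coe_toA_of_mem hy])
    have hα : α ∈ restrictedRoots 𝔤 𝔞 := by
      refine ⟨fun h0 => hi ?_, ι.toMat (b.e i), hm.mem _, fun h0 => ?_, fun H => ?_⟩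
      · have h1 : ⟪b.A i, g (toA ι 𝔞 (b.A i))⟫ = 0 := DFunLike.congr_fun h0 (toA ι 𝔞 (b.A i))
        rw [hgx _ (b.A_mem i)] at h1
        exact inner_self_eq_zero.1 h1
      · have h1 : b.e i = 0 := toMat_injective ι (by rw [h0, map_zero])
        have h2 := b.e.norm_eq_one i
        rw [h1, norm_zero] at h2
        exact zero_ne_one h2
      · have h1 := ι.map_br (g H) (b.e i)
        rw [b.br_e _ (show ι.toMat (g H) ∈ 𝔞 by rw [hg]; exact H.2), map_smul, hg] at h1
        exact h1.symm
    have := h α hα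
    rwa [show α (toA ι 𝔞 x) = ⟪b.A i, g (toA ι 𝔞 x)⟫ from rfl, hgx x hx] at this
  · rintro h α ⟨-, X, hX, hX0, hXα⟩
    obtain ⟨y, rfl⟩ := hm.surj X hX
    have h1 : S.br x y = α (toA ι 𝔞 x) • y := by
      refine toMat_injective ι ?_
      rw [ι.map_br, map_smul, ← hXα, coe_toA_of_mem hx]; rfl
    -- A root vector has a nonzero component along some weight vector, and then both weights agree
    -- at x.
    have h2 : ∃ i, ⟪b.e i, y⟫ ≠ 0 := by
      by_contra! h0
      refine hX0 ?_
      rw [← b.e.sum_repr' y, Finset.sum_eq_zero fun i _ => by rw [h0 i, zero_smul], map_zero]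
    obtain ⟨i, hi⟩ := h2
    have h3 := congrArg (fun w => ⟪b.e i, w⟫) h1
    simp only [real_inner_smul_right] at h3
    rw [← S.inner_br_p (hA.θ_eq x hx), b.br_e x hx, real_inner_smul_left] at h3
    rw [← mul_right_cancel₀ hi h3]
    exact h i

theorem exists_weylGroup (h𝔞 : IsMaximalAbelian 𝔤 θ 𝔞) {z : E →L[ℝ] E} (hz : z ∈ S.adK 0)
    (hz𝔞 : ∀ x, ι.toMat x ∈ 𝔞 → ι.toMat (z x) ∈ 𝔞) :
    ∃ w ∈ weylGroup 𝔤 θ 𝔞, ∀ x, ι.toMat x ∈ 𝔞 → w (toA ι 𝔞 x) = toA ι 𝔞 (z x) := by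
  obtain ⟨k, hk, hkz⟩ := hm.exists_groupK hz
  let f : 𝔞 →ₗ[ℝ] 𝔞 :=
    { toFun := fun H => ⟨(k : Mat n) * H * ((k⁻¹ : GL (Fin n) ℂ) : Mat n), by
        obtain ⟨x, hx, -⟩ := hm.exists_toA h𝔞 H
        rw [← hx, ← hkz]
        exact hz𝔞 x (by rw [hx]; exact H.2)⟩
      map_add' := fun H K => Subtype.ext (by simp [mul_add, add_mul])
      map_smul' := fun c H => Subtype.ext (by simp) }
  have hf : ∀ H, (f H : Mat n) = (k : Mat n) * H * ((k⁻¹ : GL (Fin n) ℂ) : Mat n) := fun H => rfl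
  have hinj : Function.Injective f := fun H K h => by
    have h1 : (k : Mat n) * H * ((k⁻¹ : GL (Fin n) ℂ) : Mat n) =
      (k : Mat n) * K * ((k⁻¹ : GL (Fin n) ℂ) : Mat n) := congrArg Subtype.val h
    have h2 := congrArg (fun A => ((k⁻¹ : GL (Fin n) ℂ) : Mat n) * A * (k : Mat n)) h1
    simp only [mul_assoc, Units.inv_mul, mul_one] at h2
    rw [← mul_assoc, ← mul_assoc, Units.inv_mul, one_mul, one_mul] at h2
    exact Subtype.ext h2
  refine ⟨LinearEquiv.ofInjectiveEndo f hinj, ⟨k, hk, fun H => hf H⟩, fun x hx => Subtype.ext ?_⟩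
  rw [coe_toA_of_mem (hz𝔞 x hx), hkz, ← coe_toA_of_mem hx]
  exact hf _

theorem isConvexInvariant (h𝔞 : IsMaximalAbelian 𝔤 θ 𝔞) {u : 𝔞 → ℝ}
    (hu : ContDiffOn ℝ ∞ u (omega 𝔤 𝔞)) (hconv : HasPosDefHessianOn u (omega 𝔤 𝔞))
    (hW : ∀ w ∈ weylGroup 𝔤 θ 𝔞, ∀ H ∈ omega 𝔤 𝔞, u (w H) = u H) :
    S.IsConvexInvariant (𝔞.comap (ι.toMat : E →ₗ[ℝ] Mat n)) (Real.pi / 2)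
      fun x => u (toA ι 𝔞 x) := by
  have hopen : ∀ H ∈ omega 𝔤 𝔞, omega 𝔤 𝔞 ∈ 𝓝 H := by
    intro H hH
    choose g hg hg' using fun H : 𝔞 => hm.exists_toA h𝔞 H
    let γ : 𝔞 →ₗ[ℝ] E :=
      { toFun := g
        map_add' := fun H K => toMat_injective ι (by rw [map_add, hg, hg, hg]; rfl)
        map_smul' := fun c H => toMat_injective ι (by rw [map_smul, hg, hg]; rfl) }
    have hiff : ∀ K, K ∈ omega 𝔤 𝔞 ↔ ‖S.br (g K)‖ < Real.pi / 2 := fun K => by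
      rw [← hm.toA_mem_omega h𝔞 (by rw [hg]; exact K.2), hg']
    have h1 : omega 𝔤 𝔞 = γ ⁻¹' {x | ‖S.br x‖ < Real.pi / 2} := Set.ext hiff
    rw [h1]
    have hc : Continuous γ := γ.continuous_of_finiteDimensional
    exact ((isOpen_norm_br (S := S) (Real.pi / 2)).preimage hc).mem_nhds ((hiff H).1 hH)
  have hC2 : ∀ H ∈ omega 𝔤 𝔞, ContDiffAt ℝ 2 u H := fun H hH =>
    ((hu H hH).contDiffAt (hopen H hH)).of_le (show ((2 : ℕ∞) : WithTop ℕ∞) ≤ ((⊤ : ℕ∞) : WithTop ℕ∞) from WithTop.coe_le_coe.2 le_top)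
  have hcd : ∀ x, ι.toMat x ∈ 𝔞 → ‖S.br x‖ < Real.pi / 2 →
      ContDiffAt ℝ 2 (fun x => u (toA ι 𝔞 x)) x := fun x hx hxr =>
    (hC2 _ ((hm.toA_mem_omega h𝔞 hx).2 hxr)).comp x (toA ι 𝔞).contDiff.contDiffAt
  refine ⟨hcd, fun x => ?_, fun z hz hz𝔞 x hx hxr => ?_, fun x hx hxr y hy hy0 => ?_⟩
  · rw [toA_proj]
  · obtain ⟨w, hw, e⟩ := hm.exists_weylGroup h𝔞 hz hz𝔞
    rw [← e x hx, hW w hw _ ((hm.toA_mem_omega h𝔞 hx).2 hxr)]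
  · have hx' := (hm.toA_mem_omega h𝔞 hx).2 hxr
    have h1 := deriv_deriv_line (hcd x hx hxr) y
    have h2 := deriv_deriv_line (hC2 _ hx') (toA ι 𝔞 y)
    simp only [map_add, map_smul] at h1
    rw [← h1, h2]
    refine hconv _ hx' _ fun h0 => hy0 (toMat_injective ι ?_)
    rw [← coe_toA_of_mem hy, h0, map_zero]; rfl

/-- The invariant extension is well defined. -/
theorem eq_of_point_eq (h𝔞 : IsMaximalAbelian 𝔤 θ 𝔞) {u : 𝔞 → ℝ}
    (hW : ∀ w ∈ weylGroup 𝔤 θ 𝔞, ∀ H ∈ omega 𝔤 𝔞, u (w H) = u H) {g g' : groupG 𝔤} {H H' : 𝔞}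
    (hH : H ∈ omega 𝔤 𝔞) (hH' : H' ∈ omega 𝔤 𝔞)
    (h : point 𝔤 θ h𝔞.mem_g g H = point 𝔤 θ h𝔞.mem_g g' H') : u H = u H' := by
  obtain ⟨x, hx, hx'⟩ := hm.exists_toA h𝔞 H
  obtain ⟨y, hy, hy'⟩ := hm.exists_toA h𝔞 H'
  have hx𝔞 : ι.toMat x ∈ 𝔞 := by rw [hx]; exact H.2
  have hy𝔞 : ι.toMat y ∈ 𝔞 := by rw [hy]; exact H'.2
  have h1 := QuotientGroup.eq.1 h
  rw [Subgroup.mem_subgroupOf] at h1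
  set k : GL (Fin n) ℂ := (((Subgroup.inclusion (groupG_le_groupGC 𝔤) g *
    expGC 𝔤 (iMul 𝔤 h𝔞.mem_g H))⁻¹ * (Subgroup.inclusion (groupG_le_groupGC 𝔤) g' *
    expGC 𝔤 (iMul 𝔤 h𝔞.mem_g H')) : groupGC 𝔤) : GL (Fin n) ℂ) with hk
  have hI : ∀ z, ι.toMatC (Cx.mk 0 z) = Complex.I • ι.toMat z := fun z => by
    rw [ι.toMatC_apply, Cx.re_mk, Cx.im_mk, map_zero, zero_add]
  have h2 : (((g'⁻¹ * g : groupG 𝔤) : GL (Fin n) ℂ)) * expGL (ι.toMatC (Cx.mk 0 x)) * k =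
      expGL (ι.toMatC (Cx.mk 0 y)) := by
    rw [hI, hI, hx, hy]
    have e1 : k = (expGL (Complex.I • (H : Mat n)))⁻¹ * (g : GL (Fin n) ℂ)⁻¹ *
        ((g' : GL (Fin n) ℂ) * expGL (Complex.I • (H' : Mat n))) := by
      rw [hk, mul_inv_rev]; rfl
    rw [e1]
    push_cast
    group
  obtain ⟨w, hw, hw𝔞, hwx⟩ := ι.exists_normalizer (hm.isMaxAbelian h𝔞)
    (hm.mem_gpG (g'⁻¹ * g : groupG 𝔤).2) (hm.mem_gpKC h1) hx𝔞 hy𝔞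
    ((hm.toA_mem_omega h𝔞 hx𝔞).1 (by rw [hx']; exact hH))
    ((hm.toA_mem_omega h𝔞 hy𝔞).1 (by rw [hy']; exact hH')) (congrArg Units.val h2)
  obtain ⟨w', hw', e⟩ := hm.exists_weylGroup h𝔞 hw hw𝔞
  rw [← hW w' hw' H hH, ← hx', e x hx𝔞, hwx, hy']

/-- A point of the domain has a representative g exp(iH) k. Lifting f to a function of matrices puts
it in the situation of `contDiffAt_and_levi_pos`, and 𝔤^ℂ is identified complex linearly with `Cx
E`. -/
theorem strictlyPlurisubharmonicOn (h𝔞 : IsMaximalAbelian 𝔤 θ 𝔞) {u : 𝔞 → ℝ}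
    (hu : ContDiffOn ℝ ∞ u (omega 𝔤 𝔞)) (hconv : HasPosDefHessianOn u (omega 𝔤 𝔞))
    (hW : ∀ w ∈ weylGroup 𝔤 θ 𝔞, ∀ H ∈ omega 𝔤 𝔞, u (w H) = u H)
    {f : Complexification 𝔤 θ → ℝ} (hf : IsInvariantExtension 𝔤 θ h𝔞.mem_g u f) :
    StrictlyPlurisubharmonicOn 𝔤 θ f (domainAG 𝔤 θ h𝔞.mem_g) := by
  classical
  rintro g₀ ⟨g, H, hH, hg₀⟩
  have hA := hm.isMaxAbelian h𝔞
  have hv := hm.isConvexInvariant h𝔞 hu hconv hW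
  obtain ⟨U, hU⟩ := hv.exists_ext hA
  have hI : ∀ z, ι.toMatC (Cx.mk 0 z) = Complex.I • ι.toMat z := fun z => by
    rw [ι.toMatC_apply, Cx.re_mk, Cx.im_mk, map_zero, zero_add]
  -- The value 0 outside G^ℂ is never used: all matrices at which φ is evaluated below are in G^ℂ.
  let φ : Mat n → ℝ := fun m =>
    if h : ∃ x : groupGC 𝔤, ((x : GL (Fin n) ℂ) : Mat n) = m then f (QuotientGroup.mk h.choose) else 0
  have hφ' : ∀ x : groupGC 𝔤, φ ((x : GL (Fin n) ℂ) : Mat n) = f (QuotientGroup.mk x) := fun x => by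
    have h : ∃ y : groupGC 𝔤, ((y : GL (Fin n) ℂ) : Mat n) = ((x : GL (Fin n) ℂ) : Mat n) :=
      ⟨x, rfl⟩
    have h1 : h.choose = x := Subtype.ext (Units.ext h.choose_spec)
    rw [show φ ((x : GL (Fin n) ℂ) : Mat n) = f (QuotientGroup.mk h.choose) from dif_pos h, h1]
  have hφ : ∀ g ∈ ι.gpG, ∀ k ∈ ι.gpKC, ∀ x ∈ 𝔞.comap (ι.toMat : E →ₗ[ℝ] Mat n),
      ‖S.br x‖ < Real.pi / 2 →
      φ (g * NormedSpace.exp (ι.toMatC (Cx.mk 0 x)) * k) = u (toA ι 𝔞 x) := by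
    intro g hg k hk x hx hxr
    obtain ⟨g, hgG, rfl⟩ := hm.exists_groupG hg
    obtain ⟨k, hkK, rfl⟩ := hm.exists_groupKC hk
    let p : groupGC 𝔤 := Subgroup.inclusion (groupG_le_groupGC 𝔤) ⟨g, hgG⟩ *
      expGC 𝔤 (iMul 𝔤 h𝔞.mem_g (toA ι 𝔞 x))
    let k' : groupGC 𝔤 := ⟨k, hm.groupKC_le hkK⟩
    have h1 : (((p * k' : groupGC 𝔤) : GL (Fin n) ℂ) : Mat n) =
        (g : Mat n) * NormedSpace.exp (ι.toMatC (Cx.mk 0 x)) * (k : Mat n) := by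
      rw [hI, ← coe_toA_of_mem hx]; rfl
    have h2 := hφ' (p * k')
    rw [h1] at h2
    refine h2.trans ?_
    have h3 : (QuotientGroup.mk (p * k') : Complexification 𝔤 θ) =
        point 𝔤 θ h𝔞.mem_g ⟨g, hgG⟩ (toA ι 𝔞 x) := by
      refine QuotientGroup.eq.2 ?_
      rw [Subgroup.mem_subgroupOf, mul_inv_rev, mul_assoc]
      have : (p⁻¹ * (Subgroup.inclusion (groupG_le_groupGC 𝔤) ⟨g, hgG⟩ *
        expGC 𝔤 (iMul 𝔤 h𝔞.mem_g (toA ι 𝔞 x)))) = 1 := inv_mul_cancel p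
      rw [this, mul_one]
      exact (groupKC 𝔤 θ).inv_mem hkK
    rw [h3]
    exact hf _ _ ((hm.toA_mem_omega h𝔞 hx).2 hxr)
  obtain ⟨x, hx, hx'⟩ := hm.exists_toA h𝔞 H
  have hx𝔞 : ι.toMat x ∈ 𝔞 := by rw [hx]; exact H.2
  have hxr : ‖S.br x‖ < Real.pi / 2 := (hm.toA_mem_omega h𝔞 hx𝔞).1 (by rw [hx']; exact hH)
  have h1 := QuotientGroup.eq.1 hg₀.symm
  rw [Subgroup.mem_subgroupOf] at h1
  set k : GL (Fin n) ℂ := (((Subgroup.inclusion (groupG_le_groupGC 𝔤) g *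
    expGC 𝔤 (iMul 𝔤 h𝔞.mem_g H))⁻¹ * g₀ : groupGC 𝔤) : GL (Fin n) ℂ) with hk
  have hg₀' : ((g₀ : GL (Fin n) ℂ) : Mat n) = ((g : GL (Fin n) ℂ) : Mat n) *
      NormedSpace.exp (ι.toMatC (Cx.mk 0 x)) * (k : Mat n) := by
    have e1 : (g₀ : GL (Fin n) ℂ) = (g : GL (Fin n) ℂ) * expGL (Complex.I • (H : Mat n)) * k := by
      rw [hk, ← mul_inv_cancel_left (Subgroup.inclusion (groupG_le_groupGC 𝔤) g *
        expGC 𝔤 (iMul 𝔤 h𝔞.mem_g H)) g₀]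
      simp only [inv_mul_cancel_left]
      rfl
    rw [e1, hI, hx]; rfl
  set ψ : Cx E → ℝ := fun z => φ (((g : GL (Fin n) ℂ) : Mat n) *
    NormedSpace.exp (ι.toMatC (Cx.mk 0 x)) * (k : Mat n) * NormedSpace.exp (ι.toMatC z)) with hψ
  obtain ⟨c1, c2⟩ := ι.contDiffAt_and_levi_pos hφ hA hv hU hx𝔞 hxr (hm.mem_gpG g.2)
    (hm.mem_gpKC h1) (ψ := ψ) fun z => rfl
  obtain ⟨π, hπ⟩ := LinearMap.exists_leftInverse_of_injective (ι.toMatC : Cx E →ₗ[ℝ] Mat n)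
    (LinearMap.ker_eq_bot.2 ι.toMatC_injective)
  have hπ' : ∀ z, π (ι.toMatC z) = z := fun z => DFunLike.congr_fun hπ z
  let M : gC 𝔤 → Cx E := fun Z => π (Z : Mat n)
  have hM : ∀ Z : gC 𝔤, ι.toMatC (M Z) = (Z : Mat n) := fun Z => by
    obtain ⟨z, hz⟩ := hm.mem_gC.1 Z.2
    show ι.toMatC (π (Z : Mat n)) = Z
    rw [← hz, hπ']
  have hMI : ∀ Z, M (Complex.I • Z) = Cx.mulI (M Z) := fun Z => by
    refine ι.toMatC_injective ?_
    rw [Cx.mulI_apply, ← ι.I_smul_toMatC, hM, hM]; rfl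
  have hpull : pullback 𝔤 θ f g₀ = fun Z => ψ (M Z) := funext fun Z => by
    rw [hψ]
    simp only [hM]
    rw [← hg₀']
    exact (hφ' (g₀ * expGC 𝔤 Z)).symm
  obtain ⟨d1, d2⟩ := leviForm_comp c1 M (fun Z W => map_add π _ _)
    (fun c Z => map_smul π c (Z : Mat n)) hMI
  rw [hpull]
  refine ⟨d1, fun Z hZ => ?_⟩
  rw [d2]
  refine mul_pos (by norm_num) (c2 _ fun h => hZ ?_)
  exact hm.mem_kC.2 ⟨M Z, h, hM Z⟩

end IsModel

end AkhiezerGindikin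

end

theorem mainTheorem2 (n : ℕ)
    (𝔤 : LieSubalgebra ℝ (AkhiezerGindikin.Mat n)) (hss : LieAlgebra.IsSemisimple ℝ 𝔤)
    (hreal : AkhiezerGindikin.IsTotallyReal 𝔤)
    (θ : 𝔤 →ₗ⁅ℝ⁆ 𝔤) (hθ : AkhiezerGindikin.IsCartanInvolution θ)
    (𝔞 : Submodule ℝ (AkhiezerGindikin.Mat n))
    (h𝔞 : AkhiezerGindikin.IsMaximalAbelian 𝔤 θ 𝔞)
    (u : 𝔞 → ℝ)
    (hu : ContDiffOn ℝ ∞ u (AkhiezerGindikin.omega 𝔤 𝔞))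
    (hconv : AkhiezerGindikin.HasPosDefHessianOn u (AkhiezerGindikin.omega 𝔤 𝔞))
    (hW : ∀ w ∈ AkhiezerGindikin.weylGroup 𝔤 θ 𝔞, ∀ H ∈ AkhiezerGindikin.omega 𝔤 𝔞,
      u (w H) = u H) :
    (∃ f : AkhiezerGindikin.Complexification 𝔤 θ → ℝ,
      AkhiezerGindikin.IsInvariantExtension 𝔤 θ h𝔞.mem_g u f) ∧
    ∀ f : AkhiezerGindikin.Complexification 𝔤 θ → ℝ,
      AkhiezerGindikin.IsInvariantExtension 𝔤 θ h𝔞.mem_g u f →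
      AkhiezerGindikin.StrictlyPlurisubharmonicOn 𝔤 θ f
        (AkhiezerGindikin.domainAG 𝔤 θ h𝔞.mem_g) := by
  classical
  have : FiniteDimensional ℝ (AkhiezerGindikin.Mat n) := FiniteDimensional.complexToReal _
  have : FiniteDimensional ℝ 𝔤 := FiniteDimensional.finiteDimensional_submodule 𝔤.toSubmodule
  obtain ⟨E, i1, i2, i3, S, e, he, hθe⟩ := AkhiezerGindikin.exists_cartanData hθ
  have : CompleteSpace E := FiniteDimensional.complete ℝ E
  obtain ⟨ι, hm⟩ := AkhiezerGindikin.exists_isModel hreal e he hθe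
  -- The value at a point of the domain is read off a chosen representative, and `eq_of_point_eq`
  -- makes the choice harmless. The value 0 elsewhere is arbitrary. Uniqueness on the domain is
  -- immediate, since every point of it is some g exp(iH) K^ℂ with H ∈ ω.
  refine ⟨⟨fun x => if h : ∃ p : AkhiezerGindikin.groupG 𝔤 × 𝔞,
    p.2 ∈ AkhiezerGindikin.omega 𝔤 𝔞 ∧ x = AkhiezerGindikin.point 𝔤 θ h𝔞.mem_g p.1 p.2
    then u h.choose.2 else 0, fun g H hH => ?_⟩,
    fun f hf => hm.strictlyPlurisubharmonicOn h𝔞 hu hconv hW hf⟩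
  have h : ∃ p : AkhiezerGindikin.groupG 𝔤 × 𝔞, p.2 ∈ AkhiezerGindikin.omega 𝔤 𝔞 ∧
      AkhiezerGindikin.point 𝔤 θ h𝔞.mem_g g H =
        AkhiezerGindikin.point 𝔤 θ h𝔞.mem_g p.1 p.2 := ⟨(g, H), hH, rfl⟩
  refine (dif_pos h).trans ?_
  exact hm.eq_of_point_eq h𝔞 hW h.choose_spec.1 hH h.choose_spec.2.symm
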